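/- **Setting.** Let $e_1,\dots,e_7$ be the standard basis of $\mathbb R^7$, let $\omega_0=\sqrt2\,(e^{167}+e^{235})-e^4\wedge(e^{15}-e^{26}-e^{37})$ and $\langle\cdot,\cdot\rangle=2(e^1\cdot e^5+e^2\cdot e^6+e^3\cdot e^7)-(e^4)^2$, an inner product of signature $(4,3)$; write $\mathbb R^{4,3}=(\mathbb R^7,\langle\cdot,\cdot\rangle)$. Let $\mathrm G_2^*\subset \mathrm{GL}(7,\mathbb R)$ be the stabilizer of $\omega_0$ and $\mathfrak g_2^*$ its Lie algebra. The natural representation on $\mathbb R^{4,3}$ of a subalgebra $\mathfrak h\subset\mathfrak g_2^*$ is *indecomposable* if it leaves no proper non-zero non-degenerate subspace invariant; an indecomposable $\mathfrak h$ is *of type III* if the socle (the sum of all irreducible subrepresentations) has dimension $3$. Put $$\mathfrak m(1,0,2)=\{h(v,y)\mid v\in\mathbb R,\ y=(y_1,y_2)\in\mathbb R^2\},\qquad \mathfrak m(1,0,1)=\{h(v,(y_1,0))\mid v,y_1\in\mathbb R\},$$ where $h(v,y)$ is the linear map with $e_1,e_2,e_3\mapsto0$, $e_4\mapsto\sqrt2\,v\,e_1$,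 $e_5\mapsto y_1e_2+y_2e_3+\sqrt2\,v\,e_4$, $e_6\mapsto -y_1e_1-v\,e_3$, $e_7\mapsto -y_2e_1+v\,e_2$. A left-invariant $\mathrm G_2^*$-structure on a $7$-dimensional Lie group $G$ with Lie algebra $\mathfrak g$ is a left-invariant $3$-form $\omega$ that equals $\omega_0$ with respect to some basis (*adapted frame*) of $\mathfrak g$; it defines a left-invariant metric, which is given by $\langle\cdot,\cdot\rangle$ with respect to every adapted frame. The structure is *parallel* if $\nabla\omega=0$ for the Levi-Civita connection $\nabla$ of this metric. Its *infinitesimal holonomy algebra* is the span of all values at the identity of the curvature tensor $R$ and of its iterated covariant derivatives, that is, of all endomorphisms $(\nabla^kR)(V_1,\dots,V_k;X,Y)$, $k\ge0$, $V_i,X,Y\in\mathfrak g$; by means of an adapted frame it is identified with a subalgebra of $\mathfrak g_2^*$, well-defined up to conjugation by $\mathrm G_2^*$. Each algebra in this conjugacy class is called the infinitesimal holonomy algebra of the structure. **Theorem.** Let $\mathfrak h\subset\mathfrak g_2^*$ be a subalgebra whose natural representation on $\mathbb R^{4,3}$ is indecomposable and of type III. Then $\mathfrak h$ is the infinitesimal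 holonomy algebra of a left-invariant parallel $\mathrm G_2^*$-structure on some $7$-dimensional Lie group if and only if $\mathfrak h$ is abelian. If $\mathfrak h$ is abelian, then either $\dim\mathfrak h=2$ and $\mathfrak h$ is conjugate by an element of $\mathrm G_2^*$ to $\mathfrak m(1,0,1)$, or $\dim\mathfrak h=3$ and $\mathfrak h$ is conjugate by an element of $\mathrm G_2^*$ to $\mathfrak m(1,0,2)$. Moreover, $\mathfrak m(1,0,1)$ and $\mathfrak m(1,0,2)$ are themselves abelian subalgebras of $\mathfrak g_2^*$ whose natural representations are indecomposable and of type III. -/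

import Mathlib

attribute [local instance 100] LieRing.ofAssociativeRing

noncomputable section

namespace G2StarHolonomy

open scoped Manifold ContDiff

/-! ### The model space and the Lie algebra of `G₂*`

Indices are shifted by one: the standard basis `e₁, …, e₇` of `ℝ⁷` corresponds to the indices
`0, …, 6` of `Fin 7`. -/

/-- The real vector space `ℝ⁷`, underlying the pseudo-Euclidean space `ℝ^{4,3}`. -/
abbrev V7 : Type := Fin 7 → ℝ

/-- Real `7 × 7` matrices, acting on `ℝ⁷` by matrix-vector multiplication. -/
abbrev Mat7 : Type := Matrix (Fin 7) (Fin 7) ℝ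

/-- The elementary three-form `eⁱ ∧ eʲ ∧ eᵏ`, whose value at `(x, y, z)` is the determinant of
the coordinates with indices `i, j, k` of `x, y, z`. -/
def wedge3 (i j k : Fin 7) : V7 [⋀^Fin 3]→ₗ[ℝ] ℝ :=
  (Matrix.detRowAlternating (R := ℝ) (n := Fin 3)).compLinearMap (LinearMap.funLeft ℝ ℝ ![i, j, k])

/-- The standard three-form
`ω₀ = √2 (e¹⁶⁷ + e²³⁵) - e⁴ ∧ (e¹⁵ - e²⁶ - e³⁷)`. -/
def omega0 : V7 [⋀^Fin 3]→ₗ[ℝ] ℝ :=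
  √2 • (wedge3 0 5 6 + wedge3 1 2 4) - (wedge3 3 0 4 - wedge3 3 1 5 - wedge3 3 2 6)

/-- The inner product `2 (e¹·e⁵ + e²·e⁶ + e³·e⁷) - (e⁴)²` of `ℝ^{4,3}`. -/
def ip : LinearMap.BilinForm ℝ V7 :=
  LinearMap.mk₂ ℝ
    (fun x y => x 0 * y 4 + x 4 * y 0 + x 1 * y 5 + x 5 * y 1 + x 2 * y 6 + x 6 * y 2 - x 3 * y 3)
    (by intros; simp; ring) (by intros; simp; ring) (by intros; simp; ring) (by intros; simp; ring)

/-- The group `G₂*`: the stabilizer of `ω₀` in `GL(7, ℝ)`. -/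
def G2Star : Subgroup (GL (Fin 7) ℝ) where
  carrier := {g | ∀ x : Fin 3 → V7, omega0 (fun i => g.val.mulVec (x i)) = omega0 x}
  one_mem' := by intro x; simp
  mul_mem' := by
    intro g k hg hk x
    have h1 := hg (fun i => k.val.mulVec (x i))
    simp only [Matrix.mulVec_mulVec] at h1
    simpa only [Units.val_mul] using h1.trans (hk x)
  inv_mem' := by
    intro g hg x
    have h1 := hg (fun i => (g⁻¹).val.mulVec (x i))
    simp only [Matrix.mulVec_mulVec] at h1
    rw [← h1, ← Units.val_mul, mul_inv_cancel]
    simp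

/-- The Lie algebra `𝔤₂*` of `G₂*`: the matrices `A` that annihilate `ω₀`, that is,
`ω₀(Ax, y, z) + ω₀(x, Ay, z) + ω₀(x, y, Az) = 0` for all `x, y, z`. -/
def g2Star : LieSubalgebra ℝ Mat7 where
  carrier := {A | ∀ x y z : V7, omega0 ![A.mulVec x, y, z] + omega0 ![x, A.mulVec y, z]
    + omega0 ![x, y, A.mulVec z] = 0}
  zero_mem' := by
    intro x y z
    have h0 := omega0.map_coord_zero (m := ![0, y, z]) 0 rfl
    have h1 := omega0.map_coord_zero (m := ![x, 0, z]) 1 rfl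
    have h2 := omega0.map_coord_zero (m := ![x, y, 0]) 2 rfl
    simp only [Matrix.zero_mulVec, h0, h1, h2, add_zero]
  add_mem' := by
    intro A B hA hB x y z
    have h0 := omega0.map_update_add ![x, y, z] 0 (A.mulVec x) (B.mulVec x)
    have h1 := omega0.map_update_add ![x, y, z] 1 (A.mulVec y) (B.mulVec y)
    have h2 := omega0.map_update_add ![x, y, z] 2 (A.mulVec z) (B.mulVec z)
    have e0 : ∀ w : V7, Function.update ![x, y, z] 0 w = ![w, y, z] := by
      intro w; ext i j; fin_cases i <;> rfl
    have e1 : ∀ w : V7, Function.update ![x, y, z] 1 w = ![x, w, z] := by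
      intro w; ext i j; fin_cases i <;> rfl
    have e2 : ∀ w : V7, Function.update ![x, y, z] 2 w = ![x, y, w] := by
      intro w; ext i j; fin_cases i <;> rfl
    simp only [e0, e1, e2] at h0 h1 h2
    simp only [Matrix.add_mulVec, h0, h1, h2]
    linarith [hA x y z, hB x y z]
  smul_mem' := by
    intro c A hA x y z
    have h0 := omega0.map_update_smul ![x, y, z] 0 c (A.mulVec x)
    have h1 := omega0.map_update_smul ![x, y, z] 1 c (A.mulVec y)
    have h2 := omega0.map_update_smul ![x, y, z] 2 c (A.mulVec z)
    have e0 : ∀ w : V7, Function.update ![x, y, z] 0 w = ![w, y, z] := by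
      intro w; ext i j; fin_cases i <;> rfl
    have e1 : ∀ w : V7, Function.update ![x, y, z] 1 w = ![x, w, z] := by
      intro w; ext i j; fin_cases i <;> rfl
    have e2 : ∀ w : V7, Function.update ![x, y, z] 2 w = ![x, y, w] := by
      intro w; ext i j; fin_cases i <;> rfl
    simp only [e0, e1, e2] at h0 h1 h2
    simp only [Matrix.smul_mulVec, h0, h1, h2, ← smul_add, hA x y z, smul_zero]
  lie_mem' := by
    intro A B hA hB x y z
    have e0 : ∀ w : V7, Function.update ![x, y, z] 0 w = ![w, y, z] := by
      intro w; ext i j; fin_cases i <;> rfl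
    have e1 : ∀ w : V7, Function.update ![x, y, z] 1 w = ![x, w, z] := by
      intro w; ext i j; fin_cases i <;> rfl
    have e2 : ∀ w : V7, Function.update ![x, y, z] 2 w = ![x, y, w] := by
      intro w; ext i j; fin_cases i <;> rfl
    have h0 := omega0.map_update_sub ![x, y, z] 0 (A.mulVec (B.mulVec x)) (B.mulVec (A.mulVec x))
    have h1 := omega0.map_update_sub ![x, y, z] 1 (A.mulVec (B.mulVec y)) (B.mulVec (A.mulVec y))
    have h2 := omega0.map_update_sub ![x, y, z] 2 (A.mulVec (B.mulVec z)) (B.mulVec (A.mulVec z))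
    simp only [e0, e1, e2] at h0 h1 h2
    simp only [Ring.lie_def, Matrix.sub_mulVec, ← Matrix.mulVec_mulVec, h0, h1, h2]
    linarith [hA (B.mulVec x) y z, hA x (B.mulVec y) z, hA x y (B.mulVec z),
      hB (A.mulVec x) y z, hB x (A.mulVec y) z, hB x y (A.mulVec z)]

/-! ### Indecomposability, socle, type -/

/-- `W` is a subrepresentation of the natural representation of `h` on `ℝ⁷`. -/
def IsInvariant (h : LieSubalgebra ℝ Mat7) (W : Submodule ℝ V7) : Prop :=
  ∀ A ∈ h, ∀ w ∈ W, A.mulVec w ∈ W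

/-- The restriction of the inner product of `ℝ^{4,3}` to `W` is non-degenerate. -/
def IsNondegenerate (W : Submodule ℝ V7) : Prop :=
  ∀ w ∈ W, (∀ w' ∈ W, ip w w' = 0) → w = 0

/-- The natural representation of `h` on `ℝ^{4,3}` is indecomposable: it leaves no proper
non-zero non-degenerate subspace invariant. -/
def IsIndecomposable (h : LieSubalgebra ℝ Mat7) : Prop :=
  ∀ W : Submodule ℝ V7, IsInvariant h W → IsNondegenerate W → W = ⊥ ∨ W = ⊤

/-- `W` is an irreducible subrepresentation of the natural representation of `h`. -/
def IsSimpleSubrep (h : LieSubalgebra ℝ Mat7) (W : Submodule ℝ V7) : Prop :=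
  IsInvariant h W ∧ W ≠ ⊥ ∧ ∀ W' ≤ W, IsInvariant h W' → W' = ⊥ ∨ W' = W

/-- The socle of the natural representation of `h`, that is, its maximal semisimple
subrepresentation: the sum of all irreducible subrepresentations. -/
def socle (h : LieSubalgebra ℝ Mat7) : Submodule ℝ V7 :=
  sSup {W | IsSimpleSubrep h W}

/-- `h` is of type III: the socle of its natural representation has dimension three. -/
def IsTypeIII (h : LieSubalgebra ℝ Mat7) : Prop :=
  Module.finrank ℝ (socle h) = 3

/-! ### The abelian Lie algebras `𝔪(1,0,1)` and `𝔪(1,0,2)` -/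

/-- The matrix `h(A, v, u, y)` with `A ∈ 𝔤𝔩(2, ℝ)`, `v ∈ ℝ`, `u, y ∈ ℝ²`. -/
def hMat (A : Matrix (Fin 2) (Fin 2) ℝ) (v : ℝ) (u y : Fin 2 → ℝ) : Mat7 :=
  !![A.trace, -u 1, u 0, √2 * v, 0, -y 0, -y 1;
     0, A 0 0, A 0 1, √2 * u 0, y 0, 0, v;
     0, A 1 0, A 1 1, √2 * u 1, y 1, -v, 0;
     0, 0, 0, 0, √2 * v, √2 * u 0, √2 * u 1;
     0, 0, 0, 0, -A.trace, 0, 0;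
     0, 0, 0, 0, u 1, -A 0 0, -A 1 0;
     0, 0, 0, 0, -u 0, -A 0 1, -A 1 1]

theorem hMat_add (v v' : ℝ) (y y' : Fin 2 → ℝ) :
    hMat 0 v 0 y + hMat 0 v' 0 y' = hMat 0 (v + v') 0 (y + y') := by
  ext i j
  fin_cases i <;> fin_cases j <;> simp [hMat] <;> try ring

theorem hMat_smul (c v : ℝ) (y : Fin 2 → ℝ) :
    c • hMat 0 v 0 y = hMat 0 (c * v) 0 (c • y) := by
  ext i j
  fin_cases i <;> fin_cases j <;> simp [hMat] <;> try ring

theorem hMat_zero : hMat 0 0 0 0 = 0 := by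
  ext i j
  fin_cases i <;> fin_cases j <;> simp [hMat]

set_option maxHeartbeats 1000000 in
theorem hMat_lie (v v' : ℝ) (y y' : Fin 2 → ℝ) : ⁅hMat 0 v 0 y, hMat 0 v' 0 y'⁆ = 0 := by
  rw [Ring.lie_def, sub_eq_zero]
  ext i j
  rw [Matrix.mul_apply, Matrix.mul_apply, Fin.sum_univ_seven, Fin.sum_univ_seven]
  fin_cases i <;> fin_cases j <;> simp [hMat] <;> ring

/-- The Lie algebra `{h(0, v, 0, y) | v ∈ ℝ, y ∈ L}` attached to a subspace `L` of `ℝ²`. -/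
def mOf (L : Submodule ℝ (Fin 2 → ℝ)) : LieSubalgebra ℝ Mat7 where
  carrier := {M | ∃ v : ℝ, ∃ y ∈ L, M = hMat 0 v 0 y}
  zero_mem' := ⟨0, 0, L.zero_mem, hMat_zero.symm⟩
  add_mem' := by
    rintro _ _ ⟨v, y, hy, rfl⟩ ⟨v', y', hy', rfl⟩
    exact ⟨_, _, L.add_mem hy hy', hMat_add v v' y y'⟩
  smul_mem' := by
    rintro c _ ⟨v, y, hy, rfl⟩
    exact ⟨_, _, L.smul_mem c hy, hMat_smul c v y⟩
  lie_mem' := by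
    rintro _ _ ⟨v, y, -, rfl⟩ ⟨v', y', -, rfl⟩
    exact ⟨0, 0, L.zero_mem, (hMat_lie v v' y y').trans hMat_zero.symm⟩

/-- `𝔪(1,0,1) = {h(0, v, 0, (y₁, 0)) | v, y₁ ∈ ℝ}`. -/
def m101 : LieSubalgebra ℝ Mat7 := mOf (LinearMap.ker (LinearMap.proj (R := ℝ) (1 : Fin 2)))

/-- `𝔪(1,0,2) = {h(0, v, 0, y) | v ∈ ℝ, y ∈ ℝ²}`. -/
def m102 : LieSubalgebra ℝ Mat7 := mOf ⊤

/-- `h` and `k` are conjugate by an element of `G₂*`: `k = g h g⁻¹` for some `g ∈ G₂*`. -/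
def IsConjugate (h k : LieSubalgebra ℝ Mat7) : Prop :=
  ∃ g ∈ G2Star, ∀ A : Mat7, A ∈ h ↔ g.val * A * (g⁻¹).val ∈ k

/-! ### Left-invariant `G₂*`-structures and their infinitesimal holonomy

Left-invariant tensor fields on a Lie group are identified with tensors on its Lie algebra `𝔤`,
and left-invariant vector fields with elements of `𝔤`. -/

section LeftInvariant

variable {𝔤 : Type*} [LieRing 𝔤] [LieAlgebra ℝ 𝔤]

/-- The basis `b` belongs to the reduction of the frame bundle defined by the three-form `φ`:
with respect to `b`, the form `φ` equals `ω₀`. The form `φ` defines a left-invariant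
`G₂*`-structure if and only if such a basis exists. -/
def IsAdaptedFrame (φ : 𝔤 [⋀^Fin 3]→ₗ[ℝ] ℝ) (b : Module.Basis (Fin 7) ℝ 𝔤) : Prop :=
  φ = omega0.compLinearMap b.equivFun.toLinearMap

/-- The metric given by `2 (e¹·e⁵ + e²·e⁶ + e³·e⁷) - (e⁴)²` with respect to the basis `b`. -/
def frameMetric (b : Module.Basis (Fin 7) ℝ 𝔤) : LinearMap.BilinForm ℝ 𝔤 :=
  ip.compl₁₂ b.equivFun.toLinearMap b.equivFun.toLinearMap

/-- `Λ X Y = ∇_X Y`, for left-invariant vector fields `X` and `Y`, is the Levi-Civita connection of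
the left-invariant metric `g`: it is torsion-free and metric. -/
structure IsLeviCivita (g : LinearMap.BilinForm ℝ 𝔤) (Λ : 𝔤 →ₗ[ℝ] Module.End ℝ 𝔤) : Prop where
  torsion_free : ∀ X Y : 𝔤, Λ X Y - Λ Y X = ⁅X, Y⁆
  metric : ∀ X Y Z : 𝔤, g (Λ X Y) Z + g Y (Λ X Z) = 0

/-- The left-invariant three-form `φ` is parallel, `∇φ = 0`. -/
def IsParallel (Λ : 𝔤 →ₗ[ℝ] Module.End ℝ 𝔤) (φ : 𝔤 [⋀^Fin 3]→ₗ[ℝ] ℝ) : Prop :=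
  ∀ W X Y Z : 𝔤, φ ![Λ W X, Y, Z] + φ ![X, Λ W Y, Z] + φ ![X, Y, Λ W Z] = 0

/-- The curvature tensor `R(X, Y) = [∇_X, ∇_Y] - ∇_{[X, Y]}`. -/
def curvature (Λ : 𝔤 →ₗ[ℝ] Module.End ℝ 𝔤) (X Y : 𝔤) : Module.End ℝ 𝔤 :=
  ⁅Λ X, Λ Y⁆ - Λ ⁅X, Y⁆

/-- The iterated covariant derivative `(∇ᵏR)(V₁, …, Vₖ; X, Y)` of the curvature tensor, where `V₁`
is the direction of the last differentiation:
`(∇_V T)(U₁, …, Uₖ; X, Y) = [∇_V, T(U₁, …, Uₖ; X, Y)] - ∑ᵢ T(U₁, …, ∇_V Uᵢ, …, Uₖ; X, Y)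
- T(U₁, …, Uₖ; ∇_V X, Y) - T(U₁, …, Uₖ; X, ∇_V Y)`. -/
def nablaCurvature (Λ : 𝔤 →ₗ[ℝ] Module.End ℝ 𝔤) :
    (k : ℕ) → (Fin k → 𝔤) → 𝔤 → 𝔤 → Module.End ℝ 𝔤
  | 0, _, X, Y => curvature Λ X Y
  | k + 1, V, X, Y =>
      ⁅Λ (V 0), nablaCurvature Λ k (Fin.tail V) X Y⁆
      - ∑ i, nablaCurvature Λ k (Function.update (Fin.tail V) i (Λ (V 0) (Fin.tail V i))) X Y
      - nablaCurvature Λ k (Fin.tail V) (Λ (V 0) X) Y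
      - nablaCurvature Λ k (Fin.tail V) X (Λ (V 0) Y)

/-- The infinitesimal holonomy algebra at the identity: the span of all values of the curvature
tensor and of all its iterated covariant derivatives. -/
def infinitesimalHolonomy (Λ : 𝔤 →ₗ[ℝ] Module.End ℝ 𝔤) : Submodule ℝ (Module.End ℝ 𝔤) :=
  Submodule.span ℝ {T | ∃ (k : ℕ) (V : Fin k → 𝔤) (X Y : 𝔤), T = nablaCurvature Λ k V X Y}

variable (𝔤) in
/-- The Lie algebra `𝔤` carries a parallel `G₂*`-structure `φ` with infinitesimal holonomy `h`:
there is an adapted frame `b` of `φ` such that `φ` is parallel for the Levi-Civita connection of the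
metric defined by `φ`, and such that the matrices with respect to `b` of the elements of the
infinitesimal holonomy algebra are exactly the elements of `h`. -/
def HasParallelG2StarStructureWithHolonomy (h : LieSubalgebra ℝ Mat7) : Prop :=
  ∃ (φ : 𝔤 [⋀^Fin 3]→ₗ[ℝ] ℝ) (b : Module.Basis (Fin 7) ℝ 𝔤) (Λ : 𝔤 →ₗ[ℝ] Module.End ℝ 𝔤),
    IsAdaptedFrame φ b ∧ IsLeviCivita (frameMetric b) Λ ∧ IsParallel Λ φ ∧
    h.toSubmodule = (infinitesimalHolonomy Λ).map (LinearMap.toMatrix b b).toLinearMap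

end LeftInvariant

/-- A smooth real Lie group is smooth enough for its tangent space at the identity to carry the
Lie algebra structure given by the bracket of left-invariant vector fields. -/
instance instLEInftyMinSmoothness : ENat.LEInfty (minSmoothness ℝ 3) where
  out := by
    rw [minSmoothness_of_isRCLikeNormedField]
    exact ENat.LEInfty.out

/-- `h` is the infinitesimal holonomy algebra of a left-invariant parallel `G₂*`-structure on some
seven-dimensional Lie group `G`. -/
def IsHolonomyOfLeftInvariantG2StarStructure (h : LieSubalgebra ℝ Mat7) : Prop :=
  ∃ (G : Type) (_ : TopologicalSpace G) (_ : ChartedSpace (EuclideanSpace ℝ (Fin 7)) G)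
    (_ : Group G) (_ : LieGroup 𝓘(ℝ, EuclideanSpace ℝ (Fin 7)) ∞ G)
    (_ : T2Space G) (_ : SecondCountableTopology G),
    HasParallelG2StarStructureWithHolonomy
      (GroupLieAlgebra 𝓘(ℝ, EuclideanSpace ℝ (Fin 7)) G) h

end G2StarHolonomy

end

set_option linter.unusedSimpArgs false

noncomputable section

/-! ### Curvature of connections with values in the matrices h(A, v, u, y) -/

namespace G2StarHolonomy

/-! In these comments pairs such as (4, 5) are indices in `Fin 7`, and E is the plane of the indices
1 and 2, on which the block A of h(A, v, u, y) acts.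

Holonomy implies abelian. The holonomy algebra h is the smallest space of matrices that contains the
curvature and is stable under brackets with the connection. So the connection normalizes h and
preserves its socle S (`mulVec_mem_socle_of_lie_mem`). Indecomposability makes S totally isotropic
(`ip_socle`), makes ω₀ vanish on S (`omega_socle`), and the cross products of elements of S fill a
line. In an adapted frame, S is the span of the first three basis vectors and this line is the first
axis (`exists_frame`). The connection then has the form h(A, v, u, y), while h consists of matrices
h(A, v, 0, y) and acts semisimply on S. Since the matrices h(0, v, 0, y) commute, it remains to show
A = 0 on h (`NF.partE_eq_zero`).

Suppose A ≠ 0 somewhere on h. Pair symmetry and the Bianchi identity leave few curvature components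
acting on E: those on (4, 5) and (4, 6), tied by `curv_sym`, and a binary quartic on (1, 5), (1, 6),
(2, 5), (2, 6). If the connection has u ≠ 0, then h annihilates the vector u, so by semisimplicity h
is diagonal of rank one on E, which `IsLie.false_of_diagonal` excludes. If u = 0, consider the trace
of the curvature, or its v-component when h is traceless. This is a closed or twisted closed
two-form, nonzero by minimality of h (in the traceless case also by indecomposability), and
supported on (4, 5) and (4, 6). A change of basis of E moves it to (4, 5) alone; closedness and the
flat pairs then force the connection to vanish on E in the directions 0 to 3 (`Model.flatK`). The
remaining polynomial system `KEqs` is inconsistent: `Reduced.false_of_flatK` treats the traceless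
case, where `Model.no_eigenvector` forbids a common eigenvector of the connection, and
`Model.false_of_rT_ne_zero` treats the other.

Classification. For abelian h, indecomposability and semisimplicity again give A = 0
(`Shape.partE_eq_zero_of_abelian`). Indecomposability also provides an element with v = 1 and one
with v = 0, y ≠ 0; SL(2) acting on E and a unipotent element of `G2Star` bring h to `m101` or
`m102`.

Existence. The connections `exampleConn ε` have holonomy `m101` for ε = 0 and `m102` for ε = 1.
After the linear change `exampleFrame` their bracket no longer depends on ε, and it is integrated by
an explicit group law on ℝ⁷. Conjugate algebras are reached by changing the adapted frame. -/

/-- The components, with respect to the standard basis of `ℝ⁷`, of a linear map into the matrices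
`h(A, v, (0, w), (y, z))` with `A = !![a, b; c, d]`. -/
structure ConnData where
  (a b c d v w y z : Fin 7 → ℝ)

namespace ConnData

variable (D : ConnData)

/-- The matrix of the covariant derivative in the direction of a basis vector. -/
def mat (i : Fin 7) : Mat7 :=
  hMat !![D.a i, D.b i; D.c i, D.d i] (D.v i) ![0, D.w i] ![D.y i, D.z i]

/-- The structure constants of the torsion-free bracket. -/
def br (i j k : Fin 7) : ℝ := D.mat i k j - D.mat j k i

/-- The value of a linear form on the bracket of two basis vectors. -/
def fc (f : Fin 7 → ℝ) (i j : Fin 7) : ℝ := ∑ k, D.br i j k * f k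

def rA (i j : Fin 7) : ℝ := D.b i * D.c j - D.b j * D.c i - D.fc D.a i j
def rB (i j : Fin 7) : ℝ :=
  D.a i * D.b j + D.b i * D.d j - D.a j * D.b i - D.b j * D.d i - D.fc D.b i j
def rC (i j : Fin 7) : ℝ :=
  D.c i * D.a j + D.d i * D.c j - D.c j * D.a i - D.d j * D.c i - D.fc D.c i j
def rD (i j : Fin 7) : ℝ := D.c i * D.b j - D.c j * D.b i - D.fc D.d i j
def rV (i j : Fin 7) : ℝ :=
  (D.a i + D.d i) * D.v j - (D.a j + D.d j) * D.v i - D.fc D.v i j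
def rW (i j : Fin 7) : ℝ := D.d i * D.w j - D.d j * D.w i - D.fc D.w i j
def rY (i j : Fin 7) : ℝ :=
  (2 * D.a i + D.d i) * D.y j + D.b i * D.z j - (2 * D.a j + D.d j) * D.y i - D.b j * D.z i
    - D.fc D.y i j
def rZ (i j : Fin 7) : ℝ :=
  D.c i * D.y j + (D.a i + 2 * D.d i) * D.z j - D.c j * D.y i - (D.a j + 2 * D.d j) * D.z i
    - 3 * (D.v i * D.w j - D.v j * D.w i) - D.fc D.z i j

/-- The curvature matrices. -/
def R (i j : Fin 7) : Mat7 := ⁅D.mat i, D.mat j⁆ - ∑ k, D.br i j k • D.mat k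

end ConnData

-- The bracket of the parabolic subalgebra that preserves the first axis. Its weights drive the
-- later computations: v scales by the trace of A, y carries A twisted by the trace, and the term
-- with factor 3 couples u and v into y.
set_option maxHeartbeats 2000000 in
theorem hMat_bracket (A A' : Matrix (Fin 2) (Fin 2) ℝ) (v v' : ℝ) (u u' y y' : Fin 2 → ℝ) :
    ⁅hMat A v u y, hMat A' v' u' y'⁆ =
      hMat ⁅A, A'⁆ (A.trace * v' - A'.trace * v + 2 * (u 0 * u' 1 - u 1 * u' 0))
        (A.mulVec u' - A'.mulVec u)
        (A.mulVec y' + A.trace • y' - A'.mulVec y - A'.trace • y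
          + (3 : ℝ) • (v' • u - v • u')) := by
  -- √2 becomes a variable known only through s ^ 2 = 2, so that powers can be collected before
  -- being reduced.
  obtain ⟨s, hs, h2⟩ : ∃ s : ℝ, √2 = s ∧ s ^ 2 = 2 := ⟨√2, rfl, Real.sq_sqrt (by norm_num)⟩
  ext i j
  rw [Ring.lie_def, Ring.lie_def, Matrix.sub_apply, Matrix.mul_apply, Matrix.mul_apply,
    Fin.sum_univ_seven, Fin.sum_univ_seven]
  unfold hMat
  rw [hs]
  fin_cases i <;> fin_cases j <;>
    simp [Matrix.trace_fin_two, Matrix.mul_apply, Fin.sum_univ_two, Matrix.mulVec,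
      dotProduct, Matrix.vecHead, Matrix.vecTail] <;> ring_nf <;> (try simp only [h2]) <;> (try ring_nf)

theorem hMat_add' (A A' : Matrix (Fin 2) (Fin 2) ℝ) (v v' : ℝ) (u u' y y' : Fin 2 → ℝ) :
    hMat A v u y + hMat A' v' u' y' = hMat (A + A') (v + v') (u + u') (y + y') := by
  ext i j
  fin_cases i <;> fin_cases j <;> simp [hMat, Matrix.trace_add] <;> try ring

theorem hMat_smul' (r : ℝ) (A : Matrix (Fin 2) (Fin 2) ℝ) (v : ℝ) (u y : Fin 2 → ℝ) :
    r • hMat A v u y = hMat (r • A) (r * v) (r • u) (r • y) := by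
  ext i j
  fin_cases i <;> fin_cases j <;> simp [hMat, Matrix.trace_smul] <;> try ring

/-- The matrices `h(A, v, u, y)` as a linear function of the parameters. -/
def hLin : (Matrix (Fin 2) (Fin 2) ℝ × ℝ × (Fin 2 → ℝ) × (Fin 2 → ℝ)) →ₗ[ℝ] Mat7 where
  toFun p := hMat p.1 p.2.1 p.2.2.1 p.2.2.2
  map_add' p q := (hMat_add' _ _ _ _ _ _ _ _).symm
  map_smul' r p := (hMat_smul' _ _ _ _ _).symm

end G2StarHolonomy

namespace G2StarHolonomy

namespace ConnData

variable (D : ConnData)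

/-- The subtracted sum is linear in the connection matrices, so `hLin` turns it into one such matrix
with entries `fc`; the commutator is `hMat_bracket`. The first entry of u arises although the
connection itself has u = (0, w). -/
theorem R_eq (i j : Fin 7) :
    D.R i j = hMat !![D.rA i j, D.rB i j; D.rC i j, D.rD i j] (D.rV i j)
      ![D.b i * D.w j - D.b j * D.w i, D.rW i j] ![D.rY i j, D.rZ i j] := by
  have h : ∑ k, D.br i j k • D.mat k =
      hMat !![D.fc D.a i j, D.fc D.b i j; D.fc D.c i j, D.fc D.d i j] (D.fc D.v i j)
        ![0, D.fc D.w i j] ![D.fc D.y i j, D.fc D.z i j] := by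
    have e : ∀ k, D.br i j k • D.mat k = hLin (D.br i j k •
        (!![D.a k, D.b k; D.c k, D.d k], D.v k, ![0, D.w k], ![D.y k, D.z k])) := by
      intro k; rw [map_smul]; rfl
    simp only [e, ← map_sum]
    change hLin _ = hLin (!![D.fc D.a i j, D.fc D.b i j; D.fc D.c i j, D.fc D.d i j],
      D.fc D.v i j, ![0, D.fc D.w i j], ![D.fc D.y i j, D.fc D.z i j])
    congr 1
    simp only [Prod.smul_mk, Prod.ext_iff, Prod.fst_sum, Prod.snd_sum, fc]
    refine ⟨?_, ?_, ?_, ?_⟩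
    · ext p q; fin_cases p <;> fin_cases q <;> simp [Matrix.sum_apply]
    · simp
    · ext p; fin_cases p <;> simp
    · ext p; fin_cases p <;> simp
  rw [R, h, mat, mat, hMat_bracket, sub_eq_add_neg, ← neg_one_smul ℝ, hMat_smul', hMat_add']
  congr 1
  · ext p q
    fin_cases p <;> fin_cases q <;>
      simp [Ring.lie_def, Matrix.mul_apply, Fin.sum_univ_two, rA, rB, rC, rD] <;> ring
  · simp [rV, Matrix.trace_fin_two]; ring
  · ext p; fin_cases p <;> simp [rW, Matrix.mulVec, dotProduct, Fin.sum_univ_two,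
        Matrix.vecHead, Matrix.vecTail] <;> ring
  · ext p; fin_cases p <;> simp [rY, rZ, Matrix.trace_fin_two, Matrix.mulVec, dotProduct, Fin.sum_univ_two,
        Matrix.vecHead, Matrix.vecTail] <;> ring


/-- The bracket satisfies the Jacobi identity, and the curvature satisfies the first Bianchi
identity and has no component in the direction of the parameter `u`. -/
structure IsLie : Prop where
  jacobi : ∀ i j l m, ∑ k, (D.br i j k * D.br k l m + D.br j l k * D.br k i m
    + D.br l i k * D.br k j m) = 0
  bianchi : ∀ i j k p, D.R i j p k + D.R j k p i + D.R k i p j = 0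
  flat_u : ∀ i j, D.b i * D.w j - D.b j * D.w i = 0
  flat_w : ∀ i j, D.rW i j = 0

/-- The index of the basis vector that is dual to a basis vector, up to sign. -/
def dual : Fin 7 → Fin 7 := ![4, 5, 6, 3, 0, 1, 2]

/-- The signs in the duality of basis vectors. -/
def sgn : Fin 7 → ℝ := ![1, 1, 1, -1, 1, 1, 1]

/-- The curvature tensor with all indices lowered. -/
def rm (i j k l : Fin 7) : ℝ := sgn l * D.R i j (dual l) k

theorem R_swap (i j : Fin 7) : D.R j i = -D.R i j := by
  have h : ∀ k, D.br j i k = -D.br i j k := fun k => by simp [br]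
  simp only [R, h, neg_smul, Finset.sum_neg_distrib, ← lie_skew (D.mat i) (D.mat j)]
  abel

theorem rm_swap_left (i j k l : Fin 7) : D.rm j i k l = -D.rm i j k l := by
  simp [rm, D.R_swap i j]

/-- All matrices h(A, v, u, y) are skew for the inner product; no Bianchi identity is involved. -/
theorem rm_swap_right (i j k l : Fin 7) : D.rm i j l k = -D.rm i j k l := by
  simp only [rm, R_eq]
  fin_cases k <;> fin_cases l <;> simp [hMat, dual, sgn, Matrix.trace_fin_two]

variable {D}

theorem IsLie.rm_cyclic (h : D.IsLie) (i j k l : Fin 7) :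
    D.rm i j k l + D.rm j k i l + D.rm k i j l = 0 := by
  have := h.bianchi i j k (dual l)
  simp only [rm]
  linear_combination sgn l * this

/-- The usual octahedron argument: four cyclic identities combined with both skew-symmetries. -/
theorem IsLie.rm_pair (h : D.IsLie) (i j k l : Fin 7) : D.rm i j k l = D.rm k l i j := by
  have h1 := h.rm_cyclic i j k l
  have h2 := h.rm_cyclic j k l i
  have h3 := h.rm_cyclic k l i j
  have h4 := h.rm_cyclic l i j k
  have s := D.rm_swap_right
  have t := D.rm_swap_left
  linarith [s i j k l, s j k i l, s k i j l, s j k l i, s k l j i, s l j k i, s k l i j,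
    s l i k j, s i k l j, s l i j k, s i j l k, s j l i k, t i k j l, t j l i k, t i k l j,
    t j l k i]

theorem IsLie.R_eq' (h : D.IsLie) (i j : Fin 7) :
    D.R i j = hMat !![D.rA i j, D.rB i j; D.rC i j, D.rD i j] (D.rV i j) 0
      ![D.rY i j, D.rZ i j] := by
  rw [R_eq, h.flat_u, h.flat_w]
  congr 1
  ext p; fin_cases p <;> rfl

end ConnData

end G2StarHolonomy

/-! ### Curvature components that survive pair symmetry and the Bianchi identity -/

namespace G2StarHolonomy

namespace ConnData

variable {D : ConnData}

/-- By pair symmetry each parameter of the curvature on (i, j) is an entry of the curvature on a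
fixed pair. A parameter that occupies several entries gives several such pairs, as the v-component
and the trace do here. -/
theorem IsLie.components (h : D.IsLie) (i j : Fin 7) :
    D.rA i j = D.rm 1 5 i j ∧ D.rB i j = D.rm 2 5 i j ∧ D.rC i j = D.rm 1 6 i j ∧
    D.rD i j = D.rm 2 6 i j ∧ D.rV i j = D.rm 6 5 i j ∧ √2 * D.rV i j = D.rm 3 4 i j ∧
    D.rY i j = D.rm 4 5 i j ∧ D.rZ i j = D.rm 4 6 i j ∧ D.rA i j + D.rD i j = D.rm 0 4 i j := by
  rw [h.rm_pair 1 5 i j, h.rm_pair 2 5 i j, h.rm_pair 1 6 i j, h.rm_pair 2 6 i j,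
    h.rm_pair 6 5 i j, h.rm_pair 3 4 i j, h.rm_pair 4 5 i j, h.rm_pair 4 6 i j, h.rm_pair 0 4 i j]
  simp only [rm, h.R_eq' i j]
  simp [hMat, dual, sgn, Matrix.trace_fin_two]

/-- The curvature vanishes on a pair of vectors. -/
def Flat (D : ConnData) (i j : Fin 7) : Prop :=
  D.rA i j = 0 ∧ D.rB i j = 0 ∧ D.rC i j = 0 ∧ D.rD i j = 0 ∧ D.rV i j = 0 ∧ D.rY i j = 0 ∧
    D.rZ i j = 0

theorem fc_swap (f : Fin 7 → ℝ) (i j : Fin 7) : D.fc f j i = -D.fc f i j := by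
  simp only [fc, br, ← Finset.sum_neg_distrib]
  exact Finset.sum_congr rfl fun k _ => by ring

theorem Flat.swap {i j : Fin 7} (h : D.Flat i j) : D.Flat j i := by
  obtain ⟨h1, h2, h3, h4, h5, h6, h7⟩ := h
  simp only [Flat, rA, rB, rC, rD, rV, rY, rZ, fc_swap _ i j] at *
  refine ⟨?_, ?_, ?_, ?_, ?_, ?_, ?_⟩ <;> linarith

/-- The lowered curvature tensor in terms of the components of the curvature. -/
theorem IsLie.rm_eq (h : D.IsLie) (i j k l : Fin 7) :
    D.rm i j k l = sgn l * hMat !![D.rA i j, D.rB i j; D.rC i j, D.rD i j] (D.rV i j) 0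
      ![D.rY i j, D.rZ i j] (dual l) k := by
  rw [rm, h.R_eq']

/-- The seven listed pairs are those that carry the seven parameters in `components`. -/
theorem IsLie.flat_of (h : D.IsLie) {i j : Fin 7}
    (hij : ∀ k l, (k, l) ∈ [(1, 5), (2, 5), (1, 6), (2, 6), (6, 5), (4, 5), (4, 6)] →
      D.rm k l i j = 0) : D.Flat i j := by
  obtain ⟨c1, c2, c3, c4, c5, -, c7, c8, -⟩ := h.components i j
  refine ⟨c1.trans (hij _ _ ?_), c2.trans (hij _ _ ?_), c3.trans (hij _ _ ?_),
    c4.trans (hij _ _ ?_), c5.trans (hij _ _ ?_), c7.trans (hij _ _ ?_),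
    c8.trans (hij _ _ ?_)⟩ <;> simp

/-- The entry of h(A, v, 0, y) that pairs the two basis vectors is identically zero, so by pair
symmetry the curvature on them vanishes. The same reason gives the other `flat` lemmas below. -/
theorem IsLie.flat01 (h : D.IsLie) : D.Flat 0 1 := by
  refine h.flat_of fun k l _ => ?_
  rw [h.rm_eq]; simp [hMat, dual, sgn]

theorem IsLie.flat02 (h : D.IsLie) : D.Flat 0 2 := by
  refine h.flat_of fun k l _ => ?_
  rw [h.rm_eq]; simp [hMat, dual, sgn]

theorem IsLie.flat12 (h : D.IsLie) : D.Flat 1 2 := by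
  refine h.flat_of fun k l _ => ?_
  rw [h.rm_eq]; simp [hMat, dual, sgn]

theorem IsLie.flat03 (h : D.IsLie) : D.Flat 0 3 := by
  refine h.flat_of fun k l _ => ?_
  rw [h.rm_eq]; simp [hMat, dual, sgn]

theorem IsLie.flat13 (h : D.IsLie) : D.Flat 1 3 := by
  refine h.flat_of fun k l _ => ?_
  rw [h.rm_eq]; simp [hMat, dual, sgn]

theorem IsLie.flat23 (h : D.IsLie) : D.Flat 2 3 := by
  refine h.flat_of fun k l _ => ?_
  rw [h.rm_eq]; simp [hMat, dual, sgn]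

theorem IsLie.flat05 (h : D.IsLie) : D.Flat 0 5 := by
  refine h.flat_of fun k l _ => ?_
  rw [h.rm_eq]; simp [hMat, dual, sgn]

theorem IsLie.flat06 (h : D.IsLie) : D.Flat 0 6 := by
  refine h.flat_of fun k l _ => ?_
  rw [h.rm_eq]; simp [hMat, dual, sgn]

theorem IsLie.flat35 (h : D.IsLie) : D.Flat 3 5 := by
  refine h.flat_of fun k l _ => ?_
  rw [h.rm_eq]; simp [hMat, dual, sgn]

theorem IsLie.flat36 (h : D.IsLie) : D.Flat 3 6 := by
  refine h.flat_of fun k l _ => ?_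
  rw [h.rm_eq]; simp [hMat, dual, sgn]

theorem IsLie.flat14 (h : D.IsLie) : D.Flat 1 4 := by
  refine h.flat_of fun k l _ => ?_
  rw [h.rm_eq]; simp [hMat, dual, sgn]

theorem IsLie.flat24 (h : D.IsLie) : D.Flat 2 4 := by
  refine h.flat_of fun k l _ => ?_
  rw [h.rm_eq]; simp [hMat, dual, sgn]

/-- The curvature matrices in terms of the components of the curvature, entrywise. -/
theorem IsLie.R_apply (h : D.IsLie) (i j p k : Fin 7) :
    D.R i j p k = hMat !![D.rA i j, D.rB i j; D.rC i j, D.rD i j] (D.rV i j) 0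
      ![D.rY i j, D.rZ i j] p k := by
  rw [h.R_eq']

/-- Bianchi on (0, 4, 5) and (0, 4, 6), where two of the three mutual pairs involving 0 are flat.
Only the y-part survives, and it is the trace of the curvature on (4, 5) and (4, 6). -/
theorem IsLie.curv04 (h : D.IsLie) :
    D.rA 0 4 = 0 ∧ D.rB 0 4 = 0 ∧ D.rC 0 4 = 0 ∧ D.rD 0 4 = 0 ∧ D.rV 0 4 = 0 ∧
      D.rY 0 4 = D.rA 4 5 + D.rD 4 5 ∧ D.rZ 0 4 = D.rA 4 6 + D.rD 4 6 := by
  obtain ⟨f1, f2, f3, f4, f5, f6, f7⟩ := h.flat05.swap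
  obtain ⟨g1, g2, g3, g4, g5, g6, g7⟩ := h.flat06.swap
  have p0 := h.bianchi 0 4 5 0
  have p2 := h.bianchi 0 4 5 2
  have p5 := h.bianchi 0 4 5 5
  have p6 := h.bianchi 0 4 5 6
  simp only [h.R_apply] at p0 p2 p5 p6
  simp [hMat, Matrix.trace_fin_two] at p0 p2 p5 p6
  have q0 := h.bianchi 0 4 6 0
  have q5 := h.bianchi 0 4 6 5
  have q6 := h.bianchi 0 4 6 6
  simp only [h.R_apply] at q0 q5 q6
  simp [hMat, Matrix.trace_fin_two] at q0 q5 q6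
  simp only [f1, f2, f3, f4, f5, f6, f7, g1, g2, g3, g4, g5, g6, g7] at *
  refine ⟨?_, ?_, ?_, ?_, ?_, ?_, ?_⟩ <;> linarith

/-- As for `curv04`, with 3 instead of 0: the surviving y-part now records the v-component on (4, 5)
and (4, 6). -/
theorem IsLie.curv34 (h : D.IsLie) :
    D.rA 3 4 = 0 ∧ D.rB 3 4 = 0 ∧ D.rC 3 4 = 0 ∧ D.rD 3 4 = 0 ∧ D.rV 3 4 = 0 ∧
      D.rY 3 4 = √2 * D.rV 4 5 ∧ D.rZ 3 4 = √2 * D.rV 4 6 := by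
  obtain ⟨f1, f2, f3, f4, f5, f6, f7⟩ := h.flat35.swap
  obtain ⟨g1, g2, g3, g4, g5, g6, g7⟩ := h.flat36.swap
  have p0 := h.bianchi 3 4 5 0
  have p2 := h.bianchi 3 4 5 2
  have p5 := h.bianchi 3 4 5 5
  have p6 := h.bianchi 3 4 5 6
  simp only [h.R_apply] at p0 p2 p5 p6
  simp [hMat, Matrix.trace_fin_two] at p0 p2 p5 p6
  have q0 := h.bianchi 3 4 6 0
  have q5 := h.bianchi 3 4 6 5
  have q6 := h.bianchi 3 4 6 6
  simp only [h.R_apply] at q0 q5 q6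
  simp [hMat, Matrix.trace_fin_two] at q0 q5 q6
  simp only [f1, f2, f3, f4, f5, f6, f7, g1, g2, g3, g4, g5, g6, g7] at *
  refine ⟨?_, ?_, ?_, ?_, ?_, ?_, ?_⟩ <;> linarith

/-- Bianchi on (1, 5, 4) with (1, 4) flat. The next three lemmas apply it to the other pairs of an
index in {1, 2} with one in {5, 6}. -/
theorem IsLie.curv15 (h : D.IsLie) :
    D.rV 1 5 = 0 ∧ D.rA 1 5 + D.rD 1 5 = 0 ∧ D.rY 1 5 = D.rA 4 5 ∧
      D.rZ 1 5 = D.rC 4 5 := by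
  obtain ⟨f1, f2, f3, f4, f5, f6, f7⟩ := h.flat14.swap
  have p1 := h.bianchi 1 5 4 1
  have p2 := h.bianchi 1 5 4 2
  have p3 := h.bianchi 1 5 4 3
  have p4 := h.bianchi 1 5 4 4
  simp only [h.R_apply] at p1 p2 p3 p4
  simp [hMat, Matrix.trace_fin_two] at p1 p2 p3 p4
  have hs := D.R_swap 4 5
  have h1 := congrFun (congrFun hs 1) 1
  have h2 := congrFun (congrFun hs 2) 1
  simp only [h.R_apply, Matrix.neg_apply] at h1 h2
  simp [hMat] at h1 h2
  simp only [f1, f2, f3, f4, f5, f6, f7] at *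
  refine ⟨by simpa using p3, ?_, ?_, ?_⟩ <;> linarith

theorem IsLie.curv16 (h : D.IsLie) :
    D.rV 1 6 = 0 ∧ D.rA 1 6 + D.rD 1 6 = 0 ∧ D.rY 1 6 = D.rA 4 6 ∧
      D.rZ 1 6 = D.rC 4 6 := by
  obtain ⟨f1, f2, f3, f4, f5, f6, f7⟩ := h.flat14.swap
  have p1 := h.bianchi 1 6 4 1
  have p2 := h.bianchi 1 6 4 2
  have p3 := h.bianchi 1 6 4 3
  have p4 := h.bianchi 1 6 4 4
  simp only [h.R_apply] at p1 p2 p3 p4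
  simp [hMat, Matrix.trace_fin_two] at p1 p2 p3 p4
  have hs := D.R_swap 4 6
  have h1 := congrFun (congrFun hs 1) 1
  have h2 := congrFun (congrFun hs 2) 1
  simp only [h.R_apply, Matrix.neg_apply] at h1 h2
  simp [hMat] at h1 h2
  simp only [f1, f2, f3, f4, f5, f6, f7] at *
  refine ⟨by simpa using p3, ?_, ?_, ?_⟩ <;> linarith

theorem IsLie.curv25 (h : D.IsLie) :
    D.rV 2 5 = 0 ∧ D.rA 2 5 + D.rD 2 5 = 0 ∧ D.rY 2 5 = D.rB 4 5 ∧
      D.rZ 2 5 = D.rD 4 5 := by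
  obtain ⟨f1, f2, f3, f4, f5, f6, f7⟩ := h.flat24.swap
  have p1 := h.bianchi 2 5 4 1
  have p2 := h.bianchi 2 5 4 2
  have p3 := h.bianchi 2 5 4 3
  have p4 := h.bianchi 2 5 4 4
  simp only [h.R_apply] at p1 p2 p3 p4
  simp [hMat, Matrix.trace_fin_two] at p1 p2 p3 p4
  have hs := D.R_swap 4 5
  have h1 := congrFun (congrFun hs 1) 2
  have h2 := congrFun (congrFun hs 2) 2
  simp only [h.R_apply, Matrix.neg_apply] at h1 h2
  simp [hMat] at h1 h2
  simp only [f1, f2, f3, f4, f5, f6, f7] at *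
  refine ⟨by simpa using p3, ?_, ?_, ?_⟩ <;> linarith

theorem IsLie.curv26 (h : D.IsLie) :
    D.rV 2 6 = 0 ∧ D.rA 2 6 + D.rD 2 6 = 0 ∧ D.rY 2 6 = D.rB 4 6 ∧
      D.rZ 2 6 = D.rD 4 6 := by
  obtain ⟨f1, f2, f3, f4, f5, f6, f7⟩ := h.flat24.swap
  have p1 := h.bianchi 2 6 4 1
  have p2 := h.bianchi 2 6 4 2
  have p3 := h.bianchi 2 6 4 3
  have p4 := h.bianchi 2 6 4 4
  simp only [h.R_apply] at p1 p2 p3 p4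
  simp [hMat, Matrix.trace_fin_two] at p1 p2 p3 p4
  have hs := D.R_swap 4 6
  have h1 := congrFun (congrFun hs 1) 2
  have h2 := congrFun (congrFun hs 2) 2
  simp only [h.R_apply, Matrix.neg_apply] at h1 h2
  simp [hMat] at h1 h2
  simp only [f1, f2, f3, f4, f5, f6, f7] at *
  refine ⟨by simpa using p3, ?_, ?_, ?_⟩ <;> linarith

/-- Bianchi on (5, 6, 4) in the coordinates 5 and 6, where the curvature on (5, 6) does not
contribute because u = 0. -/
theorem IsLie.curv_sym (h : D.IsLie) :
    D.rA 4 6 = D.rC 4 5 ∧ D.rB 4 6 = D.rD 4 5 := by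
  have p5 := h.bianchi 5 6 4 5
  have p6 := h.bianchi 5 6 4 6
  simp only [h.R_apply] at p5 p6
  simp [hMat, Matrix.trace_fin_two] at p5 p6
  have hs := D.R_swap 4 6
  have h1 := congrFun (congrFun hs 5) 5
  have h2 := congrFun (congrFun hs 6) 5
  simp only [h.R_apply, Matrix.neg_apply] at h1 h2
  simp [hMat] at h1 h2
  constructor <;> linarith

theorem IsLie.curv56 (h : D.IsLie) :
    D.rA 5 6 = 0 ∧ D.rB 5 6 = 0 ∧ D.rC 5 6 = 0 ∧ D.rD 5 6 = 0 ∧ D.rV 5 6 = 0 := by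
  obtain ⟨v15, -⟩ := h.curv15
  obtain ⟨v16, -⟩ := h.curv16
  obtain ⟨v25, -⟩ := h.curv25
  obtain ⟨v26, -⟩ := h.curv26
  have p1 := h.bianchi 5 6 1 1
  have p2 := h.bianchi 5 6 1 2
  simp only [h.R_apply] at p1 p2
  simp [hMat, Matrix.trace_fin_two] at p1 p2
  have q1 := h.bianchi 5 6 2 1
  have q2 := h.bianchi 5 6 2 2
  simp only [h.R_apply] at q1 q2
  simp [hMat, Matrix.trace_fin_two] at q1 q2
  -- The v-component on (5, 6) is tied to the v-component on (3, 4), which `curv34` shows to be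
  -- zero.
  obtain ⟨-, -, -, -, -, c, -⟩ := h.components 5 6
  have hs := D.R_swap 1 6
  have ht := D.R_swap 2 6
  have h1 := congrFun (congrFun hs 1) 6
  have h2 := congrFun (congrFun ht 1) 6
  simp only [h.R_apply, Matrix.neg_apply] at h1 h2
  simp [hMat] at h1 h2
  have w := h.curv34.2.2.2.2.1
  rw [h.rm_eq] at c
  simp [hMat, dual, sgn, w] at c
  simp only [v15, v16, v25, v26, neg_zero] at *
  refine ⟨?_, ?_, ?_, ?_, c⟩ <;> linarith

/-- The part of the curvature with values in `𝔰𝔩(2)` is a binary quartic. -/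
theorem IsLie.curv_quartic (h : D.IsLie) :
    D.rD 1 6 = D.rC 2 6 ∧ D.rA 1 6 = -D.rC 2 6 ∧ D.rC 1 5 = -D.rC 2 6 ∧ D.rD 1 5 = D.rC 2 5 ∧
    D.rA 1 5 = -D.rC 2 5 ∧ D.rB 1 6 = D.rC 2 5 ∧ D.rA 2 6 = D.rC 2 5 ∧ D.rD 2 6 = -D.rC 2 5 ∧
    D.rB 1 5 = D.rA 2 5 ∧ D.rD 2 5 = -D.rA 2 5 ∧ D.rB 2 6 = -D.rA 2 5 := by
  obtain ⟨-, t15, -⟩ := h.curv15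
  obtain ⟨-, t16, -⟩ := h.curv16
  obtain ⟨-, t25, -⟩ := h.curv25
  obtain ⟨-, t26, -⟩ := h.curv26
  obtain ⟨z1, z2, z3, z4, -⟩ := h.curv56
  obtain ⟨y1, y2, y3, y4, y5, y6, y7⟩ := h.flat12.swap
  have p1 := h.bianchi 1 5 2 1
  have p2 := h.bianchi 1 5 2 2
  simp only [h.R_apply] at p1 p2
  simp [hMat, Matrix.trace_fin_two] at p1 p2
  have q1 := h.bianchi 1 6 2 1
  have q2 := h.bianchi 1 6 2 2
  simp only [h.R_apply] at q1 q2
  simp [hMat, Matrix.trace_fin_two] at q1 q2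
  have r5 := h.bianchi 1 5 6 5
  have r6 := h.bianchi 1 5 6 6
  simp only [h.R_apply] at r5 r6
  simp [hMat, Matrix.trace_fin_two] at r5 r6
  have s5 := h.bianchi 2 5 6 5
  have s6 := h.bianchi 2 5 6 6
  simp only [h.R_apply] at s5 s6
  simp [hMat, Matrix.trace_fin_two] at s5 s6
  have e25 := D.R_swap 2 5
  have e26 := D.R_swap 2 6
  have e16 := D.R_swap 1 6
  have h1 := congrFun (congrFun e25 1) 1
  have h2 := congrFun (congrFun e25 2) 1
  have h3 := congrFun (congrFun e26 1) 1
  have h4 := congrFun (congrFun e26 2) 1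
  have h5 := congrFun (congrFun e16 5) 5
  have h6 := congrFun (congrFun e16 6) 5
  have h7 := congrFun (congrFun e26 5) 5
  have h8 := congrFun (congrFun e26 6) 5
  simp only [h.R_apply, Matrix.neg_apply] at h1 h2 h3 h4 h5 h6 h7 h8
  simp [hMat] at h1 h2 h3 h4 h5 h6 h7 h8
  refine ⟨?_, ?_, ?_, ?_, ?_, ?_, ?_, ?_, ?_, ?_, ?_⟩ <;> linarith

end ConnData

end G2StarHolonomy

/-! ### Structure constants, and the closed two-forms contained in the curvature -/

namespace G2StarHolonomy

namespace ConnData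

variable (D : ConnData)

theorem fc01 (f : Fin 7 → ℝ) : D.fc f 0 1 =
    (-D.w 0 - D.a 1 - D.d 1) * f 0 + (D.a 0) * f 1 + (D.c 0) * f 2 := by
  simp [fc, br, mat, hMat, Fin.sum_univ_seven, Matrix.trace_fin_two, -mul_eq_mul_right_iff]
  try ring

theorem fc02 (f : Fin 7 → ℝ) : D.fc f 0 2 =
    (-D.a 2 - D.d 2) * f 0 + (D.b 0) * f 1 + (D.d 0) * f 2 := by
  simp [fc, br, mat, hMat, Fin.sum_univ_seven, Matrix.trace_fin_two, -mul_eq_mul_right_iff]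
  try ring

theorem fc03 (f : Fin 7 → ℝ) : D.fc f 0 3 =
    (√2 * D.v 0 - D.a 3 - D.d 3) * f 0 + (√2 * D.w 0) * f 2 := by
  simp [fc, br, mat, hMat, Fin.sum_univ_seven, Matrix.trace_fin_two, -mul_eq_mul_right_iff]
  try ring

theorem fc04 (f : Fin 7 → ℝ) : D.fc f 0 4 =
    (-D.a 4 - D.d 4) * f 0 + (D.y 0) * f 1 + (D.z 0) * f 2 + (√2 * D.v 0) * f 3 + (-D.a 0 - D.d 0) * f 4 + (D.w 0) * f 5 := by
  simp [fc, br, mat, hMat, Fin.sum_univ_seven, Matrix.trace_fin_two, -mul_eq_mul_right_iff]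
  try ring

theorem fc05 (f : Fin 7 → ℝ) : D.fc f 0 5 =
    (-D.y 0 - D.a 5 - D.d 5) * f 0 + (-D.v 0) * f 2 + (-D.a 0) * f 5 + (-D.b 0) * f 6 := by
  simp [fc, br, mat, hMat, Fin.sum_univ_seven, Matrix.trace_fin_two, -mul_eq_mul_right_iff]
  try ring

theorem fc06 (f : Fin 7 → ℝ) : D.fc f 0 6 =
    (-D.z 0 - D.a 6 - D.d 6) * f 0 + (D.v 0) * f 1 + (√2 * D.w 0) * f 3 + (-D.c 0) * f 5 + (-D.d 0) * f 6 := by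
  simp [fc, br, mat, hMat, Fin.sum_univ_seven, Matrix.trace_fin_two, -mul_eq_mul_right_iff]
  try ring

theorem fc12 (f : Fin 7 → ℝ) : D.fc f 1 2 =
    (D.w 2) * f 0 + (D.b 1 - D.a 2) * f 1 + (D.d 1 - D.c 2) * f 2 := by
  simp [fc, br, mat, hMat, Fin.sum_univ_seven, Matrix.trace_fin_two, -mul_eq_mul_right_iff]
  try ring

theorem fc13 (f : Fin 7 → ℝ) : D.fc f 1 3 =
    (√2 * D.v 1 + D.w 3) * f 0 + (-D.a 3) * f 1 + (√2 * D.w 1 - D.c 3) * f 2 := by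
  simp [fc, br, mat, hMat, Fin.sum_univ_seven, Matrix.trace_fin_two, -mul_eq_mul_right_iff]
  try ring

theorem fc14 (f : Fin 7 → ℝ) : D.fc f 1 4 =
    (D.w 4) * f 0 + (D.y 1 - D.a 4) * f 1 + (D.z 1 - D.c 4) * f 2 + (√2 * D.v 1) * f 3 + (-D.a 1 - D.d 1) * f 4 + (D.w 1) * f 5 := by
  simp [fc, br, mat, hMat, Fin.sum_univ_seven, Matrix.trace_fin_two, -mul_eq_mul_right_iff]
  try ring

theorem fc15 (f : Fin 7 → ℝ) : D.fc f 1 5 =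
    (-D.y 1 + D.w 5) * f 0 + (-D.a 5) * f 1 + (-D.v 1 - D.c 5) * f 2 + (-D.a 1) * f 5 + (-D.b 1) * f 6 := by
  simp [fc, br, mat, hMat, Fin.sum_univ_seven, Matrix.trace_fin_two, -mul_eq_mul_right_iff]
  try ring

theorem fc16 (f : Fin 7 → ℝ) : D.fc f 1 6 =
    (-D.z 1 + D.w 6) * f 0 + (D.v 1 - D.a 6) * f 1 + (-D.c 6) * f 2 + (√2 * D.w 1) * f 3 + (-D.c 1) * f 5 + (-D.d 1) * f 6 := by
  simp [fc, br, mat, hMat, Fin.sum_univ_seven, Matrix.trace_fin_two, -mul_eq_mul_right_iff]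
  try ring

theorem fc23 (f : Fin 7 → ℝ) : D.fc f 2 3 =
    (√2 * D.v 2) * f 0 + (-D.b 3) * f 1 + (√2 * D.w 2 - D.d 3) * f 2 := by
  simp [fc, br, mat, hMat, Fin.sum_univ_seven, Matrix.trace_fin_two, -mul_eq_mul_right_iff]
  try ring

theorem fc24 (f : Fin 7 → ℝ) : D.fc f 2 4 =
    (D.y 2 - D.b 4) * f 1 + (D.z 2 - D.d 4) * f 2 + (√2 * D.v 2) * f 3 + (-D.a 2 - D.d 2) * f 4 + (D.w 2) * f 5 := by
  simp [fc, br, mat, hMat, Fin.sum_univ_seven, Matrix.trace_fin_two, -mul_eq_mul_right_iff]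
  try ring

theorem fc25 (f : Fin 7 → ℝ) : D.fc f 2 5 =
    (-D.y 2) * f 0 + (-D.b 5) * f 1 + (-D.v 2 - D.d 5) * f 2 + (-D.a 2) * f 5 + (-D.b 2) * f 6 := by
  simp [fc, br, mat, hMat, Fin.sum_univ_seven, Matrix.trace_fin_two, -mul_eq_mul_right_iff]
  try ring

theorem fc26 (f : Fin 7 → ℝ) : D.fc f 2 6 =
    (-D.z 2) * f 0 + (D.v 2 - D.b 6) * f 1 + (-D.d 6) * f 2 + (√2 * D.w 2) * f 3 + (-D.c 2) * f 5 + (-D.d 2) * f 6 := by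
  simp [fc, br, mat, hMat, Fin.sum_univ_seven, Matrix.trace_fin_two, -mul_eq_mul_right_iff]
  try ring

theorem fc34 (f : Fin 7 → ℝ) : D.fc f 3 4 =
    (-(√2 * D.v 4)) * f 0 + (D.y 3) * f 1 + (D.z 3 - √2 * D.w 4) * f 2 + (√2 * D.v 3) * f 3 + (-D.a 3 - D.d 3) * f 4 + (D.w 3) * f 5 := by
  simp [fc, br, mat, hMat, Fin.sum_univ_seven, Matrix.trace_fin_two, -mul_eq_mul_right_iff]
  try ring

theorem fc35 (f : Fin 7 → ℝ) : D.fc f 3 5 =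
    (-D.y 3 - √2 * D.v 5) * f 0 + (-D.v 3 - √2 * D.w 5) * f 2 + (-D.a 3) * f 5 + (-D.b 3) * f 6 := by
  simp [fc, br, mat, hMat, Fin.sum_univ_seven, Matrix.trace_fin_two, -mul_eq_mul_right_iff]
  try ring

theorem fc36 (f : Fin 7 → ℝ) : D.fc f 3 6 =
    (-D.z 3 - √2 * D.v 6) * f 0 + (D.v 3) * f 1 + (-(√2 * D.w 6)) * f 2 + (√2 * D.w 3) * f 3 + (-D.c 3) * f 5 + (-D.d 3) * f 6 := by
  simp [fc, br, mat, hMat, Fin.sum_univ_seven, Matrix.trace_fin_two, -mul_eq_mul_right_iff]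
  try ring

theorem fc45 (f : Fin 7 → ℝ) : D.fc f 4 5 =
    (-D.y 4) * f 0 + (-D.y 5) * f 1 + (-D.v 4 - D.z 5) * f 2 + (-(√2 * D.v 5)) * f 3 + (D.a 5 + D.d 5) * f 4 + (-D.a 4 - D.w 5) * f 5 + (-D.b 4) * f 6 := by
  simp [fc, br, mat, hMat, Fin.sum_univ_seven, Matrix.trace_fin_two, -mul_eq_mul_right_iff]
  try ring

theorem fc46 (f : Fin 7 → ℝ) : D.fc f 4 6 =
    (-D.z 4) * f 0 + (D.v 4 - D.y 6) * f 1 + (-D.z 6) * f 2 + (√2 * D.w 4 - √2 * D.v 6) * f 3 + (D.a 6 + D.d 6) * f 4 + (-D.c 4 - D.w 6) * f 5 + (-D.d 4) * f 6 := by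
  simp [fc, br, mat, hMat, Fin.sum_univ_seven, Matrix.trace_fin_two, -mul_eq_mul_right_iff]
  try ring

theorem fc56 (f : Fin 7 → ℝ) : D.fc f 5 6 =
    (-D.z 5 + D.y 6) * f 0 + (D.v 5) * f 1 + (D.v 6) * f 2 + (√2 * D.w 5) * f 3 + (-D.c 5 + D.a 6) * f 5 + (-D.d 5 + D.b 6) * f 6 := by
  simp [fc, br, mat, hMat, Fin.sum_univ_seven, Matrix.trace_fin_two, -mul_eq_mul_right_iff]
  try ring

/-- The trace of the connection on the plane of the second and third basis vectors. -/
def t (i : Fin 7) : ℝ := D.a i + D.d i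

/-- The trace of the curvature on the plane of the second and third basis vectors. -/
def rT (i j : Fin 7) : ℝ := D.rA i j + D.rD i j

/-- Commutators are traceless, so the trace of the curvature is the exterior derivative of the trace
form. -/
theorem rT_eq (i j : Fin 7) : D.rT i j = -D.fc D.t i j := by
  simp only [rT, rA, rD, fc, t, mul_add, Finset.sum_add_distrib]
  ring

variable {D}

theorem fc_self (f : Fin 7 → ℝ) (i : Fin 7) : D.fc f i i = 0 := by
  simp [fc, br]

/-- The Jacobi identity as d² = 0 on linear forms. -/
theorem IsLie.fc_fc (h : D.IsLie) (f : Fin 7 → ℝ) (i j l : Fin 7) :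
    D.fc (fun k => D.fc f k l) i j + D.fc (fun k => D.fc f k i) j l
      + D.fc (fun k => D.fc f k j) l i = 0 := by
  have e : ∀ i j l, D.fc (fun k => D.fc f k l) i j = ∑ m, (∑ k, D.br i j k * D.br k l m) * f m := by
    intro i j l
    simp only [fc, Finset.mul_sum, Finset.sum_mul]
    rw [Finset.sum_comm]
    exact Finset.sum_congr rfl fun _ _ => Finset.sum_congr rfl fun _ _ => by ring
  rw [e, e, e, ← Finset.sum_add_distrib, ← Finset.sum_add_distrib]
  refine Finset.sum_eq_zero fun m _ => ?_
  rw [← add_mul, ← add_mul, ← Finset.sum_add_distrib, ← Finset.sum_add_distrib, h.jacobi i j l m,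
    zero_mul]

/-- The trace of the curvature is a closed two-form. -/
theorem IsLie.rT_closed (h : D.IsLie) (i j l : Fin 7) :
    D.fc (fun k => D.rT k l) i j + D.fc (fun k => D.rT k i) j l
      + D.fc (fun k => D.rT k j) l i = 0 := by
  have := h.fc_fc D.t i j l
  have e : ∀ i j l, D.fc (fun k => D.rT k l) i j = -D.fc (fun k => D.fc D.t k l) i j := by
    intro i j l
    simp only [rT_eq]
    simp [fc]
  rw [e, e, e]; linarith

/-- `rV` is the differential of v twisted by the trace form t; applying the twisted differential
again leaves only its curvature `rT` wedged with v. -/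
theorem IsLie.rV_closed (h : D.IsLie) (i j l : Fin 7) :
    D.fc (fun k => D.rV k l) i j + D.fc (fun k => D.rV k i) j l + D.fc (fun k => D.rV k j) l i =
      -D.rT i j * D.v l + D.t l * D.rV i j - D.rT j l * D.v i + D.t i * D.rV j l
      - D.rT l i * D.v j + D.t j * D.rV l i := by
  have := h.fc_fc D.v i j l
  have e : ∀ i j l, D.fc (fun k => D.rV k l) i j =
      D.fc D.t i j * D.v l - D.t l * D.fc D.v i j - D.fc (fun k => D.fc D.v k l) i j := by
    intro i j l
    have : ∀ k, D.rV k l = D.v l * D.t k - D.t l * D.v k - D.fc D.v k l := by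
      intro k; rw [rV, t, t]; ring
    simp only [this]
    have e' : ∀ g : Fin 7 → ℝ, D.fc (fun k => D.v l * D.t k - D.t l * D.v k - g k) i j =
        D.fc D.t i j * D.v l - D.t l * D.fc D.v i j - D.fc g i j := by
      intro g
      simp only [fc, Finset.mul_sum, Finset.sum_mul, ← Finset.sum_sub_distrib]
      exact Finset.sum_congr rfl fun _ _ => by ring
    exact e' _
  have tt : ∀ i, D.t i = D.a i + D.d i := fun _ => rfl
  rw [e, e, e]
  simp only [rT_eq, rV, ← tt]
  linear_combination -this

end ConnData

end G2StarHolonomy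

/-! ### Nontrivial semisimple action on the plane E -/

namespace G2StarHolonomy

namespace ConnData

variable (D : ConnData)

/-- The action of the connection on the plane of the second and third basis vectors. -/
def matE (i : Fin 7) : Matrix (Fin 2) (Fin 2) ℝ := !![D.a i, D.b i; D.c i, D.d i]

/-- The action of the curvature on the plane of the second and third basis vectors. -/
def curvE (i j : Fin 7) : Matrix (Fin 2) (Fin 2) ℝ := !![D.rA i j, D.rB i j; D.rC i j, D.rD i j]

/-- The vector `(p, q)` is mapped to a multiple of itself. -/
def Eigen (T : Matrix (Fin 2) (Fin 2) ℝ) (p q : ℝ) : Prop :=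
  p * (T 1 0 * p + T 1 1 * q) = q * (T 0 0 * p + T 0 1 * q)

theorem eigen_iff {T : Matrix (Fin 2) (Fin 2) ℝ} {p q : ℝ} (hpq : (p, q) ≠ (0, 0)) :
    Eigen T p q ↔ ∃ c : ℝ, T.mulVec ![p, q] = c • ![p, q] := by
  have hpq' : p ≠ 0 ∨ q ≠ 0 := by
    by_contra! hh
    exact hpq (by simp [hh.1, hh.2])
  simp only [Eigen]
  constructor
  · intro hT
    rcases hpq' with hp | hq
    · refine ⟨(T 0 0 * p + T 0 1 * q) / p, ?_⟩
      ext k; fin_cases k <;>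
        simp [Matrix.mulVec, dotProduct, Fin.sum_univ_two] <;> field_simp
      linarith
    · refine ⟨(T 1 0 * p + T 1 1 * q) / q, ?_⟩
      ext k; fin_cases k <;>
        simp [Matrix.mulVec, dotProduct, Fin.sum_univ_two] <;> field_simp
      linarith
  · rintro ⟨c, hc⟩
    have h0 := congrFun hc 0
    have h1 := congrFun hc 1
    simp [Matrix.mulVec, dotProduct, Fin.sum_univ_two] at h0 h1
    rw [h0, h1]; ring

/-- Data of a connection with `u = 0`, the holonomy of which acts nontrivially and semisimply on
the plane of the second and third basis vectors. -/
structure Model : Prop where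
  isLie : D.IsLie
  w_eq : ∀ i, D.w i = 0
  nonzero : ∃ i j, D.curvE i j ≠ 0
  split : ∀ p q : ℝ, (p, q) ≠ (0, 0) → (∀ i, Eigen (D.matE i) p q) →
    ∃ r s, p * s - q * r = 1 ∧ (∀ i j, Eigen (D.curvE i j) r s) ∧
      ∀ i j k, Eigen ⁅D.matE k, D.curvE i j⁆ r s

variable {D}

theorem Flat.curvE_eq {i j : Fin 7} (h : D.Flat i j) : D.curvE i j = 0 := by
  obtain ⟨h1, h2, h3, h4, -⟩ := h
  rw [curvE, h1, h2, h3, h4]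
  ext p q; fin_cases p <;> fin_cases q <;> rfl

theorem curvE_swap (i j : Fin 7) : D.curvE j i = -D.curvE i j := by
  ext p q
  fin_cases p <;> fin_cases q <;>
    simp [curvE, rA, rB, rC, rD, fc_swap _ i j] <;> ring

theorem curvE_eq_zero {i j : Fin 7} (h1 : D.rA i j = 0) (h2 : D.rB i j = 0) (h3 : D.rC i j = 0)
    (h4 : D.rD i j = 0) : D.curvE i j = 0 := by
  rw [curvE, h1, h2, h3, h4]
  ext p q; fin_cases p <;> fin_cases q <;> rfl

/-- The components of the curvature that determine its action on the plane of the second and third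
basis vectors cannot all vanish. -/
theorem Model.not_flat (M : D.Model) (h1 : D.rA 4 5 = 0) (h2 : D.rB 4 5 = 0) (h3 : D.rC 4 5 = 0)
    (h4 : D.rD 4 5 = 0) (h5 : D.rC 4 6 = 0) (h6 : D.rD 4 6 = 0) (q0 : D.rC 1 6 = 0)
    (q1 : D.rC 2 6 = 0) (q2 : D.rC 2 5 = 0) (q3 : D.rA 2 5 = 0) (q4 : D.rB 2 5 = 0) : False := by
  have h := M.isLie
  obtain ⟨e1, e2, e3, e4, e5, e6, e7, e8, e9, e10, e11⟩ := h.curv_quartic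
  obtain ⟨s1, s2⟩ := h.curv_sym
  rw [q1] at e1
  rw [q1, neg_zero] at e2 e3
  rw [q2] at e4 e6 e7
  rw [q2, neg_zero] at e5 e8
  rw [q3] at e9
  rw [q3, neg_zero] at e10 e11
  rw [h3] at s1; rw [h4] at s2
  -- The quartic relations, rewritten above, settle the pairs of {1, 2} with {5, 6}, and `curv_sym`
  -- completes (4, 6); the remaining pairs act trivially on E in any case.
  have k : ∀ i j : Fin 7, i < j → D.curvE i j = 0 := by
    intro i j hij
    have z56 := h.curv56
    have z04 := h.curv04
    have z34 := h.curv34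
    fin_cases i <;> fin_cases j <;> first
      | (exfalso; revert hij; decide)
      | exact h.flat01.curvE_eq
      | exact h.flat02.curvE_eq
      | exact h.flat03.curvE_eq
      | exact h.flat05.curvE_eq
      | exact h.flat06.curvE_eq
      | exact h.flat12.curvE_eq
      | exact h.flat13.curvE_eq
      | exact h.flat23.curvE_eq
      | exact h.flat14.curvE_eq
      | exact h.flat24.curvE_eq
      | exact h.flat35.curvE_eq
      | exact h.flat36.curvE_eq
      | exact curvE_eq_zero z56.1 z56.2.1 z56.2.2.1 z56.2.2.2.1
      | exact curvE_eq_zero z04.1 z04.2.1 z04.2.2.1 z04.2.2.2.1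
      | exact curvE_eq_zero z34.1 z34.2.1 z34.2.2.1 z34.2.2.2.1
      | exact curvE_eq_zero h1 h2 h3 h4
      | exact curvE_eq_zero s1 s2 h5 h6
      | (apply curvE_eq_zero <;> assumption)
  obtain ⟨i, j, hij⟩ := M.nonzero
  rcases lt_trichotomy i j with hl | rfl | hl
  · exact hij (k i j hl)
  · apply hij
    have := D.curvE_swap i i
    ext p q
    have := congrFun (congrFun this p) q
    simp only [Matrix.neg_apply] at this
    simp only [Matrix.zero_apply]
    linarith
  · apply hij; rw [D.curvE_swap j i, k j i hl, neg_zero]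

/-- Traceless curvature does not allow a common eigenvector of the connection. -/
theorem Model.no_eigenvector (M : D.Model) (hT : ∀ i j, D.rT i j = 0) {p q : ℝ}
    (hpq : (p, q) ≠ (0, 0)) (h : ∀ i, Eigen (D.matE i) p q) : False := by
  obtain ⟨r, s, hd, hR, -⟩ := M.split p q hpq h
  -- A line invariant under the connection is invariant under its curvature.
  have hc : ∀ i j, Eigen (D.curvE i j) p q := by
    intro i j
    have e : D.curvE i j = ⁅D.matE i, D.matE j⁆ - ∑ k, D.br i j k • D.matE k := by
      ext p q
      rw [Matrix.sub_apply, Matrix.sum_apply]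
      fin_cases p <;> fin_cases q <;>
        simp [curvE, matE, rA, rB, rC, rD, fc, Ring.lie_def] <;>
        ring
    rw [eigen_iff hpq, e]
    choose c hc using fun i => (eigen_iff hpq).1 (h i)
    refine ⟨-∑ k, D.br i j k * c k, ?_⟩
    simp only [Ring.lie_def, Matrix.sub_mulVec, ← Matrix.mulVec_mulVec, hc, Matrix.mulVec_smul,
      Matrix.sum_mulVec, Matrix.smul_mulVec, neg_smul, Finset.sum_smul, smul_smul, mul_comm (c i)]
    simp
  -- A traceless map with eigenvectors (p, q) and (r, s) has eigenvalues θ and -θ on them, so all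
  -- curvature matrices are multiples of one fixed matrix.
  have key : ∀ i j, ∃ θ, D.rA i j = θ * (p * s + q * r) ∧ D.rB i j = θ * (-2 * p * r) ∧
      D.rC i j = θ * (2 * q * s) ∧ D.rD i j = - θ * (p * s + q * r) := by
    intro i j
    have h1 := hc i j
    have h2 := hR i j
    have h3 := hT i j
    simp [Eigen, curvE, rT] at h1 h2 h3
    generalize D.rA i j = A at *
    generalize D.rB i j = B at *
    generalize D.rC i j = C at *
    generalize D.rD i j = E at *
    obtain rfl : E = -A := by linarith
    refine ⟨s * (A * p + B * q) - r * (C * p - A * q), ?_, ?_, ?_, ?_⟩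
    · linear_combination r * s * h1 + p * q * h2 - A * (p * s - q * r + 1) * hd
    · linear_combination -r ^ 2 * h1 - p ^ 2 * h2 - B * (p * s - q * r + 1) * hd
    · linear_combination s ^ 2 * h1 + q ^ 2 * h2 - C * (p * s - q * r + 1) * hd
    · linear_combination -r * s * h1 - p * q * h2 + A * (p * s - q * r + 1) * hd
  -- The fixed matrix squares to the identity, since x² + yz = (ps - qr)²; nothing else about it is
  -- needed.
  obtain ⟨x, y, z, hx, key⟩ : ∃ x y z : ℝ, x ^ 2 + y * z = 1 ∧ ∀ i j, ∃ θ, D.rA i j = θ * x ∧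
      D.rB i j = θ * y ∧ D.rC i j = θ * z ∧ D.rD i j = -θ * x :=
    ⟨_, _, _, by linear_combination (p * s - q * r + 1) * hd, key⟩
  have h := M.isLie
  obtain ⟨e1, e2, e3, e4, e5, e6, e7, e8, e9, e10, e11⟩ := h.curv_quartic
  obtain ⟨s1, s2⟩ := h.curv_sym
  obtain ⟨θ6, a1, a2, a3, a4⟩ := key 4 5
  obtain ⟨θ7, b1, b2, b3, b4⟩ := key 4 6
  obtain ⟨θ15, c1, c2, c3, c4⟩ := key 1 5
  obtain ⟨θ16, d1, d2, d3, d4⟩ := key 1 6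
  obtain ⟨θ25, f1, f2, f3, f4⟩ := key 2 5
  obtain ⟨θ26, g1, g2, g3, g4⟩ := key 2 6
  -- `curv_sym` and `curv_quartic` are now linear relations between the factors θ; x² + yz = 1
  -- inverts them.
  have r1 : θ7 * x = θ6 * z := by linarith
  have r2 : θ7 * y = -θ6 * x := by linarith
  have t1 : θ15 * x = -θ25 * z := by linarith
  have t2 : θ15 * y = θ25 * x := by linarith
  have t3 : θ26 * x = θ25 * z := by linarith
  have t4 : θ26 * y = -θ25 * x := by linarith
  have t5 : θ16 * x = -θ26 * z := by linarith
  have t6 : θ16 * y = θ25 * z := by linarith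
  have z7 : θ7 = 0 := by linear_combination -θ7 * hx + x * r1 + z * r2
  have z6 : θ6 = 0 := by linear_combination -θ6 * hx + x * r2 - y * r1
  have z25 : θ25 = 0 := by linear_combination -θ25 * hx - x * t2 + y * t1
  have z15 : θ15 = 0 := by linear_combination -θ15 * hx + x * t1 + z * t2
  have z26 : θ26 = 0 := by linear_combination -θ26 * hx + x * t3 + z * t4
  have z16 : θ16 = 0 := by
    linear_combination -θ16 * hx + x * t5 + z * t6 - x * z * z26 + z ^ 2 * z25
  subst z7 z6 z25 z15 z26 z16
  simp only [zero_mul, neg_zero] at *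
  exact M.not_flat a1 a2 a3 a4 b3 b4 d3 g3 f3 f1 f2

end ConnData

end G2StarHolonomy

/-! ### Vanishing of the connection on E in the directions 0 to 3 -/

namespace G2StarHolonomy

namespace ConnData
variable {D : ConnData}

/-- The curvature acts nontrivially on the plane of the second and third basis vectors, so the
plane cannot be annihilated by the connection and all the vectors `y`. -/
theorem Model.not_flat' (M : D.Model) (a1 : D.a 1 = 0) (b1 : D.b 1 = 0) (c1 : D.c 1 = 0)
    (d1 : D.d 1 = 0) (a2 : D.a 2 = 0) (b2 : D.b 2 = 0) (c2 : D.c 2 = 0) (d2 : D.d 2 = 0)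
    (y1 : D.y 1 = 0) (z1 : D.z 1 = 0) (y2 : D.y 2 = 0) (z2 : D.z 2 = 0)
    (hv : D.v 1 = 0 ∧ D.v 2 = 0) : False := by
  have h := M.isLie
  have hw := M.w_eq
  obtain ⟨v1, v2⟩ := hv
  obtain ⟨-, -, A45, C45⟩ := h.curv15
  obtain ⟨-, -, A46, C46⟩ := h.curv16
  obtain ⟨-, -, B45, D45⟩ := h.curv25
  obtain ⟨-, -, B46, D46⟩ := h.curv26
  simp only [rY, rZ, fc15, fc16, fc25, fc26, a1, b1, c1, d1, a2, b2, c2, d2, y1, y2, z1, z2, v1, v2,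
    hw, mul_zero, zero_mul, add_zero, sub_zero, neg_zero, zero_sub, zero_add] at A45 B45 C45 D45 A46 B46 C46 D46
  refine M.not_flat A45.symm B45.symm C45.symm D45.symm C46.symm D46.symm ?_ ?_ ?_ ?_ ?_ <;>
  simp only [rA, rB, rC, fc15, fc16, fc25, fc26, a1, b1, c1, d1, a2, b2, c2, d2, y1, y2, z1, z2, v1, v2,
    hw, mul_zero, zero_mul, add_zero, sub_zero, neg_zero, zero_sub, zero_add]

/-- m = 1 belongs to the trace of the curvature, m = 2 to its v-component, and the hypotheses on a,
d, c are what closedness of that form yields. A nonzero s0 or s3 would kill all components in the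
directions 1 and 2, contrary to `not_flat'`; a nonzero s1 or s2 would kill the form itself. -/
theorem Model.trace_eq_zero (M : D.Model) (m s0 s1 s2 s3 : ℝ)
    (hz : (m = 1 ∧ ¬(D.rT 4 5 = 0 ∧ D.rT 4 6 = 0)) ∨ (m = 2 ∧ ¬(D.rV 4 5 = 0 ∧ D.rV 4 6 = 0)))
    (a0 : D.a 0 = -m * s0) (d0 : D.d 0 = (m + 1) * s0) (c0 : D.c 0 = 0)
    (a1 : D.a 1 = -m * s1) (d1 : D.d 1 = (m + 1) * s1) (c1 : D.c 1 = 0)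
    (a2 : D.a 2 = -m * s2) (d2 : D.d 2 = (m + 1) * s2) (c2 : D.c 2 = 0)
    (a3 : D.a 3 = -m * s3) (d3 : D.d 3 = (m + 1) * s3) (c3 : D.c 3 = 0) :
    s0 = 0 ∧ s1 = 0 ∧ s2 = 0 ∧ s3 = 0 ∧ D.b 1 = 0 ∧ D.v 0 = 0 := by
  have h := M.isLie
  have hw := M.w_eq
  have hm : m = 1 ∨ m = 2 := hz.imp And.left And.left
  have hm0 : 0 < m := by rcases hm with rfl | rfl <;> norm_num
  obtain ⟨A01, B01, C01, D01, V01, Y01, Z01⟩ := h.flat01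
  obtain ⟨A02, B02, C02, D02, V02, Y02, Z02⟩ := h.flat02
  obtain ⟨A12, B12, C12, D12, V12, Y12, Z12⟩ := h.flat12
  obtain ⟨A03, B03, C03, D03, V03, Y03, Z03⟩ := h.flat03
  obtain ⟨A13, B13, C13, D13, V13, Y13, Z13⟩ := h.flat13
  obtain ⟨A23, B23, C23, D23, V23, Y23, Z23⟩ := h.flat23
  obtain ⟨A04, B04, C04, D04, V04, Y04, Z04⟩ := h.curv04
  obtain ⟨A34, B34, C34, D34, V34, Y34, Z34⟩ := h.curv34
  have T15 := h.curv15.2.1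
  have T16 := h.curv16.2.1
  have T25 := h.curv25.2.1
  have T26 := h.curv26.2.1
  rw [← rT] at Y04 Z04
  simp only [rV] at V01 V02 V12 V03 V13 V23
  simp only [rA, rB, rC, rD, rY, rZ, fc01, fc02, fc12, fc03, fc13, fc23,
    fc04, fc34, fc15, fc16, fc25, fc26, hw, a0, d0, c0,
    a1, d1, c1, a2, d2, c2, a3, d3, c3, mul_zero, zero_mul, add_zero, zero_add, sub_zero, zero_sub,
    neg_zero] at A01 B01 C01 D01 V01 Y01 Z01 A02 B02 C02 D02 V02 Y02 Z02 A12 B12 C12 D12 V12 Y12 Z12 A03 B03 C03 D03 V03 Y03 Z03 A13 B13 C13 D13 V13 Y13 Z13 A23 B23 C23 D23 V23 Y23 Z23 A04 B04 C04 D04 Y04 Z04 A34 B34 C34 D34 Y34 Z34 T15 T16 T25 T26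
  have e01 : s0 * s1 = 0 := by
    have : m * (m + 1) * (s0 * s1) = 0 := by linear_combination -A01
    have h3 : m + 1 ≠ 0 := by positivity
    simpa [h3, hm0.ne'] using this
  have e02 : D.b 0 * s1 + m * s0 * s2 = 0 := by
    linear_combination -A02 - D02
  -- If s0 ≠ 0, the flat pairs among 0, 1, 2 give b, v = 0 in the directions 1 and 2, and
  -- tracelessness on the pairs of {1, 2} with {5, 6} gives y, z = 0 there.
  have h0 : s0 = 0 := by
    by_contra h0
    obtain rfl : s1 = 0 := by simpa [h0] using e01
    obtain rfl : s2 = 0 := by simpa [h0, hm0.ne'] using e02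
    have b1 : D.b 1 = 0 := by
      have : D.b 1 ^ 2 = 0 := by linear_combination -B12
      simpa using this
    simp only [b1, mul_zero, zero_mul, add_zero, sub_zero, neg_zero, zero_sub] at Y01 Z01 A02 B02 V02 Y02 Z02 A12 B12 V12 Y12 Z12 A03 B03 V03 Y03 Z03 A13 B13 V13 Y13 Z13 A23 B23 V23 Y23 Z23 Y04 Z04 Y34 Z34 T15 T16 T25 T26
    have b2 : D.b 2 = 0 := by
      have : (3 * m + 2) * s0 * D.b 2 = 0 := by linear_combination -B02
      have h3 : 3 * m + 2 ≠ 0 := by positivity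
      simpa [h0, h3] using this
    have v1 : D.v 1 = 0 := by
      have : (m + 1) * s0 * D.v 1 = 0 := by linear_combination V01
      have h3 : m + 1 ≠ 0 := by positivity
      simpa [h0, h3] using this
    have v2 : D.v 2 = 0 := by
      have : m * s0 * D.v 2 = 0 := by linear_combination -V02 - D.b 0 * v1
      simpa [h0, hm0.ne'] using this
    have y1 : D.y 1 = 0 := by
      have : s0 * D.y 1 = 0 := by linear_combination T15
      simpa [h0] using this
    have z1 : D.z 1 = 0 := by
      have : s0 * D.z 1 = 0 := by linear_combination T16
      simpa [h0] using this
    have y2 : D.y 2 = 0 := by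
      have : s0 * D.y 2 = 0 := by linear_combination T25 - (D.a 6 + D.d 6) * b2
      simpa [h0] using this
    have z2 : D.z 2 = 0 := by
      have : s0 * D.z 2 = 0 := by linear_combination T26
      simpa [h0] using this
    exact M.not_flat' (by simpa using a1) b1 c1 (by simpa using d1) (by simpa using a2) b2 c2
      (by simpa using d2) y1 z1 y2 z2 ⟨v1, v2⟩
  subst h0
  have v0 : D.v 0 = 0 := by
    have : √2 * D.v 0 ^ 2 = 0 := by linear_combination -V03
    simpa using this
  simp only [v0, mul_zero, zero_mul, add_zero, sub_zero, neg_zero, zero_sub] at Y01 Z01 A02 B02 V02 Y02 Z02 A12 B12 V12 Y12 Z12 A03 B03 V03 Y03 Z03 A13 B13 V13 Y13 Z13 A23 B23 V23 Y23 Z23 Y04 Z04 Y34 Z34 T15 T16 T25 T26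
  -- Otherwise `curv04` makes the trace form zero on (4, 5) and (4, 6) or, for m = 2, `curv34` does
  -- so for the v-form, against `hz`.
  have hy : ¬ (D.b 0 = 0 ∧ D.y 0 = 0 ∧ D.z 0 = 0 ∧ (m = 2 → D.y 3 = 0 ∧ D.z 3 = 0 ∧ s3 = 0 ∧ D.b 3 = 0)) := by
    rintro ⟨b0, y0, z0, h2⟩
    simp only [b0, y0, z0, mul_zero, zero_mul, add_zero, sub_zero, neg_zero, zero_sub] at Y04 Z04 Y34 Z34
    rcases hz with ⟨-, hz⟩ | ⟨h3, hz⟩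
    · exact hz ⟨Y04.symm, Z04.symm⟩
    · obtain ⟨y3, z3, rfl, b3⟩ := h2 h3
      simp only [y3, z3, b3, mul_zero, zero_mul, add_zero, sub_zero, neg_zero, zero_sub] at Y34 Z34
      simp at Y34 Z34
      exact hz ⟨Y34, Z34⟩
  have h1 : s1 = 0 := by
    by_contra h1
    have b0 : D.b 0 = 0 := by simpa [h1] using e02
    have z0 : D.z 0 = 0 := by
      have : (m + 1) * s1 * D.z 0 = 0 := by linear_combination -Z01
      have h3 : m + 1 ≠ 0 := by positivity
      simpa [h1, h3] using this
    have y0 : D.y 0 = 0 := by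
      have : m * s1 * D.y 0 = 0 := by linear_combination Y01 + D.b 1 * z0 - D.z 1 * b0
      simpa [h1, hm0.ne'] using this
    simp only [b0, y0, z0, mul_zero, zero_mul, add_zero, sub_zero, neg_zero, zero_sub] at Y01 Z01 A02 B02 V02 Y02 Z02 A12 B12 V12 Y12 Z12 A03 B03 V03 Y03 Z03 A13 B13 V13 Y13 Z13 A23 B23 V23 Y23 Z23 Y04 Z04 Y34 Z34 T15 T16 T25 T26
    have h3 : s3 = 0 := by simpa [h1, hm0.ne'] using A13
    subst h3
    have b3 : D.b 3 = 0 := by simpa [h1, hm0.ne'] using A23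
    have z3 : D.z 3 = 0 := by
      have : (m + 2) * s1 * D.z 3 = 0 := by linear_combination Z13
      have h3 : m + 2 ≠ 0 := by positivity
      simpa [h1, h3] using this
    refine hy ⟨b0, y0, z0, fun h2 => ⟨?_, z3, rfl, b3⟩⟩
    subst h2
    have : s1 * D.y 3 = 0 := by linear_combination -Y13 + D.b 1 * z3 - D.z 1 * b3
    simpa [h1] using this
  subst h1
  have e12 : D.b 1 * ((m + 1) * s2 - D.b 1) = 0 := by linear_combination B12
  have h2 : s2 = 0 := by
    by_contra h2
    have e02 : D.b 0 * ((2 * m + 2) * s2 - D.b 1) = 0 := by linear_combination B02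
    have b0 : D.b 0 = 0 := by
      rcases mul_eq_zero.1 e12 with h3 | h3
      · have h4 : 2 * m + 2 ≠ 0 := by positivity
        simpa [h3, h2, h4] using e02
      · have : (m + 1) * s2 * D.b 0 = 0 := by linear_combination e02 - D.b 0 * h3
        have h4 : m + 1 ≠ 0 := by positivity
        simpa [h2, h4] using this
    have z0 : D.z 0 = 0 := by
      have : (m + 1) * s2 * D.z 0 = 0 := by linear_combination -Z02 - D.z 1 * b0
      have h3 : m + 1 ≠ 0 := by positivity
      simpa [h2, h3] using this
    have y0 : D.y 0 = 0 := by
      have : m * s2 * D.y 0 = 0 := by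
        linear_combination Y02 + D.b 2 * z0 - D.z 2 * b0 + D.y 1 * b0
      simpa [h2, hm0.ne'] using this
    simp only [b0, y0, z0, mul_zero, zero_mul, add_zero, sub_zero, neg_zero, zero_sub] at Y01 Z01 A02 B02 V02 Y02 Z02 A12 B12 V12 Y12 Z12 A03 B03 V03 Y03 Z03 A13 B13 V13 Y13 Z13 A23 B23 V23 Y23 Z23 Y04 Z04 Y34 Z34 T15 T16 T25 T26
    have h3 : s3 = 0 := by
      have h4 : m + 1 ≠ 0 := by positivity
      simpa [h2, hm0.ne', h4] using A23
    subst h3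
    have b3 : D.b 3 = 0 := by
      have e23 : D.b 3 * ((2 * m + 1) * s2 - D.b 1) = 0 := by linear_combination -B23
      rcases mul_eq_zero.1 e12 with h3 | h3
      · have h4 : 2 * m + 1 ≠ 0 := by positivity
        simpa [h3, h2, h4] using e23
      · have : m * s2 * D.b 3 = 0 := by linear_combination e23 - D.b 3 * h3
        simpa [h2, hm0.ne'] using this
    have z3 : D.z 3 = 0 := by
      have : (m + 2) * s2 * D.z 3 = 0 := by linear_combination Z23 - D.z 1 * b3
      have h3 : m + 2 ≠ 0 := by positivity
      simpa [h2, h3] using this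
    refine hy ⟨b0, y0, z0, fun h2 => ⟨?_, z3, rfl, b3⟩⟩
    subst h2
    have : s2 * D.y 3 = 0 := by
      linear_combination -Y23 + D.b 2 * z3 - D.z 2 * b3 + D.y 1 * b3
    simpa [h2] using this
  subst h2
  have b1 : D.b 1 = 0 := by simpa using e12
  simp only [b1, mul_zero, zero_mul, add_zero, sub_zero, neg_zero, zero_sub] at Y01 Z01 A02 B02 V02 Y02 Z02 A12 B12 V12 Y12 Z12 A03 B03 V03 Y03 Z03 A13 B13 V13 Y13 Z13 A23 B23 V23 Y23 Z23 Y04 Z04 Y34 Z34 T15 T16 T25 T26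
  -- If s3 ≠ 0, the flat pairs (0, 3), (1, 3), (2, 3) successively empty the directions 1 and 2.
  refine ⟨rfl, rfl, rfl, ?_, b1, v0⟩
  by_contra h3
  have b0 : D.b 0 = 0 := by
    have : (2 * m + 2) * s3 * D.b 0 = 0 := by linear_combination B03
    have h4 : 2 * m + 2 ≠ 0 := by positivity
    simpa [h3, h4] using this
  have b2 : D.b 2 = 0 := by
    have : (3 * m + 2) * s3 * D.b 2 = 0 := by linear_combination B23 + √2 * D.v 2 * b0
    have h4 : 3 * m + 2 ≠ 0 := by positivity
    simpa [h3, h4] using this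
  have z0 : D.z 0 = 0 := by
    have : (m + 1) * s3 * D.z 0 = 0 := by linear_combination -Z03
    have h4 : m + 1 ≠ 0 := by positivity
    simpa [h3, h4] using this
  have y0 : D.y 0 = 0 := by
    have : m * s3 * D.y 0 = 0 := by linear_combination Y03 - D.z 3 * b0 + D.b 3 * z0
    simpa [h3, hm0.ne'] using this
  simp only [b0, b2, y0, z0, mul_zero, zero_mul, add_zero, sub_zero, neg_zero, zero_sub] at Y01 Z01 A02 B02 V02 Y02 Z02 A12 B12 V12 Y12 Z12 A03 B03 V03 Y03 Z03 A13 B13 V13 Y13 Z13 A23 B23 V23 Y23 Z23 Y04 Z04 Y34 Z34 T15 T16 T25 T26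
  have z1 : D.z 1 = 0 := by
    have : (2 * m + 2) * s3 * D.z 1 = 0 := by linear_combination -Z13
    have h4 : 2 * m + 2 ≠ 0 := by positivity
    simpa [h3, h4] using this
  have y1 : D.y 1 = 0 := by
    have : s3 * D.y 1 = 0 := by linear_combination -Y13 - D.b 3 * z1
    simpa [h3] using this
  have z2 : D.z 2 = 0 := by
    have : s3 * D.z 2 = 0 := by linear_combination -Z23 + D.b 3 * z1
    simpa [h3] using this
  have y2 : D.y 2 = 0 := by
    have : 2 * m * s3 * D.y 2 = 0 := by linear_combination Y23 + D.b 3 * z2 - D.b 3 * y1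
    simpa [h3, hm0.ne'] using this
  have v1 : D.v 1 = 0 := by
    have : (m + 1) * s3 * D.v 1 = 0 := by linear_combination -V13
    have h4 : m + 1 ≠ 0 := by positivity
    simpa [h3, h4] using this
  have v2 : D.v 2 = 0 := by
    have : m * s3 * D.v 2 = 0 := by linear_combination V23 - D.b 3 * v1
    simpa [h3, hm0.ne'] using this
  exact M.not_flat' (by simpa using a1) b1 c1 (by simpa using d1) (by simpa using a2) b2 c2
      (by simpa using d2) y1 z1 y2 z2 ⟨v1, v2⟩

/-- The connection annihilates the orthogonal complement of the socle if it acts on it by nilpotent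
maps. -/
theorem Model.b_eq_zero (M : D.Model) (m : ℝ) (hm : m = 1 ∨ m = 2)
    (a0 : D.a 0 = 0) (d0 : D.d 0 = 0) (c0 : D.c 0 = 0)
    (a1 : D.a 1 = 0) (d1 : D.d 1 = 0) (c1 : D.c 1 = 0)
    (a2 : D.a 2 = 0) (d2 : D.d 2 = 0) (c2 : D.c 2 = 0)
    (a3 : D.a 3 = 0) (d3 : D.d 3 = 0) (c3 : D.c 3 = 0) (b1 : D.b 1 = 0) (v0 : D.v 0 = 0)
    (hc : (m + 1) * D.a 6 + m * D.d 6 = D.c 5) :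
    D.b 0 = 0 ∧ D.b 2 = 0 ∧ D.b 3 = 0 := by
  have h := M.isLie
  have hw := M.w_eq
  -- With c = 0 in every direction, (1, 0) is invariant and has a complement (r, 1) fixed by the
  -- curvature and by its bracket with the nilpotent matrix in the direction `l`. Together these
  -- force B = 0 and A = D; the Bianchi relations then annihilate the action on E.
  have hb : ∀ i : Fin 7, i ∈ [(0 : Fin 7), 2, 3] → D.b i ≠ 0 → D.c 4 = 0 → D.c 5 = 0 → D.c 6 = 0 → False := by
    intro l hl hbl c4 c5 c6
    have hc : ∀ i, D.c i = 0 := by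
      intro i; fin_cases i <;> assumption
    obtain ⟨r, s, hd, hR, hR'⟩ := M.split 1 0 (by simp) (fun i => by simp [Eigen, matE, hc])
    obtain rfl : s = 1 := by simpa using hd
    have hRC : ∀ i j, D.rC i j = 0 := by
      intro i j; simp [rC, fc, hc]
    have hal : D.a l = 0 ∧ D.d l = 0 := by
      simp only [List.mem_cons, List.not_mem_nil, or_false] at hl
      rcases hl with rfl | rfl | rfl <;> constructor <;> assumption
    have key : ∀ i j, D.rB i j = 0 ∧ D.rA i j = D.rD i j := by
      intro i j
      have h1 := hR i j
      have h2 := hR' i j l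
      simp [Eigen, curvE, matE, hRC, hc, hal.1, hal.2, Ring.lie_def] at h1 h2
      have h3 : D.rA i j = D.rD i j := by
        have : D.b l * (D.rA i j - D.rD i j) = 0 := by linarith
        linarith [(mul_eq_zero.1 this).resolve_left hbl]
      exact ⟨by rw [h3] at h1; linarith, h3⟩
    obtain ⟨q1, q2, q3, q4, q5, q6, q7, q8, q9, q10, q11⟩ := h.curv_quartic
    obtain ⟨s1, s2⟩ := h.curv_sym
    have k := fun i j => (key i j).2
    have k' := fun i j => (key i j).1
    refine M.not_flat ?_ (k' _ _) (hRC _ _) ?_ (hRC _ _) ?_ (hRC _ _) (hRC _ _) (hRC _ _) ?_ (k' _ _)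
    · rw [k, ← s2, k']
    · rw [← s2, k']
    · rw [← k, s1, hRC]
    · rw [← q9, k']
  obtain ⟨A04, B04, C04, D04, -⟩ := h.curv04
  obtain ⟨A34, B34, C34, D34, -⟩ := h.curv34
  obtain ⟨A24, B24, C24, D24, -⟩ := h.flat24
  obtain ⟨A05, B05, C05, D05, -⟩ := h.flat05
  obtain ⟨A06, B06, C06, D06, -⟩ := h.flat06
  obtain ⟨A35, B35, C35, D35, -⟩ := h.flat35
  obtain ⟨A36, B36, C36, D36, -⟩ := h.flat36
  obtain ⟨q1, q2, q3, q4, q5, q6, q7, q8, q9, q10, q11⟩ := h.curv_quartic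
  simp only [rA, rB, rC, rD, rY, rZ,
    fc04, fc34, fc15, fc16, fc25, fc26, fc24, fc05, fc06, fc35, fc36, hw, a0, d0, c0,
    a1, d1, c1, a2, d2, c2, a3, d3, c3, b1, v0, mul_zero, zero_mul, add_zero, zero_add, sub_zero, zero_sub,
    neg_zero, sub_self] at A04 B04 C04 D04 A34 B34 C34 D34 A24 B24 C24 D24 A05 B05 C05 D05 A06 B06 C06 D06 A35 B35 C35 D35 A36 B36 C36 D36 q1 q2 q3 q4 q5 q6 q7 q8 q9 q10 q11
  -- If b 0 ≠ 0, the pairs (0, 4), (0, 5), (0, 6) give c 4 = c 6 = 0, a 6 = -c 5 and d 6 = c 5, and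
  -- `hc` then gives c 5 = 0 for every m.
  have h0 : D.b 0 = 0 := by
    by_contra hn
    have c4 : D.c 4 = 0 := by simpa [hn] using A04
    have c6 : D.c 6 = 0 := by simpa [hn] using A06
    have a6 : D.a 6 = -D.c 5 := by
      apply mul_left_cancel₀ hn; linear_combination A05
    have d6 : D.d 6 = D.c 5 := by
      apply mul_left_cancel₀ hn; linear_combination D05
    exact hb 0 (by simp) hn c4 (by rw [a6, d6] at hc; linarith) c6
  have h3 : D.b 3 = 0 := by
    by_contra hn
    have c4 : D.c 4 = 0 := by simpa [hn] using A34
    have c6 : D.c 6 = 0 := by simpa [hn] using A36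
    have a6 : D.a 6 = -D.c 5 := by
      apply mul_left_cancel₀ hn; linear_combination A35
    have d6 : D.d 6 = D.c 5 := by
      apply mul_left_cancel₀ hn; linear_combination D35
    exact hb 3 (by simp) hn c4 (by rw [a6, d6] at hc; linarith) c6
  refine ⟨h0, ?_, h3⟩
  -- In the direction 2 only the pair (2, 4) is flat; the quartic relations replace the missing
  -- equations for c 6, d 6 and c 5.
  by_contra hn
  have c4 : D.c 4 = 0 := by simpa [hn] using A24
  have c6 : D.c 6 = 0 := by
    apply mul_left_cancel₀ hn; linear_combination -q4
  have d6 : D.d 6 = -D.a 6 := by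
    apply mul_left_cancel₀ hn; linear_combination q10
  have c5 : D.c 5 = 2 * D.a 6 := by
    apply mul_left_cancel₀ hn
    linear_combination q11 - 2 * D.b 2 * d6 - D.z 2 * h0
  rw [c5, d6] at hc
  have a6 : D.a 6 = 0 := by linarith
  exact hb 2 (by simp) hn c4 (by rw [c5, a6, mul_zero]) c6

end ConnData

end G2StarHolonomy

/-! ### Holonomy data in an adapted frame and their conjugation -/

namespace G2StarHolonomy

/-- The bracket on `ℝ⁷` for which the connection `L` is torsion-free. -/
def bra (L : V7 →ₗ[ℝ] Mat7) (x y : V7) : V7 := (L x).mulVec y - (L y).mulVec x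

/-- The curvature of the connection `L`. -/
def cur (L : V7 →ₗ[ℝ] Mat7) (x y : V7) : Mat7 := ⁅L x, L y⁆ - L (bra L x y)

/-- The linear map `L` is the Levi-Civita connection of a left-invariant parallel structure with
indecomposable infinitesimal holonomy algebra `h`, in terms of an adapted frame. -/
structure HolData (L : V7 →ₗ[ℝ] Mat7) (h : LieSubalgebra ℝ Mat7) : Prop where
  mem_g2 : ∀ x, L x ∈ g2Star
  jacobi : ∀ x y z, bra L (bra L x y) z + bra L (bra L y z) x + bra L (bra L z x) y = 0
  cur_mem : ∀ x y, cur L x y ∈ h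
  lie_mem : ∀ x, ∀ T ∈ h, ⁅L x, T⁆ ∈ h
  least : ∀ W : Submodule ℝ Mat7, (∀ x y, cur L x y ∈ W) →
    (∀ x, ∀ T ∈ W, ⁅L x, T⁆ ∈ W) → h.toSubmodule ≤ W
  indec : IsIndecomposable h

/-- An element of `G₂*` that also preserves the inner product. -/
structure IsAut (g : GL (Fin 7) ℝ) : Prop where
  mem : g ∈ G2Star
  ip_eq : ∀ x y, ip (g.val.mulVec x) (g.val.mulVec y) = ip x y

/-- The conjugate `g⁻¹ h g` of a Lie algebra of matrices. -/
def conjSub (g : GL (Fin 7) ℝ) (h : LieSubalgebra ℝ Mat7) : LieSubalgebra ℝ Mat7 where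
  carrier := {A | g.val * A * (g⁻¹).val ∈ h}
  zero_mem' := by simp
  add_mem' := by
    intro A B hA hB
    have := h.add_mem hA hB
    simpa [mul_add, add_mul] using this
  smul_mem' := by
    intro c A hA
    have := h.smul_mem c hA
    simpa using this
  lie_mem' := by
    intro A B hA hB
    have := h.lie_mem hA hB
    have e : ∀ A B : Mat7, g.val * A * (g⁻¹).val * (g.val * B * (g⁻¹).val) =
        g.val * (A * B) * (g⁻¹).val := by
      intro A B
      have : (g⁻¹).val * g.val = 1 := by rw [← Units.val_mul]; simp
      calc _ = g.val * A * ((g⁻¹).val * g.val) * B * (g⁻¹).val := by noncomm_ring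
        _ = _ := by rw [this]; noncomm_ring
    simp only [Ring.lie_def, e] at this
    simpa [Ring.lie_def, mul_sub, sub_mul] using this

theorem mem_conjSub {g : GL (Fin 7) ℝ} {h : LieSubalgebra ℝ Mat7} {A : Mat7} :
    A ∈ conjSub g h ↔ g.val * A * (g⁻¹).val ∈ h := Iff.rfl

/-- The conjugate of a connection by a change of frame. -/
def conjConn (g : GL (Fin 7) ℝ) (L : V7 →ₗ[ℝ] Mat7) : V7 →ₗ[ℝ] Mat7 where
  toFun x := (g⁻¹).val * L (g.val.mulVec x) * g.val
  map_add' x y := by simp [Matrix.mulVec_add, mul_add, add_mul]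
  map_smul' c x := by simp [Matrix.mulVec_smul]

theorem GL_inv_mul (g : GL (Fin 7) ℝ) : (g⁻¹).val * g.val = 1 := by rw [← Units.val_mul]; simp

theorem GL_mul_inv (g : GL (Fin 7) ℝ) : g.val * (g⁻¹).val = 1 := by rw [← Units.val_mul]; simp

theorem GL_inv_mulVec (g : GL (Fin 7) ℝ) (x : V7) :
    (g⁻¹).val.mulVec (g.val.mulVec x) = x := by
  rw [Matrix.mulVec_mulVec, GL_inv_mul, Matrix.one_mulVec]

theorem GL_mulVec_inv (g : GL (Fin 7) ℝ) (x : V7) :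
    g.val.mulVec ((g⁻¹).val.mulVec x) = x := by
  rw [Matrix.mulVec_mulVec, GL_mul_inv, Matrix.one_mulVec]

theorem conj_lie (g : GL (Fin 7) ℝ) (A B : Mat7) :
    ⁅(g⁻¹).val * A * g.val, (g⁻¹).val * B * g.val⁆ = (g⁻¹).val * ⁅A, B⁆ * g.val := by
  have e : ∀ A B : Mat7, (g⁻¹).val * A * g.val * ((g⁻¹).val * B * g.val) =
      (g⁻¹).val * (A * B) * g.val := by
    intro A B
    calc _ = (g⁻¹).val * A * (g.val * (g⁻¹).val) * B * g.val := by noncomm_ring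
      _ = _ := by rw [GL_mul_inv]; noncomm_ring
  rw [Ring.lie_def, Ring.lie_def, e, e, mul_sub, sub_mul]

theorem conj_conj (g : GL (Fin 7) ℝ) (A : Mat7) :
    (g⁻¹).val * (g.val * A * (g⁻¹).val) * g.val = A := by
  calc _ = ((g⁻¹).val * g.val) * A * ((g⁻¹).val * g.val) := by noncomm_ring
    _ = _ := by rw [GL_inv_mul]; noncomm_ring

theorem conj_conj' (g : GL (Fin 7) ℝ) (A : Mat7) :
    g.val * ((g⁻¹).val * A * g.val) * (g⁻¹).val = A := by
  calc _ = (g.val * (g⁻¹).val) * A * (g.val * (g⁻¹).val) := by noncomm_ring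
    _ = _ := by rw [GL_mul_inv]; noncomm_ring

theorem bra_conjConn (g : GL (Fin 7) ℝ) (L : V7 →ₗ[ℝ] Mat7) (x y : V7) :
    bra (conjConn g L) x y = (g⁻¹).val.mulVec (bra L (g.val.mulVec x) (g.val.mulVec y)) := by
  have e : ∀ x, conjConn g L x = (g⁻¹).val * L (g.val.mulVec x) * g.val := fun _ => rfl
  simp only [bra, e, Matrix.mulVec_sub, ← Matrix.mulVec_mulVec]

theorem cur_conjConn (g : GL (Fin 7) ℝ) (L : V7 →ₗ[ℝ] Mat7) (x y : V7) :
    cur (conjConn g L) x y = (g⁻¹).val * cur L (g.val.mulVec x) (g.val.mulVec y) * g.val := by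
  have e : ∀ x, conjConn g L x = (g⁻¹).val * L (g.val.mulVec x) * g.val := fun _ => rfl
  rw [cur, bra_conjConn, e, e, e, GL_mulVec_inv, conj_lie, cur, mul_sub, sub_mul]

theorem omega0_mem_iff (A : Mat7) : A ∈ g2Star ↔ ∀ x y z : V7, omega0 ![A.mulVec x, y, z] +
    omega0 ![x, A.mulVec y, z] + omega0 ![x, y, A.mulVec z] = 0 := Iff.rfl

theorem omega0_mulVec {g : GL (Fin 7) ℝ} (hg : g ∈ G2Star) (x y z : V7) :
    omega0 ![g.val.mulVec x, g.val.mulVec y, g.val.mulVec z] = omega0 ![x, y, z] := by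
  have := hg ![x, y, z]
  rw [← this]
  congr 1
  ext i j; fin_cases i <;> rfl

theorem conj_mem_g2Star {g : GL (Fin 7) ℝ} (hg : g ∈ G2Star) {A : Mat7} (hA : A ∈ g2Star) :
    (g⁻¹).val * A * g.val ∈ g2Star := by
  rw [omega0_mem_iff]
  intro x y z
  have := hA (g.val.mulVec x) (g.val.mulVec y) (g.val.mulVec z)
  rw [← this]
  simp only [← Matrix.mulVec_mulVec]
  rw [← omega0_mulVec hg, ← omega0_mulVec hg x, ← omega0_mulVec hg x y]
  simp only [GL_mulVec_inv]

theorem isInvariant_conjSub {g : GL (Fin 7) ℝ} {h : LieSubalgebra ℝ Mat7} {W : Submodule ℝ V7} :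
    IsInvariant (conjSub g h) W ↔ IsInvariant h (W.map g.val.mulVecLin) := by
  constructor
  · rintro hW A hA _ ⟨w, hw, rfl⟩
    refine ⟨((g⁻¹).val * A * g.val).mulVec w, hW _ ?_ _ hw, ?_⟩
    · rw [mem_conjSub, conj_conj']; exact hA
    · simp only [Matrix.mulVecLin_apply, ← Matrix.mulVec_mulVec, GL_mulVec_inv]
  · intro hW A hA w hw
    obtain ⟨w', hw', e⟩ := hW _ hA _ ⟨w, hw, rfl⟩
    simp only [Matrix.mulVecLin_apply, ← Matrix.mulVec_mulVec, GL_inv_mulVec] at e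
    have : w' = A.mulVec w := by rw [← GL_inv_mulVec g w', e, GL_inv_mulVec]
    rw [← this]; exact hw'

theorem map_mulVecLin_eq_bot {g : GL (Fin 7) ℝ} {W : Submodule ℝ V7}
    (h : W.map g.val.mulVecLin = ⊥) : W = ⊥ := by
  rw [Submodule.eq_bot_iff]
  intro w hw
  have : g.val.mulVec w ∈ W.map g.val.mulVecLin := ⟨w, hw, rfl⟩
  rw [h, Submodule.mem_bot] at this
  rw [← GL_inv_mulVec g w, this, Matrix.mulVec_zero]

theorem IsIndecomposable.conjSub {g : GL (Fin 7) ℝ} (hg : IsAut g) {h : LieSubalgebra ℝ Mat7}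
    (hh : IsIndecomposable h) : IsIndecomposable (conjSub g h) := by
  intro W hW hn
  rw [isInvariant_conjSub] at hW
  have hn' : IsNondegenerate (W.map g.val.mulVecLin) := by
    rintro _ ⟨w, hw, rfl⟩ h2
    have := hn w hw fun w' hw' => by
      rw [← hg.ip_eq]
      exact h2 _ ⟨w', hw', rfl⟩
    rw [this, map_zero]
  rcases hh _ hW hn' with h1 | h1
  · exact Or.inl (map_mulVecLin_eq_bot h1)
  · right
    rw [eq_top_iff]
    intro x _
    have : g.val.mulVec x ∈ W.map g.val.mulVecLin := by rw [h1]; trivial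
    obtain ⟨w, hw, e⟩ := this
    have : w = x := by
      rw [← GL_inv_mulVec g x, ← GL_inv_mulVec g w]
      exact congrArg _ e
    rwa [← this]

theorem HolData.conj {L : V7 →ₗ[ℝ] Mat7} {h : LieSubalgebra ℝ Mat7} (H : HolData L h)
    {g : GL (Fin 7) ℝ} (hg : IsAut g) : HolData (conjConn g L) (conjSub g h) where
  mem_g2 x := conj_mem_g2Star hg.mem (H.mem_g2 _)
  jacobi x y z := by
    simp only [bra_conjConn, GL_mulVec_inv, ← Matrix.mulVec_add, H.jacobi, Matrix.mulVec_zero]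
  cur_mem x y := by
    rw [cur_conjConn, mem_conjSub, conj_conj']; exact H.cur_mem _ _
  lie_mem x T hT := by
    have := H.lie_mem (g.val.mulVec x) _ hT
    rw [mem_conjSub]
    have e : ⁅conjConn g L x, T⁆ = (g⁻¹).val * ⁅L (g.val.mulVec x), g.val * T * (g⁻¹).val⁆ * g.val := by
      rw [← conj_lie, conj_conj]; rfl
    rw [e, conj_conj']; exact this
  least W h1 h2 := by
    let f : Mat7 →ₗ[ℝ] Mat7 := (LinearMap.mulRight ℝ g.val).comp (LinearMap.mulLeft ℝ (g⁻¹).val)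
    have hf : ∀ A, f A = (g⁻¹).val * A * g.val := fun A => rfl
    have := H.least (W.comap f) (fun x y => by
      have := h1 ((g⁻¹).val.mulVec x) ((g⁻¹).val.mulVec y)
      rw [cur_conjConn, GL_mulVec_inv, GL_mulVec_inv] at this
      exact this) (fun x T hT => by
      have := h2 ((g⁻¹).val.mulVec x) _ hT
      rw [hf] at this
      have e : ∀ x, conjConn g L x = (g⁻¹).val * L (g.val.mulVec x) * g.val := fun _ => rfl
      rw [e, conj_lie, GL_mulVec_inv] at this
      exact this)
    intro A hA
    have h3 := this (show g.val * A * (g⁻¹).val ∈ h from hA)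
    rw [Submodule.mem_comap, hf, conj_conj] at h3
    exact h3
  indec := H.indec.conjSub hg

end G2StarHolonomy

/-! ### The normal form and its components -/

namespace G2StarHolonomy

/-- The span of the first three basis vectors. -/
def S0 : Submodule ℝ V7 where
  carrier := {x | x 3 = 0 ∧ x 4 = 0 ∧ x 5 = 0 ∧ x 6 = 0}
  zero_mem' := by simp
  add_mem' := by rintro x y ⟨h1, h2, h3, h4⟩ ⟨k1, k2, k3, k4⟩; simp [h1, h2, h3, h4, k1, k2, k3, k4]
  smul_mem' := by rintro c x ⟨h1, h2, h3, h4⟩; simp [h1, h2, h3, h4]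

theorem mem_S0 {x : V7} : x ∈ S0 ↔ x 3 = 0 ∧ x 4 = 0 ∧ x 5 = 0 ∧ x 6 = 0 := Iff.rfl

/-- The action of `h(A, v, 0, y)` on the plane of the second and third basis vectors. -/
def partE (T : Mat7) : Matrix (Fin 2) (Fin 2) ℝ := !![T 1 1, T 1 2; T 2 1, T 2 2]

theorem partE_hMat (A : Matrix (Fin 2) (Fin 2) ℝ) (v : ℝ) (u y : Fin 2 → ℝ) :
    partE (hMat A v u y) = A := by
  ext i j; fin_cases i <;> fin_cases j <;> rfl

/-- The Lie algebra `h` consists of matrices `h(A, v, 0, y)` and acts semisimply on the span of the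
first three basis vectors. -/
structure Shape (h : LieSubalgebra ℝ Mat7) : Prop where
  shape : ∀ T ∈ h, ∃ A v y, T = hMat A v 0 y
  compl : ∀ W ≤ S0, IsInvariant h W → ∃ W' ≤ S0, IsInvariant h W' ∧ W ⊓ W' = ⊥ ∧ W ⊔ W' = S0

/-- The vector with second and third coordinates `p` and `q`. -/
def vecE (p q : ℝ) : V7 := ![0, p, q, 0, 0, 0, 0]

theorem vecE_mem_S0 (p q : ℝ) : vecE p q ∈ S0 := ⟨rfl, rfl, rfl, rfl⟩

theorem hMat_mulVec_vecE (A : Matrix (Fin 2) (Fin 2) ℝ) (v : ℝ) (y : Fin 2 → ℝ) (p q : ℝ) :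
    (hMat A v 0 y).mulVec (vecE p q) = vecE (A 0 0 * p + A 0 1 * q) (A 1 0 * p + A 1 1 * q) := by
  ext i
  rw [Matrix.mulVec, dotProduct, Fin.sum_univ_seven]
  fin_cases i <;> simp [hMat, vecE]

theorem vecE_add (p q r s : ℝ) : vecE p q + vecE r s = vecE (p + r) (q + s) := by
  ext i; fin_cases i <;> simp [vecE]

theorem vecE_smul (c p q : ℝ) : c • vecE p q = vecE (c * p) (c * q) := by
  ext i; fin_cases i <;> simp [vecE]

-- The line of (p, q) has an invariant complement in `S0`. That complement meets E in a line
-- transverse to (p, q), and this line is invariant because h maps E to itself.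
open ConnData in
theorem Shape.split {h : LieSubalgebra ℝ Mat7} (H : Shape h) {p q : ℝ} (hpq : (p, q) ≠ (0, 0))
    (he : ∀ T ∈ h, Eigen (partE T) p q) :
    ∃ r s, p * s - q * r = 1 ∧ ∀ T ∈ h, Eigen (partE T) r s := by
  have hinv : IsInvariant h (Submodule.span ℝ {vecE p q}) := by
    intro T hT w hw
    obtain ⟨c, rfl⟩ := Submodule.mem_span_singleton.1 hw
    obtain ⟨A, v, y, rfl⟩ := H.shape T hT
    have := he _ hT
    rw [partE_hMat] at this
    rw [Matrix.mulVec_smul]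
    refine Submodule.smul_mem _ _ ?_
    rw [hMat_mulVec_vecE, Submodule.mem_span_singleton]
    have hpq' : p ≠ 0 ∨ q ≠ 0 := by
      by_contra! hh; exact hpq (by simp [hh.1, hh.2])
    rw [Eigen] at this
    rcases hpq' with hp | hq
    · refine ⟨(A 0 0 * p + A 0 1 * q) / p, ?_⟩
      rw [vecE_smul]; congr 1 <;> field_simp
      linarith
    · refine ⟨(A 1 0 * p + A 1 1 * q) / q, ?_⟩
      rw [vecE_smul]; congr 1 <;> field_simp
      linarith
  obtain ⟨W, hW0, hWi, hW1, hW2⟩ := H.compl _ (by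
    rw [Submodule.span_singleton_le_iff_mem]; exact vecE_mem_S0 p q) hinv
  have hx : vecE p q ∉ W := by
    intro hx
    have : vecE p q ∈ Submodule.span ℝ {vecE p q} ⊓ W := ⟨Submodule.mem_span_singleton_self _, hx⟩
    rw [hW1, Submodule.mem_bot] at this
    have h1 := congrFun this 1
    have h2 := congrFun this 2
    simp [vecE] at h1 h2
    exact hpq (by simp [h1, h2])
  -- A vector of E enters W after subtraction of a multiple of (p, q); starting from (0, 1) or (1,
  -- 0) this produces the transverse vector, rescaled to determinant 1.
  have hE : ∀ a b, ∃ c, vecE (a - c * p) (b - c * q) ∈ W := by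
    intro a b
    have : vecE a b ∈ Submodule.span ℝ {vecE p q} ⊔ W := by rw [hW2]; exact vecE_mem_S0 a b
    obtain ⟨y, hy, z, hz, e⟩ := Submodule.mem_sup.1 this
    obtain ⟨c, rfl⟩ := Submodule.mem_span_singleton.1 hy
    refine ⟨c, ?_⟩
    have : z = vecE (a - c * p) (b - c * q) := by
      rw [eq_sub_of_add_eq' e, vecE_smul]
      ext i; fin_cases i <;> simp [vecE]
    rwa [← this]
  have hrs : ∃ r s, p * s - q * r = 1 ∧ vecE r s ∈ W := by
    have hpq' : p ≠ 0 ∨ q ≠ 0 := by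
      by_contra! hh; exact hpq (by simp [hh.1, hh.2])
    rcases hpq' with hp | hq
    · obtain ⟨c, hc⟩ := hE 0 1
      refine ⟨_, _, ?_, vecE_smul p⁻¹ _ _ ▸ W.smul_mem p⁻¹ hc⟩
      field_simp; ring
    · obtain ⟨c, hc⟩ := hE 1 0
      refine ⟨_, _, ?_, vecE_smul (-q⁻¹) _ _ ▸ W.smul_mem (-q⁻¹) hc⟩
      field_simp; ring
  obtain ⟨r, s, hd, hrs⟩ := hrs
  refine ⟨r, s, hd, fun T hT => ?_⟩
  have h1 := hWi T hT _ hrs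
  obtain ⟨A, v, y, rfl⟩ := H.shape T hT
  rw [hMat_mulVec_vecE] at h1
  rw [partE_hMat, Eigen]
  -- Otherwise (r, s) and its image span E inside W, and Cramer's rule puts (p, q) into W.
  by_contra hne
  set a := A 0 0 * r + A 0 1 * s
  set b := A 1 0 * r + A 1 1 * s
  apply hx
  have hne' : r * b - s * a ≠ 0 := sub_ne_zero.2 hne
  have : vecE p q = ((p * b - q * a) / (r * b - s * a)) • vecE r s
      + (-(1 / (r * b - s * a))) • vecE a b := by
    rw [vecE_smul, vecE_smul, vecE_add]
    have e1 : ∀ a x r d : ℝ, x / d * r + -(1 / d) * a = (x * r - a) / d := by intros; ring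
    rw [e1 a, e1 b]
    congr 1
    · rw [eq_div_iff hne']; linear_combination (-a) * hd
    · rw [eq_div_iff hne']; linear_combination (-b) * hd
  rw [this]
  exact W.add_mem (W.smul_mem _ hrs) (W.smul_mem _ h1)

/-- Holonomy data in normal form. -/
structure NF (L : V7 →ₗ[ℝ] Mat7) (h : LieSubalgebra ℝ Mat7) : Prop extends HolData L h, Shape h where
  shape_conn : ∀ x, ∃ A v u y, L x = hMat A v u y

/-- The components of the connection `L`. -/
def connData (L : V7 →ₗ[ℝ] Mat7) : ConnData where
  a i := L (Pi.single i 1) 1 1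
  b i := L (Pi.single i 1) 1 2
  c i := L (Pi.single i 1) 2 1
  d i := L (Pi.single i 1) 2 2
  v i := L (Pi.single i 1) 1 6
  w i := L (Pi.single i 1) 5 4
  y i := L (Pi.single i 1) 1 4
  z i := L (Pi.single i 1) 2 4

variable {L : V7 →ₗ[ℝ] Mat7} {h : LieSubalgebra ℝ Mat7}

/-- The entry (6, 4) is minus the first component of u, the only parameter that `ConnData` does not
record. -/
theorem NF.mat_eq (H : NF L h) (hu : ∀ i, L (Pi.single i 1) 6 4 = 0) (i : Fin 7) :
    (connData L).mat i = L (Pi.single i 1) := by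
  obtain ⟨A, v, u, y, e⟩ := H.shape_conn (Pi.single i 1)
  have hu := hu i
  have : (connData L).mat i = hMat (partE (L (Pi.single i 1))) (L (Pi.single i 1) 1 6)
    ![0, L (Pi.single i 1) 5 4] ![L (Pi.single i 1) 1 4, L (Pi.single i 1) 2 4] := rfl
  rw [this]
  rw [e] at hu ⊢
  rw [partE_hMat]
  have h0 : u 0 = 0 := by simpa [hMat] using hu
  congr 1
  · ext j; fin_cases j
    · exact h0.symm
    · rfl
  · ext j; fin_cases j <;> rfl

theorem eq_sum_single (L : V7 →ₗ[ℝ] Mat7) (x : V7) : L x = ∑ k, x k • L (Pi.single k 1) := by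
  conv_lhs => rw [pi_eq_sum_univ' x]
  simp

theorem NF.br_eq (H : NF L h) (hu : ∀ i, L (Pi.single i 1) 6 4 = 0) (i j k : Fin 7) :
    (connData L).br i j k = bra L (Pi.single i 1) (Pi.single j 1) k := by
  simp [ConnData.br, H.mat_eq hu, bra]

theorem NF.R_eq (H : NF L h) (hu : ∀ i, L (Pi.single i 1) 6 4 = 0) (i j : Fin 7) :
    (connData L).R i j = cur L (Pi.single i 1) (Pi.single j 1) := by
  rw [cur, eq_sum_single L (bra _ _ _)]
  simp only [ConnData.R, H.mat_eq hu, H.br_eq hu]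

/-- For a torsion-free connection the first Bianchi identity is the Jacobi identity of its bracket.
-/
theorem HolData.bianchi (H : HolData L h) (x y z : V7) :
    (cur L x y).mulVec z + (cur L y z).mulVec x + (cur L z x).mulVec y = 0 := by
  have h1 := H.jacobi x y z
  have e : ∀ x y z, (cur L x y).mulVec z = (L x).mulVec ((L y).mulVec z)
      - (L y).mulVec ((L x).mulVec z) - (L (bra L x y)).mulVec z := by
    intro x y z
    simp only [cur, Ring.lie_def, Matrix.sub_mulVec, Matrix.mulVec_mulVec]
  have e' : ∀ x y z, bra L (bra L x y) z = (L (bra L x y)).mulVec z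
      - (L z).mulVec ((L x).mulVec y) + (L z).mulVec ((L y).mulVec x) := by
    intro x y z
    conv_lhs => rw [bra]
    rw [show bra L x y = (L x).mulVec y - (L y).mulVec x from rfl, Matrix.mulVec_sub]
    abel
  rw [e' x y z, e' y z x, e' z x y] at h1
  rw [e x y z, e y z x, e z x y, ← neg_eq_zero, ← h1]
  abel

theorem jacobi_single {i j l : Fin 7} (m : Fin 7) :
    bra L (bra L (Pi.single i 1) (Pi.single j 1)) (Pi.single l 1) m =
      ∑ k, bra L (Pi.single i 1) (Pi.single j 1) k * bra L (Pi.single k 1) (Pi.single l 1) m := by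
  have hb : ∀ x z, bra L x z = ∑ k, x k • bra L (Pi.single k 1) z := by
    intro x z
    conv_lhs => rw [pi_eq_sum_univ' x]
    simp only [bra, map_sum, Matrix.sum_mulVec, Matrix.mulVec_sum, ← Finset.sum_sub_distrib]
    exact Finset.sum_congr rfl fun k _ => by
      simp [smul_sub, Matrix.smul_mulVec, Matrix.mulVec_smul]
  rw [hb]
  simp

/-- The two flatness fields express that the curvature lies in h, whose elements have u = 0. -/
theorem NF.isLie (H : NF L h) (hu : ∀ i, L (Pi.single i 1) 6 4 = 0) : (connData L).IsLie := by
  have hflat : ∀ i j, (connData L).b i * (connData L).w j - (connData L).b j * (connData L).w i = 0 ∧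
      (connData L).rW i j = 0 := by
    intro i j
    obtain ⟨A, v, y, e⟩ := H.shape _ (H.cur_mem (Pi.single i 1) (Pi.single j 1))
    rw [← H.R_eq hu, ConnData.R_eq] at e
    have e1 := congrFun (congrFun e 6) 4
    have e2 := congrFun (congrFun e 5) 4
    simp [hMat] at e1 e2
    exact ⟨by linarith, e2⟩
  refine ⟨fun i j l m => ?_, fun i j k p => ?_, fun i j => (hflat i j).1, fun i j => (hflat i j).2⟩
  · have := congrFun (H.jacobi (Pi.single i 1) (Pi.single j 1) (Pi.single l 1)) m
    simp only [Pi.add_apply, jacobi_single, Pi.zero_apply] at this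
    simp only [H.br_eq hu, Finset.sum_add_distrib]
    exact this
  · have := congrFun (H.bianchi (Pi.single i 1) (Pi.single j 1) (Pi.single k 1)) p
    simp only [H.R_eq hu]
    simpa using this

theorem NF.curvE_eq (H : NF L h) (hu : ∀ i, L (Pi.single i 1) 6 4 = 0) (i j : Fin 7) :
    (connData L).curvE i j = partE (cur L (Pi.single i 1) (Pi.single j 1)) := by
  rw [← H.R_eq hu, ConnData.R_eq, partE_hMat, ConnData.curvE]

theorem cur_eq_sum (x y : V7) :
    cur L x y = ∑ i, ∑ j, (x i * y j) • cur L (Pi.single i 1) (Pi.single j 1) := by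
  have h1 : ∀ x z, cur L x z = ∑ k, x k • cur L (Pi.single k 1) z := by
    intro x z
    conv_lhs => rw [pi_eq_sum_univ' x]
    simp only [cur, bra, map_sum, map_sub, Matrix.sum_mulVec, Matrix.mulVec_sum, smul_sub, sum_lie,
      Finset.sum_sub_distrib, map_smul, smul_lie, Matrix.smul_mulVec, Matrix.mulVec_smul]
  have h2 : ∀ x z, cur L x z = ∑ k, z k • cur L x (Pi.single k 1) := by
    intro x z
    conv_lhs => rw [pi_eq_sum_univ' z]
    simp only [cur, bra, map_sum, map_sub, Matrix.sum_mulVec, Matrix.mulVec_sum, smul_sub, lie_sum,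
      Finset.sum_sub_distrib, map_smul, lie_smul, Matrix.smul_mulVec, Matrix.mulVec_smul]
  rw [h1]
  refine Finset.sum_congr rfl fun i _ => ?_
  rw [h2, Finset.smul_sum]
  simp [smul_smul]

/-- A property of the action on the plane of the second and third basis vectors that is inherited by
linear combinations and stable under the connection holds for `h` if it holds for the curvature. -/
theorem NF.induct (H : NF L h) (P : Submodule ℝ (Matrix (Fin 2) (Fin 2) ℝ))
    (h1 : ∀ i j, partE (cur L (Pi.single i 1) (Pi.single j 1)) ∈ P)
    (h2 : ∀ i, ∀ A ∈ P, ⁅partE (L (Pi.single i 1)), A⁆ ∈ P) : ∀ T ∈ h, partE T ∈ P := by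
  let E : Mat7 →ₗ[ℝ] Matrix (Fin 2) (Fin 2) ℝ :=
    { toFun := partE
      map_add' := by intro A B; ext i j; fin_cases i <;> fin_cases j <;> rfl
      map_smul' := by intro A B; ext i j; fin_cases i <;> fin_cases j <;> rfl }
  have hE : ∀ T, E T = partE T := fun _ => rfl
  have hcur : ∀ x y, partE (cur L x y) ∈ P := by
    intro x y
    rw [cur_eq_sum, ← hE, map_sum]
    refine P.sum_mem fun i _ => ?_
    rw [map_sum]
    exact P.sum_mem fun j _ => by rw [map_smul]; exact P.smul_mem _ (h1 i j)
  have hlie : ∀ x, ∀ A ∈ P, ⁅partE (L x), A⁆ ∈ P := by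
    intro x A hA
    rw [eq_sum_single, ← hE, map_sum, sum_lie]
    exact P.sum_mem fun j _ => by rw [map_smul, smul_lie]; exact P.smul_mem _ (h2 j A hA)
  -- Minimality of h, applied to the part of h on which the property holds.
  refine fun T hT => (H.least (h.toSubmodule ⊓ P.comap E) (fun x y => ⟨H.cur_mem x y, hcur x y⟩)
    (fun x T hT => ⟨H.lie_mem x T hT.1, ?_⟩) hT).2
  obtain ⟨A, v, y, e⟩ := H.shape T hT.1
  obtain ⟨A', v', u', y', e'⟩ := H.shape_conn x
  have h3 : ⁅partE (L x), partE T⁆ ∈ P := hlie x _ hT.2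
  change partE _ ∈ P
  rw [e, e'] at h3 ⊢
  rw [partE_hMat, partE_hMat] at h3
  rwa [hMat_bracket, partE_hMat]

end G2StarHolonomy

/-! ### From the normal form to `Model`, and changes of basis of E -/

namespace G2StarHolonomy

variable {L : V7 →ₗ[ℝ] Mat7} {h : LieSubalgebra ℝ Mat7}

-- For `split`, an eigenvector of the connection is one of all of h by `NF.induct`; the complement
-- from `Shape.split` is then invariant under h, which contains the curvature and its brackets with
-- the connection.
open ConnData in
theorem NF.model (H : NF L h) (hu : ∀ i, L (Pi.single i 1) 6 4 = 0)
    (hw : ∀ i, L (Pi.single i 1) 5 4 = 0) (hn : ∃ T ∈ h, partE T ≠ 0) : (connData L).Model where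
  isLie := H.isLie hu
  w_eq := hw
  nonzero := by
    by_contra! hc
    obtain ⟨T, hT, hne⟩ := hn
    refine hne ?_
    have := H.induct ⊥ (fun i j => by rw [← H.curvE_eq hu, hc]; exact Submodule.zero_mem _)
      (fun i A hA => by
        rw [(Submodule.mem_bot ℝ).1 hA, lie_zero]; exact Submodule.zero_mem _) T hT
    exact (Submodule.mem_bot ℝ).1 this
  split := by
    intro p q hpq he
    let P : Submodule ℝ (Matrix (Fin 2) (Fin 2) ℝ) :=
      { carrier := {T | Eigen T p q}
        zero_mem' := by simp [Eigen]
        add_mem' := by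
          intro A B hA hB
          simp only [Set.mem_ofPred_eq, Eigen, Matrix.add_apply] at *
          linarith
        smul_mem' := by
          intro c A hA
          simp only [Set.mem_ofPred_eq, Eigen, Matrix.smul_apply, smul_eq_mul] at *
          linear_combination c * hA }
    have hlie : ∀ A B, Eigen A p q → Eigen B p q → Eigen ⁅A, B⁆ p q := by
      intro A B hA hB
      rw [eigen_iff hpq] at *
      obtain ⟨c, hc⟩ := hA
      obtain ⟨d, hd⟩ := hB
      refine ⟨0, ?_⟩
      rw [Ring.lie_def, Matrix.sub_mulVec, ← Matrix.mulVec_mulVec, ← Matrix.mulVec_mulVec, hc, hd,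
        Matrix.mulVec_smul, Matrix.mulVec_smul, hc, hd, smul_smul, smul_smul, mul_comm]
      simp
    have hmat : ∀ i, partE (L (Pi.single i 1)) = (connData L).matE i := fun i => rfl
    have hP : ∀ T ∈ h, Eigen (partE T) p q := by
      refine H.induct P (fun i j => ?_) (fun i A hA => ?_)
      · rw [cur]
        obtain ⟨A, v, u, y, e⟩ := H.shape_conn (Pi.single i 1)
        obtain ⟨A', v', u', y', e'⟩ := H.shape_conn (Pi.single j 1)
        have e1 : partE ⁅L (Pi.single i 1), L (Pi.single j 1)⁆ =
            ⁅partE (L (Pi.single i 1)), partE (L (Pi.single j 1))⁆ := by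
          rw [e, e', hMat_bracket, partE_hMat, partE_hMat, partE_hMat]
        have e2 : ∀ A B, partE (A - B) = partE A - partE B := by
          intro A B; ext k l; fin_cases k <;> fin_cases l <;> rfl
        have e3 : ∀ x, partE (L x) = ∑ k, x k • (connData L).matE k := by
          intro x
          rw [eq_sum_single L x]
          ext k l
          rw [Matrix.sum_apply]
          fin_cases k <;> fin_cases l <;> simp [partE, Matrix.sum_apply, matE, connData]
        rw [e2, e1, hmat, hmat]
        refine P.sub_mem (hlie _ _ (he i) (he j)) ?_
        rw [e3]
        exact P.sum_mem fun k _ => P.smul_mem _ (he k)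
      · rw [hmat]; exact hlie _ _ (he i) hA
    obtain ⟨r, s, hd, hrs⟩ := H.split hpq hP
    refine ⟨r, s, hd, fun i j => ?_, fun i j k => ?_⟩
    · rw [H.curvE_eq hu]; exact hrs _ (H.cur_mem _ _)
    · have h1 := hrs _ (H.lie_mem (Pi.single k 1) _ (H.cur_mem (Pi.single i 1) (Pi.single j 1)))
      obtain ⟨A, v, u, y, e⟩ := H.shape_conn (Pi.single k 1)
      obtain ⟨A', v', y', e'⟩ := H.shape _ (H.cur_mem (Pi.single i 1) (Pi.single j 1))
      rw [H.curvE_eq hu, ← hmat]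
      rw [e, e'] at h1 ⊢
      rw [hMat_bracket, partE_hMat] at h1
      rwa [partE_hMat, partE_hMat]

theorem omega0_apply (x : Fin 3 → V7) : omega0 x =
    √2 * ((x 0 0 * (x 1 5 * x 2 6 - x 1 6 * x 2 5) - x 0 5 * (x 1 0 * x 2 6 - x 1 6 * x 2 0)
        + x 0 6 * (x 1 0 * x 2 5 - x 1 5 * x 2 0))
      + (x 0 1 * (x 1 2 * x 2 4 - x 1 4 * x 2 2) - x 0 2 * (x 1 1 * x 2 4 - x 1 4 * x 2 1)
        + x 0 4 * (x 1 1 * x 2 2 - x 1 2 * x 2 1)))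
    - ((x 0 3 * (x 1 0 * x 2 4 - x 1 4 * x 2 0) - x 0 0 * (x 1 3 * x 2 4 - x 1 4 * x 2 3)
        + x 0 4 * (x 1 3 * x 2 0 - x 1 0 * x 2 3))
      - (x 0 3 * (x 1 1 * x 2 5 - x 1 5 * x 2 1) - x 0 1 * (x 1 3 * x 2 5 - x 1 5 * x 2 3)
        + x 0 5 * (x 1 3 * x 2 1 - x 1 1 * x 2 3))
      - (x 0 3 * (x 1 2 * x 2 6 - x 1 6 * x 2 2) - x 0 2 * (x 1 3 * x 2 6 - x 1 6 * x 2 3)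
        + x 0 6 * (x 1 3 * x 2 2 - x 1 2 * x 2 3))) := by
  have hw : ∀ i j k, wedge3 i j k x = x 0 i * (x 1 j * x 2 k - x 1 k * x 2 j)
      - x 0 j * (x 1 i * x 2 k - x 1 k * x 2 i) + x 0 k * (x 1 i * x 2 j - x 1 j * x 2 i) := by
    intro i j k
    simp only [wedge3, AlternatingMap.compLinearMap_apply]
    change Matrix.det (Matrix.of fun l => (LinearMap.funLeft ℝ ℝ ![i, j, k]) (x l)) = _
    rw [Matrix.det_fin_three]
    simp [LinearMap.funLeft]
    ring
  simp only [omega0, AlternatingMap.sub_apply, AlternatingMap.smul_apply, AlternatingMap.add_apply,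
    hw, smul_eq_mul]

theorem ip_apply (x y : V7) : ip x y =
    x 0 * y 4 + x 4 * y 0 + x 1 * y 5 + x 5 * y 1 + x 2 * y 6 + x 6 * y 2 - x 3 * y 3 := rfl

/-- The change of basis of the plane of the second and third basis vectors. -/
def planeMat (p q r s : ℝ) : Mat7 :=
  !![1, 0, 0, 0, 0, 0, 0;
     0, p, r, 0, 0, 0, 0;
     0, q, s, 0, 0, 0, 0;
     0, 0, 0, 1, 0, 0, 0;
     0, 0, 0, 0, 1, 0, 0;
     0, 0, 0, 0, 0, s, -q;
     0, 0, 0, 0, 0, -r, p]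

theorem planeMat_mul {p q r s : ℝ} (hd : p * s - q * r = 1) :
    planeMat p q r s * planeMat s (-q) (-r) p = 1 := by
  ext i j
  rw [Matrix.mul_apply, Fin.sum_univ_seven]
  fin_cases i <;> fin_cases j <;> simp [planeMat, Matrix.one_apply] <;>
    first | linear_combination hd | linear_combination -hd | ring

/-- The change of basis of the plane of the second and third basis vectors, as an element of
`GL(7, ℝ)`. -/
def planeGL {p q r s : ℝ} (hd : p * s - q * r = 1) : GL (Fin 7) ℝ where
  val := planeMat p q r s
  inv := planeMat s (-q) (-r) p
  val_inv := planeMat_mul hd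
  inv_val := by
    have := planeMat_mul (p := s) (q := -q) (r := -r) (s := p) (by linear_combination hd)
    simpa using this

theorem planeMat_mulVec (p q r s : ℝ) (x : V7) : (planeMat p q r s).mulVec x =
    ![x 0, p * x 1 + r * x 2, q * x 1 + s * x 2, x 3, x 4, s * x 5 - q * x 6,
      -r * x 5 + p * x 6] := by
  ext i
  rw [Matrix.mulVec, dotProduct, Fin.sum_univ_seven]
  fin_cases i <;> simp [planeMat] <;> ring

/-- SL(2) acts on E and dually on the indices 5 and 6; both ω₀ and the inner product change only
through the determinant. -/
theorem planeGL_isAut {p q r s : ℝ} (hd : p * s - q * r = 1) : IsAut (planeGL hd) where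
  mem := by
    intro x
    have e : ∀ x, (planeGL hd).val.mulVec x = _ := planeMat_mulVec p q r s
    rw [omega0_apply, omega0_apply]
    simp only [e]
    simp
    linear_combination (√2 * ((x 0 0 * (x 1 5 * x 2 6 - x 1 6 * x 2 5)
        - x 0 5 * (x 1 0 * x 2 6 - x 1 6 * x 2 0) + x 0 6 * (x 1 0 * x 2 5 - x 1 5 * x 2 0))
      + (x 0 1 * (x 1 2 * x 2 4 - x 1 4 * x 2 2) - x 0 2 * (x 1 1 * x 2 4 - x 1 4 * x 2 1)
        + x 0 4 * (x 1 1 * x 2 2 - x 1 2 * x 2 1)))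
      + (x 0 3 * (x 1 1 * x 2 5 - x 1 5 * x 2 1) - x 0 1 * (x 1 3 * x 2 5 - x 1 5 * x 2 3)
        + x 0 5 * (x 1 3 * x 2 1 - x 1 1 * x 2 3))
      + (x 0 3 * (x 1 2 * x 2 6 - x 1 6 * x 2 2) - x 0 2 * (x 1 3 * x 2 6 - x 1 6 * x 2 3)
        + x 0 6 * (x 1 3 * x 2 2 - x 1 2 * x 2 3))) * hd
  ip_eq x y := by
    have e : ∀ x, (planeGL hd).val.mulVec x = _ := planeMat_mulVec p q r s
    rw [ip_apply, ip_apply, e, e]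
    simp
    linear_combination (x 1 * y 5 + x 5 * y 1 + x 2 * y 6 + x 6 * y 2) * hd

set_option maxHeartbeats 1000000 in
theorem hMat_mul_planeMat {p q r s : ℝ} (hd : p * s - q * r = 1) (a b c d v y z : ℝ) :
    hMat !![a, b; c, d] v ![0, 0] ![y, z] * planeMat p q r s = planeMat p q r s *
      hMat !![s * (a * p + b * q) - r * (c * p + d * q), s * (a * r + b * s) - r * (c * r + d * s);
        -q * (a * p + b * q) + p * (c * p + d * q), -q * (a * r + b * s) + p * (c * r + d * s)] v
        ![0, 0] ![s * y - r * z, -q * y + p * z] := by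
  ext i j
  rw [Matrix.mul_apply, Matrix.mul_apply, Fin.sum_univ_seven, Fin.sum_univ_seven]
  unfold hMat planeMat
  rw [Matrix.trace_fin_two, Matrix.trace_fin_two]
  fin_cases i <;> fin_cases j <;> simp <;> first
    | ring1
    | linear_combination (-a - d) * hd
    | linear_combination (-(a * p + b * q)) * hd
    | linear_combination (-(a * r + b * s)) * hd
    | linear_combination (-(c * p + d * q)) * hd
    | linear_combination (-(c * r + d * s)) * hd
    | linear_combination (-y) * hd
    | linear_combination (-z) * hd
    | linear_combination (a + d) * hd
    | linear_combination (a * s - c * r) * hd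
    | linear_combination (-(a * q - c * p)) * hd
    | linear_combination (b * s - d * r) * hd
    | linear_combination (-(b * q - d * p)) * hd

/-- The components of a linear form with respect to the new basis. -/
def planeForm (p q r s : ℝ) (f : Fin 7 → ℝ) : Fin 7 → ℝ :=
  ![f 0, p * f 1 + q * f 2, r * f 1 + s * f 2, f 3, f 4, s * f 5 - r * f 6, -q * f 5 + p * f 6]

/-- The components of a connection with `w = 0` after a change of basis of the plane of the second
and third basis vectors. -/
def ConnData.rebase (D : ConnData) (p q r s : ℝ) : ConnData where
  a := planeForm p q r s fun i => s * (D.a i * p + D.b i * q) - r * (D.c i * p + D.d i * q)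
  b := planeForm p q r s fun i => s * (D.a i * r + D.b i * s) - r * (D.c i * r + D.d i * s)
  c := planeForm p q r s fun i => -q * (D.a i * p + D.b i * q) + p * (D.c i * p + D.d i * q)
  d := planeForm p q r s fun i => -q * (D.a i * r + D.b i * s) + p * (D.c i * r + D.d i * s)
  v := planeForm p q r s D.v
  w := fun _ => 0
  y := planeForm p q r s fun i => s * D.y i - r * D.z i
  z := planeForm p q r s fun i => -q * D.y i + p * D.z i

theorem planeForm_eq (p q r s : ℝ) (f : Fin 7 → ℝ) (i : Fin 7) :
    planeForm p q r s f i = ∑ k, planeMat p q r s k i * f k := by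
  rw [Fin.sum_univ_seven]
  fin_cases i <;> simp [planeForm, planeMat] <;> ring

theorem conj_hMat_plane {p q r s : ℝ} (hd : p * s - q * r = 1) (a b c d v y z : ℝ) :
    (planeGL hd)⁻¹.val * hMat !![a, b; c, d] v 0 ![y, z] * (planeGL hd).val =
      hMat !![s * (a * p + b * q) - r * (c * p + d * q), s * (a * r + b * s) - r * (c * r + d * s);
        -q * (a * p + b * q) + p * (c * p + d * q), -q * (a * r + b * s) + p * (c * r + d * s)] v
        0 ![s * y - r * z, -q * y + p * z] := by
  have h0 : (0 : Fin 2 → ℝ) = ![0, 0] := by ext i; fin_cases i <;> rfl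
  rw [h0, mul_assoc]
  have := hMat_mul_planeMat hd a b c d v y z
  change (planeGL hd)⁻¹.val * (_ * planeMat p q r s) = _
  rw [this, ← mul_assoc]
  change ((planeGL hd)⁻¹.val * (planeGL hd).val) * _ = _
  rw [GL_inv_mul, one_mul]

/-- A change of frame acts on the direction of differentiation through `planeForm` and on the values
by conjugation. With u = 0 both operations stay within `ConnData`. -/
theorem connData_rebase (hu : ∀ i, (connData L).mat i = L (Pi.single i 1))
    (hw : ∀ i, (connData L).w i = 0) {p q r s : ℝ} (hd : p * s - q * r = 1) :
    connData (conjConn (planeGL hd) L) = (connData L).rebase p q r s ∧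
      ∀ i, ((connData L).rebase p q r s).mat i = conjConn (planeGL hd) L (Pi.single i 1) := by
  have key : ∀ i, conjConn (planeGL hd) L (Pi.single i 1) =
      ((connData L).rebase p q r s).mat i := by
    intro i
    have e : ∀ x, conjConn (planeGL hd) L x =
      (planeGL hd)⁻¹.val * L ((planeGL hd).val.mulVec x) * (planeGL hd).val := fun _ => rfl
    have e1 : L ((planeGL hd).val.mulVec (Pi.single i 1)) = ∑ k, planeMat p q r s k i • (connData L).mat k := by
      rw [eq_sum_single L, Matrix.mulVec_single_one]
      simp only [hu]; rfl
    have e2 : ∀ k, (planeGL hd)⁻¹.val * (planeMat p q r s k i • (connData L).mat k) * (planeGL hd).val =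
        hLin (planeMat p q r s k i •
          (!![s * ((connData L).a k * p + (connData L).b k * q) - r * ((connData L).c k * p + (connData L).d k * q),
            s * ((connData L).a k * r + (connData L).b k * s) - r * ((connData L).c k * r + (connData L).d k * s);
            -q * ((connData L).a k * p + (connData L).b k * q) + p * ((connData L).c k * p + (connData L).d k * q),
            -q * ((connData L).a k * r + (connData L).b k * s) + p * ((connData L).c k * r + (connData L).d k * s)],
            (connData L).v k, 0,
            ![s * (connData L).y k - r * (connData L).z k, -q * (connData L).y k + p * (connData L).z k])) := by
      intro k
      rw [map_smul, mul_smul_comm, smul_mul_assoc]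
      congr 1
      rw [ConnData.mat, hw]
      have h0 : ![(0 : ℝ), 0] = 0 := by ext i; fin_cases i <;> rfl
      rw [h0, conj_hMat_plane]
      rfl
    rw [e, e1, Matrix.mul_sum, Matrix.sum_mul, Finset.sum_congr rfl fun k _ => e2 k, ← map_sum]
    have e3 : ∀ D : ConnData, D.mat i =
      hLin (!![D.a i, D.b i; D.c i, D.d i], D.v i, ![0, D.w i], ![D.y i, D.z i]) := fun _ => rfl
    rw [e3]
    congr 1
    simp only [Prod.smul_mk, Prod.ext_iff, Prod.fst_sum, Prod.snd_sum]
    refine ⟨?_, ?_, ?_, ?_⟩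
    · ext m n; fin_cases m <;> fin_cases n <;>
        simp only [ConnData.rebase, planeForm_eq, Matrix.sum_apply] <;> rfl
    · simp only [ConnData.rebase, planeForm_eq, smul_eq_mul]
    · ext m; fin_cases m <;> simp [ConnData.rebase]
    · ext m; fin_cases m <;> simp [ConnData.rebase, planeForm_eq, - neg_mul]
  refine ⟨?_, fun i => (key i).symm⟩
  simp only [connData, key]
  rfl

end G2StarHolonomy

/-! ### Linear equations of the Lie algebra of `G₂*` -/

namespace G2StarHolonomy

/-- The linear equations that define the Lie algebra of `G₂*`. -/
theorem g2Star_eqs {A : Mat7} (hA : A ∈ g2Star) :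
    A 4 0 = 0 ∧
    -(A 4 1) - A 5 0 = 0 ∧
    -(√2 * A 2 0) + A 3 1 = 0 ∧
    A 3 0 - √2 * A 6 1 = 0 ∧
    A 5 1 = 0 ∧
    -(A 4 2) - A 6 0 = 0 ∧
    √2 * A 1 0 + A 3 2 = 0 ∧
    A 6 2 = 0 ∧
    A 3 0 + √2 * A 5 2 = 0 ∧
    A 0 0 + A 3 3 + A 4 4 = 0 ∧
    -(A 1 0) + A 4 5 - √2 * A 6 3 = 0 ∧
    -(A 2 0) + A 4 6 + √2 * A 5 3 = 0 ∧
    -(A 3 5) - √2 * A 6 4 = 0 ∧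
    -(A 3 6) + √2 * A 5 4 = 0 ∧
    √2 * A 0 0 + √2 * A 5 5 + √2 * A 6 6 = 0 ∧
    √2 * A 4 3 + A 5 2 - A 6 1 = 0 ∧
    √2 * A 1 1 + √2 * A 2 2 + √2 * A 4 4 = 0 ∧
    -(A 3 2) + √2 * A 4 5 = 0 ∧
    A 3 1 + √2 * A 4 6 = 0 ∧
    A 0 1 + √2 * A 2 3 - A 5 4 = 0 ∧
    -(A 1 1) - A 3 3 - A 5 5 = 0 ∧
    -(A 2 1) - A 5 6 = 0 ∧
    -(√2 * A 2 5) - A 3 4 = 0 ∧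
    A 2 6 = 0 ∧
    √2 * A 0 1 + A 3 6 = 0 ∧
    A 0 2 - √2 * A 1 3 - A 6 4 = 0 ∧
    -(A 1 2) - A 6 5 = 0 ∧
    -(A 2 2) - A 3 3 - A 6 6 = 0 ∧
    A 1 5 = 0 ∧
    √2 * A 1 6 - A 3 4 = 0 ∧
    √2 * A 0 2 - A 3 5 = 0 ∧
    A 0 5 + A 1 4 = 0 ∧
    A 0 6 + A 2 4 = 0 ∧
    √2 * A 0 3 - A 1 6 + A 2 5 = 0 ∧
    A 0 4 = 0 := by
  have e := fun i j k => hA (Pi.single i 1) (Pi.single j 1) (Pi.single k 1)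
  simp only [omega0_apply, Matrix.mulVec_single_one, Matrix.col_apply] at e
  refine ⟨?_, ?_, ?_, ?_, ?_, ?_, ?_, ?_, ?_, ?_, ?_, ?_, ?_, ?_, ?_, ?_, ?_, ?_, ?_, ?_, ?_, ?_, ?_, ?_, ?_, ?_, ?_, ?_, ?_, ?_, ?_, ?_, ?_, ?_, ?_⟩
  · have := e 0 1 2; simp at this; exact this
  · have := e 0 1 3; simp at this; linarith
  · have := e 0 1 4; simp at this; exact this
  · have := e 0 1 5; simp at this; exact this
  · have := e 0 1 6; simp at this; exact this
  · have := e 0 2 3; simp at this; linarith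
  · have := e 0 2 4; simp at this; exact this
  · have := e 0 2 5; simp at this; exact this
  · have := e 0 2 6; simp at this; exact this
  · have := e 0 3 4; simp at this; exact this
  · have := e 0 3 5; simp at this; linarith
  · have := e 0 3 6; simp at this; linarith
  · have := e 0 4 5; simp at this; linarith
  · have := e 0 4 6; simp at this; linarith
  · have := e 0 5 6; simp at this; exact this
  · have := e 1 2 3; simp at this; linarith
  · have := e 1 2 4; simp at this; exact this
  · have := e 1 2 5; simp at this; exact this
  · have := e 1 2 6; simp at this; exact this
  · have := e 1 3 4; simp at this; exact this
  · have := e 1 3 5; simp at this; exact this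
  · have := e 1 3 6; simp at this; exact this
  · have := e 1 4 5; simp at this; linarith
  · have := e 1 4 6; simp at this; exact this
  · have := e 1 5 6; simp at this; exact this
  · have := e 2 3 4; simp at this; exact this
  · have := e 2 3 5; simp at this; exact this
  · have := e 2 3 6; simp at this; exact this
  · have := e 2 4 5; simp at this; exact this
  · have := e 2 4 6; simp at this; linarith
  · have := e 2 5 6; simp at this; exact this
  · have := e 3 4 5; simp at this; linarith
  · have := e 3 4 6; simp at this; linarith
  · have := e 3 5 6; simp at this; linarith
  · have := e 4 5 6; simp at this; exact this

/-- The elements of the Lie algebra of `G₂*` are skew-symmetric. -/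
theorem g2Star_skew_eqs {A : Mat7} (hA : A ∈ g2Star) :
    (A 4 0 = 0 ∧ A 5 1 = 0 ∧ A 6 2 = 0 ∧ A 3 3 = 0 ∧ A 0 4 = 0 ∧ A 1 5 = 0 ∧ A 2 6 = 0) ∧
    (A 4 1 = -A 5 0 ∧ A 4 2 = -A 6 0 ∧ A 4 3 = A 3 0 ∧ A 4 4 = -A 0 0 ∧ A 4 5 = -A 1 0 ∧
      A 4 6 = -A 2 0) ∧
    (A 5 2 = -A 6 1 ∧ A 5 3 = A 3 1 ∧ A 5 4 = -A 0 1 ∧ A 5 5 = -A 1 1 ∧ A 5 6 = -A 2 1) ∧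
    (A 6 3 = A 3 2 ∧ A 6 4 = -A 0 2 ∧ A 6 5 = -A 1 2 ∧ A 6 6 = -A 2 2) ∧
    (A 3 4 = A 0 3 ∧ A 3 5 = A 1 3 ∧ A 3 6 = A 2 3) ∧
    (A 1 4 = -A 0 5 ∧ A 2 4 = -A 0 6 ∧ A 2 5 = -A 1 6) := by
  obtain ⟨s, hs, h2⟩ : ∃ s : ℝ, √2 = s ∧ s ^ 2 = 2 := ⟨√2, rfl, Real.sq_sqrt (by norm_num)⟩
  have e := g2Star_eqs hA
  rw [hs] at e
  obtain ⟨e1, e2, e3, e4, e5, e6, e7, e8, e9, e10, e11, e12, e13, e14, e15, e16, e17, e18, e19, e20,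
    e21, e22, e23, e24, e25, e26, e27, e28, e29, e30, e31, e32, e33, e34, e35⟩ := e
  refine ⟨⟨?_, ?_, ?_, ?_, ?_, ?_, ?_⟩, ⟨?_, ?_, ?_, ?_, ?_, ?_⟩, ⟨?_, ?_, ?_, ?_, ?_⟩,
    ⟨?_, ?_, ?_, ?_⟩, ⟨?_, ?_, ?_⟩, ⟨?_, ?_, ?_⟩⟩ <;> first | linarith | grind

theorem ip_mulVec {A : Mat7} (hA : A ∈ g2Star) (x y : V7) :
    ip (A.mulVec x) y + ip x (A.mulVec y) = 0 := by
  obtain ⟨⟨a1, a2, a3, a4, a5, a6, a7⟩, ⟨b1, b2, b3, b4, b5, b6⟩, ⟨c1, c2, c3, c4, c5⟩,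
    ⟨d1, d2, d3, d4⟩, ⟨f1, f2, f3⟩, ⟨g1, g2, g3⟩⟩ := g2Star_skew_eqs hA
  rw [ip_apply, ip_apply]
  simp only [Matrix.mulVec, dotProduct, Fin.sum_univ_seven, a1, a2, a3, a4, a5, a6, a7, b1, b2, b3,
    b4, b5, b6, c1, c2, c3, c4, c5, d1, d2, d3, d4, f1, f2, f3, g1, g2, g3]
  ring

/-- The elements of the Lie algebra of `G₂*` that preserve the first coordinate line. -/
theorem eq_hMat {A : Mat7} (hA : A ∈ g2Star) (h1 : A 1 0 = 0) (h2 : A 2 0 = 0) (h3 : A 3 0 = 0)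
    (h5 : A 5 0 = 0) (h6 : A 6 0 = 0) :
    A = hMat (partE A) (A 1 6) ![-A 6 4, A 5 4] ![A 1 4, A 2 4] := by
  obtain ⟨⟨a1, a2, a3, a4, a5, a6, a7⟩, ⟨b1, b2, b3, b4, b5, b6⟩, ⟨c1, c2, c3, c4, c5⟩,
    ⟨d1, d2, d3, d4⟩, ⟨f1, f2, f3⟩, ⟨g1, g2, g3⟩⟩ := g2Star_skew_eqs hA
  obtain ⟨s, hs, hq⟩ : ∃ s : ℝ, √2 = s ∧ s ^ 2 = 2 := ⟨√2, rfl, Real.sq_sqrt (by norm_num)⟩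
  have e := g2Star_eqs hA
  obtain ⟨e1, e2, e3, e4, e5, e6, e7, e8, e9, e10, e11, e12, e13, e14, e15, e16, e17, e18, e19, e20,
    e21, e22, e23, e24, e25, e26, e27, e28, e29, e30, e31, e32, e33, e34, e35⟩ := e
  have hs0 : √2 ≠ 0 := by positivity
  have t1 : A 0 0 = A 1 1 + A 2 2 := by
    apply mul_left_cancel₀ hs0; linear_combination -e17 + √2 * b4
  have t2 : A 0 3 = √2 * A 1 6 := by linear_combination -f1 - e30
  have t3 : A 1 3 = √2 * -A 6 4 := by linear_combination -f2 - e13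
  have t4 : A 2 3 = √2 * A 5 4 := by linear_combination -f3 - e14
  have t5 : A 3 1 = 0 := by linear_combination e3 + √2 * h2
  have t6 : A 3 2 = 0 := by linear_combination e7 - √2 * h1
  have t7 : A 6 1 = 0 := by
    apply mul_left_cancel₀ hs0; linear_combination -e4 + h3
  have t8 : A 2 5 = -A 1 6 := g3
  have t9 : A 0 1 = -A 5 4 := by linear_combination c3
  have t10 : A 0 2 = A 6 4 * -1 := by linear_combination d2
  have t11 : A 0 5 = -A 1 4 := by linear_combination g1
  have t12 : A 0 6 = -A 2 4 := by linear_combination g2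
  clear e1 e2 e3 e4 e5 e6 e7 e8 e9 e10 e11 e12 e13 e14 e15 e16 e17 e18 e19 e20 e21 e22 e23 e24 e25
    e26 e27 e28 e29 e30 e31 e32 e33 e34 e35 c3 d2 g1 g2
  unfold hMat
  rw [Matrix.trace_fin_two]
  ext i j
  fin_cases i <;> fin_cases j <;>
    simp [partE, a1, a2, a3, a4, a5, a6, a7, b1, b2, b3, b4, b5, b6, c1, c2, c4, c5, d1, d3, d4, f1,
      f2, f3, t1, t2, t3, t4, t5, t6, t7, t8, t9, t10, t11, t12, h1, h2, h3, h5, h6]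

end G2StarHolonomy

/-! ### Stability of the normal form under changes of basis of E -/

namespace G2StarHolonomy

variable {L : V7 →ₗ[ℝ] Mat7} {h : LieSubalgebra ℝ Mat7}

theorem conj_hMat_plane' {p q r s : ℝ} (hd : p * s - q * r = 1) (A : Matrix (Fin 2) (Fin 2) ℝ)
    (v : ℝ) (y : Fin 2 → ℝ) :
    (planeGL hd)⁻¹.val * hMat A v 0 y * (planeGL hd).val =
      hMat (!![s, -r; -q, p] * A * !![p, r; q, s]) v 0 ![s * y 0 - r * y 1, -q * y 0 + p * y 1] := by
  have e1 : hMat A v 0 y = hMat !![A 0 0, A 0 1; A 1 0, A 1 1] v 0 ![y 0, y 1] := by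
    congr 1
    · exact Matrix.eta_fin_two A
    · ext i; fin_cases i <;> rfl
  rw [e1, conj_hMat_plane]
  congr 1
  conv_rhs => rw [Matrix.eta_fin_two A, Matrix.mul_fin_two, Matrix.mul_fin_two]
  ext i j
  fin_cases i <;> fin_cases j <;> simp <;> ring

theorem planeGL_mem_S0 {p q r s : ℝ} (hd : p * s - q * r = 1) {x : V7} :
    (planeGL hd).val.mulVec x ∈ S0 ↔ x ∈ S0 := by
  have e : (planeGL hd).val.mulVec x = _ := planeMat_mulVec p q r s x
  have e' : (planeGL hd)⁻¹.val.mulVec ((planeGL hd).val.mulVec x) = _ :=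
    planeMat_mulVec s (-q) (-r) p _
  rw [GL_inv_mulVec] at e'
  constructor
  · rintro ⟨h1, h2, h3, h4⟩
    rw [e']
    simp [mem_S0, h1, h2, h3, h4]
  · rintro ⟨h1, h2, h3, h4⟩
    rw [e]
    simp [mem_S0, h1, h2, h3, h4]

theorem Shape.conj (H : Shape h) {p q r s : ℝ} (hd : p * s - q * r = 1) :
    Shape (conjSub (planeGL hd) h) where
  shape T hT := by
    obtain ⟨A, v, y, e⟩ := H.shape _ hT
    rw [← conj_conj (planeGL hd) T, e, conj_hMat_plane']
    exact ⟨_, _, _, rfl⟩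
  compl W hW hi := by
    have hW' : W.map (planeGL hd).val.mulVecLin ≤ S0 := by
      rintro _ ⟨w, hw, rfl⟩
      exact (planeGL_mem_S0 hd).2 (hW hw)
    obtain ⟨U, hU, hUi, hU1, hU2⟩ := H.compl _ hW' (isInvariant_conjSub.1 hi)
    have hmap : (U.comap (planeGL hd).val.mulVecLin).map (planeGL hd).val.mulVecLin = U := by
      refine Submodule.map_comap_eq_of_surjective (fun x => ?_) _
      exact ⟨(planeGL hd)⁻¹.val.mulVec x, by rw [Matrix.mulVecLin_apply, GL_mulVec_inv]⟩
    refine ⟨U.comap (planeGL hd).val.mulVecLin, fun x hx => (planeGL_mem_S0 hd).1 (hU hx), ?_, ?_, ?_⟩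
    · rw [isInvariant_conjSub, hmap]; exact hUi
    · rw [Submodule.eq_bot_iff]
      rintro x ⟨hx1, hx2⟩
      have : (planeGL hd).val.mulVec x ∈ W.map (planeGL hd).val.mulVecLin ⊓ U := ⟨⟨x, hx1, rfl⟩, hx2⟩
      rw [hU1, Submodule.mem_bot] at this
      rw [← GL_inv_mulVec (planeGL hd) x, this, Matrix.mulVec_zero]
    · refine le_antisymm (sup_le hW fun x hx => (planeGL_mem_S0 hd).1 (hU hx)) fun x hx => ?_
      have : (planeGL hd).val.mulVec x ∈ W.map (planeGL hd).val.mulVecLin ⊔ U := by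
        rw [hU2]; exact (planeGL_mem_S0 hd).2 hx
      rw [← hmap, ← Submodule.map_sup] at this
      obtain ⟨z, hz, e⟩ := this
      have : z = x := by
        rw [← GL_inv_mulVec (planeGL hd) x, ← GL_inv_mulVec (planeGL hd) z]
        exact congrArg _ e
      rwa [← this]

/-- The change of basis fixes the first basis vector, so the conjugate connection still preserves
its line; `eq_hMat` then gives `shape_conn`. -/
theorem NF.conj (H : NF L h) {p q r s : ℝ} (hd : p * s - q * r = 1) :
    NF (conjConn (planeGL hd) L) (conjSub (planeGL hd) h) where
  toHolData := H.toHolData.conj (planeGL_isAut hd)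
  toShape := H.toShape.conj hd
  shape_conn x := by
    have hm := (H.toHolData.conj (planeGL_isAut hd)).mem_g2 x
    obtain ⟨A, v, u, y, e⟩ := H.shape_conn ((planeGL hd).val.mulVec x)
    have key : (conjConn (planeGL hd) L x).mulVec (Pi.single 0 1) = ![A.trace, 0, 0, 0, 0, 0, 0] := by
      have e1 : conjConn (planeGL hd) L x =
        (planeGL hd)⁻¹.val * L ((planeGL hd).val.mulVec x) * (planeGL hd).val := rfl
      have e2 : ∀ x, (planeGL hd).val.mulVec x = _ := planeMat_mulVec p q r s
      have e3 : ∀ x, (planeGL hd)⁻¹.val.mulVec x = _ := planeMat_mulVec s (-q) (-r) p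
      rw [e1, e, ← Matrix.mulVec_mulVec, ← Matrix.mulVec_mulVec, e2, e3]
      simp only [Matrix.mulVec, dotProduct, Fin.sum_univ_seven]
      ext i; fin_cases i <;> simp [hMat]
    rw [Matrix.mulVec_single_one] at key
    exact ⟨_, _, _, _, eq_hMat hm (congrFun key 1) (congrFun key 2) (congrFun key 3)
      (congrFun key 5) (congrFun key 6)⟩

theorem partE_conj (H : Shape h) {p q r s : ℝ} (hd : p * s - q * r = 1) {T : Mat7}
    (hT : T ∈ conjSub (planeGL hd) h) : ∃ T' ∈ h, T' = (planeGL hd).val * T * (planeGL hd)⁻¹.val ∧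
      partE T = !![s, -r; -q, p] * partE T' * !![p, r; q, s] := by
  refine ⟨_, hT, rfl, ?_⟩
  obtain ⟨A, v, y, e⟩ := H.shape _ hT
  rw [e, partE_hMat, ← conj_conj (planeGL hd) T, e, conj_hMat_plane', partE_hMat]

theorem NF.nonzero_conj (H : Shape h) {p q r s : ℝ} (hd : p * s - q * r = 1)
    (hn : ∃ T ∈ h, partE T ≠ 0) : ∃ T ∈ conjSub (planeGL hd) h, partE T ≠ 0 := by
  obtain ⟨T, hT, hne⟩ := hn
  refine ⟨(planeGL hd)⁻¹.val * T * (planeGL hd).val, by rwa [mem_conjSub, conj_conj'], ?_⟩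
  obtain ⟨A, v, y, rfl⟩ := H.shape _ hT
  rw [partE_hMat] at hne
  rw [conj_hMat_plane', partE_hMat]
  intro h0
  apply hne
  have e : !![p, r; q, s] * !![s, -r; -q, p] = 1 := by
    ext i j
    fin_cases i <;> fin_cases j <;> simp [Matrix.mul_apply, Fin.sum_univ_two] <;>
      first | ring1 | linear_combination hd
  calc A = !![p, r; q, s] * !![s, -r; -q, p] * A * (!![p, r; q, s] * !![s, -r; -q, p]) := by
        rw [e]; simp
    _ = !![p, r; q, s] * (!![s, -r; -q, p] * A * !![p, r; q, s]) * !![s, -r; -q, p] := by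
        simp only [mul_assoc]
    _ = 0 := by rw [h0]; simp

end G2StarHolonomy

/-! ### The polynomial system left after the directions 0 to 3 act trivially on E -/

namespace G2StarHolonomy

namespace ConnData

/-- The connection annihilates the plane of the second and third basis vectors in the directions
of the orthogonal complement of the socle. -/
structure FlatK (D : ConnData) : Prop where
  a_eq : D.a 0 = 0 ∧ D.a 1 = 0 ∧ D.a 2 = 0 ∧ D.a 3 = 0
  b_eq : D.b 0 = 0 ∧ D.b 1 = 0 ∧ D.b 2 = 0 ∧ D.b 3 = 0
  c_eq : D.c 0 = 0 ∧ D.c 1 = 0 ∧ D.c 2 = 0 ∧ D.c 3 = 0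
  d_eq : D.d 0 = 0 ∧ D.d 1 = 0 ∧ D.d 2 = 0 ∧ D.d 3 = 0
  v_eq : D.v 0 = 0

/-- The structure equations of a connection that annihilates the plane of the second and third basis
vectors in the directions of the orthogonal complement of the socle. -/
structure KEqs (D : ConnData) : Prop where
  vy1 : D.v 1 * D.y 0 = 0
  vz1 : D.v 1 * D.z 0 = 0
  vy2 : D.v 2 * D.y 0 = 0
  vz2 : D.v 2 * D.z 0 = 0
  y05 : D.y 0 * D.y 0 = D.a 5 * D.y 0 + D.b 5 * D.z 0
  z05 : D.y 0 * D.z 0 = D.c 5 * D.y 0 + D.d 5 * D.z 0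
  y06 : D.z 0 * D.y 0 = D.a 6 * D.y 0 + D.b 6 * D.z 0
  z06 : D.z 0 * D.z 0 = D.c 6 * D.y 0 + D.d 6 * D.z 0
  v35 : D.v 3 * (D.a 5 + D.d 5 - D.v 2) = 0
  y35 : (2 * D.a 5 + D.d 5) * D.y 3 + D.b 5 * D.z 3 =
    (D.y 3 + √2 * D.v 5) * D.y 0 + D.v 3 * D.y 2
  z35 : D.c 5 * D.y 3 + (D.a 5 + 2 * D.d 5) * D.z 3 =
    (D.y 3 + √2 * D.v 5) * D.z 0 + D.v 3 * D.z 2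
  v36 : D.v 3 * (D.a 6 + D.d 6 + D.v 1) = 0
  y36 : (2 * D.a 6 + D.d 6) * D.y 3 + D.b 6 * D.z 3 =
    (D.z 3 + √2 * D.v 6) * D.y 0 - D.v 3 * D.y 1
  z36 : D.c 6 * D.y 3 + (D.a 6 + 2 * D.d 6) * D.z 3 =
    (D.z 3 + √2 * D.v 6) * D.z 0 - D.v 3 * D.z 1
  y14 : (D.a 4 + D.d 4 + D.y 1) * D.y 1 + D.b 4 * D.z 1 + (D.z 1 - D.c 4) * D.y 2
    + √2 * D.v 1 * D.y 3 = 0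
  z24 : D.c 4 * D.y 2 + (D.a 4 + D.d 4 + D.z 2) * D.z 2 + (D.y 2 - D.b 4) * D.z 1
    + √2 * D.v 2 * D.z 3 = 0
  v14 : (D.d 4 + D.y 1 + √2 * D.v 3) * D.v 1 + (D.z 1 - D.c 4) * D.v 2 = 0
  v24 : (D.a 4 + D.z 2 + √2 * D.v 3) * D.v 2 + (D.y 2 - D.b 4) * D.v 1 = 0
  v34 : (D.a 4 + D.d 4) * D.v 3 + D.y 3 * D.v 1 + D.z 3 * D.v 2 + √2 * D.v 3 * D.v 3 = 0
  v15 : D.d 5 * D.v 1 = (D.v 1 + D.c 5) * D.v 2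
  v16 : D.d 6 * D.v 1 + D.v 1 * D.v 1 = D.c 6 * D.v 2
  v25 : D.a 5 * D.v 2 = D.v 2 * D.v 2 + D.b 5 * D.v 1
  v26 : D.a 6 * D.v 2 + D.v 2 * D.v 1 = D.b 6 * D.v 1
  y04 : D.rT 4 5 = -(D.a 4 * D.y 0) - D.b 4 * D.z 0 - D.y 0 * D.y 1 - D.z 0 * D.y 2
  z04 : D.rT 4 6 = -(D.c 4 * D.y 0) - D.d 4 * D.z 0 - D.y 0 * D.z 1 - D.z 0 * D.z 2
  y34 : √2 * D.rV 4 5 = -((2 * D.a 4 + D.d 4) * D.y 3) - D.b 4 * D.z 3 + √2 * D.v 4 * D.y 0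
    - D.y 3 * D.y 1 - D.z 3 * D.y 2 - √2 * D.v 3 * D.y 3
  z34 : √2 * D.rV 4 6 = -(D.c 4 * D.y 3) - (D.a 4 + 2 * D.d 4) * D.z 3 + √2 * D.v 4 * D.z 0
    - D.y 3 * D.z 1 - D.z 3 * D.z 2 - √2 * D.v 3 * D.z 3
  y15 : D.rA 4 5 = -((D.a 5 + D.d 5) * D.y 1) - D.b 5 * D.z 1 + D.y 1 * D.y 0
    + (D.v 1 + D.c 5) * D.y 2
  z15 : D.rC 4 5 = -(D.c 5 * D.y 1) - 2 * D.d 5 * D.z 1 + D.y 1 * D.z 0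
    + (D.v 1 + D.c 5) * D.z 2
  y16 : D.rA 4 6 = -((D.a 6 + D.d 6 + D.v 1) * D.y 1) - D.b 6 * D.z 1 + D.z 1 * D.y 0
    + D.c 6 * D.y 2
  z16 : D.rC 4 6 = -(D.c 6 * D.y 1) - (2 * D.d 6 + D.v 1) * D.z 1 + D.z 1 * D.z 0
    + D.c 6 * D.z 2
  y25 : D.rB 4 5 = -((2 * D.a 5 - D.v 2) * D.y 2) - D.b 5 * D.z 2 + D.y 2 * D.y 0
    + D.b 5 * D.y 1
  z25 : D.rD 4 5 = -(D.c 5 * D.y 2) - (D.a 5 + D.d 5 - D.v 2) * D.z 2 + D.y 2 * D.z 0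
    + D.b 5 * D.z 1
  y26 : D.rB 4 6 = -((2 * D.a 6) * D.y 2) - D.b 6 * D.z 2 + D.z 2 * D.y 0
    - (D.v 2 - D.b 6) * D.y 1
  z26 : D.rD 4 6 = -(D.c 6 * D.y 2) - (D.a 6 + D.d 6) * D.z 2 + D.z 2 * D.z 0
    - (D.v 2 - D.b 6) * D.z 1
  a56 : D.b 5 * D.c 6 - D.b 6 * D.c 5 = (D.a 6 - D.c 5) * D.a 5 + (D.b 6 - D.d 5) * D.a 6
  b56 : D.a 5 * D.b 6 + D.b 5 * D.d 6 - D.a 6 * D.b 5 - D.b 6 * D.d 5 =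
    (D.a 6 - D.c 5) * D.b 5 + (D.b 6 - D.d 5) * D.b 6
  c56 : D.c 5 * D.a 6 + D.d 5 * D.c 6 - D.c 6 * D.a 5 - D.d 6 * D.c 5 =
    (D.a 6 - D.c 5) * D.c 5 + (D.b 6 - D.d 5) * D.c 6
  d56 : D.c 5 * D.b 6 - D.c 6 * D.b 5 = (D.a 6 - D.c 5) * D.d 5 + (D.b 6 - D.d 5) * D.d 6
  a45 : D.rA 4 5 = D.b 4 * D.c 5 - D.b 5 * D.c 4 - D.d 5 * D.a 4 + D.b 4 * D.a 6
  b45 : D.rB 4 5 = 2 * D.a 4 * D.b 5 - 2 * D.a 5 * D.b 4 - D.b 5 * D.d 4 + D.b 4 * D.b 6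
  c45 : D.rC 4 5 = D.d 4 * D.c 5 - 2 * D.d 5 * D.c 4 + D.b 4 * D.c 6
  d45 : D.rD 4 5 = D.c 4 * D.b 5 - D.c 5 * D.b 4 - (D.a 5 + D.d 5) * D.d 4 + D.a 4 * D.d 5
    + D.b 4 * D.d 6
  a46 : D.rA 4 6 = D.b 4 * D.c 6 - D.b 6 * D.c 4 - (D.a 6 + D.d 6) * D.a 4 + D.c 4 * D.a 5
    + D.d 4 * D.a 6
  b46 : D.rB 4 6 = D.a 4 * D.b 6 - 2 * D.a 6 * D.b 4 - D.b 6 * D.d 4 + D.c 4 * D.b 5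
    + D.d 4 * D.b 6
  c46 : D.rC 4 6 = 2 * D.d 4 * D.c 6 - D.c 6 * D.a 4 - 2 * D.d 6 * D.c 4 + D.c 4 * D.c 5
  d46 : D.rD 4 6 = D.c 4 * D.b 6 - D.c 6 * D.b 4 - (D.a 6 + D.d 6) * D.d 4 + D.c 4 * D.d 5
    + D.d 4 * D.d 6
  symA : D.rA 4 6 = D.rC 4 5
  symB : D.rB 4 6 = D.rD 4 5
  flat16 : D.rC 1 6 = 0
  flat26 : D.rC 2 6 = 0
  flat25 : D.rC 2 5 = 0 ∧ D.rA 2 5 = 0 ∧ D.rB 2 5 = 0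

variable {D : ConnData}

-- Each equation is one curvature identity with the `fc` formulas inserted and the zero components
-- dropped. The components on (4, 5) and (4, 6) stay as unknowns, since each has two expressions:
-- its definition, and the y-part on a pair of {1, 2} with {5, 6}.
set_option maxHeartbeats 2000000 in
theorem FlatK.eqs (F : D.FlatK) (h : D.IsLie) (hw : ∀ i, D.w i = 0) : D.KEqs := by
  obtain ⟨⟨a0, a1, a2, a3⟩, ⟨b0, b1, b2, b3⟩, ⟨c0, c1, c2, c3⟩, ⟨d0, d1, d2, d3⟩, v0⟩ := F
  obtain ⟨-, -, -, -, -, Y13, Z13⟩ := h.flat13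
  obtain ⟨-, -, -, -, -, Y23, Z23⟩ := h.flat23
  obtain ⟨-, -, -, -, -, Y05, Z05⟩ := h.flat05
  obtain ⟨-, -, -, -, -, Y06, Z06⟩ := h.flat06
  obtain ⟨-, -, -, -, V35, Y35, Z35⟩ := h.flat35
  obtain ⟨-, -, -, -, V36, Y36, Z36⟩ := h.flat36
  obtain ⟨-, -, -, -, V14, Y14, -⟩ := h.flat14
  obtain ⟨-, -, -, -, V24, -, Z24⟩ := h.flat24
  obtain ⟨A04, B04, C04, D04, V04, Y04, Z04⟩ := h.curv04
  obtain ⟨A34, B34, C34, D34, V34, Y34, Z34⟩ := h.curv34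
  obtain ⟨V15, -, Y15, Z15⟩ := h.curv15
  obtain ⟨V16, -, Y16, Z16⟩ := h.curv16
  obtain ⟨V25, -, Y25, Z25⟩ := h.curv25
  obtain ⟨V26, -, Y26, Z26⟩ := h.curv26
  obtain ⟨q0, q1, q2, q3, -⟩ := h.curv56
  have A45 := rA.eq_1 D 4 5
  have B45 := rB.eq_1 D 4 5
  have C45 := rC.eq_1 D 4 5
  have D45 := rD.eq_1 D 4 5
  have A46 := rA.eq_1 D 4 6
  have B46 := rB.eq_1 D 4 6
  have C46 := rC.eq_1 D 4 6
  have D46 := rD.eq_1 D 4 6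
  have C16 := rC.eq_1 D 1 6
  have C26 := rC.eq_1 D 2 6
  have C25 := rC.eq_1 D 2 5
  have A25 := rA.eq_1 D 2 5
  have B25 := rB.eq_1 D 2 5
  have T45 : D.rT 4 5 = D.rA 4 5 + D.rD 4 5 := rfl
  have T46 : D.rT 4 6 = D.rA 4 6 + D.rD 4 6 := rfl
  rw [← T45] at Y04
  rw [← T46] at Z04
  rw [rV] at V14 V24 V34 V15 V16 V25 V26 V35 V36
  rw [rY] at Y13 Y23 Y05 Y06 Y35 Y36 Y14 Y04 Y34 Y15 Y16 Y25 Y26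
  rw [rZ] at Z13 Z23 Z05 Z06 Z35 Z36 Z24 Z04 Z34 Z15 Z16 Z25 Z26
  rw [rA] at q0
  rw [rB] at q1
  rw [rC] at q2
  rw [rD] at q3
  simp only [fc45, fc46, fc13, fc23, fc05, fc06, fc35, fc36, fc14, fc24, fc04, fc34, fc15, fc16,
    fc25, fc26, fc56, hw, a0, b0, c0, d0, v0, a1, b1, c1, d1, a2, b2, c2, d2, a3, b3, c3, d3,
    mul_zero, zero_mul, add_zero, zero_add, sub_zero, zero_sub, neg_zero, sub_self]
    at Y13 Z13 Y23 Z23 Y05 Z05 Y06 Z06 V35 Y35 Z35 V36 Y36 Z36 V14 V24 Y14 Z24 V34 V15 V16 V25 V26 Y04 Y34 Y15 Y16 Y25 Y26 Z04 Z34 Z15 Z16 Z25 Z26 q0 q1 q2 q3 A45 B45 C45 D45 A46 B46 C46 D46 C16 C26 C25 A25 B25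
  have s2 : √2 ≠ 0 := by positivity
  constructor
  · apply mul_left_cancel₀ s2; linear_combination -Y13
  · apply mul_left_cancel₀ s2; linear_combination -Z13
  · apply mul_left_cancel₀ s2; linear_combination -Y23
  · apply mul_left_cancel₀ s2; linear_combination -Z23
  · linear_combination Y05
  · linear_combination Z05
  · linear_combination Y06
  · linear_combination Z06
  · linear_combination -V35
  · linear_combination -Y35
  · linear_combination -Z35
  · linear_combination -V36
  · linear_combination -Y36
  · linear_combination -Z36
  · linear_combination -Y14
  · linear_combination -Z24
  · linear_combination -V14
  · linear_combination -V24
  · linear_combination -V34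
  · linear_combination -V15
  · linear_combination -V16
  · linear_combination -V25
  · linear_combination -V26
  · linear_combination -Y04
  · linear_combination -Z04
  · linear_combination -Y34
  · linear_combination -Z34
  · linear_combination -Y15
  · linear_combination -Z15
  · linear_combination -Y16
  · linear_combination -Z16
  · linear_combination -Y25
  · linear_combination -Z25
  · linear_combination -Y26
  · linear_combination -Z26
  · linear_combination q0
  · linear_combination q1
  · linear_combination q2
  · linear_combination q3
  · linear_combination A45
  · linear_combination B45
  · linear_combination C45
  · linear_combination D45
  · linear_combination A46
  · linear_combination B46
  · linear_combination C46
  · linear_combination D46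
  · exact h.curv_sym.1
  · exact h.curv_sym.2
  · exact C16
  · exact C26
  · exact ⟨C25, A25, B25⟩

end ConnData

end G2StarHolonomy

/-! ### Inconsistency of the polynomial system -/

namespace G2StarHolonomy

namespace ConnData

variable {D : ConnData}

theorem FlatK.eigen_iff (F : D.FlatK) {p q : ℝ} (h4 : Eigen (D.matE 4) p q)
    (h5 : Eigen (D.matE 5) p q) (h6 : Eigen (D.matE 6) p q) (i : Fin 7) :
    Eigen (D.matE i) p q := by
  obtain ⟨⟨a0, a1, a2, a3⟩, ⟨b0, b1, b2, b3⟩, ⟨c0, c1, c2, c3⟩, ⟨d0, d1, d2, d3⟩, v0⟩ := F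
  fin_cases i <;> first | assumption | simp [Eigen, matE, *]

/-- The case of v ≠ 0 on E, in a basis with v 1 = 0. The v-equations make the matrices in the
directions 5 and 6 upper triangular, so c 4 ≠ 0 by `no_eigenvector`. -/
theorem Model.false_of_v_plane_ne_zero (M : D.Model) (F : D.FlatK) (hT : ∀ i j, D.rT i j = 0)
    (hV : ¬(D.rV 4 5 = 0 ∧ D.rV 4 6 = 0)) (h1 : D.v 1 = 0) (h2 : D.v 2 ≠ 0) : False := by
  have K := F.eqs M.isLie M.w_eq
  have y0 : D.y 0 = 0 := by simpa [h2] using K.vy2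
  have z0 : D.z 0 = 0 := by simpa [h2] using K.vz2
  have c5 : D.c 5 = 0 := by
    apply mul_right_cancel₀ h2; linear_combination -K.v15 + (D.d 5 - D.v 2) * h1
  have c6 : D.c 6 = 0 := by
    apply mul_right_cancel₀ h2; linear_combination -K.v16 + (D.d 6 + D.v 1) * h1
  have a5 : D.a 5 = D.v 2 := by
    apply mul_right_cancel₀ h2; linear_combination K.v25 + D.b 5 * h1
  have a6 : D.a 6 = 0 := by
    apply mul_right_cancel₀ h2; linear_combination K.v26 + (D.b 6 - D.v 2) * h1
  have c4 : D.c 4 ≠ 0 := by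
    intro c4
    refine M.no_eigenvector hT (p := 1) (q := 0) (by simp) (F.eigen_iff ?_ ?_ ?_) <;>
      simp [Eigen, matE, *]
  have e1 := K.b56
  have A46 := K.a46
  have D46 := K.d46
  have C45 := K.c45
  have sA := K.symA
  have t46 : D.rA 4 6 + D.rD 4 6 = 0 := hT 4 6
  -- If v 3 = 0, then y 3 ≠ 0 fixes d 5 and d 6, `symA` gives b 6 = -3 v 2, and `b56` becomes (v 2)²
  -- = 0. If v 3 ≠ 0, then d 5 = d 6 = 0 and the trace on (4, 6) equals c 4 · v 2.
  by_cases v3 : D.v 3 = 0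
  · have z3 : D.z 3 = 0 := by
      have := K.v34
      simpa [v3, h1, h2] using this
    have y3 : D.y 3 ≠ 0 := by
      intro y3
      have s2 : √2 ≠ 0 := by positivity
      refine hV ⟨?_, ?_⟩
      · simpa [v3, y3, z3, y0, z0] using K.y34
      · simpa [v3, y3, z3, y0, z0] using K.z34
    have d5 : D.d 5 = -2 * D.v 2 := by
      have := K.y35
      rw [z3, v3, y0, a5] at this
      apply mul_right_cancel₀ y3; linear_combination this
    have d6 : D.d 6 = 0 := by simpa [z3, v3, y0, a6, y3] using K.y36
    rw [A46, C45] at sA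
    simp only [a5, a6, d5, d6, c5, c6] at sA e1
    have b6 : D.b 6 = -3 * D.v 2 := by
      apply mul_right_cancel₀ c4; linear_combination -sA
    rw [b6] at e1
    have : D.v 2 * D.v 2 = 0 := by linear_combination (-1/12) * e1
    simp [h2] at this
  · have d5 : D.d 5 = 0 := by
      have := K.v35
      rw [a5] at this
      apply mul_left_cancel₀ v3; linear_combination this
    have d6 : D.d 6 = 0 := by simpa [a6, h1, v3] using K.v36
    rw [A46, C45] at sA
    rw [A46, D46] at t46
    simp only [a5, a6, d5, d6, c5, c6] at sA t46
    have : D.c 4 * D.v 2 = 0 := by linear_combination t46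
    simp [h2, c4] at this

/-- Here (1, 0) is an eigenvector in the directions 5 and 6 by `y05` to `z06`, so c 4 ≠ 0. Two
expressions for `rC` give d 5 = d 6 = 0, and the trace on (4, 6) becomes c 4 · y 0. -/
theorem Model.false_of_y_ne_zero (M : D.Model) (F : D.FlatK) (hT : ∀ i j, D.rT i j = 0)
    (z0 : D.z 0 = 0) (y0 : D.y 0 ≠ 0) : False := by
  have K := F.eqs M.isLie M.w_eq
  have v1 : D.v 1 = 0 := by simpa [y0] using K.vy1
  have v2 : D.v 2 = 0 := by simpa [y0] using K.vy2
  have a5 : D.a 5 = D.y 0 := by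
    apply mul_right_cancel₀ y0; linear_combination -K.y05 - D.b 5 * z0
  have c5 : D.c 5 = 0 := by
    apply mul_right_cancel₀ y0; linear_combination -K.z05 + (D.y 0 - D.d 5) * z0
  have a6 : D.a 6 = 0 := by
    apply mul_right_cancel₀ y0; linear_combination -K.y06 + (D.y 0 - D.b 6) * z0
  have c6 : D.c 6 = 0 := by
    apply mul_right_cancel₀ y0; linear_combination -K.z06 + (D.z 0 - D.d 6) * z0
  have c4 : D.c 4 ≠ 0 := by
    intro c4
    refine M.no_eigenvector hT (p := 1) (q := 0) (by simp) (F.eigen_iff ?_ ?_ ?_) <;>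
      simp [Eigen, matE, *]
  have z1 : D.z 1 = -D.c 4 := by
    have := K.z04
    rw [hT, z0] at this
    apply mul_right_cancel₀ y0; linear_combination this
  have C45 := K.c45
  have C46 := K.c46
  have A46 := K.a46
  have D46 := K.d46
  have D45 := K.d45
  have A45 := K.a45
  have t46 : D.rA 4 6 + D.rD 4 6 = 0 := hT 4 6
  have t45 : D.rA 4 5 + D.rD 4 5 = 0 := hT 4 5
  have d6 : D.d 6 = 0 := by
    have := K.z16
    rw [C46, c6, c5, v1, z1, z0] at this
    apply mul_right_cancel₀ c4; linear_combination -1/4 * this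
  have d5 : D.d 5 = 0 := by
    have := K.z15
    rw [C45, c6, c5, v1, z1, z0] at this
    apply mul_right_cancel₀ c4; linear_combination -1/4 * this
  have := K.symA
  rw [A46, C45] at this
  rw [A46, D46] at t46
  rw [A45, D45] at t45
  simp only [c5, c6, d5, d6, a5, a6, mul_zero, zero_mul, add_zero, zero_add, sub_zero, zero_sub]
    at this t46 t45
  have d4 : D.d 4 = 0 := by
    apply mul_left_cancel₀ y0; linear_combination -t45
  have : D.c 4 * D.y 0 = 0 := by linear_combination t46
  simp [c4, y0] at this

/-- Only (y 3, z 3) is left to carry the v-form, in a basis with z 3 = 0. For a 6 = 0 the curvature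
vanishes on E; for a 6 ≠ 0 the vector (a 5, a 6) is a common eigenvector of the connection. -/
theorem Model.false_of_v_eq_zero (M : D.Model) (F : D.FlatK) (hT : ∀ i j, D.rT i j = 0)
    (v1 : D.v 1 = 0) (v2 : D.v 2 = 0) (y0 : D.y 0 = 0) (z0 : D.z 0 = 0) (v3 : D.v 3 = 0)
    (z3 : D.z 3 = 0) (y3 : D.y 3 ≠ 0) : False := by
  have K := F.eqs M.isLie M.w_eq
  have d5 : D.d 5 = -2 * D.a 5 := by
    have := K.y35
    rw [z3, v3, y0] at this
    apply mul_right_cancel₀ y3; linear_combination this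
  have d6 : D.d 6 = -2 * D.a 6 := by
    have := K.y36
    rw [z3, v3, y0] at this
    apply mul_right_cancel₀ y3; linear_combination this
  have c5 : D.c 5 = 0 := by simpa [z3, v3, z0, y3] using K.z35
  have c6 : D.c 6 = 0 := by simpa [z3, v3, z0, y3] using K.z36
  have c4 : D.c 4 ≠ 0 := by
    intro c4
    refine M.no_eigenvector hT (p := 1) (q := 0) (by simp) (F.eigen_iff ?_ ?_ ?_) <;>
      simp [Eigen, matE, *]
  have A46 := K.a46
  have B46 := K.b46
  have C46 := K.c46
  have D46 := K.d46
  have A45 := K.a45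
  have B45 := K.b45
  have C45 := K.c45
  have D45 := K.d45
  have sA := K.symA
  have sB := K.symB
  have t46 : D.rA 4 6 + D.rD 4 6 = 0 := hT 4 6
  have t45 : D.rA 4 5 + D.rD 4 5 = 0 := hT 4 5
  have e0 := K.a56
  have e1 := K.b56
  by_cases a6 : D.a 6 = 0
  · have h1 : D.b 6 = -3 * D.a 5 := by
      rw [A46, C45] at sA
      simp only [c5, c6, d5, d6, a6] at sA
      apply mul_right_cancel₀ c4; linear_combination -sA
    have a5 : D.a 5 = 0 := by
      rw [h1, d5, d6, a6, c5] at e1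
      have : D.a 5 * D.a 5 = 0 := by linear_combination (-1/12) * e1
      simpa using this
    rw [a5, mul_zero] at h1 d5
    rw [a6, mul_zero] at d6
    have e26 := K.y26
    simp only [h1, d5, d6, a5, a6, c5, c6, z0, y0, v1, v2, mul_zero, zero_mul, add_zero, zero_add,
      sub_zero, zero_sub, neg_zero] at e26 A46 B46 C46 D46 A45 B45 C45 D45
    have b5 : D.b 5 = 0 := by
      rw [B46] at e26
      simpa [c4] using e26
    rw [b5] at A45 B45 D45
    obtain ⟨f1, f2, f3⟩ := K.flat25
    exact M.not_flat (by simpa using A45) (by simpa using B45) C45 (by simpa using D45) C46 D46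
      K.flat16 K.flat26 f1 f2 f3
  · have h1 : D.b 6 = -3 * D.a 5 := by
      rw [d5, c5] at e0
      apply mul_left_cancel₀ a6; linear_combination -e0 + D.b 5 * c6
    have h2 : D.a 6 * D.b 5 = -3 * D.a 5 ^ 2 := by
      rw [h1, d5, d6, c5] at e1
      linear_combination (-1/4) * e1
    have z1 : D.z 1 = D.c 4 := by
      have := K.z16
      rw [C46, d6, c6, c5, v1, z0] at this
      apply mul_left_cancel₀ a6; linear_combination (-1/4) * this
    rw [A46, C45] at sA
    rw [A46, D46] at t46
    rw [A45, D45] at t45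
    simp only [c5, c6, d5, d6, h1] at sA t46 t45
    have h3 : D.d 4 * D.a 6 = -D.a 5 * D.c 4 := by linear_combination sA - t46
    have h4 : D.b 4 * D.a 6 = D.a 5 * D.d 4 := by linear_combination -t45
    have h5 : D.a 4 * D.a 6 = D.a 5 * D.c 4 := by linear_combination sA - h3
    refine M.no_eigenvector hT (p := D.a 5) (q := D.a 6) (by simp [a6]) (F.eigen_iff ?_ ?_ ?_)
    · simp only [Eigen, matE, Matrix.of_apply, Matrix.cons_val', Matrix.cons_val_zero, Matrix.cons_val_one, Matrix.cons_val_fin_one]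
      linear_combination -D.a 6 * h4 - D.a 5 * h5
    · simp only [Eigen, matE, Matrix.of_apply, Matrix.cons_val', Matrix.cons_val_zero, Matrix.cons_val_one, Matrix.cons_val_fin_one]
      rw [c5, d5]
      linear_combination -D.a 6 * h2
    · simp only [Eigen, matE, Matrix.of_apply, Matrix.cons_val', Matrix.cons_val_zero, Matrix.cons_val_one, Matrix.cons_val_fin_one]
      rw [c6, d6, h1]
      ring

/-- v 3 ≠ 0 makes the matrices in the directions 5 and 6 traceless; c 5 = c 6 = 0 is arranged by the
common eigenvector of `KEqs.exists_eigenvector`. The ending is the same alternative on a 6 as in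
`false_of_v_eq_zero`. -/
theorem Model.false_of_v_ne_zero (M : D.Model) (F : D.FlatK) (hT : ∀ i j, D.rT i j = 0)
    (v1 : D.v 1 = 0) (v2 : D.v 2 = 0) (y0 : D.y 0 = 0) (z0 : D.z 0 = 0) (v3 : D.v 3 ≠ 0)
    (c5 : D.c 5 = 0) (c6 : D.c 6 = 0) : False := by
  have K := F.eqs M.isLie M.w_eq
  have d5 : D.d 5 = -D.a 5 := by
    have := K.v35
    rw [v2] at this
    apply mul_left_cancel₀ v3; linear_combination this
  have d6 : D.d 6 = -D.a 6 := by
    have := K.v36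
    rw [v1] at this
    apply mul_left_cancel₀ v3; linear_combination this
  have c4 : D.c 4 ≠ 0 := by
    intro c4
    refine M.no_eigenvector hT (p := 1) (q := 0) (by simp) (F.eigen_iff ?_ ?_ ?_) <;>
      simp [Eigen, matE, *]
  have A46 := K.a46
  have B46 := K.b46
  have C46 := K.c46
  have D46 := K.d46
  have A45 := K.a45
  have B45 := K.b45
  have C45 := K.c45
  have D45 := K.d45
  have sA := K.symA
  have sB := K.symB
  have t46 : D.rA 4 6 + D.rD 4 6 = 0 := hT 4 6
  have t45 : D.rA 4 5 + D.rD 4 5 = 0 := hT 4 5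
  have e0 := K.a56
  have e1 := K.b56
  have Z15 := K.z15
  by_cases a6 : D.a 6 = 0
  · rw [a6, neg_zero] at d6
    have z1 : D.z 1 = 0 := by simpa [c6, a6, d6, z0, v3] using K.z36
    have a5 : D.a 5 = 0 := by
      rw [C45, d5, c5, c6, v1, z1, z0] at Z15
      apply mul_right_cancel₀ c4; linear_combination (1/2) * Z15
    rw [a5, neg_zero] at d5
    have b6 : D.b 6 = 0 := by
      rw [a5, a6, d5, d6, c5] at e1
      simpa using e1
    have z2 : D.z 2 = 0 := by simpa [c5, a5, d5, z0, v3] using K.z35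
    have y1 : D.y 1 = 0 := by simpa [c6, a6, d6, y0, v3, b6] using K.y36
    have e26 := K.y26
    simp only [b6, d5, d6, a5, a6, c5, c6, z0, y0, v1, v2, y1, z2, mul_zero, zero_mul, add_zero, zero_add,
      sub_zero, zero_sub, neg_zero] at e26 A46 B46 C46 D46 A45 B45 C45 D45
    have b5 : D.b 5 = 0 := by
      rw [B46] at e26
      simpa [c4] using e26
    rw [b5] at A45 B45 D45
    obtain ⟨f1, f2, f3⟩ := K.flat25
    exact M.not_flat (by simpa using A45) (by simpa using B45) C45 (by simpa using D45) C46 D46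
      K.flat16 K.flat26 f1 f2 f3
  · have h1 : D.b 6 = -2 * D.a 5 := by
      rw [d5, c5] at e0
      apply mul_left_cancel₀ a6; linear_combination -e0 + D.b 5 * c6
    have h2 : D.a 6 * D.b 5 = -2 * D.a 5 ^ 2 := by
      rw [h1, d5, d6, c5] at e1
      linear_combination (-1/3) * e1
    rw [A46, C45] at sA
    rw [B46, D45] at sB
    simp only [c5, c6, d5, d6, h1] at sA sB
    have h3 : D.d 4 * D.a 6 = -D.a 5 * D.c 4 := by linear_combination sA
    have h4 : D.a 5 * D.a 4 + D.a 6 * D.b 4 = 0 := by linear_combination -sB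
    refine M.no_eigenvector hT (p := D.a 5) (q := D.a 6) (by simp [a6]) (F.eigen_iff ?_ ?_ ?_)
    · simp only [Eigen, matE, Matrix.of_apply, Matrix.cons_val', Matrix.cons_val_zero, Matrix.cons_val_one, Matrix.cons_val_fin_one]
      linear_combination D.a 5 * h3 - D.a 6 * h4
    · simp only [Eigen, matE, Matrix.of_apply, Matrix.cons_val', Matrix.cons_val_zero, Matrix.cons_val_one, Matrix.cons_val_fin_one]
      rw [c5, d5]
      linear_combination -D.a 6 * h2
    · simp only [Eigen, matE, Matrix.of_apply, Matrix.cons_val', Matrix.cons_val_zero, Matrix.cons_val_one, Matrix.cons_val_fin_one]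
      rw [c6, d6, h1]
      ring

/-- Two traceless matrices that satisfy the flatness equations have a common eigenvector. -/
theorem KEqs.exists_eigenvector (K : D.KEqs) (h5 : D.d 5 = -D.a 5) (h6 : D.d 6 = -D.a 6) :
    ∃ p q : ℝ, (p, q) ≠ (0, 0) ∧ Eigen (D.matE 5) p q ∧ Eigen (D.matE 6) p q := by
  have e0 := K.a56
  have e1 := K.b56
  have e2 := K.c56
  simp only [Eigen, matE, Matrix.of_apply, Matrix.cons_val', Matrix.cons_val_zero,
    Matrix.cons_val_one, Matrix.cons_val_fin_one, h5, h6] at *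
  generalize D.a 5 = a at *
  generalize D.b 5 = b at *
  generalize D.c 5 = c at *
  generalize D.a 6 = a' at *
  generalize D.b 6 = b' at *
  generalize D.c 6 = c' at *
  clear K h5 h6
  -- Up to sign this is the determinant of the commutator of the two matrices. By the flatness
  -- equations the commutator lies in their span, to which it is orthogonal for the trace form, so
  -- it is nilpotent.
  have hdet : (b * c' - b' * c) ^ 2 + 4 * (a * b' - b * a') * (c * a' - a * c') = 0 := by
    linear_combination (b * c' - b' * c) * e0 + (a * b' - b * a') * e2 + (c * a' - a * c') * e1
  -- A kernel vector of a nonzero commutator is the common eigenvector; if the matrices commute,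
  -- `e0` and `e1` provide one.
  by_cases n2 : a * b' - b * a' = 0
  · have n1 : b * c' - b' * c = 0 := by
      rw [n2] at hdet
      simpa using hdet
    by_cases n3 : c * a' - a * c' = 0
    · by_cases ha : (a, a') = (0, 0)
      · obtain ⟨rfl, rfl⟩ : a = 0 ∧ a' = 0 := by simpa using ha
        by_cases hb : (b, b') = (0, 0)
        · obtain ⟨rfl, rfl⟩ : b = 0 ∧ b' = 0 := by simpa using hb
          exact ⟨0, 1, by simp, by ring, by ring⟩
        · refine ⟨b, b', hb, ?_, ?_⟩
          · linear_combination b * e1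
          · linear_combination b' * e1 + b * n1
      · refine ⟨a, a', ha, ?_, ?_⟩
        · linear_combination -a * n1 + a * e0 + a' * n2
        · linear_combination -a' * n1 + a' * e0 - a * n3
    · refine ⟨0, 1, by simp, ?_, ?_⟩
      · apply mul_right_cancel₀ n3; linear_combination c * n2 + a * n1
      · apply mul_right_cancel₀ n3; linear_combination c' * n2 + a' * n1
  · refine ⟨2 * (a * b' - b * a'), -(b * c' - b' * c), by simp [n2], ?_, ?_⟩
    · linear_combination -b * hdet
    · linear_combination -b' * hdet

/-- Here (1, 0) has eigenvalue 1 in the direction 5 and 0 in the direction 6. A distinction on c 4 =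
0 and z 1 = c 4 makes the remaining equations nearly linear, and every branch is inconsistent. -/
theorem Model.false_of_rT_ne_zero (M : D.Model) (F : D.FlatK)
    (hT : ¬(D.rT 4 5 = 0 ∧ D.rT 4 6 = 0)) (y0 : D.y 0 = 1) (z0 : D.z 0 = 0) : False := by
  have K := F.eqs M.isLie M.w_eq
  have v1 : D.v 1 = 0 := by simpa [y0] using K.vy1
  have v2 : D.v 2 = 0 := by simpa [y0] using K.vy2
  have a5 : D.a 5 = 1 := by simpa [y0, z0] using K.y05.symm
  have c5 : D.c 5 = 0 := by simpa [y0, z0] using K.z05.symm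
  have a6 : D.a 6 = 0 := by simpa [y0, z0] using K.y06.symm
  have c6 : D.c 6 = 0 := by simpa [y0, z0] using K.z06.symm
  have A46 := K.a46
  have B46 := K.b46
  have C46 := K.c46
  have D46 := K.d46
  have A45 := K.a45
  have B45 := K.b45
  have C45 := K.c45
  have D45 := K.d45
  have sA := K.symA
  have sB := K.symB
  have T46 : D.rT 4 6 = D.rA 4 6 + D.rD 4 6 := rfl
  have T45 : D.rT 4 5 = D.rA 4 5 + D.rD 4 5 := rfl
  have e1 := K.b56
  have e3 := K.d56
  have Y04 := K.y04
  have Z04 := K.z04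
  have Y15 := K.y15
  have Z15 := K.z15
  have Z16 := K.z16
  have Y16 := K.y16
  have Y25 := K.y25
  have Z25 := K.z25
  have Z26 := K.z26
  have Y14 := K.y14
  have Z24 := K.z24
  clear K F M
  simp only [v1, v2, y0, z0, a5, c5, a6, c6, mul_zero, zero_mul, add_zero, zero_add, sub_zero,
    zero_sub, mul_one, one_mul, neg_zero] at *
  generalize D.a 4 = a at *
  generalize D.b 4 = b at *
  generalize D.c 4 = c at *
  generalize D.d 4 = d at *
  generalize D.b 5 = b5 at *
  generalize D.d 5 = d5 at *
  generalize D.b 6 = b6 at *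
  generalize D.d 6 = d6 at *
  generalize D.y 1 = y1 at *
  generalize D.z 1 = z1 at *
  generalize D.y 2 = y2 at *
  generalize D.z 2 = z2 at *
  -- Comparison of the two expressions for `rC` on (4, 6) and, below, on (4, 5).
  have k6 : d6 * (z1 - c) = 0 := by linarith
  have k5 : d5 * (z1 - c) = 0 := by linarith
  by_cases hc : c = 0
  · subst hc
    have hz : z1 = d6 * a := by linarith
    have h6 : d6 * a = 0 := by
      have : (d6 * a) ^ 2 = 0 := by rw [hz] at k6; linear_combination a * k6
      simpa using this
    rw [h6] at hz
    subst hz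
    have hT45 : D.rT 4 5 ≠ 0 := fun h0 => hT ⟨h0, by linarith⟩
    have hy : y1 * (a + d + y1) = 0 := by linear_combination Y14
    have hz : z2 * (a + d + z2) = 0 := by linear_combination Z24
    have h5 : d5 * (y1 - a) = 0 := by linarith
    by_cases h50 : d5 = 0
    · subst h50
      have hz2 : z2 ≠ 0 := by rintro rfl; apply hT45; linarith
      have hz' : z2 = -(a + d) := by linarith [(mul_eq_zero.1 hz).resolve_left hz2]
      have e : a + y1 = z2 := by linarith
      rcases mul_eq_zero.1 hy with h1 | h1
      · have ha : a ≠ 0 := by rintro rfl; apply hz2; linarith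
        have : d6 = 0 := by simpa [ha] using h6
        subst this
        apply hz2; linarith
      · have ha : a = 0 := by linarith
        subst ha
        apply hz2; linarith
    · have hy1 : y1 = a := by
        have := (mul_eq_zero.1 h5).resolve_left h50; linarith
      subst hy1
      have ha : y1 ≠ 0 := by rintro rfl; apply hT45; linarith
      have : d6 = 0 := by simpa [ha] using h6
      subst this
      have hd : d = -2 * y1 := by linarith [(mul_eq_zero.1 hy).resolve_left ha]
      subst hd
      rcases mul_eq_zero.1 hz with h1 | h1
      · subst h1
        have : d5 = 2 := by apply mul_right_cancel₀ ha; linarith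
        subst this
        apply ha; linarith
      · have : z2 = y1 := by linarith
        subst this
        have : d5 = 1 / 2 := by apply mul_right_cancel₀ ha; linarith
        subst this
        apply ha; linarith
  · by_cases hz : z1 = c
    · subst hz
      have h1 : d6 * a = z1 * (3 + d5) := by linarith
      have h2 : b6 = d5 - 2 := by apply mul_right_cancel₀ hc; linarith
      subst h2
      have : d6 = 0 := by linarith
      subst this
      have : d5 = -3 := by apply mul_right_cancel₀ hc; linarith
      subst this
      linarith
    · have hz' : z1 - c ≠ 0 := sub_ne_zero.2 hz
      obtain rfl : d6 = 0 := by simpa [hz'] using k6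
      obtain rfl : d5 = 0 := by simpa [hz'] using k5
      have h1 : b6 = 1 := by apply mul_right_cancel₀ hc; linarith
      subst h1
      apply hc; linarith

end ConnData

end G2StarHolonomy

/-! ### Support of the closed two-forms and their normalization -/

namespace G2StarHolonomy

namespace ConnData

variable {D : ConnData}

/-- A two-form on `ℝ⁷`, in components, that only pairs the fifth basis vector with the sixth and
the seventh one. -/
structure IsSupported (ρ : Fin 7 → Fin 7 → ℝ) : Prop where
  swap : ∀ i j, ρ j i = -ρ i j
  low : ∀ i j, i ≤ 3 → ρ i j = 0
  high : ρ 5 6 = 0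

theorem IsSupported.eq_zero {ρ : Fin 7 → Fin 7 → ℝ} (h : IsSupported ρ) (h45 : ρ 4 5 = 0)
    (h46 : ρ 4 6 = 0) (i j : Fin 7) : ρ i j = 0 := by
  have self : ∀ i, ρ i i = 0 := fun i => by linarith [h.swap i i]
  have low' : ∀ i j, j ≤ 3 → ρ i j = 0 := fun i j hj => by rw [h.swap j i, h.low j i hj, neg_zero]
  by_cases hi : i ≤ 3
  · exact h.low i j hi
  by_cases hj : j ≤ 3
  · exact low' i j hj
  have h54 : ρ 5 4 = 0 := by rw [h.swap 4 5, h45, neg_zero]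
  have h64 : ρ 6 4 = 0 := by rw [h.swap 4 6, h46, neg_zero]
  have h65 : ρ 6 5 = 0 := by rw [h.swap 5 6, h.high, neg_zero]
  have h56 := h.high
  fin_cases i <;> first
    | (exfalso; revert hi; decide)
    | (fin_cases j <;> first
        | (exfalso; revert hj; decide)
        | assumption
        | exact self _)

theorem rV_swap (i j : Fin 7) : D.rV j i = -D.rV i j := by
  simp only [rV, fc_swap _ i j]; ring

theorem rT_swap (i j : Fin 7) : D.rT j i = -D.rT i j := by
  simp only [rT_eq, fc_swap _ i j]

theorem IsLie.rV_supported (h : D.IsLie) : IsSupported D.rV where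
  swap i j := rV_swap i j
  high := h.curv56.2.2.2.2
  low i j hi := by
    have self : ∀ i, D.rV i i = 0 := fun i => by simp [rV, fc_self]
    fin_cases i <;> first
    | (exfalso; revert hi; decide)
    | (fin_cases j <;> first
      | exact self _
      | exact h.flat01.2.2.2.2.1
      | exact h.flat02.2.2.2.2.1
      | exact h.flat03.2.2.2.2.1
      | exact h.flat05.2.2.2.2.1
      | exact h.flat06.2.2.2.2.1
      | exact h.flat12.2.2.2.2.1
      | exact h.flat13.2.2.2.2.1
      | exact h.flat23.2.2.2.2.1
      | exact h.flat14.2.2.2.2.1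
      | exact h.flat24.2.2.2.2.1
      | exact h.flat35.2.2.2.2.1
      | exact h.flat36.2.2.2.2.1
      | exact h.curv04.2.2.2.2.1
      | exact h.curv34.2.2.2.2.1
      | exact h.curv15.1
      | exact h.curv16.1
      | exact h.curv25.1
      | exact h.curv26.1
      | exact h.flat01.swap.2.2.2.2.1
      | exact h.flat02.swap.2.2.2.2.1
      | exact h.flat03.swap.2.2.2.2.1
      | exact h.flat12.swap.2.2.2.2.1
      | exact h.flat13.swap.2.2.2.2.1
      | exact h.flat23.swap.2.2.2.2.1)

theorem Flat.rT_eq_zero {i j : Fin 7} (h : D.Flat i j) : D.rT i j = 0 := by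
  rw [rT, h.1, h.2.2.2.1, add_zero]

theorem IsLie.rT_supported (h : D.IsLie) : IsSupported D.rT where
  swap i j := rT_swap i j
  high := by rw [rT, h.curv56.1, h.curv56.2.2.2.1, add_zero]
  low i j hi := by
    have self : ∀ i, D.rT i i = 0 := fun i => by rw [rT_eq, fc_self, neg_zero]
    fin_cases i <;> first
    | (exfalso; revert hi; decide)
    | (fin_cases j <;> first
      | exact self _
      | exact h.flat01.rT_eq_zero
      | exact h.flat02.rT_eq_zero
      | exact h.flat03.rT_eq_zero
      | exact h.flat05.rT_eq_zero
      | exact h.flat06.rT_eq_zero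
      | exact h.flat12.rT_eq_zero
      | exact h.flat13.rT_eq_zero
      | exact h.flat23.rT_eq_zero
      | exact h.flat14.rT_eq_zero
      | exact h.flat24.rT_eq_zero
      | exact h.flat35.rT_eq_zero
      | exact h.flat36.rT_eq_zero
      | exact (by rw [h.curv04.1, h.curv04.2.2.2.1, add_zero] : D.rA 0 4 + D.rD 0 4 = 0)
      | exact (by rw [h.curv34.1, h.curv34.2.2.2.1, add_zero] : D.rA 3 4 + D.rD 3 4 = 0)
      | exact h.curv15.2.1
      | exact h.curv16.2.1
      | exact h.curv25.2.1
      | exact h.curv26.2.1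
      | exact h.flat01.swap.rT_eq_zero
      | exact h.flat02.swap.rT_eq_zero
      | exact h.flat03.swap.rT_eq_zero
      | exact h.flat12.swap.rT_eq_zero
      | exact h.flat13.swap.rT_eq_zero
      | exact h.flat23.swap.rT_eq_zero)

/-- The connection annihilates the plane of the second and third basis vectors in the directions of
the orthogonal complement of the socle. -/
theorem Model.flatK (M : D.Model) (m : ℝ) (ρ : Fin 7 → Fin 7 → ℝ) (hρ : IsSupported ρ)
    (hm : (m = 1 ∧ ρ = D.rT) ∨ (m = 2 ∧ ρ = D.rV)) (h46 : ρ 4 6 = 0) (h45 : ρ 4 5 ≠ 0)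
    (closed : ∀ i j l, D.fc (fun k => ρ k l) i j + D.fc (fun k => ρ k i) j l
      + D.fc (fun k => ρ k j) l i = (m - 1) * (D.t l * ρ i j + D.t i * ρ j l + D.t j * ρ l i)) :
    D.FlatK := by
  have hm' : m = 1 ∨ m = 2 := hm.imp And.left And.left
  have h54 : ρ 5 4 = -ρ 4 5 := hρ.swap 4 5
  have h64 : ρ 6 4 = 0 := by rw [hρ.swap 4 6, h46, neg_zero]
  have h65 : ρ 6 5 = 0 := by rw [hρ.swap 5 6, hρ.high, neg_zero]
  have h56 := hρ.high
  have self : ∀ i, ρ i i = 0 := fun i => by linarith [hρ.swap i i]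
  have l0 : ∀ j, ρ 0 j = 0 := fun j => hρ.low 0 j (by decide)
  have l1 : ∀ j, ρ 1 j = 0 := fun j => hρ.low 1 j (by decide)
  have l2 : ∀ j, ρ 2 j = 0 := fun j => hρ.low 2 j (by decide)
  have l3 : ∀ j, ρ 3 j = 0 := fun j => hρ.low 3 j (by decide)
  have r0 : ∀ j, ρ j 0 = 0 := fun j => by rw [hρ.swap 0 j, l0, neg_zero]
  have r1 : ∀ j, ρ j 1 = 0 := fun j => by rw [hρ.swap 1 j, l1, neg_zero]
  have r2 : ∀ j, ρ j 2 = 0 := fun j => by rw [hρ.swap 2 j, l2, neg_zero]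
  have r3 : ∀ j, ρ j 3 = 0 := fun j => by rw [hρ.swap 3 j, l3, neg_zero]
  have hw := M.w_eq
  -- With ρ concentrated on (4, 5), closedness is linear in the connection: (i, 4, 5) gives a i = -m
  -- (a i + d i), (i, 4, 6) gives c i = 0, and (4, 5, 6) gives the hypothesis `hc` of `b_eq_zero`.
  have C045 := closed 0 4 5
  have C046 := closed 0 4 6
  have C145 := closed 1 4 5
  have C146 := closed 1 4 6
  have C245 := closed 2 4 5
  have C246 := closed 2 4 6
  have C345 := closed 3 4 5
  have C346 := closed 3 4 6
  have C456 := closed 4 5 6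
  rw [fc_swap _ 0 5] at C045
  rw [fc_swap _ 0 6] at C046
  rw [fc_swap _ 1 5] at C145
  rw [fc_swap _ 1 6] at C146
  rw [fc_swap _ 2 5] at C245
  rw [fc_swap _ 2 6] at C246
  rw [fc_swap _ 3 5] at C345
  rw [fc_swap _ 3 6] at C346
  rw [fc_swap _ 4 6] at C456
  simp only [fc04, fc05, fc06, fc14, fc15, fc16, fc24, fc25, fc26, fc34, fc35, fc36, fc45, fc46,
    fc56, l0, l1, l2, l3, r0, r1, r2, r3, h46, h54, h64, h65, h56, self, hw, mul_zero, zero_mul,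
    add_zero, zero_add, neg_zero, sub_zero, t] at C045 C046 C145 C146 C245 C246 C345 C346 C456
  have t0 : D.a 0 = -m * (D.a 0 + D.d 0) := by
    apply mul_right_cancel₀ h45; linear_combination -C045
  have t1 : D.a 1 = -m * (D.a 1 + D.d 1) := by
    apply mul_right_cancel₀ h45; linear_combination -C145
  have t2 : D.a 2 = -m * (D.a 2 + D.d 2) := by
    apply mul_right_cancel₀ h45; linear_combination -C245
  have t3 : D.a 3 = -m * (D.a 3 + D.d 3) := by
    apply mul_right_cancel₀ h45; linear_combination -C345
  have c0 : D.c 0 = 0 := by apply mul_right_cancel₀ h45; linear_combination -C046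
  have c1 : D.c 1 = 0 := by apply mul_right_cancel₀ h45; linear_combination -C146
  have c2 : D.c 2 = 0 := by apply mul_right_cancel₀ h45; linear_combination -C246
  have c3 : D.c 3 = 0 := by apply mul_right_cancel₀ h45; linear_combination -C346
  obtain ⟨s0, s1, s2, s3, b1, v0⟩ := M.trace_eq_zero m _ _ _ _
    (hm.imp (fun h => ⟨h.1, fun e => h45 (by rw [h.2]; exact e.1)⟩)
      (fun h => ⟨h.1, fun e => h45 (by rw [h.2]; exact e.1)⟩))
    t0 (by linear_combination -t0) c0 t1 (by linear_combination -t1) c1 t2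
    (by linear_combination -t2) c2 t3 (by linear_combination -t3) c3
  have a0 : D.a 0 = 0 := by rw [t0, s0, mul_zero]
  have a1 : D.a 1 = 0 := by rw [t1, s1, mul_zero]
  have a2 : D.a 2 = 0 := by rw [t2, s2, mul_zero]
  have a3 : D.a 3 = 0 := by rw [t3, s3, mul_zero]
  have d0 : D.d 0 = 0 := by linarith
  have d1 : D.d 1 = 0 := by linarith
  have d2 : D.d 2 = 0 := by linarith
  have d3 : D.d 3 = 0 := by linarith
  obtain ⟨b0, b2, b3⟩ := M.b_eq_zero m hm' a0 d0 c0 a1 d1 c1 a2 d2 c2 a3 d3 c3 b1 v0 (by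
    apply mul_right_cancel₀ h45; linear_combination -C456)
  exact ⟨⟨a0, a1, a2, a3⟩, ⟨b0, b1, b2, b3⟩, ⟨c0, c1, c2, c3⟩, ⟨d0, d1, d2, d3⟩, v0⟩

theorem FlatK.rebase (F : D.FlatK) (p q r s : ℝ) : (D.rebase p q r s).FlatK := by
  obtain ⟨⟨a0, a1, a2, a3⟩, ⟨b0, b1, b2, b3⟩, ⟨c0, c1, c2, c3⟩, ⟨d0, d1, d2, d3⟩, v0⟩ := F
  constructor <;> simp [ConnData.rebase, planeForm, *]

end ConnData

theorem exists_det_eq_one {p q : ℝ} (h : (p, q) ≠ (0, 0)) : ∃ r s : ℝ, p * s - q * r = 1 := by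
  by_cases hp : p = 0
  · have hq : q ≠ 0 := by rintro rfl; exact h (by simp [hp])
    exact ⟨-q⁻¹, 0, by field_simp; ring⟩
  · exact ⟨0, p⁻¹, by field_simp; ring⟩

/-- Holonomy data in normal form, with a nonabelian holonomy algebra, the connection of which has no
component in the direction of the parameter `u`. -/
structure Reduced (L : V7 →ₗ[ℝ] Mat7) (h : LieSubalgebra ℝ Mat7) : Prop extends NF L h where
  u_eq : ∀ i, L (Pi.single i 1) 6 4 = 0
  w_eq : ∀ i, L (Pi.single i 1) 5 4 = 0
  nonzero : ∃ T ∈ h, partE T ≠ 0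

variable {L : V7 →ₗ[ℝ] Mat7} {h : LieSubalgebra ℝ Mat7}

theorem Reduced.model (H : Reduced L h) : (connData L).Model := H.toNF.model H.u_eq H.w_eq H.nonzero

theorem Reduced.connData_conj (H : Reduced L h) {p q r s : ℝ} (hd : p * s - q * r = 1) :
    connData (conjConn (planeGL hd) L) = (connData L).rebase p q r s :=
  (connData_rebase (H.toNF.mat_eq H.u_eq) H.w_eq hd).1

theorem Reduced.conj (H : Reduced L h) {p q r s : ℝ} (hd : p * s - q * r = 1) :
    Reduced (conjConn (planeGL hd) L) (conjSub (planeGL hd) h) where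
  toNF := H.toNF.conj hd
  u_eq i := by
    rw [← (connData_rebase (H.toNF.mat_eq H.u_eq) H.w_eq hd).2]
    simp [ConnData.mat, hMat]
  w_eq i := by
    rw [← (connData_rebase (H.toNF.mat_eq H.u_eq) H.w_eq hd).2]
    simp [ConnData.mat, hMat, ConnData.rebase]
  nonzero := NF.nonzero_conj H.toShape hd H.nonzero

theorem conj_plane_apply (H : Shape h) {p q r s : ℝ} (hd : p * s - q * r = 1) {T : Mat7}
    (hT : T ∈ h) : ((planeGL hd)⁻¹.val * T * (planeGL hd).val) 1 6 = T 1 6 ∧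
      ((planeGL hd)⁻¹.val * T * (planeGL hd).val) 0 0 = T 0 0 := by
  obtain ⟨A, v, y, rfl⟩ := H.shape _ hT
  rw [conj_hMat_plane']
  have e : ∀ A v u y, hMat A v u y 1 6 = v ∧ hMat A v u y 0 0 = A.trace := fun _ _ _ _ => ⟨rfl, rfl⟩
  rw [(e _ _ _ _).1, (e _ _ _ _).1, (e _ _ _ _).2, (e _ _ _ _).2, mul_assoc, Matrix.trace_mul_comm,
    mul_assoc]
  refine ⟨rfl, ?_⟩
  have : !![p, r; q, s] * !![s, -r; -q, p] = 1 := by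
    ext i j
    fin_cases i <;> fin_cases j <;> simp [Matrix.mul_apply, Fin.sum_univ_two] <;>
      first | ring1 | linear_combination hd
  rw [this, mul_one]

theorem Reduced.conj_apply (H : Shape h) {p q r s : ℝ} (hd : p * s - q * r = 1) {T : Mat7}
    (hT : T ∈ conjSub (planeGL hd) h) : T 0 0 = ((planeGL hd).val * T * (planeGL hd)⁻¹.val) 0 0 := by
  have := (conj_plane_apply H hd hT).2
  rwa [conj_conj] at this

theorem cur_add_smul (L : V7 →ₗ[ℝ] Mat7) (x y z : V7) (b c : ℝ) :
    cur L x (b • y + c • z) = b • cur L x y + c • cur L x z := by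
  simp only [cur, bra, map_add, map_smul, map_sub, Matrix.mulVec_add, Matrix.add_mulVec,
    Matrix.mulVec_smul, Matrix.smul_mulVec, lie_add, lie_smul, smul_sub]
  abel

theorem Reduced.rV_apply (H : Reduced L h) (i j : Fin 7) :
    (connData L).rV i j = cur L (Pi.single i 1) (Pi.single j 1) 1 6 ∧
      (connData L).rT i j = cur L (Pi.single i 1) (Pi.single j 1) 0 0 := by
  rw [← H.toNF.R_eq H.u_eq, ConnData.R_eq]
  exact ⟨rfl, (Matrix.trace_fin_two_of _ _ _ _).symm⟩

/-- Taking (p, q) to be the pair of values on (4, 5) and (4, 6) turns these values into 1 and 0. -/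
theorem Reduced.cur_conj (H : Reduced L h) {p q r s : ℝ} (hd : p * s - q * r = 1) :
    (connData (conjConn (planeGL hd) L)).rV 4 5 =
      s * (connData L).rV 4 5 - r * (connData L).rV 4 6 ∧
    (connData (conjConn (planeGL hd) L)).rV 4 6 =
      -q * (connData L).rV 4 5 + p * (connData L).rV 4 6 ∧
    (connData (conjConn (planeGL hd) L)).rT 4 5 =
      s * (connData L).rT 4 5 - r * (connData L).rT 4 6 ∧
    (connData (conjConn (planeGL hd) L)).rT 4 6 =
      -q * (connData L).rT 4 5 + p * (connData L).rT 4 6 := by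
  have e : ∀ x, (planeGL hd).val.mulVec x = _ := planeMat_mulVec p q r s
  have e4 : (planeGL hd).val.mulVec (Pi.single 4 1) = Pi.single 4 1 := by
    rw [e]; ext i; fin_cases i <;> simp
  have e5 : (planeGL hd).val.mulVec (Pi.single 5 1) =
      s • Pi.single 5 1 + (-r) • Pi.single 6 1 := by
    rw [e]; ext i; fin_cases i <;> simp
  have e6 : (planeGL hd).val.mulVec (Pi.single 6 1) =
      (-q) • Pi.single 5 1 + p • Pi.single 6 1 := by
    rw [e]; ext i; fin_cases i <;> simp
  have k := fun i j => (H.conj hd).rV_apply i j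
  have k' := fun i j => H.rV_apply i j
  simp only [cur_conjConn] at k
  have c := fun x y => conj_plane_apply H.toShape hd (H.cur_mem x y)
  rw [(k 4 5).1, (k 4 6).1, (k 4 5).2, (k 4 6).2, (k' 4 5).1, (k' 4 6).1, (k' 4 5).2, (k' 4 6).2,
    (c _ _).1, (c _ _).1, (c _ _).2, (c _ _).2, e4, e5, e6, cur_add_smul, cur_add_smul]
  simp only [Matrix.add_apply, Matrix.smul_apply, smul_eq_mul]
  refine ⟨?_, trivial, ?_, trivial⟩ <;> ring

end G2StarHolonomy

/-! ### Exclusion of a nontrivial action on E when u = 0 -/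

namespace G2StarHolonomy

variable {L : V7 →ₗ[ℝ] Mat7} {h : LieSubalgebra ℝ Mat7}

/-- If an invariant linear form on the holonomy algebra vanishes on the curvature, then it vanishes. -/
theorem HolData.apply_eq_zero (H : HolData L h) (f : Mat7 →ₗ[ℝ] ℝ)
    (h1 : ∀ i j, f (cur L (Pi.single i 1) (Pi.single j 1)) = 0)
    (h2 : ∀ x, ∀ T ∈ h, f T = 0 → f ⁅L x, T⁆ = 0) : ∀ T ∈ h, f T = 0 := by
  intro T hT
  refine (H.least (h.toSubmodule ⊓ LinearMap.ker f) (fun x y => ⟨H.cur_mem x y, ?_⟩)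
    (fun x T hT => ⟨H.lie_mem x T hT.1, h2 x T hT.1 hT.2⟩) hT).2
  change f (cur L x y) = 0
  rw [cur_eq_sum, map_sum]
  refine Finset.sum_eq_zero fun i _ => ?_
  rw [map_sum]
  exact Finset.sum_eq_zero fun j _ => by rw [map_smul, h1, smul_zero]

/-- The linear form that takes the value `T i j` at a matrix `T`. -/
def entryForm (i j : Fin 7) : Mat7 →ₗ[ℝ] ℝ where
  toFun T := T i j
  map_add' _ _ := rfl
  map_smul' _ _ := rfl

/-- The fourth basis vector is not invariant under an indecomposable holonomy algebra. -/
theorem HolData.exists_v_ne_zero (H : HolData L h) (hs : Shape h) : ∃ T ∈ h, T 1 6 ≠ 0 := by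
  by_contra! hv
  have := H.indec (Submodule.span ℝ {Pi.single 3 1}) (by
    intro T hT w hw
    obtain ⟨c, rfl⟩ := Submodule.mem_span_singleton.1 hw
    have hv := hv T hT
    obtain ⟨A, v, y, rfl⟩ := hs.shape T hT
    have hv : v = 0 := hv
    subst hv
    rw [Matrix.mulVec_smul]
    have : (hMat A 0 0 y).mulVec (Pi.single 3 1) = 0 := by
      rw [Matrix.mulVec_single_one]
      ext i; fin_cases i <;> simp [hMat]
    rw [this, smul_zero]
    exact Submodule.zero_mem _) (by
    intro w hw h2
    obtain ⟨c, rfl⟩ := Submodule.mem_span_singleton.1 hw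
    have := h2 _ (Submodule.mem_span_singleton_self _)
    simp [ip_apply] at this
    simp [this])
  rcases this with h1 | h1
  · rw [Submodule.span_singleton_eq_bot] at h1
    have := congrFun h1 3
    simp at this
  · have : (Pi.single 0 1 : V7) ∈ Submodule.span ℝ {(Pi.single 3 1 : V7)} := by rw [h1]; trivial
    obtain ⟨c, hc⟩ := Submodule.mem_span_singleton.1 this
    have := congrFun hc 0
    simp at this

/-- On a traceless h the condition v = 0 is stable under brackets with the connection, so by
minimality it would pass from the curvature to h, against `exists_v_ne_zero`. -/
theorem Reduced.rV_ne_zero (H : Reduced L h) (htr : ∀ T ∈ h, T 0 0 = 0) :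
    ¬((connData L).rV 4 5 = 0 ∧ (connData L).rV 4 6 = 0) := by
  rintro ⟨h45, h46⟩
  obtain ⟨T, hT, hv⟩ := H.exists_v_ne_zero H.toShape
  refine hv (H.apply_eq_zero (entryForm 1 6) (fun i j => ?_) (fun x T hT h0 => ?_) T hT)
  · exact (H.rV_apply i j).1.symm.trans (H.model.isLie.rV_supported.eq_zero h45 h46 i j)
  · have ht := htr T hT
    obtain ⟨A, v, y, rfl⟩ := H.shape T hT
    obtain ⟨A', v', u', y', e'⟩ := H.shape_conn x
    have h0 : v = 0 := h0
    have ht : A.trace = 0 := ht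
    rw [e', hMat_bracket]
    change A'.trace * v - A.trace * v' + 2 * (u' 0 * (0 : Fin 2 → ℝ) 1 - u' 1 * (0 : Fin 2 → ℝ) 0) = 0
    simp [h0, ht]

theorem Reduced.rT_ne_zero (H : Reduced L h) (hn : ∃ T ∈ h, T 0 0 ≠ 0) :
    ¬((connData L).rT 4 5 = 0 ∧ (connData L).rT 4 6 = 0) := by
  rintro ⟨h45, h46⟩
  obtain ⟨T, hT, hv⟩ := hn
  refine hv (H.apply_eq_zero (entryForm 0 0) (fun i j => ?_) (fun x T hT h0 => ?_) T hT)
  · exact (H.rV_apply i j).2.symm.trans (H.model.isLie.rT_supported.eq_zero h45 h46 i j)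
  · obtain ⟨A, v, y, rfl⟩ := H.shape T hT
    obtain ⟨A', v', u', y', e'⟩ := H.shape_conn x
    rw [e', hMat_bracket]
    change Matrix.trace ⁅A', A⁆ = 0
    rw [Ring.lie_def, Matrix.trace_sub, Matrix.trace_mul_comm, sub_self]

theorem Reduced.traceless_conj (H : Reduced L h) (htr : ∀ T ∈ h, T 0 0 = 0) {p q r s : ℝ}
    (hd : p * s - q * r = 1) : ∀ T ∈ conjSub (planeGL hd) h, T 0 0 = 0 := by
  intro T hT
  rw [Reduced.conj_apply H.toShape hd hT]
  exact htr _ hT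

theorem ConnData.closed_rV {D : ConnData} (h : D.IsLie) (hT : ∀ i j, D.rT i j = 0) (i j l : Fin 7) :
    D.fc (fun k => D.rV k l) i j + D.fc (fun k => D.rV k i) j l
      + D.fc (fun k => D.rV k j) l i =
      (2 - 1) * (D.t l * D.rV i j + D.t i * D.rV j l + D.t j * D.rV l i) := by
  rw [h.rV_closed, hT, hT, hT]; ring

/-- A connection that annihilates the plane in the directions of the orthogonal complement of the
socle has holonomy with nontrivial trace. -/
theorem Reduced.false_of_flatK (H : Reduced L h) (htr : ∀ T ∈ h, T 0 0 = 0)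
    (F : (connData L).FlatK) : False := by
  have hT : ∀ {L : V7 →ₗ[ℝ] Mat7} {h : LieSubalgebra ℝ Mat7} (H : Reduced L h)
      (htr : ∀ T ∈ h, T 0 0 = 0), ∀ i j, (connData L).rT i j = 0 := by
    intro L h H htr i j
    rw [(H.rV_apply i j).2]
    exact htr _ (H.cur_mem _ _)
  -- Four cases, each normalized by a change of basis of E: v ≠ 0 on E; (y 0, z 0) ≠ 0; v 3 ≠ 0; or
  -- only (y 3, z 3) left, nonzero by `rV_ne_zero`.
  by_cases hv : ((connData L).v 1, (connData L).v 2) = (0, 0)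
  · by_cases hy : ((connData L).y 0, (connData L).z 0) = (0, 0)
    · obtain ⟨v1, v2⟩ := Prod.mk.inj hv
      obtain ⟨y0, z0⟩ := Prod.mk.inj hy
      have K := F.eqs H.model.isLie H.model.w_eq
      by_cases v3 : (connData L).v 3 = 0
      · have hy3 : ((connData L).y 3, (connData L).z 3) ≠ (0, 0) := by
          intro hy3
          obtain ⟨y3, z3⟩ := Prod.mk.inj hy3
          have s2 : √2 ≠ 0 := by positivity
          refine H.rV_ne_zero htr ⟨?_, ?_⟩
          · simpa [v3, y3, z3, y0, z0] using K.y34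
          · simpa [v3, y3, z3, y0, z0] using K.z34
        obtain ⟨r, s, hd⟩ := exists_det_eq_one hy3
        have H' := H.conj hd
        have F' := F.rebase ((connData L).y 3) ((connData L).z 3) r s
        have hm := H'.model
        have hT' := hT H' (H.traceless_conj htr hd)
        rw [H.connData_conj hd] at hm hT'
        refine hm.false_of_v_eq_zero F' hT' ?_ ?_ ?_ ?_ ?_ ?_ ?_ <;>
          simp [ConnData.rebase, planeForm, v1, v2, v3, y0, z0]
        · ring
        · intro h0; linarith
      · have d5 : (connData L).d 5 = -(connData L).a 5 := by
          have := K.v35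
          rw [v2] at this
          apply mul_left_cancel₀ v3; linear_combination this
        have d6 : (connData L).d 6 = -(connData L).a 6 := by
          have := K.v36
          rw [v1] at this
          apply mul_left_cancel₀ v3; linear_combination this
        obtain ⟨p, q, hpq, h5, h6⟩ := K.exists_eigenvector d5 d6
        obtain ⟨r, s, hd⟩ := exists_det_eq_one hpq
        have H' := H.conj hd
        have F' := F.rebase p q r s
        have hm := H'.model
        have hT' := hT H' (H.traceless_conj htr hd)
        rw [H.connData_conj hd] at hm hT'
        simp only [ConnData.Eigen, ConnData.matE, Matrix.of_apply, Matrix.cons_val', Matrix.cons_val_zero,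
          Matrix.cons_val_one, Matrix.cons_val_fin_one] at h5 h6
        refine hm.false_of_v_ne_zero F' hT' ?_ ?_ ?_ ?_ ?_ ?_ ?_ <;>
          simp [ConnData.rebase, planeForm, v1, v2, v3, y0, z0]
        · linear_combination s * h5 - r * h6
        · linear_combination -q * h5 + p * h6
    · obtain ⟨r, s, hd⟩ := exists_det_eq_one hy
      have H' := H.conj hd
      have F' := F.rebase ((connData L).y 0) ((connData L).z 0) r s
      have hm := H'.model
      have hT' := hT H' (H.traceless_conj htr hd)
      rw [H.connData_conj hd] at hm hT'
      refine hm.false_of_y_ne_zero F' hT' ?_ ?_ <;> simp [ConnData.rebase, planeForm]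
      · ring
      · intro h0; linarith
  -- The kernel of v on E becomes the first basis vector, so the new v 1 is 0 and the new v 2 is -1.
  · obtain ⟨r, s, hd⟩ := exists_det_eq_one (p := -(connData L).v 2) (q := (connData L).v 1) (by
      intro h0; apply hv
      obtain ⟨h1, h2⟩ := Prod.mk.inj h0
      rw [h2, neg_eq_zero.1 h1])
    have H' := H.conj hd
    have F' := F.rebase (-(connData L).v 2) ((connData L).v 1) r s
    have hm := H'.model
    have htr' := H.traceless_conj htr hd
    have hT' := hT H' htr'
    have hV' := H'.rV_ne_zero htr'
    rw [H.connData_conj hd] at hm hT' hV'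
    refine hm.false_of_v_plane_ne_zero F' hT' hV' ?_ ?_ <;> simp [ConnData.rebase, planeForm]
    · ring
    · intro h0; linarith

/-- The holonomy algebra cannot act by traceless maps on the plane. -/
theorem Reduced.exists_trace_ne_zero (H : Reduced L h) : ∃ T ∈ h, T 0 0 ≠ 0 := by
  by_contra! htr
  have hne : ((connData L).rV 4 5, (connData L).rV 4 6) ≠ (0, 0) := fun h0 =>
    H.rV_ne_zero htr (Prod.mk.inj h0)
  obtain ⟨r, s, hd⟩ := exists_det_eq_one hne
  have H' := H.conj hd
  have htr' := H.traceless_conj htr hd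
  have hT' : ∀ i j, (connData (conjConn (planeGL hd) L)).rT i j = 0 := by
    intro i j
    rw [(H'.rV_apply i j).2]
    exact htr' _ (H'.cur_mem _ _)
  obtain ⟨c1, c2, -, -⟩ := H.cur_conj hd
  refine H'.false_of_flatK htr' (H'.model.flatK 2 _ H'.model.isLie.rV_supported (Or.inr ⟨rfl, rfl⟩) ?_ ?_
    (ConnData.closed_rV H'.model.isLie hT'))
  · rw [c2]; ring
  · rw [c1]; intro h0; linarith

/-- A connection without a component in the direction of the parameter `u` has abelian holonomy. -/
theorem Reduced.false (H : Reduced L h) : False := by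
  have hne : ((connData L).rT 4 5, (connData L).rT 4 6) ≠ (0, 0) := fun h0 =>
    H.rT_ne_zero H.exists_trace_ne_zero (Prod.mk.inj h0)
  obtain ⟨r, s, hd⟩ := exists_det_eq_one hne
  have H' := H.conj hd
  obtain ⟨-, -, c1, c2⟩ := H.cur_conj hd
  have F := H'.model.flatK 1 _ H'.model.isLie.rT_supported (Or.inl ⟨rfl, rfl⟩)
    (by rw [c2]; ring) (by rw [c1]; intro h0; linarith)
    (fun i j l => by rw [H'.model.isLie.rT_closed]; ring)
  have K := F.eqs H'.model.isLie H'.model.w_eq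
  have hne' := H'.rT_ne_zero H'.exists_trace_ne_zero
  have hy : ((connData (conjConn (planeGL hd) L)).y 0, (connData (conjConn (planeGL hd) L)).z 0)
      ≠ (0, 0) := by
    intro hy
    obtain ⟨y0, z0⟩ := Prod.mk.inj hy
    exact hne' ⟨by simpa [y0, z0] using K.y04, by simpa [y0, z0] using K.z04⟩
  -- A second change of basis achieves (y 0, z 0) = (1, 0).
  obtain ⟨r', s', hd'⟩ := exists_det_eq_one hy
  have H2 := H'.conj hd'
  have hm := H2.model
  have hT := H2.rT_ne_zero H2.exists_trace_ne_zero
  rw [H'.connData_conj hd'] at hm hT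
  refine hm.false_of_rT_ne_zero (F.rebase _ _ r' s') hT ?_ ?_ <;>
    simp [ConnData.rebase, planeForm]
  · linear_combination hd'
  · ring

end G2StarHolonomy

/-! ### Exclusion of diagonal holonomy of rank one on E -/

namespace G2StarHolonomy

namespace ConnData

variable {D : ConnData}

/-- The holonomy algebra cannot act by diagonal maps of rank one on the plane of the second and third
basis vectors. -/
theorem IsLie.false_of_diagonal (h : D.IsLie) (hb : ∀ i, D.b i = 0) (hc : ∀ i, D.c i = 0)
    (hD : ∀ i j, D.rD i j = 0) (hA : ∃ i j, D.rA i j ≠ 0) : False := by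
  have hB : ∀ i j, D.rB i j = 0 := by intro i j; simp [rB, fc, hb]
  have hC : ∀ i j, D.rC i j = 0 := by intro i j; simp [rC, fc, hc]
  obtain ⟨-, e2, -, -, e5, -, e7, -, e9, -, -⟩ := h.curv_quartic
  rw [hC] at e2 e5 e7
  rw [hB] at e9
  have anti : ∀ i j, D.rA j i = -D.rA i j := by
    intro i j
    have := rT_swap (D := D) i j
    rwa [rT, rT, hD, hD, add_zero, add_zero] at this
  -- Since D = 0, `rA` is the trace form; with C = 0 only its value on (4, 5) can be nonzero.
  have hsup : IsSupported D.rA := by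
    have : D.rA = D.rT := by ext i j; rw [rT, hD, add_zero]
    rw [this]; exact h.rT_supported
  have A46 : D.rA 4 6 = 0 := by rw [h.curv_sym.1, hC]
  have hp : D.rA 4 5 ≠ 0 := by
    intro h0
    obtain ⟨i, j, hij⟩ := hA
    exact hij (hsup.eq_zero h0 A46 i j)
  have A54 : D.rA 5 4 = -D.rA 4 5 := anti 4 5
  have A64 : D.rA 6 4 = 0 := by rw [anti 4 6, A46, neg_zero]
  have A65 : D.rA 6 5 = 0 := by rw [anti 5 6, hsup.high, neg_zero]
  have A56 := hsup.high
  have self : ∀ i, D.rA i i = 0 := fun i => by linarith [anti i i]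
  have low : ∀ i j, i ≤ 3 → D.rA i j = 0 := hsup.low
  have low' : ∀ i j, i ≤ 3 → D.rA j i = 0 := fun i j hi => by rw [anti i j, low i j hi, neg_zero]
  have l0 : ∀ j, D.rA 0 j = 0 := fun j => low 0 j (by decide)
  have l1 : ∀ j, D.rA 1 j = 0 := fun j => low 1 j (by decide)
  have l2 : ∀ j, D.rA 2 j = 0 := fun j => low 2 j (by decide)
  have l3 : ∀ j, D.rA 3 j = 0 := fun j => low 3 j (by decide)
  have r0 : ∀ j, D.rA j 0 = 0 := fun j => low' 0 j (by decide)
  have r1 : ∀ j, D.rA j 1 = 0 := fun j => low' 1 j (by decide)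
  have r2 : ∀ j, D.rA j 2 = 0 := fun j => low' 2 j (by decide)
  have r3 : ∀ j, D.rA j 3 = 0 := fun j => low' 3 j (by decide)
  have fa : ∀ i j, D.rA i j = -D.fc D.a i j := by intro i j; rw [rA, hb, hc, hb]; ring
  have fd : ∀ i j, D.fc D.d i j = 0 := by
    intro i j; have := hD i j; rw [rD, hb, hc, hb] at this; linarith
  have closed : ∀ i j l, D.fc (fun k => D.rA k l) i j + D.fc (fun k => D.rA k i) j l
      + D.fc (fun k => D.rA k j) l i = 0 := by
    intro i j l
    have := h.rT_closed i j l
    simpa only [rT, hD, add_zero] using this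
  -- Closedness on (i, 4, 5) gives d i = -2 a i for i = 0, 1, 2, 3, 6.
  have C045 := closed 0 4 5
  have C145 := closed 1 4 5
  have C245 := closed 2 4 5
  have C345 := closed 3 4 5
  have C645 := closed 6 4 5
  rw [fc_swap _ 0 5] at C045
  rw [fc_swap _ 1 5] at C145
  rw [fc_swap _ 2 5] at C245
  rw [fc_swap _ 3 5] at C345
  rw [fc_swap _ 4 6] at C645
  simp only [fc04, fc05, fc06, fc14, fc15, fc16, fc24, fc25, fc26, fc34, fc35, fc36, fc45, fc46,
    fc56, l0, l1, l2, l3, r0, r1, r2, r3, A46, A54, A64, A65, A56, self, mul_zero, zero_mul,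
    add_zero, zero_add, neg_zero, sub_zero, hc] at C045 C145 C245 C345 C645
  have d0 : D.d 0 = -2 * D.a 0 := by apply mul_right_cancel₀ hp; linear_combination -C045
  have d1 : D.d 1 = -2 * D.a 1 := by apply mul_right_cancel₀ hp; linear_combination -C145
  have d2 : D.d 2 = -2 * D.a 2 := by apply mul_right_cancel₀ hp; linear_combination -C245
  have d3 : D.d 3 = -2 * D.a 3 := by apply mul_right_cancel₀ hp; linear_combination -C345
  have d6 : D.d 6 = -2 * D.a 6 := by apply mul_right_cancel₀ hp; linear_combination -C645
  have hva : ∀ i j, (i, j) ∈ [((0 : Fin 7), (4 : Fin 7)), (0, 5), (1, 4), (1, 5), (2, 4), (2, 5), (3, 4), (3, 5), (4, 6), (5, 6)] →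
      D.fc D.a i j = 0 := by
    intro i j hij
    have := fa i j
    simp only [List.mem_cons, Prod.mk.injEq, List.not_mem_nil, or_false] at hij
    rcases hij with ⟨rfl, rfl⟩ | ⟨rfl, rfl⟩ | ⟨rfl, rfl⟩ | ⟨rfl, rfl⟩ | ⟨rfl, rfl⟩ | ⟨rfl, rfl⟩ | ⟨rfl, rfl⟩ |
      ⟨rfl, rfl⟩ | ⟨rfl, rfl⟩ | ⟨rfl, rfl⟩ <;> simp only [l0, l1, l2, l3, A46, A56] at this <;> linarith
  have E45 := fa 4 5
  have F45 := fd 4 5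
  have E04 := hva 0 4 (by simp)
  have F04 := fd 0 4
  have E05 := hva 0 5 (by simp)
  have F05 := fd 0 5
  have E14 := hva 1 4 (by simp)
  have F14 := fd 1 4
  have E15 := hva 1 5 (by simp)
  have F15 := fd 1 5
  have E24 := hva 2 4 (by simp)
  have F24 := fd 2 4
  have E25 := hva 2 5 (by simp)
  have F25 := fd 2 5
  have E34 := hva 3 4 (by simp)
  have F34 := fd 3 4
  have E35 := hva 3 5 (by simp)
  have F35 := fd 3 5
  have E46 := hva 4 6 (by simp)
  have F46 := fd 4 6
  have E56 := hva 5 6 (by simp)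
  have F56 := fd 5 6
  simp only [fc04, fc05, fc14, fc15, fc24, fc25, fc34, fc35, fc45, fc46, fc56, hb, hc, d0, d1, d2,
    d3, d6] at E45 F45 E04 F04 E05 F05 E14 F14 E15 F15 E24 F24 E25 F25 E34 F34 E35 F35 E46 F46 E56 F56
  -- the linear form `2 a + d` is supported on the fifth and sixth basis vectors
  have low : D.a 0 = 0 ∧ D.a 1 = 0 ∧ D.a 2 = 0 ∧ D.a 3 = 0 ∧ D.a 6 = 0 ∧
      D.w 0 = 0 ∧ D.w 1 = 0 ∧ D.w 2 = 0 ∧ D.w 3 = 0 ∧ D.w 6 = 0 := by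
    have g04 : D.a 0 * (2 * D.a 4 + D.d 4) + D.w 0 * (2 * D.a 5 + D.d 5) = 0 := by
      linear_combination 2 * E04 + F04
    have g05 : D.a 0 * (2 * D.a 5 + D.d 5) = 0 := by linear_combination -2 * E05 - F05
    have g14 : D.a 1 * (2 * D.a 4 + D.d 4) + D.w 1 * (2 * D.a 5 + D.d 5) = 0 := by
      linear_combination 2 * E14 + F14
    have g15 : D.a 1 * (2 * D.a 5 + D.d 5) = 0 := by linear_combination -2 * E15 - F15
    have g24 : D.a 2 * (2 * D.a 4 + D.d 4) + D.w 2 * (2 * D.a 5 + D.d 5) = 0 := by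
      linear_combination 2 * E24 + F24
    have g25 : D.a 2 * (2 * D.a 5 + D.d 5) = 0 := by linear_combination -2 * E25 - F25
    have g34 : D.a 3 * (2 * D.a 4 + D.d 4) + D.w 3 * (2 * D.a 5 + D.d 5) = 0 := by
      linear_combination 2 * E34 + F34
    have g35 : D.a 3 * (2 * D.a 5 + D.d 5) = 0 := by linear_combination -2 * E35 - F35
    have g46 : D.a 6 * (2 * D.a 4 + D.d 4) + D.w 6 * (2 * D.a 5 + D.d 5) = 0 := by
      linear_combination -2 * E46 - F46
    have g56 : D.a 6 * (2 * D.a 5 + D.d 5) = 0 := by linear_combination 2 * E56 + F56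
    -- On this bracket the form 2 a + d takes the nonzero value -2 `rA` (4, 5), so one of its two
    -- remaining coefficients is nonzero, whereas it kills the other listed brackets.
    have g45 : (D.a 5 + D.d 5) * (2 * D.a 4 + D.d 4) - (D.a 4 + D.w 5) * (2 * D.a 5 + D.d 5) =
        -2 * D.rA 4 5 := by linear_combination 2 * E45 + F45
    by_cases f5 : 2 * D.a 5 + D.d 5 = 0
    · rw [f5] at g04 g05 g14 g24 g34 g46 g45
      have f4 : 2 * D.a 4 + D.d 4 ≠ 0 := by
        intro f4; rw [f4] at g45; apply hp; linarith
      have a0 : D.a 0 = 0 := by simpa [f4] using g04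
      have a1 : D.a 1 = 0 := by simpa [f4] using g14
      have a2 : D.a 2 = 0 := by simpa [f4] using g24
      have a3 : D.a 3 = 0 := by simpa [f4] using g34
      have a6 : D.a 6 = 0 := by simpa [f4] using g46
      have a5 : D.a 5 ≠ 0 := by
        intro a5
        have : D.d 5 = 0 := by linarith
        rw [a5, this] at g45
        apply hp; linarith
      simp only [a0, a1, a2, a3, a6, mul_zero, zero_mul, add_zero, zero_add, sub_zero, neg_zero]
        at E04 E14 E24 E34 E46
      exact ⟨a0, a1, a2, a3, a6, by simpa [a5] using E04, by simpa [a5] using E14,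
        by simpa [a5] using E24, by simpa [a5] using E34, by simpa [a5] using E46⟩
    · have a0 : D.a 0 = 0 := by simpa [f5] using g05
      have a1 : D.a 1 = 0 := by simpa [f5] using g15
      have a2 : D.a 2 = 0 := by simpa [f5] using g25
      have a3 : D.a 3 = 0 := by simpa [f5] using g35
      have a6 : D.a 6 = 0 := by simpa [f5] using g56
      rw [a0] at g04
      rw [a1] at g14
      rw [a2] at g24
      rw [a3] at g34
      rw [a6] at g46
      exact ⟨a0, a1, a2, a3, a6, by simpa [f5] using g04, by simpa [f5] using g14,
        by simpa [f5] using g24, by simpa [f5] using g34, by simpa [f5] using g46⟩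
  clear E04 F04 E05 F05 E14 F14 E15 F15 E24 F24 E25 F25 E34 F34 E35 F35 E46 F46 E56 F56 C045 C145 C245 C345 C645
  obtain ⟨a0, a1, a2, a3, a6, w0, w1, w2, w3, w6⟩ := low
  rw [a0, mul_zero] at d0
  rw [a1, mul_zero] at d1
  rw [a2, mul_zero] at d2
  rw [a3, mul_zero] at d3
  rw [a6, mul_zero] at d6
  obtain ⟨-, -, -, -, V03, -, -⟩ := h.flat03
  obtain ⟨-, -, -, -, -, Y05, -⟩ := h.flat05
  obtain ⟨-, -, -, -, -, -, Z06⟩ := h.flat06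
  obtain ⟨-, -, -, -, -, Y13, -⟩ := h.flat13
  obtain ⟨-, -, -, -, -, Y23, -⟩ := h.flat23
  obtain ⟨-, -, -, -, -, Y14, -⟩ := h.flat14
  obtain ⟨-, -, -, -, -, Y04, -⟩ := h.curv04
  obtain ⟨-, -, Y15, -⟩ := h.curv15
  obtain ⟨-, -, Y16, -⟩ := h.curv16
  obtain ⟨-, -, Y25, -⟩ := h.curv25
  obtain ⟨-, -, Y26, -⟩ := h.curv26
  have W := h.flat_w 4 5
  rw [hB] at Y25 Y26
  rw [A46] at Y16
  rw [hD] at Y04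
  rw [rV] at V03
  rw [rY] at Y05 Y13 Y23 Y14 Y04 Y15 Y16 Y25 Y26
  rw [rZ] at Z06
  rw [rW] at W
  simp only [fc03, fc05, fc06, fc13, fc23, fc14, fc04, fc15, fc16, fc25, fc26, fc45, hb, hc, a0, a1,
    a2, a3, d0, d1, d2, d3, w0, w1, w2, w3, a6, d6, w6, mul_zero, zero_mul, add_zero, zero_add,
    sub_zero, zero_sub, neg_zero, sub_self] at V03 Y05 Y13 Y23 Y14 Y04 Y15 Y16 Y25 Y26 Z06 W
  have s2 : √2 ≠ 0 := by positivity
  have v0 : D.v 0 = 0 := by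
    have : √2 * (D.v 0 * D.v 0) = 0 := by linear_combination -V03
    simpa [s2] using this
  rw [v0] at Y05 Z06 Y04
  have z0 : D.z 0 = 0 := by
    have : D.z 0 * D.z 0 = 0 := by linear_combination Z06
    simpa using this
  have y0 : D.y 0 ≠ 0 := by
    intro y0; rw [y0, z0] at Y04; apply hp; linear_combination -Y04
  have v1 : D.v 1 = 0 := by simpa [y0] using Y13
  have v2 : D.v 2 = 0 := by simpa [y0] using Y23
  have z1 : D.z 1 = 0 := by apply mul_right_cancel₀ y0; linear_combination Y16 + D.y 1 * v1
  have a5 : D.a 5 = D.y 0 := by apply mul_right_cancel₀ y0; linear_combination -Y05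
  have y2 : D.y 2 = 0 := by
    apply mul_right_cancel₀ y0; rw [a5, v2] at Y25; linear_combination -Y25
  rw [a0, a1, a2, a3, a6] at E45 F45
  rw [a5] at Y15 E45 F45 W
  rw [z1, v1] at Y14
  rw [z0] at Y04
  rw [v1] at Y15
  have hs : D.y 0 * (D.a 4 + D.y 1) = -D.rA 4 5 := by linear_combination -Y04
  have hs0 : D.a 4 + D.y 1 ≠ 0 := by
    intro h0; rw [h0] at hs; apply hp; linarith
  have d5 : D.d 5 = 2 * D.y 0 := by
    apply mul_right_cancel₀ hs0; linear_combination -Y15 + E45 - 2 * hs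
  have w5 : D.w 5 = D.a 4 - D.y 1 := by
    apply mul_left_cancel₀ y0; linear_combination -Y15 - hs - D.y 1 * d5
  have d4 : D.d 4 = 2 / 3 * (2 * D.a 4 - D.y 1) := by
    rw [d5, w5] at F45
    apply mul_left_cancel₀ y0; linear_combination 1 / 3 * F45
  rw [d4, w5, d5] at W
  rw [d4] at Y14
  -- Vanishing of the w-curvature on (4, 5) and of the y-curvature on (1, 4) combine to a perfect
  -- square, against `hs0`.
  have : (D.a 4 + D.y 1) ^ 2 = 0 := by linear_combination 3 / 10 * W - 3 / 2 * Y14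
  simp [hs0] at this

end ConnData

end G2StarHolonomy

/-! ### Triviality of the holonomy on E -/

namespace G2StarHolonomy

variable {L : V7 →ₗ[ℝ] Mat7} {h : LieSubalgebra ℝ Mat7}

/-- The bracket of the connection with an element of the holonomy algebra, on the plane of the second
and third basis vectors. -/
theorem NF.partE_lie (H : NF L h) (x : V7) {T : Mat7} (hT : T ∈ h) :
    partE ⁅L x, T⁆ = ⁅partE (L x), partE T⁆ := by
  obtain ⟨A, v, y, rfl⟩ := H.shape T hT
  obtain ⟨A', v', u', y', e'⟩ := H.shape_conn x
  rw [e', hMat_bracket, partE_hMat, partE_hMat, partE_hMat]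

/-- The holonomy algebra annihilates the vectors `u` of the connection. -/
theorem NF.partE_mulVec_u (H : NF L h) (x : V7) {T : Mat7} (hT : T ∈ h) :
    partE T 0 0 * L x 6 4 = partE T 0 1 * L x 5 4 ∧
      partE T 1 0 * L x 6 4 = partE T 1 1 * L x 5 4 := by
  obtain ⟨A'', v'', y'', e''⟩ := H.shape _ (H.lie_mem x T hT)
  obtain ⟨A, v, y, rfl⟩ := H.shape T hT
  obtain ⟨A', v', u', y', e'⟩ := H.shape_conn x
  rw [e', hMat_bracket] at e''
  rw [e', partE_hMat]
  have h5 := congrFun (congrFun e'' 5) 4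
  have h6 := congrFun (congrFun e'' 6) 4
  simp [hMat, Matrix.mulVec, dotProduct, Fin.sum_univ_two] at h5 h6 ⊢
  constructor <;> linarith

/-- The holonomy algebra cannot act by diagonal maps of rank one on the plane of the second and third
basis vectors. -/
theorem NF.false_of_diagonal (H : NF L h) (hn : ∃ T ∈ h, partE T ≠ 0)
    (hd : ∀ T ∈ h, partE T 0 1 = 0 ∧ partE T 1 0 = 0 ∧ partE T 1 1 = 0) : False := by
  obtain ⟨T₀, hT₀, hne⟩ := hn
  obtain ⟨h1, h2, h3⟩ := hd T₀ hT₀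
  have h0 : partE T₀ 0 0 ≠ 0 := by
    intro h0; apply hne
    ext i j; fin_cases i <;> fin_cases j <;> assumption
  have hu : ∀ i, L (Pi.single i 1) 6 4 = 0 := by
    intro i
    have := (H.partE_mulVec_u (Pi.single i 1) hT₀).1
    rw [h1, zero_mul] at this
    exact (mul_eq_zero.1 this).resolve_left h0
  -- The off-diagonal entries of the bracket with `T₀` are ± those of the connection times the
  -- nonzero entry of `T₀`, and they vanish in h.
  have hbc : ∀ i, partE (L (Pi.single i 1)) 0 1 = 0 ∧ partE (L (Pi.single i 1)) 1 0 = 0 := by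
    intro i
    obtain ⟨e1, e2, -⟩ := hd _ (H.lie_mem (Pi.single i 1) T₀ hT₀)
    rw [H.partE_lie _ hT₀] at e1 e2
    simp [Ring.lie_def, Matrix.mul_apply, Fin.sum_univ_two, h1, h2, h3] at e1 e2
    exact ⟨e1.resolve_left h0, e2.resolve_right h0⟩
  have hcur := fun i j => hd _ (H.cur_mem (Pi.single i 1) (Pi.single j 1))
  simp only [← H.curvE_eq hu] at hcur
  refine (H.isLie hu).false_of_diagonal (fun i => (hbc i).1) (fun i => (hbc i).2)
    (fun i j => (hcur i j).2.2) ?_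
  by_contra! hA
  refine hne ((Submodule.mem_bot ℝ).1 (H.induct ⊥ (fun i j => ?_) (fun i A hA => ?_) T₀ hT₀))
  · rw [← H.curvE_eq hu, Submodule.mem_bot]
    exact ConnData.curvE_eq_zero (hA i j) (hcur i j).1 (hcur i j).2.1 (hcur i j).2.2
  · rw [(Submodule.mem_bot ℝ).1 hA, lie_zero]; exact Submodule.zero_mem _

/-- The holonomy algebra in normal form acts trivially on the plane of the second and third basis
vectors. -/
theorem NF.partE_eq_zero (H : NF L h) : ∀ T ∈ h, partE T = 0 := by
  by_contra! hn
  by_cases hu : ∀ i, L (Pi.single i 1) 6 4 = 0 ∧ L (Pi.single i 1) 5 4 = 0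
  · exact Reduced.false ⟨H, fun i => (hu i).1, fun i => (hu i).2, hn⟩
  · rw [not_forall] at hu
    obtain ⟨i, hi⟩ := hu
    -- (p, q) is the vector u of the connection, which h annihilates. With an invariant complement
    -- as first and u as second basis vector of E, h becomes diagonal of rank one.
    set p := -L (Pi.single i 1) 6 4 with hp
    set q := L (Pi.single i 1) 5 4 with hq
    have hpq : (p, q) ≠ (0, 0) := by
      intro h0
      obtain ⟨e1, e2⟩ := Prod.mk.inj h0
      exact hi ⟨neg_eq_zero.1 e1, e2⟩
    have hk : ∀ T ∈ h, partE T 0 0 * p + partE T 0 1 * q = 0 ∧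
        partE T 1 0 * p + partE T 1 1 * q = 0 := by
      intro T hT
      obtain ⟨e1, e2⟩ := H.partE_mulVec_u (Pi.single i 1) hT
      constructor <;> rw [hp, hq] <;> linarith
    obtain ⟨r, s, hd, hrs⟩ := H.toShape.split hpq (fun T hT => by
      obtain ⟨e1, e2⟩ := hk T hT
      rw [ConnData.Eigen, e1, e2, mul_zero, mul_zero])
    have hd' : (-r) * q - (-s) * p = 1 := by linear_combination hd
    refine (H.conj hd').false_of_diagonal (NF.nonzero_conj H.toShape hd' hn) fun T hT => ?_
    obtain ⟨T', hT', -, e⟩ := partE_conj H.toShape hd' hT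
    obtain ⟨e1, e2⟩ := hk T' hT'
    have e3 := hrs T' hT'
    rw [ConnData.Eigen] at e3
    rw [e]
    clear_value p q
    simp [Matrix.mul_apply, Matrix.vecMul, dotProduct, Fin.sum_univ_two]
    refine ⟨?_, ?_, ?_⟩
    · linear_combination q * e1 - p * e2
    · linear_combination e3
    · linear_combination s * e1 - r * e2

end G2StarHolonomy

/-! ### The cross product -/

namespace G2StarHolonomy

/-- The cross product on `ℝ⁷` that is defined by the form `ω₀` and the inner product. -/
def cross (x y : V7) : V7 :=
  ![√2 * (x 1 * y 2 - x 2 * y 1) - x 3 * y 0 + x 0 * y 3,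
    √2 * (x 6 * y 0 - x 0 * y 6) + x 3 * y 1 - x 1 * y 3,
    √2 * (x 0 * y 5 - x 5 * y 0) + x 3 * y 2 - x 2 * y 3,
    x 0 * y 4 - x 4 * y 0 - x 1 * y 5 + x 5 * y 1 - x 2 * y 6 + x 6 * y 2,
    √2 * (x 5 * y 6 - x 6 * y 5) + x 3 * y 4 - x 4 * y 3,
    √2 * (x 2 * y 4 - x 4 * y 2) - x 3 * y 5 + x 5 * y 3,
    √2 * (x 4 * y 1 - x 1 * y 4) - x 3 * y 6 + x 6 * y 3]

theorem ip_cross (x y z : V7) : ip (cross x y) z = omega0 ![x, y, z] := by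
  rw [ip_apply, omega0_apply]
  simp [cross]
  ring

theorem cross_swap (x y : V7) : cross y x = -cross x y := by
  ext i; fin_cases i <;> simp [cross] <;> ring

theorem cross_self (x : V7) : cross x x = 0 := by
  ext i; fin_cases i <;> simp [cross] <;> ring

theorem cross_add_left (x y z : V7) : cross (x + y) z = cross x z + cross y z := by
  ext i; fin_cases i <;> simp [cross] <;> ring

theorem cross_smul_left (c : ℝ) (x y : V7) : cross (c • x) y = c • cross x y := by
  ext i; fin_cases i <;> simp [cross] <;> ring

theorem cross_add_right (x y z : V7) : cross x (y + z) = cross x y + cross x z := by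
  ext i; fin_cases i <;> simp [cross] <;> ring

theorem cross_smul_right (c : ℝ) (x y : V7) : cross x (c • y) = c • cross x y := by
  ext i; fin_cases i <;> simp [cross] <;> ring

theorem cross_neg_right (x y : V7) : cross x (-y) = -cross x y := by
  ext i; fin_cases i <;> simp [cross] <;> ring

theorem cross_zero (x : V7) : cross x 0 = 0 := by
  ext i; fin_cases i <;> simp [cross]

theorem ip_comm (x y : V7) : ip x y = ip y x := by
  rw [ip_apply, ip_apply]; ring

/-- The characteristic identity of a cross product. With its polarization `cross_cross` and the
cyclic symmetry of ω₀ it governs the products of isotropic vectors below. -/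
theorem cross_cross_self (x y : V7) : cross x (cross x y) = ip x y • x - ip x x • y := by
  obtain ⟨s, hs, h2⟩ : ∃ s : ℝ, √2 = s ∧ s ^ 2 = 2 := ⟨√2, rfl, Real.sq_sqrt (by norm_num)⟩
  have e : ∀ a b c d : ℝ, s * (a * (s * b + c) - d) = 2 * a * b + s * (a * c - d) := by
    intro a b c d; linear_combination a * b * h2
  ext i
  simp only [cross, ip_apply, hs]
  fin_cases i <;> simp <;> ring_nf <;> simp only [h2] <;> ring

theorem ip_cross_left (x y : V7) : ip (cross x y) x = 0 := by
  rw [ip_apply]; simp [cross]; ring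

theorem ip_cross_cyclic (x y z : V7) : ip (cross x y) z = ip (cross y z) x := by
  rw [ip_apply, ip_apply]; simp [cross]; ring

theorem ip_cross_right (x y : V7) : ip (cross x y) y = 0 := by
  rw [ip_apply]; simp [cross]; ring

theorem cross_cross (x y z : V7) : cross x (cross y z) + cross y (cross x z) =
    ip x z • y + ip y z • x - (2 * ip x y) • z := by
  have h1 := cross_cross_self (x + y) z
  have h2 := cross_cross_self x z
  have h3 := cross_cross_self y z
  simp only [cross_add_left, cross_add_right, map_add, LinearMap.add_apply, h2, h3] at h1
  have h4 : ip x x • z + ip y x • z + (ip x y • z + ip y y • z) =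
      ip x x • z + ip y y • z + (2 * ip x y) • z := by
    rw [ip_comm y x, two_mul, add_smul]; abel
  ext i
  have h5 := congrFun h1 i
  simp only [Pi.add_apply, Pi.sub_apply, Pi.smul_apply, smul_eq_mul] at h5 ⊢
  rw [ip_comm y x] at h5
  linear_combination h5

theorem ip_nondegenerate {x : V7} (h : ∀ y, ip x y = 0) : x = 0 := by
  have e := fun i : Fin 7 => h (Pi.single i 1)
  simp only [ip_apply] at e
  have e0 := e 0
  have e1 := e 1
  have e2 := e 2
  have e3 := e 3
  have e4 := e 4
  have e5 := e 5
  have e6 := e 6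
  simp at e0 e1 e2 e3 e4 e5 e6
  ext i; fin_cases i <;> assumption

/-- The infinitesimal automorphisms of `ω₀` are derivations of the cross product. -/
theorem mulVec_cross {A : Mat7} (hA : A ∈ g2Star) (x y : V7) :
    A.mulVec (cross x y) = cross (A.mulVec x) y + cross x (A.mulVec y) := by
  rw [← sub_eq_zero]
  refine ip_nondegenerate fun z => ?_
  have h1 := hA x y z
  have h2 := ip_mulVec hA (cross x y) z
  rw [← ip_cross, ← ip_cross, ← ip_cross] at h1
  rw [map_sub, map_add, LinearMap.sub_apply, LinearMap.add_apply]
  linarith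

end G2StarHolonomy

/-! ### Adapted frames generated by isotropic triples -/

namespace G2StarHolonomy

/-- The linear map with the given images of the standard basis vectors. -/
def ofColumns (f : Fin 7 → V7) : Mat7 := Matrix.of fun i j => f j i

theorem ofColumns_mulVec (f : Fin 7 → V7) (x : V7) : (ofColumns f).mulVec x =
    x 0 • f 0 + x 1 • f 1 + x 2 • f 2 + x 3 • f 3 + x 4 • f 4 + x 5 • f 5 + x 6 • f 6 := by
  ext i
  rw [Matrix.mulVec, dotProduct, Fin.sum_univ_seven]
  simp [ofColumns, mul_comm]

set_option maxHeartbeats 2000000 in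
/-- Three isotropic, pairwise orthogonal vectors `a, b, c` with `ω₀(a, b, c) = √2` extend to an
adapted frame with second, third and fifth vector `a, b, c`. -/
theorem exists_isAut {a b c : V7} (haa : ip a a = 0) (hbb : ip b b = 0) (hcc : ip c c = 0)
    (hab : ip a b = 0) (hbc : ip b c = 0) (hca : ip c a = 0) (hw : ip (cross a b) c = √2) :
    ∃ g : GL (Fin 7) ℝ, IsAut g ∧ g.val.mulVec (Pi.single 0 1) = (√2 / 2) • cross a b ∧
      g.val.mulVec (Pi.single 1 1) = a ∧ g.val.mulVec (Pi.single 2 1) = b := by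
  obtain ⟨s, hs, h2⟩ : ∃ s : ℝ, √2 = s ∧ s ^ 2 = 2 := ⟨√2, rfl, Real.sq_sqrt (by norm_num)⟩
  have h3 : s ^ 3 = 2 * s := by rw [pow_succ, h2]
  rw [hs] at hw ⊢
  have hba := (ip_comm b a).trans hab
  have hcb := (ip_comm c b).trans hbc
  have hac := (ip_comm a c).trans hca
  -- a, b, c, their pairwise products r, p, q and n = a × (b × c) span the frame. What follows is
  -- their complete table of inner and cross products.
  obtain ⟨r, hr⟩ : ∃ r, cross a b = r := ⟨_, rfl⟩
  obtain ⟨p, hp⟩ : ∃ p, cross b c = p := ⟨_, rfl⟩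
  obtain ⟨q, hq⟩ : ∃ q, cross c a = q := ⟨_, rfl⟩
  obtain ⟨n, hn⟩ : ∃ n, cross a p = n := ⟨_, rfl⟩
  have hr' : cross b a = -r := by rw [cross_swap, hr]
  have hp' : cross c b = -p := by rw [cross_swap, hp]
  have hq' : cross a c = -q := by rw [cross_swap, hq]
  have hrc : ip r c = s := hr ▸ hw
  have hpa : ip p a = s := by rw [← hp, ← ip_cross_cyclic, hw]
  have hqb : ip q b = s := by rw [← hq, ip_cross_cyclic, hw]
  have har : cross a r = 0 := by rw [← hr, cross_cross_self, hab, haa]; simp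
  have haq : cross a q = 0 := by
    rw [← neg_neg q, ← hq', cross_neg_right, cross_cross_self, hac, haa]; simp
  have hbp : cross b p = 0 := by rw [← hp, cross_cross_self, hbc, hbb]; simp
  have hbr : cross b r = 0 := by
    rw [← neg_neg r, ← hr', cross_neg_right, cross_cross_self, hba, hbb]; simp
  have hcq : cross c q = 0 := by rw [← hq, cross_cross_self, hca, hcc]; simp
  have hcp : cross c p = 0 := by
    rw [← neg_neg p, ← hp', cross_neg_right, cross_cross_self, hcb, hcc]; simp
  have hbq : cross b q = n := by
    have := cross_cross a b c
    rw [hp, hq', hn, hac, hbc, hab, cross_neg_right] at this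
    simp at this
    rw [← sub_eq_add_neg, sub_eq_zero] at this
    exact this.symm
  have hcr : cross c r = n := by
    have := cross_cross b c a
    rw [hq, hr', hbq, hba, hca, hbc, cross_neg_right] at this
    simp at this
    rw [← sub_eq_add_neg, sub_eq_zero] at this
    exact this.symm
  have hpp : ip p p = 0 := by
    nth_rw 1 [← hp]; rw [ip_cross_cyclic, hcp]; simp
  have hqq : ip q q = 0 := by
    nth_rw 1 [← hq]; rw [ip_cross_cyclic, haq]; simp
  have hrr : ip r r = 0 := by
    nth_rw 1 [← hr]; rw [ip_cross_cyclic, hbr]; simp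
  have hnc : ip n c = 0 := by rw [← hcr, ip_cross_left]
  have hna : ip n a = 0 := by rw [← hn, ip_cross_left]
  have hnb : ip n b = 0 := by rw [← hbq, ip_cross_left]
  have hnp : ip n p = 0 := by rw [← hn, ip_cross_right]
  have hnq : ip n q = 0 := by rw [← hbq, ip_cross_right]
  have hnr : ip n r = 0 := by rw [← hcr, ip_cross_right]
  have hqp : ip q p = 0 := by rw [← hq, ip_cross_cyclic, hn, hnc]
  have hrq : ip r q = 0 := by rw [← hr, ip_cross_cyclic, hbq, hna]
  have hpr : ip p r = 0 := by rw [← hp, ip_cross_cyclic, hcr, hnb]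
  have hqa : ip q a = 0 := by rw [← hq, ip_cross_right]
  have hqc : ip q c = 0 := by rw [← hq, ip_cross_left]
  have hra : ip r a = 0 := by rw [← hr, ip_cross_left]
  have hrb : ip r b = 0 := by rw [← hr, ip_cross_right]
  have hpb : ip p b = 0 := by rw [← hp, ip_cross_left]
  have hpc : ip p c = 0 := by rw [← hp, ip_cross_right]
  have han : cross a n = s • a := by
    rw [← hn, cross_cross_self, ip_comm, hpa, haa]; simp
  have hbn : cross b n = s • b := by
    rw [← hbq, cross_cross_self, ip_comm, hqb, hbb]; simp
  have hcn : cross c n = s • c := by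
    rw [← hcr, cross_cross_self, ip_comm, hrc, hcc]; simp
  have hpn : cross p n = (-s) • p := by
    rw [← hn, cross_swap p a, cross_neg_right, cross_cross_self, hpa, hpp]; simp
  have hqn : cross q n = (-s) • q := by
    rw [← hbq, cross_swap q b, cross_neg_right, cross_cross_self, hqb, hqq]; simp
  have hrn : cross r n = (-s) • r := by
    rw [← hcr, cross_swap r c, cross_neg_right, cross_cross_self, hrc, hrr]; simp
  have hpa' : cross p a = -n := by rw [cross_swap, hn]
  have hqb' : cross q b = -n := by rw [cross_swap, hbq]
  have hrc' : cross r c = -n := by rw [cross_swap, hcr]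
  have hpq : cross p q = (2 * s) • c := by
    have := cross_cross p c a
    rw [hq, hpa', hpa, hca, hpc, cross_neg_right, hcn] at this
    simp at this
    rw [add_neg_eq_iff_eq_add] at this
    rw [this, two_mul, add_smul]
  have hqr : cross q r = (2 * s) • a := by
    have := cross_cross q a b
    rw [hr, hqb', hqb, hab, hqa, cross_neg_right, han] at this
    simp at this
    rw [add_neg_eq_iff_eq_add] at this
    rw [this, two_mul, add_smul]
  have hrp : cross r p = (2 * s) • b := by
    have := cross_cross r b c
    rw [hp, hrc', hrc, hbc, hrb, cross_neg_right, hbn] at this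
    simp at this
    rw [add_neg_eq_iff_eq_add] at this
    rw [this, two_mul, add_smul]
  have hnn : ip n n = -2 := by
    nth_rw 1 [← hn]
    rw [ip_cross_cyclic, hpn, map_smul, LinearMap.smul_apply, hpa, smul_eq_mul]
    linarith
  have hqp' : cross q p = -((2 * s) • c) := by rw [cross_swap, hpq]
  have hrq' : cross r q = -((2 * s) • a) := by rw [cross_swap, hqr]
  have hpr' : cross p r = -((2 * s) • b) := by rw [cross_swap, hrp]
  have hra' : cross r a = 0 := by rw [cross_swap, har, neg_zero]
  have hqa' : cross q a = 0 := by rw [cross_swap, haq, neg_zero]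
  have hpb' : cross p b = 0 := by rw [cross_swap, hbp, neg_zero]
  have hrb' : cross r b = 0 := by rw [cross_swap, hbr, neg_zero]
  have hqc' : cross q c = 0 := by rw [cross_swap, hcq, neg_zero]
  have hpc' : cross p c = 0 := by rw [cross_swap, hcp, neg_zero]
  have hna' : cross n a = -(s • a) := by rw [cross_swap, han]
  have hnb' : cross n b = -(s • b) := by rw [cross_swap, hbn]
  have hnc' : cross n c = -(s • c) := by rw [cross_swap, hcn]
  have hnp' : cross n p = -((-s) • p) := by rw [cross_swap, hpn]
  have hnq' : cross n q = -((-s) • q) := by rw [cross_swap, hqn]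
  have hnr' : cross n r = -((-s) • r) := by rw [cross_swap, hrn]
  -- The scalars invert the standard relations e₂ × e₃ = √2 e₁, e₃ × e₅ = √2 e₆, e₅ × e₂ = √2 e₇ and
  -- e₂ × (e₃ × e₅) = -√2 e₄.
  let G := ofColumns ![(s / 2) • r, a, b, (-s / 2) • n, c, (s / 2) • p, (s / 2) • q]
  have hG : ∀ x, G.mulVec x = x 0 • (s / 2) • r + x 1 • a + x 2 • b + x 3 • (-s / 2) • n +
      x 4 • c + x 5 • (s / 2) • p + x 6 • (s / 2) • q := ofColumns_mulVec _
  have hip : ∀ x y, ip (G.mulVec x) (G.mulVec y) = ip x y := by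
    intro x y
    rw [hG, hG]
    simp only [map_add, map_smul, LinearMap.add_apply, LinearMap.smul_apply, smul_eq_mul,
      haa, hbb, hcc, hab, hba, hbc, hcb, hac, hca, hrc, hpa, hqb, hpp, hqq, hrr, hnc, hna, hnb,
      hnp, hnq, hnr, hqp, hrq, hpr, hqa, hqc, hra, hrb, hpb, hpc, hnn,
      (ip_comm c r).trans hrc, (ip_comm a p).trans hpa, (ip_comm b q).trans hqb,
      (ip_comm c n).trans hnc, (ip_comm a n).trans hna, (ip_comm b n).trans hnb,
      (ip_comm p n).trans hnp, (ip_comm q n).trans hnq, (ip_comm r n).trans hnr,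
      (ip_comm p q).trans hqp, (ip_comm q r).trans hrq, (ip_comm r p).trans hpr,
      (ip_comm a q).trans hqa, (ip_comm c q).trans hqc, (ip_comm a r).trans hra,
      (ip_comm b r).trans hrb, (ip_comm b p).trans hpb, (ip_comm c p).trans hpc]
    rw [ip_apply]
    linear_combination (1 / 2) * (x 0 * y 4 + x 4 * y 0 + x 1 * y 5 + x 5 * y 1 + x 2 * y 6
      + x 6 * y 2 - x 3 * y 3) * h2
  have hcross : ∀ x y, cross (G.mulVec x) (G.mulVec y) = G.mulVec (cross x y) := by
    intro x y
    rw [hG, hG, hG]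
    simp only [cross_add_left, cross_add_right, cross_smul_left, cross_smul_right, cross_self,
      hr, hp, hq, hn, hr', hp', hq', har, haq, hbp, hbr, hcq, hcp, hbq, hcr, han, hbn, hcn, hpn,
      hqn, hrn, hpa', hqb', hrc', hpq, hqr, hrp, hqp', hrq', hpr', hra', hqa', hpb', hrb', hqc',
      hpc', hna', hnb', hnc', hnp', hnq', hnr']
    simp only [cross, hs]
    simp only [Matrix.cons_val]
    match_scalars <;> ring_nf <;> simp only [h2, h3] <;> ring
  -- A map that preserves a nondegenerate form has trivial kernel.
  have hdet : IsUnit G := by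
    rw [Matrix.isUnit_iff_isUnit_det, isUnit_iff_ne_zero]
    intro h0
    obtain ⟨v, hv, e⟩ := Matrix.exists_mulVec_eq_zero_iff.2 h0
    exact hv (ip_nondegenerate fun y => by rw [← hip, e]; simp)
  obtain ⟨g, hg⟩ := hdet
  refine ⟨g, ⟨fun x => ?_, fun x y => by rw [hg, hip]⟩, ?_, ?_, ?_⟩
  · rw [hg]
    have e : ∀ z : Fin 3 → V7, ![z 0, z 1, z 2] = z := by
      intro z; ext i j; fin_cases i <;> rfl
    rw [← e x, ← e fun i => G.mulVec (![x 0, x 1, x 2] i), ← ip_cross, ← ip_cross]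
    simp only [Matrix.cons_val]
    rw [hcross, hip]
  · rw [hg, hG, hr]; simp
  · rw [hg, hG]; simp
  · rw [hg, hG]; simp

end G2StarHolonomy

/-! ### The socle is isotropic and annihilated by ω₀ -/

namespace G2StarHolonomy

variable {h : LieSubalgebra ℝ Mat7}

theorem IsInvariant.sup {W W' : Submodule ℝ V7} (hW : IsInvariant h W) (hW' : IsInvariant h W') :
    IsInvariant h (W ⊔ W') := by
  intro A hA x hx
  obtain ⟨y, hy, z, hz, rfl⟩ := Submodule.mem_sup.1 hx
  rw [Matrix.mulVec_add]
  exact Submodule.add_mem_sup (hW A hA y hy) (hW' A hA z hz)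

theorem IsInvariant.inf {W W' : Submodule ℝ V7} (hW : IsInvariant h W) (hW' : IsInvariant h W') :
    IsInvariant h (W ⊓ W') :=
  fun A hA x hx => ⟨hW A hA x hx.1, hW' A hA x hx.2⟩

theorem isInvariant_bot : IsInvariant h ⊥ := by
  intro A _ x hx
  rw [(Submodule.mem_bot ℝ).1 hx, Matrix.mulVec_zero]
  exact Submodule.zero_mem _

theorem isInvariant_sSup {s : Set (Submodule ℝ V7)} (hs : ∀ W ∈ s, IsInvariant h W) :
    IsInvariant h (sSup s) := by
  intro A hA
  have : sSup s ≤ (sSup s).comap A.mulVecLin :=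
    sSup_le fun W hW w hw => Submodule.mem_sSup_of_mem hW (hs W hW A hA w hw)
  exact fun w hw => this hw

theorem isInvariant_socle : IsInvariant h (socle h) := isInvariant_sSup fun _ hW => hW.1

/-- The orthogonal complement of `W`. -/
def orth (W : Submodule ℝ V7) : Submodule ℝ V7 where
  carrier := {x | ∀ w ∈ W, ip x w = 0}
  zero_mem' := by simp
  add_mem' := by
    intro x y hx hy w hw
    rw [map_add, LinearMap.add_apply, hx w hw, hy w hw, add_zero]
  smul_mem' := by
    intro c x hx w hw
    rw [map_smul, LinearMap.smul_apply, hx w hw, smul_zero]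

theorem IsInvariant.orth (hg : h ≤ g2Star) {W : Submodule ℝ V7} (hW : IsInvariant h W) :
    IsInvariant h (orth W) := by
  intro A hA x hx w hw
  have := ip_mulVec (hg hA) x w
  rwa [hx _ (hW A hA w hw), add_zero] at this

/-- The socle is a semisimple subrepresentation. -/
theorem exists_isCompl_socle {W : Submodule ℝ V7} (hW : W ≤ socle h) (hi : IsInvariant h W) :
    ∃ W' ≤ socle h, IsInvariant h W' ∧ W ⊓ W' = ⊥ ∧ W ⊔ W' = socle h := by
  let P : Set (Submodule ℝ V7) := {W' | W' ≤ socle h ∧ IsInvariant h W' ∧ Disjoint W W'}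
  -- A maximal invariant subspace of the socle disjoint from W: an irreducible U outside W ⊔ W'
  -- could be added to it.
  obtain ⟨W', ⟨h1, h2, h3⟩, hmax⟩ := wellFounded_gt.has_min P ⟨⊥, bot_le, isInvariant_bot,
    disjoint_bot_right⟩
  refine ⟨W', h1, h2, disjoint_iff.1 h3, le_antisymm (sup_le hW h1) (sSup_le fun U hU => ?_)⟩
  have hUs : U ≤ socle h := le_sSup hU
  rcases hU.2.2 _ (inf_le_left : U ⊓ (W ⊔ W') ≤ U) (hU.1.inf (hi.sup h2)) with h4 | h4
  · have h5 : Disjoint (W ⊔ W') U := by rw [disjoint_iff, inf_comm]; exact h4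
    have h6 := hmax (W' ⊔ U) ⟨sup_le h1 hUs, h2.sup hU.1,
      h3.disjoint_sup_right_of_disjoint_sup_left h5⟩
    have h7 : W' = W' ⊔ U := by
      by_contra hne
      exact h6 (lt_of_le_of_ne le_sup_left hne)
    have h8 : U ≤ W' := by rw [h7]; exact le_sup_right
    exact h8.trans le_sup_right
  · exact inf_eq_left.1 h4

/-- A totally isotropic subspace has dimension at most three. -/
theorem finrank_le_three {W : Submodule ℝ V7} (hW : ∀ x ∈ W, ∀ y ∈ W, ip x y = 0) :
    Module.finrank ℝ W ≤ 3 := by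
  have hn : ip.Nondegenerate := by
    refine ⟨fun x hx => ip_nondegenerate hx, fun x hx => ip_nondegenerate fun y => ?_⟩
    rw [ip_comm]; exact hx y
  have h1 := LinearMap.BilinForm.finrank_orthogonal hn W
  have h2 : W ≤ ip.orthogonal W := fun x hx y hy => hW y hy x hx
  have h3 := Submodule.finrank_mono h2
  have h4 : Module.finrank ℝ V7 = 7 := by simp
  omega

theorem exists_ip_eq {x : Fin 3 → V7} (hx : LinearIndependent ℝ x) (c : Fin 3 → ℝ) :
    ∃ f, ∀ i, ip f (x i) = c i := by
  obtain ⟨ψ, hψ⟩ := LinearMap.exists_leftInverse_of_injective (Fintype.linearCombination ℝ x)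
    (LinearMap.ker_eq_bot.2 hx.fintypeLinearCombination_injective)
  have h1 : ∀ i, ψ (x i) = Pi.single i 1 := by
    intro i
    have := LinearMap.congr_fun hψ (Pi.single i 1)
    rwa [LinearMap.comp_apply, Fintype.linearCombination_apply_single, one_smul] at this
  let φ : V7 →ₗ[ℝ] ℝ := (Fintype.linearCombination ℝ c) ∘ₗ ψ
  have h2 : ∀ i, φ (x i) = c i := by
    intro i
    rw [LinearMap.comp_apply, h1, Fintype.linearCombination_apply_single, one_smul]
  let e : Fin 7 → V7 := fun i => Pi.single i 1
  -- The permutation and the sign at index 3 invert the matrix of the inner product, so this vector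
  -- represents φ.
  refine ⟨![φ (e 4), φ (e 5), φ (e 6), -φ (e 3), φ (e 0), φ (e 1), φ (e 2)], fun i => ?_⟩
  have h3 : x i = ∑ j, x i j • e j := pi_eq_sum_univ' (x i)
  have h4 := congrArg φ h3
  rw [map_sum, Fin.sum_univ_seven] at h4
  rw [← h2, h4, ip_apply]
  simp only [Matrix.cons_val, map_smul, smul_eq_mul]
  ring

theorem not_isIndecomposable_of_line {n : V7} (hi : ∀ A ∈ h, ∃ c : ℝ, A.mulVec n = c • n)
    (hn : ip n n ≠ 0) : ¬ IsIndecomposable h := by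
  intro hI
  have hne : n ≠ 0 := by rintro rfl; simp at hn
  have h1 : IsInvariant h (Submodule.span ℝ {n}) := by
    intro A hA w hw
    obtain ⟨c, rfl⟩ := Submodule.mem_span_singleton.1 hw
    obtain ⟨d, hd⟩ := hi A hA
    rw [Matrix.mulVec_smul, hd]
    exact Submodule.smul_mem _ _ (Submodule.smul_mem _ _ (Submodule.mem_span_singleton_self n))
  have h2 : IsNondegenerate (Submodule.span ℝ {n}) := by
    intro w hw hw'
    obtain ⟨c, rfl⟩ := Submodule.mem_span_singleton.1 hw
    have := hw' n (Submodule.mem_span_singleton_self n)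
    rw [map_smul, LinearMap.smul_apply, smul_eq_mul] at this
    rw [(mul_eq_zero.1 this).resolve_right hn, zero_smul]
  rcases hI _ h1 h2 with h3 | h3
  · exact hne (by simpa using h3)
  · have h4 := finrank_span_singleton (K := ℝ) hne
    rw [h3, finrank_top] at h4
    simp at h4

theorem ip_cross_cross {x y : V7} (hx : ip x x = 0) (hy : ip y y = 0) (hxy : ip x y = 0) :
    ip (cross x y) (cross x y) = 0 := by
  have h1 := cross_cross_self y x
  rw [ip_comm, hxy, hy, cross_swap x y, cross_neg_right] at h1
  simp at h1
  rw [ip_cross_cyclic, h1]; simp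

/-- The radical of the form on the socle has an invariant complement in the socle. That complement
is nondegenerate, and of dimension at most 3, hence zero. -/
theorem ip_socle (hg : h ≤ g2Star) (hI : IsIndecomposable h) (h3 : IsTypeIII h) {x y : V7}
    (hx : x ∈ socle h) (hy : y ∈ socle h) : ip x y = 0 := by
  obtain ⟨N, hN, hNi, hN1, hN2⟩ := exists_isCompl_socle (inf_le_left : socle h ⊓ orth (socle h) ≤ _)
    (isInvariant_socle.inf (isInvariant_socle.orth hg))
  have hnd : IsNondegenerate N := by
    intro w hw hw'
    have : w ∈ socle h ⊓ orth (socle h) ⊓ N := by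
      refine ⟨⟨hN hw, fun s hs => ?_⟩, hw⟩
      rw [← hN2] at hs
      obtain ⟨a, ha, b, hb, rfl⟩ := Submodule.mem_sup.1 hs
      rw [map_add, hw' b hb, ip_comm, ha.2 w (hN hw), add_zero]
    rwa [hN1, Submodule.mem_bot] at this
  have hb : N = ⊥ := by
    rcases hI N hNi hnd with h1 | h1
    · exact h1
    · exfalso
      have h4 : socle h = ⊤ := top_le_iff.1 (h1 ▸ hN)
      have h5 : Module.finrank ℝ (socle h) = 3 := h3
      rw [h4, finrank_top] at h5
      simp at h5
  rw [hb, sup_bot_eq] at hN2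
  rw [← hN2] at hx
  exact hx.2 y hy

theorem exists_basis_of_finrank {S : Submodule ℝ V7} (hS : Module.finrank ℝ S = 3) :
    ∃ x : Fin 3 → V7, LinearIndependent ℝ x ∧ (∀ i, x i ∈ S) ∧
      ∀ s ∈ S, ∃ c : Fin 3 → ℝ, s = c 0 • x 0 + c 1 • x 1 + c 2 • x 2 := by
  let b := Module.finBasisOfFinrankEq ℝ S hS
  refine ⟨fun i => b i, b.linearIndependent.map' S.subtype S.ker_subtype, fun i => (b i).2,
    fun s hs => ⟨b.repr ⟨s, hs⟩, ?_⟩⟩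
  have := b.sum_repr ⟨s, hs⟩
  rw [Fin.sum_univ_three] at this
  exact (congrArg Subtype.val this).symm

/-- If ω₀ is nonzero on a basis of the socle, then n = b₀ × (b₁ × b₂) is not isotropic, and h acts
on n by its trace on the socle: an invariant nondegenerate line. -/
theorem omega_socle (hg : h ≤ g2Star) (hI : IsIndecomposable h) (h3 : IsTypeIII h) {x y z : V7}
    (hx : x ∈ socle h) (hy : y ∈ socle h) (hz : z ∈ socle h) : ip (cross x y) z = 0 := by
  obtain ⟨b, -, hb, hsp⟩ := exists_basis_of_finrank h3
  have hip : ∀ i j, ip (b i) (b j) = 0 := fun i j => ip_socle hg hI h3 (hb i) (hb j)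
  by_cases hd : ip (cross (b 0) (b 1)) (b 2) = 0
  · have h1 : ∀ i j, ip (cross (b i) (b i)) (b j) = 0 := by intro i j; rw [cross_self]; simp
    have h2 : ∀ i j, ip (cross (b i) (b j)) (b j) = 0 := fun i j => ip_cross_right _ _
    have h2' : ∀ i j, ip (cross (b i) (b j)) (b i) = 0 := fun i j => ip_cross_left _ _
    have e1 : ip (cross (b 1) (b 2)) (b 0) = 0 := by rw [← ip_cross_cyclic, hd]
    have e2 : ip (cross (b 2) (b 0)) (b 1) = 0 := by rw [← ip_cross_cyclic, e1]
    have e3 : ip (cross (b 1) (b 0)) (b 2) = 0 := by rw [cross_swap]; simp [hd]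
    have e4 : ip (cross (b 2) (b 1)) (b 0) = 0 := by rw [cross_swap]; simp [e1]
    have e5 : ip (cross (b 0) (b 2)) (b 1) = 0 := by rw [cross_swap]; simp [e2]
    obtain ⟨c, rfl⟩ := hsp x hx
    obtain ⟨d, rfl⟩ := hsp y hy
    obtain ⟨e, rfl⟩ := hsp z hz
    simp [cross_add_left, cross_add_right, cross_smul_left, cross_smul_right, h1, h2, h2', hd, e1,
      e2, e3, e4, e5]
  · exfalso
    obtain ⟨p, hp⟩ : ∃ p, cross (b 1) (b 2) = p := ⟨_, rfl⟩
    obtain ⟨n, hn⟩ : ∃ n, cross (b 0) p = n := ⟨_, rfl⟩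
    have hpp : ip p p = 0 := hp ▸ ip_cross_cross (hip 1 1) (hip 2 2) (hip 1 2)
    have hpn : cross p n = (-ip p (b 0)) • p := by
      rw [← hn, cross_swap p, cross_neg_right, cross_cross_self, hpp]; simp
    have hnn : ip n n ≠ 0 := by
      nth_rw 1 [← hn]
      rw [ip_cross_cyclic, hpn, map_smul, LinearMap.smul_apply, smul_eq_mul, ← hp,
        ← ip_cross_cyclic]
      simpa using hd
    refine not_isIndecomposable_of_line (n := n) (fun A hA => ?_) hnn hI
    have hc : ∀ i j k, cross (b i) (cross (b j) (b k)) = -cross (b j) (cross (b i) (b k)) := by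
      intro i j k
      rw [eq_neg_iff_add_eq_zero, cross_cross, hip, hip, hip]; simp
    have hc0 : ∀ i k, cross (b i) (cross (b i) (b k)) = 0 := by
      intro i k; rw [cross_cross_self, hip, hip]; simp
    have e1 : cross (b 1) (cross (b 2) (b 0)) = n := by
      rw [cross_swap (b 0), cross_neg_right, hc, neg_neg, hp, hn]
    have e2 : cross (b 2) (cross (b 0) (b 1)) = n := by
      rw [cross_swap (b 1), cross_neg_right, hc, neg_neg, e1]
    have hc0' : ∀ i k, cross (b i) (cross (b k) (b i)) = 0 := by
      intro i k; rw [hc, cross_self, cross_zero, neg_zero]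
    obtain ⟨c, hc1⟩ := hsp _ (isInvariant_socle A hA _ (hb 0))
    obtain ⟨d, hd1⟩ := hsp _ (isInvariant_socle A hA _ (hb 1))
    obtain ⟨e, he1⟩ := hsp _ (isInvariant_socle A hA _ (hb 2))
    have hn' := hn
    rw [← hp] at hn'
    refine ⟨c 0 + d 1 + e 2, ?_⟩
    rw [← hn', mulVec_cross (hg hA), mulVec_cross (hg hA), hc1, hd1, he1]
    simp only [cross_add_left, cross_add_right, cross_smul_left, cross_smul_right, cross_self,
      cross_zero, hc0, hc0', hn', smul_zero, add_smul, add_zero, zero_add]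
    abel

end G2StarHolonomy

/-! ### Frames adapted to the socle -/

namespace G2StarHolonomy

variable {h : LieSubalgebra ℝ Mat7}

/-- The socle has the maximal dimension 3 of a totally isotropic subspace. -/
theorem mem_socle_of_isotropic (hg : h ≤ g2Star) (hI : IsIndecomposable h) (h3 : IsTypeIII h)
    {x : V7} (hx : ip x x = 0) (hxs : ∀ s ∈ socle h, ip x s = 0) : x ∈ socle h := by
  have h1 : Module.finrank ℝ ↥(socle h ⊔ Submodule.span ℝ {x}) ≤ 3 := by
    refine finrank_le_three fun y hy z hz => ?_
    obtain ⟨s, hs, _, ha, rfl⟩ := Submodule.mem_sup.1 hy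
    obtain ⟨t, ht, _, hb, rfl⟩ := Submodule.mem_sup.1 hz
    obtain ⟨a, rfl⟩ := Submodule.mem_span_singleton.1 ha
    obtain ⟨b, rfl⟩ := Submodule.mem_span_singleton.1 hb
    simp [ip_socle hg hI h3 hs ht, hxs t ht, hx, (ip_comm s x).trans (hxs s hs)]
  have h2 : socle h = socle h ⊔ Submodule.span ℝ {x} :=
    Submodule.eq_of_le_of_finrank_le le_sup_left (h1.trans (le_of_eq h3.symm))
  rw [h2]
  exact Submodule.mem_sup_right (Submodule.mem_span_singleton_self x)

theorem cross_mem_socle (hg : h ≤ g2Star) (hI : IsIndecomposable h) (h3 : IsTypeIII h)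
    {x y : V7} (hx : x ∈ socle h) (hy : y ∈ socle h) : cross x y ∈ socle h :=
  mem_socle_of_isotropic hg hI h3
    (ip_cross_cross (ip_socle hg hI h3 hx hx) (ip_socle hg hI h3 hy hy) (ip_socle hg hI h3 hx hy))
    fun _ hs => omega_socle hg hI h3 hx hy hs

/-- If all products vanish, take f dual to b₀ and orthogonal to b₁ and b₂. Then b₁ × f is isotropic
and orthogonal to the socle, hence in it, and the polarized identity reduces to 2 b₁ = 0. -/
theorem exists_cross_ne_zero (hg : h ≤ g2Star) (hI : IsIndecomposable h) (h3 : IsTypeIII h) :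
    ∃ x ∈ socle h, ∃ y ∈ socle h, cross x y ≠ 0 := by
  by_contra! hc
  obtain ⟨b, hli, hb, hsp⟩ := exists_basis_of_finrank h3
  have hip : ∀ i j, ip (b i) (b j) = 0 := fun i j => ip_socle hg hI h3 (hb i) (hb j)
  obtain ⟨f, hf⟩ := exists_ip_eq hli ![1, 0, 0]
  have hf0 : ip f (b 0) = 1 := hf 0
  have hf1 : ip f (b 1) = 0 := hf 1
  have h1 : cross (b 1) f ∈ socle h := by
    refine mem_socle_of_isotropic hg hI h3 ?_ fun s hs => ?_
    · have := cross_cross_self f (b 1)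
      rw [cross_swap (b 1) f, cross_neg_right, hf1] at this
      rw [ip_cross_cyclic, neg_eq_iff_eq_neg.1 this]
      simp [hip]
    · rw [← ip_cross_cyclic, hc s hs _ (hb 1)]; simp
  have h2 := cross_cross (b 0) f (b 1)
  rw [hc _ (hb 0) _ (hb 1), hip, hf1, ip_comm, hf0, cross_swap (b 1), cross_neg_right,
    hc _ (hb 0) _ h1] at h2
  simp [cross_zero] at h2
  exact hli.ne_zero 1 h2

theorem linearIndependent_cross {x y : V7} (hx : ip x x = 0) (hy : ip y y = 0) (hxy : ip x y = 0)
    (hz : cross x y ≠ 0) : LinearIndependent ℝ ![x, y, cross x y] := by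
  have hxz : cross x (cross x y) = 0 := by
    rw [cross_cross_self, hx, hxy]; simp
  have hyz : cross y (cross x y) = 0 := by
    rw [cross_swap y x, cross_neg_right, cross_cross_self, hy, ip_comm, hxy]; simp
  rw [Fintype.linearIndependent_iff]
  intro c hc
  rw [Fin.sum_univ_three] at hc
  simp only [Matrix.cons_val] at hc
  have h1 := congrArg (cross x) hc
  have h2 := congrArg (cross y) hc
  simp only [cross_add_right, cross_smul_right, cross_self, hxz, hyz, cross_zero, smul_zero,
    zero_add, add_zero, smul_eq_zero, hz, or_false, cross_swap x y, neg_eq_zero] at h1 h2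
  rw [h1, h2] at hc
  simp only [zero_smul, zero_add, smul_eq_zero, hz, or_false] at hc
  intro i
  fin_cases i
  · exact h2
  · exact h1
  · exact hc

theorem exists_socle_eq (hg : h ≤ g2Star) (hI : IsIndecomposable h) (h3 : IsTypeIII h) {x y : V7}
    (hx : x ∈ socle h) (hy : y ∈ socle h) (hz : cross x y ≠ 0) {s : V7} (hs : s ∈ socle h) :
    ∃ c : Fin 3 → ℝ, s = c 0 • x + c 1 • y + c 2 • cross x y := by
  have hli := linearIndependent_cross (ip_socle hg hI h3 hx hx) (ip_socle hg hI h3 hy hy)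
    (ip_socle hg hI h3 hx hy) hz
  have h1 : Submodule.span ℝ (Set.range ![x, y, cross x y]) = socle h := by
    refine Submodule.eq_of_le_of_finrank_le (Submodule.span_le.2 ?_) ?_
    · rintro _ ⟨i, rfl⟩
      fin_cases i
      · exact hx
      · exact hy
      · exact cross_mem_socle hg hI h3 hx hy
    · rw [finrank_span_eq_card hli]
      exact le_of_eq h3
  rw [← h1, Submodule.mem_span_range_iff_exists_fun] at hs
  obtain ⟨c, rfl⟩ := hs
  exact ⟨c, by rw [Fin.sum_univ_three]; rfl⟩

/-- The products of elements of the socle form a line. -/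
theorem exists_mulVec_eq_smul (hg : h ≤ g2Star) (hI : IsIndecomposable h) (h3 : IsTypeIII h)
    {x y : V7} (hx : x ∈ socle h) (hy : y ∈ socle h) (hz : cross x y ≠ 0) {D : Mat7}
    (hD : D ∈ g2Star) (hDs : ∀ s ∈ socle h, D.mulVec s ∈ socle h) :
    ∃ c : ℝ, D.mulVec (cross x y) = c • cross x y := by
  obtain ⟨c, hc⟩ := exists_socle_eq hg hI h3 hx hy hz (hDs x hx)
  obtain ⟨d, hd⟩ := exists_socle_eq hg hI h3 hx hy hz (hDs y hy)
  have hxz : cross x (cross x y) = 0 := by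
    rw [cross_cross_self, ip_socle hg hI h3 hx hx, ip_socle hg hI h3 hx hy]; simp
  have hyz : cross (cross x y) y = 0 := by
    rw [cross_swap, cross_swap y x, cross_neg_right, cross_cross_self, ip_socle hg hI h3 hy hy,
      ip_socle hg hI h3 hy hx]; simp
  -- The trace of D on the socle modulo the line of x × y.
  refine ⟨c 0 + d 1, ?_⟩
  rw [mulVec_cross hD, hc, hd]
  simp only [cross_add_left, cross_add_right, cross_smul_left, cross_smul_right, cross_self, hxz,
    hyz, smul_zero, add_zero, zero_add, add_smul]

theorem GL_conj_mulVec {g : GL (Fin 7) ℝ} (D : Mat7) {x y : V7}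
    (hxy : D.mulVec (g.val.mulVec x) = g.val.mulVec y) :
    ((g⁻¹).val * D * g.val).mulVec x = y := by
  rw [← Matrix.mulVec_mulVec, ← Matrix.mulVec_mulVec, hxy, GL_inv_mulVec]

/-- In a suitable adapted frame, the socle is the span of the first three basis vectors, and the
elements of `𝔤₂*` that preserve it have the form `h(A, v, u, y)`. -/
theorem exists_frame (hg : h ≤ g2Star) (hI : IsIndecomposable h) (h3 : IsTypeIII h) :
    ∃ g : GL (Fin 7) ℝ, IsAut g ∧ Shape (conjSub g h) ∧ ∀ D ∈ g2Star,
      (∀ s ∈ socle h, D.mulVec s ∈ socle h) → ∃ A v u y, (g⁻¹).val * D * g.val = hMat A v u y := by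
  obtain ⟨x₀, hx₀, y₀, hy₀, hz⟩ := exists_cross_ne_zero hg hI h3
  obtain ⟨z, hxy₀⟩ : ∃ z, cross x₀ y₀ = z := ⟨_, rfl⟩
  have hDz := fun D => exists_mulVec_eq_smul hg hI h3 hx₀ hy₀ hz (D := D)
  have hxz₀ : cross x₀ z = 0 := by
    rw [← hxy₀, cross_cross_self, ip_socle hg hI h3 hx₀ hx₀, ip_socle hg hI h3 hx₀ hy₀]; simp
  have hzy₀ : cross z y₀ = 0 := by
    rw [← hxy₀, cross_swap, cross_swap y₀ x₀, cross_neg_right, cross_cross_self,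
      ip_socle hg hI h3 hy₀ hy₀, ip_socle hg hI h3 hy₀ hx₀]; simp
  have hzs : z ∈ socle h := hxy₀ ▸ cross_mem_socle hg hI h3 hx₀ hy₀
  rw [hxy₀] at hz hDz
  obtain ⟨E, hE, hEi, hE1, hE2⟩ := exists_isCompl_socle
    ((Submodule.span_singleton_le_iff_mem z _).2 hzs) (fun A hA w hw => by
      obtain ⟨c, rfl⟩ := Submodule.mem_span_singleton.1 hw
      obtain ⟨d, hd⟩ := hDz A (hg hA) (isInvariant_socle A hA)
      rw [Matrix.mulVec_smul, hd]
      exact Submodule.smul_mem _ _ (Submodule.smul_mem _ _ (Submodule.mem_span_singleton_self z)))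
  have hproj : ∀ s ∈ socle h, ∃ c : ℝ, ∃ e ∈ E, s = c • z + e := by
    intro s hs
    rw [← hE2] at hs
    obtain ⟨_, ha, e, he, rfl⟩ := Submodule.mem_sup.1 hs
    obtain ⟨c, rfl⟩ := Submodule.mem_span_singleton.1 ha
    exact ⟨c, e, he, rfl⟩
  -- Passing to the components in the invariant complement E of the line of z does not change the
  -- product, since z annihilates both factors.
  obtain ⟨a, x, hx, rfl⟩ := hproj x₀ hx₀
  obtain ⟨b, y, hy, rfl⟩ := hproj y₀ hy₀
  simp only [cross_add_left, cross_smul_left, cross_add_right, cross_smul_right, cross_self,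
    smul_zero, zero_add] at hxz₀ hzy₀ hxy₀
  rw [hxz₀, hzy₀, smul_zero, smul_zero, zero_add, zero_add] at hxy₀
  have hxs := hE hx
  have hys := hE hy
  have hz' : cross x y ≠ 0 := hxy₀.symm ▸ hz
  have hip : ∀ {s t}, s ∈ socle h → t ∈ socle h → ip s t = 0 := fun hs ht =>
    ip_socle hg hI h3 hs ht
  obtain ⟨f, hf⟩ := exists_ip_eq (linearIndependent_cross (hip hxs hxs) (hip hys hys)
    (hip hxs hys) hz') ![0, 0, √2]
  have hfx : ip f x = 0 := hf 0
  have hfy : ip f y = 0 := hf 1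
  have hfz : ip f z = √2 := by rw [← hxy₀]; exact hf 2
  have h2 : √2 ≠ 0 := by positivity
  -- f pairs with x, y, z as 0, 0, √2; the multiple of z makes it isotropic without disturbing these
  -- values.
  obtain ⟨g, hga, hg0, hg1, hg2⟩ := exists_isAut (a := x) (b := y)
    (c := f - (ip f f / (2 * √2)) • z) (hip hxs hxs) (hip hys hys)
    (by
      simp only [map_sub, map_smul, LinearMap.sub_apply, LinearMap.smul_apply, smul_eq_mul, hfz,
        hip hzs hzs, ip_comm z f]
      field_simp
      ring)
    (hip hxs hys)
    (by rw [map_sub, map_smul, ip_comm, hfy, hip hys hzs]; simp)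
    (by rw [map_sub, map_smul, LinearMap.sub_apply, LinearMap.smul_apply, hfx, hip hzs hxs]; simp)
    (by rw [hxy₀, map_sub, map_smul, ip_comm, hfz, hip hzs hzs]; simp)
  rw [hxy₀] at hg0
  have hmap : S0.map g.val.mulVecLin = socle h := by
    apply le_antisymm
    · rintro _ ⟨w, ⟨w3, w4, w5, w6⟩, rfl⟩
      have hw : w = w 0 • Pi.single 0 1 + w 1 • Pi.single 1 1 + w 2 • Pi.single 2 1 := by
        ext i; fin_cases i <;> simp [w3, w4, w5, w6]
      rw [hw, Matrix.mulVecLin_apply, Matrix.mulVec_add, Matrix.mulVec_add, Matrix.mulVec_smul,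
        Matrix.mulVec_smul, Matrix.mulVec_smul, hg0, hg1, hg2]
      exact add_mem (add_mem (Submodule.smul_mem _ _ (Submodule.smul_mem _ _ hzs))
        (Submodule.smul_mem _ _ hxs)) (Submodule.smul_mem _ _ hys)
    · intro s hs
      obtain ⟨c, rfl⟩ := exists_socle_eq hg hI h3 hxs hys hz' hs
      refine ⟨(c 2 * √2) • Pi.single 0 1 + c 0 • Pi.single 1 1 + c 1 • Pi.single 2 1,
        by simp [mem_S0], ?_⟩
      rw [Matrix.mulVecLin_apply, Matrix.mulVec_add, Matrix.mulVec_add, Matrix.mulVec_smul,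
        Matrix.mulVec_smul, Matrix.mulVec_smul, hg0, hg1, hg2, hxy₀, smul_smul, mul_assoc,
        mul_div_assoc', Real.mul_self_sqrt (by norm_num)]
      norm_num
      abel
  have hcol : ∀ {M : Mat7} {j : Fin 7} {w : V7}, M.mulVec (Pi.single j 1) = w →
      ∀ i, M i j = w i := by
    rintro M j _ rfl i
    simp
  have hfr : ∀ D ∈ g2Star, (∀ s ∈ socle h, D.mulVec s ∈ socle h) →
      (g⁻¹).val * D * g.val = hMat (partE ((g⁻¹).val * D * g.val)) (((g⁻¹).val * D * g.val) 1 6)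
        ![-((g⁻¹).val * D * g.val) 6 4, ((g⁻¹).val * D * g.val) 5 4]
        ![((g⁻¹).val * D * g.val) 1 4, ((g⁻¹).val * D * g.val) 2 4] := by
    intro D hD hDs
    obtain ⟨c, hc⟩ := hDz D hD hDs
    have := hcol (GL_conj_mulVec (g := g) (x := Pi.single 0 1) (y := c • Pi.single 0 1) D (by
      rw [hg0, Matrix.mulVec_smul, Matrix.mulVec_smul, hc, hg0, smul_comm]))
    apply eq_hMat (conj_mem_g2Star hga.mem hD) <;> rw [this] <;> simp
  refine ⟨g, hga, ⟨fun T hT => ?_, fun W hW hWi => ?_⟩, fun D hD hDs => ⟨_, _, _, _, hfr D hD hDs⟩⟩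
  · rw [mem_conjSub] at hT
    have h4 := hfr _ (hg hT) (isInvariant_socle _ hT)
    rw [conj_conj] at h4
    -- E is spanned by x and y and is invariant under h, so the entries of T that map to the first
    -- axis vanish there; these entries are u.
    have hEs : ∀ s ∈ E, ∃ c d : ℝ, s = c • x + d • y := by
      intro s hs
      obtain ⟨c, hc⟩ := exists_socle_eq hg hI h3 hxs hys hz' (hE hs)
      refine ⟨c 0, c 1, ?_⟩
      have h5 : c 2 • z ∈ Submodule.span ℝ {z} ⊓ E := by
        refine ⟨Submodule.smul_mem _ _ (Submodule.mem_span_singleton_self z), ?_⟩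
        have : c 2 • z = s - (c 0 • x + c 1 • y) := by rw [hc, hxy₀]; abel
        rw [this]
        exact E.sub_mem hs (E.add_mem (E.smul_mem _ hx) (E.smul_mem _ hy))
      rw [hE1, Submodule.mem_bot] at h5
      rw [hc, hxy₀, h5, add_zero]
    obtain ⟨c, d, hcd⟩ := hEs _ (hEi _ hT x hx)
    obtain ⟨c', d', hcd'⟩ := hEs _ (hEi _ hT y hy)
    have h5 := hcol (GL_conj_mulVec (g := g) (x := Pi.single 1 1)
      (y := c • Pi.single 1 1 + d • Pi.single 2 1) _ (by
        rw [hg1, Matrix.mulVec_add, Matrix.mulVec_smul, Matrix.mulVec_smul, hcd, hg1, hg2])) 0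
    have h6 := hcol (GL_conj_mulVec (g := g) (x := Pi.single 2 1)
      (y := c' • Pi.single 1 1 + d' • Pi.single 2 1) _ (by
        rw [hg2, Matrix.mulVec_add, Matrix.mulVec_smul, Matrix.mulVec_smul, hcd', hg1, hg2])) 0
    rw [conj_conj] at h5 h6
    have h7 := congrFun (congrFun h4 0) 1
    have h8 := congrFun (congrFun h4 0) 2
    rw [h5] at h7
    rw [h6] at h8
    simp [hMat] at h7 h8
    refine ⟨partE T, T 1 6, ![T 1 4, T 2 4], h4.trans ?_⟩
    congr 1
    ext i; fin_cases i <;> simp [h7, h8]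
  · rw [isInvariant_conjSub] at hWi
    obtain ⟨W', h4, h5, h6, h7⟩ := exists_isCompl_socle (hmap ▸ Submodule.map_mono hW) hWi
    have hinj : Function.Injective g.val.mulVecLin := fun v w hvw => by
      rw [← GL_inv_mulVec g v, ← GL_inv_mulVec g w]
      exact congrArg _ hvw
    have hW' : (W'.comap g.val.mulVecLin).map g.val.mulVecLin = W' := by
      refine Submodule.map_comap_eq_self ?_
      intro w _
      exact ⟨(g⁻¹).val.mulVec w, GL_mulVec_inv g w⟩
    refine ⟨W'.comap g.val.mulVecLin, ?_, ?_, ?_, ?_⟩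
    · rw [← Submodule.map_le_map_iff_of_injective hinj, hW', hmap]; exact h4
    · rw [isInvariant_conjSub, hW']; exact h5
    · apply Submodule.map_injective_of_injective hinj
      rw [Submodule.map_inf _ hinj, hW', h6, Submodule.map_bot]
    · apply Submodule.map_injective_of_injective hinj
      rw [Submodule.map_sup, hW', h7, hmap]

end G2StarHolonomy

/-! ### The normalizer of h preserves the socle -/

namespace G2StarHolonomy

variable {h : LieSubalgebra ℝ Mat7}

theorem mulVecLin_injective (g : GL (Fin 7) ℝ) : Function.Injective g.val.mulVecLin := fun v w hvw => by
  rw [← GL_inv_mulVec g v, ← GL_inv_mulVec g w]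
  exact congrArg _ hvw

theorem map_comap_mulVecLin (g : GL (Fin 7) ℝ) (W : Submodule ℝ V7) :
    (W.comap g.val.mulVecLin).map g.val.mulVecLin = W :=
  Submodule.map_comap_eq_self fun w _ => ⟨(g⁻¹).val.mulVec w, GL_mulVec_inv g w⟩

theorem IsSimpleSubrep.map {g : GL (Fin 7) ℝ} {U : Submodule ℝ V7}
    (hU : IsSimpleSubrep (conjSub g h) U) : IsSimpleSubrep h (U.map g.val.mulVecLin) := by
  refine ⟨isInvariant_conjSub.1 hU.1, fun hb => hU.2.1 (map_mulVecLin_eq_bot hb), ?_⟩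
  intro W hW hWi
  rw [← map_comap_mulVecLin g W] at hWi ⊢
  rw [← isInvariant_conjSub] at hWi
  rw [← map_comap_mulVecLin g W, Submodule.map_le_map_iff_of_injective (mulVecLin_injective g)] at hW
  rcases hU.2.2 _ hW hWi with h1 | h1
  · left; rw [h1, Submodule.map_bot]
  · right; rw [h1]

/-- An element of the group normalizer permutes the irreducible subrepresentations. -/
theorem mulVec_mem_socle {g : GL (Fin 7) ℝ} (hg : conjSub g h = h) {s : V7} (hs : s ∈ socle h) :
    g.val.mulVec s ∈ socle h := by
  have h1 : socle h ≤ (socle h).comap g.val.mulVecLin := by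
    refine sSup_le fun U hU u hu => ?_
    have h2 : IsSimpleSubrep h (U.map g.val.mulVecLin) := by
      refine IsSimpleSubrep.map ?_
      rw [hg]; exact hU
    exact Submodule.mem_sSup_of_mem h2 (Submodule.mem_map_of_mem hu)
  exact h1 hs

open NormedSpace in
/-- A linear differential equation has solutions in each invariant subspace. -/
theorem exists_hasDerivAt {V : Type*} [NormedAddCommGroup V] [NormedSpace ℝ V]
    [FiniteDimensional ℝ V] {a : V → V} (ha : ∀ x y, a (x + y) = a x + a y)
    (ha' : ∀ (c : ℝ) x, a (c • x) = c • a x) {M : Submodule ℝ V} (hM : ∀ x ∈ M, a x ∈ M) {x : V}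
    (hx : x ∈ M) : ∃ X : ℝ → V, X 0 = x ∧ (∀ t, X t ∈ M) ∧ ∀ t, HasDerivAt X (a (X t)) t := by
  have : CompleteSpace V := FiniteDimensional.complete ℝ V
  let A : V →L[ℝ] V := LinearMap.toContinuousLinearMap ⟨⟨a, ha⟩, ha'⟩
  have hA : ∀ x, A x = a x := fun x => rfl
  refine ⟨fun t => exp (t • A) x, by simp, fun t => ?_, fun t => ?_⟩
  · have h1 := (NormedSpace.exp_series_hasSum_exp' (𝕂 := ℝ) (t • A)).mapL
      (ContinuousLinearMap.apply ℝ V x)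
    refine M.closed_of_finiteDimensional.mem_of_tendsto h1 (Filter.Eventually.of_forall fun s => ?_)
    refine Submodule.sum_mem _ fun n _ => ?_
    have h2 : ∀ n, ((t • A) ^ n) x ∈ M := by
      intro n
      induction n with
      | zero => simpa using hx
      | succ n ih =>
        rw [pow_succ']
        exact M.smul_mem t (hM _ ih)
    exact M.smul_mem _ (h2 n)
  · have h2 := (hasDerivAt_exp_smul_const' (𝕂 := ℝ) A t).clm_apply (hasDerivAt_const t x)
    simpa [hA] using h2

-- For E t = exp(tD), conjugation preserves M because the equation X' = [D, X] can be solved inside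
-- M and exp(-tD) X exp(tD) is constant. A subspace that contains the whole one-parameter group
-- contains its derivative D at 0, which turns group invariance into invariance under D.
open NormedSpace in
theorem exists_one_parameter_group {R : Type*} [NormedRing R] [NormedAlgebra ℝ R]
    [FiniteDimensional ℝ R] {D : R} {M : Submodule ℝ R} (hD : ∀ T ∈ M, D * T - T * D ∈ M) :
    ∃ E : ℝ → Rˣ, (∀ t, ∀ T ∈ M, (E t).val * T * ((E t)⁻¹).val ∈ M) ∧ (∀ t, E (-t) = (E t)⁻¹) ∧
      ∀ S : Submodule ℝ R, (∀ t, (E t).val ∈ S) → D ∈ S := by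
  have : CompleteSpace R := FiniteDimensional.complete ℝ R
  letI : NormedAlgebra ℚ R := NormedAlgebra.restrictScalars ℚ ℝ R
  have e1 : ∀ X : R, exp X * exp (-X) = 1 := by
    intro X
    rw [← exp_add_of_commute (Commute.neg_right (Commute.refl _)), add_neg_cancel, exp_zero]
  have e2 : ∀ X : R, exp (-X) * exp X = 1 := by
    intro X
    rw [← exp_add_of_commute (Commute.neg_left (Commute.refl _)), neg_add_cancel, exp_zero]
  refine ⟨fun t => ⟨_, _, e1 (t • D), e2 (t • D)⟩, fun t T hT => ?_, fun t => ?_, fun S hS => ?_⟩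
  · obtain ⟨X, h0, hX, hX'⟩ := exists_hasDerivAt (a := fun T => D * T - T * D)
      (fun x y => by noncomm_ring) (fun c x => by simp [smul_sub]) hD hT
    have hG : ∀ s, HasDerivAt (fun s : ℝ => exp (s • (-D)) * X s * exp (s • D)) 0 s := by
      intro s
      have h1 := hasDerivAt_exp_smul_const (𝕂 := ℝ) (-D) s
      have h3 := hasDerivAt_exp_smul_const' (𝕂 := ℝ) D s
      have h4 := (h1.mul (hX' s)).mul h3
      have h5 : (exp (s • -D) * -D * X s + exp (s • -D) * (D * X s - X s * D)) * exp (s • D) +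
          exp (s • -D) * X s * (D * exp (s • D)) = 0 := by noncomm_ring
      rw [← h5]
      exact h4
    have hc := is_const_of_deriv_eq_zero (fun s => (hG s).differentiableAt)
      (fun s => (hG s).deriv) t 0
    simp only [h0, zero_smul, exp_zero, one_mul, mul_one] at hc
    have h4 := e1 (t • D)
    change exp (t • D) * T * exp (-(t • D)) ∈ M
    have h5 : exp (t • D) * T * exp (-(t • D)) =
        (exp (t • D) * exp (-(t • D))) * X t * (exp (t • D) * exp (-(t • D))) := by
      rw [← hc, smul_neg]; simp only [mul_assoc]
    rw [h5, h4, one_mul, mul_one]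
    exact hX t
  · ext
    simp [neg_smul]
  · have h3 := hasDerivAt_exp_smul_const (𝕂 := ℝ) D 0
    simp only [zero_smul, exp_zero, one_mul] at h3
    rw [hasDerivAt_iff_tendsto_slope] at h3
    refine S.closed_of_finiteDimensional.mem_of_tendsto h3 (Filter.Eventually.of_forall ?_)
    intro t
    exact S.smul_mem _ (S.sub_mem (hS t) (hS 0))

attribute [local instance] Matrix.linftyOpNormedRing Matrix.linftyOpNormedAlgebra in
/-- The socle of the natural representation of `h` is preserved by the normalizer of `h`. -/
theorem mulVec_mem_socle_of_lie_mem {D : Mat7} (hD : ∀ T ∈ h, ⁅D, T⁆ ∈ h) {s : V7}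
    (hs : s ∈ socle h) : D.mulVec s ∈ socle h := by
  obtain ⟨E, hE, hE', hS⟩ := exists_one_parameter_group (M := h.toSubmodule) hD
  let ev : Mat7 →ₗ[ℝ] V7 := (LinearMap.applyₗ s).comp (Matrix.toLin'.toLinearMap : Mat7 →ₗ[ℝ] _)
  refine hS ((socle h).comap ev) fun t => mulVec_mem_socle (g := E t) ?_ hs
  ext T
  rw [mem_conjSub]
  constructor
  · intro hT
    have := hE (-t) _ hT
    rw [hE', inv_inv, conj_conj] at this
    exact this
  · exact hE t T

end G2StarHolonomy

/-! ### From left-invariant structures to holonomy data -/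

namespace G2StarHolonomy

variable {h : LieSubalgebra ℝ Mat7}

section Transfer

variable {𝔤 : Type*} [LieRing 𝔤] [LieAlgebra ℝ 𝔤]

/-- The connection `Λ` in terms of the basis `b`. -/
def frameConn (b : Module.Basis (Fin 7) ℝ 𝔤) (Λ : 𝔤 →ₗ[ℝ] Module.End ℝ 𝔤) : V7 →ₗ[ℝ] Mat7 :=
  (LinearMap.toMatrix b b).toLinearMap ∘ₗ Λ ∘ₗ b.equivFun.symm.toLinearMap

theorem frameConn_equivFun (b : Module.Basis (Fin 7) ℝ 𝔤) (Λ : 𝔤 →ₗ[ℝ] Module.End ℝ 𝔤) (X : 𝔤) :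
    frameConn b Λ (b.equivFun X) = LinearMap.toMatrix b b (Λ X) := by
  simp [frameConn]

theorem toMatrix_mulVec_equivFun (b : Module.Basis (Fin 7) ℝ 𝔤) (f : Module.End ℝ 𝔤) (X : 𝔤) :
    (LinearMap.toMatrix b b f).mulVec (b.equivFun X) = b.equivFun (f X) :=
  LinearMap.toMatrix_mulVec_repr b b f X

theorem toMatrix_lie (b : Module.Basis (Fin 7) ℝ 𝔤) (f k : Module.End ℝ 𝔤) :
    LinearMap.toMatrix b b ⁅f, k⁆ = ⁅LinearMap.toMatrix b b f, LinearMap.toMatrix b b k⁆ := by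
  rw [Ring.lie_def, Ring.lie_def, map_sub, LinearMap.toMatrix_mul, LinearMap.toMatrix_mul]

theorem bra_frameConn {b : Module.Basis (Fin 7) ℝ 𝔤} {Λ : 𝔤 →ₗ[ℝ] Module.End ℝ 𝔤}
    (hΛ : IsLeviCivita (frameMetric b) Λ) (X Y : 𝔤) :
    bra (frameConn b Λ) (b.equivFun X) (b.equivFun Y) = b.equivFun ⁅X, Y⁆ := by
  rw [bra, frameConn_equivFun, frameConn_equivFun, toMatrix_mulVec_equivFun,
    toMatrix_mulVec_equivFun, ← map_sub, hΛ.torsion_free]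

theorem cur_frameConn {b : Module.Basis (Fin 7) ℝ 𝔤} {Λ : 𝔤 →ₗ[ℝ] Module.End ℝ 𝔤}
    (hΛ : IsLeviCivita (frameMetric b) Λ) (X Y : 𝔤) :
    cur (frameConn b Λ) (b.equivFun X) (b.equivFun Y) = LinearMap.toMatrix b b (curvature Λ X Y) := by
  rw [cur, bra_frameConn hΛ, frameConn_equivFun, frameConn_equivFun, frameConn_equivFun, curvature,
    map_sub, toMatrix_lie]

theorem curvature_mem_infinitesimalHolonomy (Λ : 𝔤 →ₗ[ℝ] Module.End ℝ 𝔤) (X Y : 𝔤) :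
    curvature Λ X Y ∈ infinitesimalHolonomy Λ :=
  Submodule.subset_span ⟨0, Fin.elim0, X, Y, rfl⟩

/-- The defining formula of the next covariant derivative, solved for its commutator term: every
other term already lies in the span. -/
theorem lie_mem_infinitesimalHolonomy (Λ : 𝔤 →ₗ[ℝ] Module.End ℝ 𝔤) (X : 𝔤) {T : Module.End ℝ 𝔤}
    (hT : T ∈ infinitesimalHolonomy Λ) : ⁅Λ X, T⁆ ∈ infinitesimalHolonomy Λ := by
  induction hT using Submodule.span_induction with
  | mem T hT =>
    obtain ⟨k, V, Y, Z, rfl⟩ := hT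
    have h1 : nablaCurvature Λ (k + 1) (Fin.cons X V) Y Z ∈ infinitesimalHolonomy Λ :=
      Submodule.subset_span ⟨_, _, _, _, rfl⟩
    have h2 : ∀ V Y Z, nablaCurvature Λ k V Y Z ∈ infinitesimalHolonomy Λ :=
      fun V Y Z => Submodule.subset_span ⟨_, _, _, _, rfl⟩
    rw [nablaCurvature, Fin.cons_zero, Fin.tail_cons] at h1
    have h3 := (infinitesimalHolonomy Λ).sum_mem (t := Finset.univ) fun i _ =>
      h2 (Function.update V i (Λ X (V i))) Y Z
    have := add_mem (add_mem (add_mem h1 (h2 V Y (Λ X Z))) (h2 V (Λ X Y) Z)) h3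
    simpa using this
  | zero => rw [lie_zero]; exact Submodule.zero_mem _
  | add S T _ _ h1 h2 => rw [lie_add]; exact Submodule.add_mem _ h1 h2
  | smul c T _ h1 => rw [lie_smul]; exact Submodule.smul_mem _ c h1

/-- The minimality behind the field `least`: each covariant derivative is a commutator of
lower-order terms plus lower-order terms. -/
theorem infinitesimalHolonomy_le {Λ : 𝔤 →ₗ[ℝ] Module.End ℝ 𝔤} {W : Submodule ℝ (Module.End ℝ 𝔤)}
    (h1 : ∀ X Y, curvature Λ X Y ∈ W) (h2 : ∀ X, ∀ T ∈ W, ⁅Λ X, T⁆ ∈ W) :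
    infinitesimalHolonomy Λ ≤ W := by
  refine Submodule.span_le.2 ?_
  rintro _ ⟨k, V, X, Y, rfl⟩
  induction k generalizing X Y with
  | zero => exact h1 X Y
  | succ k ih =>
    rw [nablaCurvature]
    exact sub_mem (sub_mem (sub_mem (h2 _ _ (ih _ _ _)) (sum_mem fun i _ => ih _ _ _)) (ih _ _ _))
      (ih _ _ _)

theorem HasParallelG2StarStructureWithHolonomy.exists_holData
    (H : HasParallelG2StarStructureWithHolonomy 𝔤 h) (hI : IsIndecomposable h) :
    ∃ L, HolData L h := by
  obtain ⟨φ, b, Λ, hφ, hΛ, hp, hh⟩ := H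
  have hsurj : ∀ x : V7, ∃ X : 𝔤, b.equivFun X = x := b.equivFun.surjective
  have hmem : ∀ T, T ∈ h ↔ ∃ f ∈ infinitesimalHolonomy Λ, LinearMap.toMatrix b b f = T := by
    intro T
    rw [← LieSubalgebra.mem_toSubmodule, hh]; rfl
  refine ⟨frameConn b Λ, fun x => ?_, fun x y z => ?_, fun x y => ?_, fun x T hT => ?_,
    fun W h1 h2 T hT => ?_, hI⟩
  · obtain ⟨W, rfl⟩ := hsurj x
    rw [frameConn_equivFun, omega0_mem_iff]
    intro x y z
    obtain ⟨X, rfl⟩ := hsurj x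
    obtain ⟨Y, rfl⟩ := hsurj y
    obtain ⟨Z, rfl⟩ := hsurj z
    have h1 := hp W X Y Z
    rw [hφ] at h1
    have e : ∀ X Y Z : 𝔤, (omega0.compLinearMap b.equivFun.toLinearMap) ![X, Y, Z] =
        omega0 ![b.equivFun X, b.equivFun Y, b.equivFun Z] := by
      intro X Y Z
      rw [AlternatingMap.compLinearMap_apply]
      congr 1
      ext i j; fin_cases i <;> rfl
    simpa only [e, toMatrix_mulVec_equivFun] using h1
  · obtain ⟨X, rfl⟩ := hsurj x
    obtain ⟨Y, rfl⟩ := hsurj y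
    obtain ⟨Z, rfl⟩ := hsurj z
    simp only [bra_frameConn hΛ, ← map_add]
    have := lie_jacobi Z X Y
    rw [← lie_skew Z ⁅X, Y⁆, ← lie_skew X ⁅Y, Z⁆, ← lie_skew Y ⁅Z, X⁆, ← neg_add, ← neg_add,
      neg_eq_zero] at this
    rw [this, map_zero]
  · obtain ⟨X, rfl⟩ := hsurj x
    obtain ⟨Y, rfl⟩ := hsurj y
    rw [cur_frameConn hΛ, hmem]
    exact ⟨_, curvature_mem_infinitesimalHolonomy Λ X Y, rfl⟩
  · obtain ⟨X, rfl⟩ := hsurj x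
    obtain ⟨f, hf, rfl⟩ := (hmem T).1 hT
    rw [frameConn_equivFun, ← toMatrix_lie, hmem]
    exact ⟨_, lie_mem_infinitesimalHolonomy Λ X hf, rfl⟩
  · obtain ⟨f, hf, rfl⟩ := (hmem T).1 hT
    have h3 : infinitesimalHolonomy Λ ≤ W.comap (LinearMap.toMatrix b b).toLinearMap := by
      refine infinitesimalHolonomy_le (fun X Y => ?_) fun X T hT => ?_
      · have := h1 (b.equivFun X) (b.equivFun Y)
        rwa [cur_frameConn hΛ] at this
      · have := h2 (b.equivFun X) _ hT
        rw [LinearEquiv.coe_coe, frameConn_equivFun, ← toMatrix_lie] at this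
        exact this
    exact h3 hf

end Transfer

/-- An indecomposable infinitesimal holonomy algebra of type III is abelian. -/
theorem HolData.lie_eq_zero {L : V7 →ₗ[ℝ] Mat7} (H : HolData L h) (hg : h ≤ g2Star)
    (h3 : IsTypeIII h) {S T : Mat7} (hS : S ∈ h) (hT : T ∈ h) : ⁅S, T⁆ = 0 := by
  obtain ⟨g, hga, hsh, hD⟩ := exists_frame hg H.indec h3
  -- The connection normalizes h, so it preserves the socle, so in the chosen frame it has the form
  -- h(A, v, u, y).
  have hN : NF (conjConn g L) (conjSub g h) :=
    { H.conj hga, hsh with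
      shape_conn := fun x => hD _ (H.mem_g2 _) fun s hs =>
        mulVec_mem_socle_of_lie_mem (H.lie_mem _) hs }
  have h1 : ∀ T ∈ conjSub g h, ∃ v y, T = hMat 0 v 0 y := by
    intro T hT
    have h2 := hN.partE_eq_zero T hT
    obtain ⟨A, v, y, rfl⟩ := hN.shape T hT
    rw [partE_hMat] at h2
    exact ⟨v, y, by rw [h2]⟩
  obtain ⟨v, y, e⟩ := h1 ((g⁻¹).val * S * g.val) (by rwa [mem_conjSub, conj_conj'])
  obtain ⟨v', y', e'⟩ := h1 ((g⁻¹).val * T * g.val) (by rwa [mem_conjSub, conj_conj'])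
  have h4 := conj_lie g S T
  rw [e, e', hMat_lie] at h4
  rw [← conj_conj' g ⁅S, T⁆, ← h4]
  simp

end G2StarHolonomy

/-! ### Abelian indecomposable algebras act trivially on E -/

namespace G2StarHolonomy

variable {h k : LieSubalgebra ℝ Mat7}

theorem hMat_mulVec (A : Matrix (Fin 2) (Fin 2) ℝ) (v : ℝ) (y : Fin 2 → ℝ) (x : V7) :
    (hMat A v 0 y).mulVec x =
      ![A.trace * x 0 + √2 * v * x 3 - y 0 * x 5 - y 1 * x 6,
        A 0 0 * x 1 + A 0 1 * x 2 + y 0 * x 4 + v * x 6,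
        A 1 0 * x 1 + A 1 1 * x 2 + y 1 * x 4 - v * x 5,
        √2 * v * x 4, -A.trace * x 4, -A 0 0 * x 5 - A 1 0 * x 6, -A 0 1 * x 5 - A 1 1 * x 6] := by
  ext i
  rw [Matrix.mulVec, dotProduct, Fin.sum_univ_seven]
  fin_cases i <;> simp [hMat] <;> ring

theorem hMat_injective {A A' : Matrix (Fin 2) (Fin 2) ℝ} {v v' : ℝ} {u u' y y' : Fin 2 → ℝ}
    (e : hMat A v u y = hMat A' v' u' y') : A = A' ∧ v = v' ∧ y = y' := by
  refine ⟨by rw [← partE_hMat A v u y, e, partE_hMat], ?_, ?_⟩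
  · simpa [hMat] using congrFun (congrFun e 1) 6
  · ext i
    fin_cases i
    · simpa [hMat] using congrFun (congrFun e 1) 4
    · simpa [hMat] using congrFun (congrFun e 2) 4

theorem ip_single_three : ip (Pi.single 3 1) (Pi.single 3 1) = -1 := by
  rw [ip_apply]; simp

/-- If tr A ≠ 0, the combination e₄ - (√2 v / tr A) e₁ is in the kernel of this element, and
commutation forces every element of h to annihilate it; its line is nondegenerate. -/
theorem Shape.trace_eq_zero (H : Shape h) (hI : IsIndecomposable h)
    (hab : ∀ S ∈ h, ∀ T ∈ h, ⁅S, T⁆ = 0) {A : Matrix (Fin 2) (Fin 2) ℝ} {v : ℝ} {y : Fin 2 → ℝ}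
    (hT : hMat A v 0 y ∈ h) : A.trace = 0 := by
  by_contra ht
  refine not_isIndecomposable_of_line (n := ![-(√2 * v / A.trace), 0, 0, 1, 0, 0, 0])
    (fun S hS => ⟨0, ?_⟩) (by rw [ip_apply]; simp) hI
  obtain ⟨A', v', y', rfl⟩ := H.shape S hS
  have h1 := (hMat_bracket _ _ _ _ _ _ _ _).symm.trans (hab _ hT _ hS)
  rw [← hMat_zero] at h1
  have h2 := (hMat_injective h1).2.1
  simp at h2
  rw [hMat_mulVec, zero_smul]
  ext i; fin_cases i <;> simp
  field_simp
  linear_combination √2 * h2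

/-- If A is invertible, solve A (p, q) = y. Commutation gives A' (p, q) = y' for all elements of h,
which makes the four-dimensional space W below invariant and nondegenerate. -/
theorem Shape.det_eq_zero (H : Shape h) (hI : IsIndecomposable h)
    (hab : ∀ S ∈ h, ∀ T ∈ h, ⁅S, T⁆ = 0) {A : Matrix (Fin 2) (Fin 2) ℝ} {v : ℝ} {y : Fin 2 → ℝ}
    (hT : hMat A v 0 y ∈ h) : A 0 0 * A 1 1 - A 0 1 * A 1 0 = 0 := by
  by_contra hd
  obtain ⟨d, hd'⟩ : ∃ d, A 0 0 * A 1 1 - A 0 1 * A 1 0 = d := ⟨_, rfl⟩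
  obtain ⟨p, hp⟩ : ∃ p, p = (A 1 1 * y 0 - A 0 1 * y 1) / d := ⟨_, rfl⟩
  obtain ⟨q, hq⟩ : ∃ q, q = (A 0 0 * y 1 - A 1 0 * y 0) / d := ⟨_, rfl⟩
  rw [hd'] at hd
  have hy0 : A 0 0 * p + A 0 1 * q = y 0 := by
    rw [hp, hq]; field_simp; linear_combination y 0 * hd'
  have hy1 : A 1 0 * p + A 1 1 * q = y 1 := by
    rw [hp, hq]; field_simp; linear_combination y 1 * hd'
  have key : ∀ A' v' y', hMat A' v' 0 y' ∈ h →
      A' 0 0 * p + A' 0 1 * q = y' 0 ∧ A' 1 0 * p + A' 1 1 * q = y' 1 := by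
    intro A' v' y' hS
    have h1 := (hMat_bracket _ _ _ _ _ _ _ _).symm.trans (hab _ hT _ hS)
    rw [← hMat_zero] at h1
    obtain ⟨h2, -, h3⟩ := hMat_injective h1
    rw [H.trace_eq_zero hI hab hT, H.trace_eq_zero hI hab hS] at h3
    have e0 := congrFun h3 0
    have e1 := congrFun h3 1
    simp [Matrix.mulVec, dotProduct, Fin.sum_univ_two] at e0 e1
    have e00 := congrFun (congrFun h2 0) 0
    have e01 := congrFun (congrFun h2 0) 1
    have e10 := congrFun (congrFun h2 1) 0
    have e11 := congrFun (congrFun h2 1) 1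
    simp [Ring.lie_def, Matrix.mul_apply, Fin.sum_univ_two] at e00 e01 e10 e11
    have f0 : A 0 0 * (A' 0 0 * p + A' 0 1 * q - y' 0) + A 0 1 * (A' 1 0 * p + A' 1 1 * q - y' 1) = 0 := by
      linear_combination p * e00 + q * e01 - e0 + A' 0 0 * hy0 + A' 0 1 * hy1
    have f1 : A 1 0 * (A' 0 0 * p + A' 0 1 * q - y' 0) + A 1 1 * (A' 1 0 * p + A' 1 1 * q - y' 1) = 0 := by
      linear_combination p * e10 + q * e11 - e1 + A' 1 0 * hy0 + A' 1 1 * hy1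
    constructor
    · apply sub_eq_zero.1
      apply (mul_eq_zero.1 _).resolve_left hd
      linear_combination A 1 1 * f0 - A 0 1 * f1 - (A' 0 0 * p + A' 0 1 * q - y' 0) * hd'
    · apply sub_eq_zero.1
      apply (mul_eq_zero.1 _).resolve_left hd
      linear_combination A 0 0 * f1 - A 1 0 * f0 - (A' 1 0 * p + A' 1 1 * q - y' 1) * hd'
  let W : Submodule ℝ V7 :=
    { carrier := {x | x 3 = 0 ∧ x 4 = 0 ∧ x 0 = p * x 5 + q * x 6}
      zero_mem' := by simp
      add_mem' := by
        rintro x y ⟨h1, h2, h3⟩ ⟨k1, k2, k3⟩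
        refine ⟨by simp [h1, k1], by simp [h2, k2], ?_⟩
        simp only [Pi.add_apply]; rw [h3, k3]; ring
      smul_mem' := by
        rintro c x ⟨h1, h2, h3⟩
        refine ⟨by simp [h1], by simp [h2], ?_⟩
        simp only [Pi.smul_apply, smul_eq_mul]; rw [h3]; ring }
  have hWi : IsInvariant h W := by
    rintro S hS x ⟨h1, h2, h3⟩
    obtain ⟨A', v', y', rfl⟩ := H.shape S hS
    obtain ⟨k1, k2⟩ := key _ _ _ hS
    have ht := H.trace_eq_zero hI hab hS
    rw [hMat_mulVec]
    refine ⟨by simp [h2], by simp [h2], ?_⟩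
    simp only [Matrix.cons_val, ht, h1]
    linear_combination x 5 * k1 + x 6 * k2
  have hWn : IsNondegenerate W := by
    rintro w ⟨h1, h2, h3⟩ hw
    have e1 := hw (Pi.single 1 1) ⟨by simp, by simp, by simp⟩
    have e2 := hw (Pi.single 2 1) ⟨by simp, by simp, by simp⟩
    have e3 := hw ![p, 0, 0, 0, 0, 1, 0] ⟨by simp, by simp, by simp⟩
    have e4 := hw ![q, 0, 0, 0, 0, 0, 1] ⟨by simp, by simp, by simp⟩
    rw [ip_apply] at e1 e2 e3 e4
    simp [h2] at e1 e2 e3 e4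
    simp [e1, e2] at h3
    ext i; fin_cases i <;> simp [h1, h2, h3, e1, e2, e3, e4]
  rcases hI W hWi hWn with h1 | h1
  · have : (Pi.single 1 1 : V7) ∈ W := ⟨by simp, by simp, by simp⟩
    rw [h1, Submodule.mem_bot] at this
    simpa using congrFun this 1
  · have : (Pi.single 3 1 : V7) ∈ W := by rw [h1]; trivial
    simpa using this.1

/-- By the two preceding lemmas A is nilpotent. If A ≠ 0, its kernel in E is an invariant line; an
invariant complement would be a second eigenline of a nonzero nilpotent map. -/
theorem Shape.partE_eq_zero_of_abelian (H : Shape h) (hI : IsIndecomposable h)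
    (hab : ∀ S ∈ h, ∀ T ∈ h, ⁅S, T⁆ = 0) {T : Mat7} (hT : T ∈ h) : partE T = 0 := by
  obtain ⟨A, v, y, rfl⟩ := H.shape T hT
  rw [partE_hMat]
  by_contra hA
  have htr := H.trace_eq_zero hI hab hT
  have hdet := H.det_eq_zero hI hab hT
  rw [Matrix.trace_fin_two] at htr
  have h11 : A 1 1 = -A 0 0 := by linarith
  rw [h11] at hdet
  have hcomm : ∀ S ∈ h, ∃ A' v' y', S = hMat A' v' 0 y' ∧
      A 0 1 * A' 1 0 = A' 0 1 * A 1 0 ∧ 2 * A 0 0 * A' 0 1 = A 0 1 * (A' 0 0 - A' 1 1) ∧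
      2 * A 0 0 * A' 1 0 = A 1 0 * (A' 0 0 - A' 1 1) := by
    intro S hS
    obtain ⟨A', v', y', rfl⟩ := H.shape S hS
    have h1 := (hMat_bracket _ _ _ _ _ _ _ _).symm.trans (hab _ hT _ hS)
    rw [← hMat_zero] at h1
    obtain ⟨h2, -, h3⟩ := hMat_injective h1
    have e00 := congrFun (congrFun h2 0) 0
    have e01 := congrFun (congrFun h2 0) 1
    have e10 := congrFun (congrFun h2 1) 0
    simp [Ring.lie_def, Matrix.mul_apply, Fin.sum_univ_two, h11] at e00 e01 e10
    exact ⟨A', v', y', rfl, by linear_combination e00, by linear_combination e01,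
      by linear_combination -e10⟩
  -- The vector (A₀₁, -A₀₀) spans the kernel unless it is zero, and then (0, A₁₀) does.
  by_cases hc : (A 0 1, -A 0 0) = ((0 : ℝ), (0 : ℝ))
  · obtain ⟨h1, h2⟩ := Prod.mk.inj hc
    have h2 : A 0 0 = 0 := by linarith
    have h10 : A 1 0 ≠ 0 := by
      intro h10
      apply hA
      ext i j; fin_cases i <;> fin_cases j <;> simp [h1, h2, h10, h11]
    obtain ⟨r, s, hrs, he⟩ := H.split (p := 0) (q := A 1 0) (by simpa using h10) (by
      intro S hS
      obtain ⟨A', v', y', rfl, k1, k2, k3⟩ := hcomm S hS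
      rw [partE_hMat, ConnData.Eigen]
      rw [h1] at k1
      linear_combination (A 1 0) * k1)
    have := he _ hT
    rw [partE_hMat, ConnData.Eigen, h11, h2, h1] at this
    have h3 : r * r * A 1 0 = 0 := by linear_combination this
    have h4 : r = 0 := by simpa [h10] using h3
    rw [h4] at hrs
    simp at hrs
  · obtain ⟨r, s, hrs, he⟩ := H.split hc (by
      intro S hS
      obtain ⟨A', v', y', rfl, k1, k2, k3⟩ := hcomm S hS
      rw [partE_hMat, ConnData.Eigen]
      linear_combination A 0 1 * k1 - A 0 0 * k2 + A' 0 1 * (-hdet))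
    have := he _ hT
    rw [partE_hMat, ConnData.Eigen, h11] at this
    have h1 : (1 : ℝ) = 0 := by
      linear_combination -A 0 1 * this - r ^ 2 * hdet - (A 0 0 * r + A 0 1 * s + 1) * hrs
    exact one_ne_zero h1

end G2StarHolonomy

/-! ### Conjugation of abelian algebras to the two models -/

namespace G2StarHolonomy

variable {h k l : LieSubalgebra ℝ Mat7}

theorem IsConjugate.trans (h1 : IsConjugate h k) (h2 : IsConjugate k l) : IsConjugate h l := by
  obtain ⟨g, hg, e⟩ := h1
  obtain ⟨g', hg', e'⟩ := h2
  refine ⟨g' * g, G2Star.mul_mem hg' hg, fun A => ?_⟩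
  rw [e, e', mul_inv_rev, Units.val_mul, Units.val_mul]
  simp only [mul_assoc]

theorem isConjugate_conjSub {g : GL (Fin 7) ℝ} (hg : g ∈ G2Star) : IsConjugate h (conjSub g h) := by
  refine ⟨g⁻¹, G2Star.inv_mem hg, fun A => ?_⟩
  rw [mem_conjSub, inv_inv, conj_conj']

theorem IsConjugate.finrank_eq (hc : IsConjugate h k) :
    Module.finrank ℝ h = Module.finrank ℝ k := by
  obtain ⟨g, hg, e⟩ := hc
  let f : Mat7 ≃ₗ[ℝ] Mat7 :=
    { toFun := fun A => g.val * A * (g⁻¹).val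
      invFun := fun A => (g⁻¹).val * A * g.val
      left_inv := conj_conj g
      right_inv := conj_conj' g
      map_add' := fun A B => by simp [mul_add, add_mul]
      map_smul' := fun c A => by simp }
  have h1 : k.toSubmodule = h.toSubmodule.map f.toLinearMap := by
    ext B
    constructor
    · intro hB
      refine ⟨f.symm B, ?_, f.apply_symm_apply B⟩
      have : B ∈ k := hB
      rw [← f.apply_symm_apply B] at this
      exact (e _).2 this
    · rintro ⟨A, hA, rfl⟩
      exact (e A).1 hA
  have h2 := LinearEquiv.finrank_map_eq f h.toSubmodule
  change Module.finrank ℝ h.toSubmodule = Module.finrank ℝ k.toSubmodule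
  rw [h1, h2]

theorem mem_m101 {A : Mat7} : A ∈ m101 ↔ ∃ v c : ℝ, A = hMat 0 v 0 ![c, 0] := by
  constructor
  · rintro ⟨v, y, hy, rfl⟩
    have hy : y 1 = 0 := hy
    refine ⟨v, y 0, ?_⟩
    congr 1
    ext i; fin_cases i <;> simp [hy]
  · rintro ⟨v, c, rfl⟩
    exact ⟨v, _, rfl, rfl⟩

theorem mem_m102 {A : Mat7} : A ∈ m102 ↔ ∃ (v : ℝ) (y : Fin 2 → ℝ), A = hMat 0 v 0 y := by
  constructor
  · rintro ⟨v, y, -, rfl⟩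
    exact ⟨v, y, rfl⟩
  · rintro ⟨v, y, rfl⟩
    exact ⟨v, y, trivial, rfl⟩

/-- The linear map `(v, y) ↦ h(0, v, 0, y)`. -/
def hMatLinear : ℝ × (Fin 2 → ℝ) →ₗ[ℝ] Mat7 where
  toFun p := hMat 0 p.1 0 p.2
  map_add' p q := (hMat_add _ _ _ _).symm
  map_smul' c p := (hMat_smul _ _ _).symm

theorem hMatLinear_injective : Function.Injective hMatLinear := fun p q hpq => by
  have := hMat_injective hpq
  exact Prod.ext this.2.1 this.2.2

theorem finrank_m102 : Module.finrank ℝ m102 = 3 := by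
  have h1 : m102.toSubmodule = LinearMap.range hMatLinear := by
    ext A
    rw [LieSubalgebra.mem_toSubmodule, mem_m102, LinearMap.mem_range]
    constructor
    · rintro ⟨v, y, rfl⟩; exact ⟨(v, y), rfl⟩
    · rintro ⟨p, rfl⟩; exact ⟨p.1, p.2, rfl⟩
  change Module.finrank ℝ m102.toSubmodule = 3
  rw [h1, LinearMap.finrank_range_of_inj hMatLinear_injective]
  simp

theorem finrank_m101 : Module.finrank ℝ m101 = 2 := by
  let f : ℝ × ℝ →ₗ[ℝ] Mat7 :=
    hMatLinear ∘ₗ LinearMap.prodMap LinearMap.id (LinearMap.single ℝ (fun _ : Fin 2 => ℝ) 0)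
  have hf : ∀ v c, f (v, c) = hMat 0 v 0 ![c, 0] := by
    intro v c
    change hMat 0 v 0 (Pi.single 0 c) = _
    congr 1
    ext i; fin_cases i <;> simp
  have h1 : m101.toSubmodule = LinearMap.range f := by
    ext A
    rw [LieSubalgebra.mem_toSubmodule, mem_m101, LinearMap.mem_range]
    constructor
    · rintro ⟨v, y, rfl⟩; exact ⟨(v, y), hf v y⟩
    · rintro ⟨p, rfl⟩; exact ⟨p.1, p.2, hf p.1 p.2⟩
  have h2 : Function.Injective f := by
    rintro ⟨v, c⟩ ⟨v', c'⟩ e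
    rw [hf, hf] at e
    obtain ⟨-, e1, e2⟩ := hMat_injective e
    exact Prod.ext e1 (congrFun e2 0)
  change Module.finrank ℝ m101.toSubmodule = 2
  rw [h1, LinearMap.finrank_range_of_inj h2]
  simp

/-- The exponential of the matrix `h(0, 0, (0, t), 0)`. -/
def unipotentMat (t : ℝ) : Mat7 :=
  !![1, -t, 0, 0, 0, 0, 0;
     0, 1, 0, 0, 0, 0, 0;
     0, 0, 1, √2 * t, 0, 0, t ^ 2;
     0, 0, 0, 1, 0, 0, √2 * t;
     0, 0, 0, 0, 1, 0, 0;
     0, 0, 0, 0, t, 1, 0;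
     0, 0, 0, 0, 0, 0, 1]

theorem unipotentMat_mulVec (t : ℝ) (x : V7) : (unipotentMat t).mulVec x =
    ![x 0 - t * x 1, x 1, x 2 + √2 * t * x 3 + t ^ 2 * x 6, x 3 + √2 * t * x 6, x 4,
      t * x 4 + x 5, x 6] := by
  ext i
  rw [Matrix.mulVec, dotProduct, Fin.sum_univ_seven]
  fin_cases i <;> simp [unipotentMat] <;> ring

theorem unipotentMat_mul_neg (t : ℝ) : unipotentMat t * unipotentMat (-t) = 1 := by
  apply Matrix.ext_of_mulVec_single
  intro i
  have h2 : √2 ^ 2 = 2 := Real.sq_sqrt (by norm_num)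
  rw [← Matrix.mulVec_mulVec, unipotentMat_mulVec, unipotentMat_mulVec, Matrix.one_mulVec]
  ext j
  fin_cases j <;> simp <;> ring_nf
  rw [h2]; ring

/-- `unipotentMat` as an invertible matrix. -/
def unipotentGL (t : ℝ) : GL (Fin 7) ℝ where
  val := unipotentMat t
  inv := unipotentMat (-t)
  val_inv := unipotentMat_mul_neg t
  inv_val := by simpa using unipotentMat_mul_neg (-t)

theorem unipotentGL_mem (t : ℝ) : unipotentGL t ∈ G2Star := by
  intro x
  have e : ∀ x, (unipotentGL t).val.mulVec x = _ := unipotentMat_mulVec t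
  obtain ⟨s, hs, h2⟩ : ∃ s : ℝ, √2 = s ∧ s ^ 2 = 2 := ⟨√2, rfl, Real.sq_sqrt (by norm_num)⟩
  have h3 : s ^ 3 = 2 * s := by rw [pow_succ, h2]
  simp only [e, omega0_apply, hs, Matrix.cons_val]
  ring_nf
  simp only [h2, h3]
  ring

/-- The coupling of u and v in `hMat_bracket`, integrated: it shifts y along v by a multiple of (0,
1). -/
theorem unipotentGL_conj (t v : ℝ) (y : Fin 2 → ℝ) :
    (unipotentGL t).val * hMat 0 v 0 y * (unipotentGL t)⁻¹.val =
      hMat 0 v 0 ![y 0, y 1 + 3 * t * v] := by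
  have h2 : √2 ^ 2 = 2 := Real.sq_sqrt (by norm_num)
  have h1 : (unipotentGL t).val * hMat 0 v 0 y =
      hMat 0 v 0 ![y 0, y 1 + 3 * t * v] * (unipotentGL t).val := by
    apply Matrix.ext_of_mulVec_single
    intro i
    have e : ∀ x, (unipotentGL t).val.mulVec x = _ := unipotentMat_mulVec t
    rw [← Matrix.mulVec_mulVec, ← Matrix.mulVec_mulVec, e, e, hMat_mulVec, hMat_mulVec]
    ext j
    fin_cases j <;> simp <;> ring_nf <;> simp only [h2] <;> ring
  rw [h1, mul_assoc, GL_mul_inv, mul_one]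

theorem Shape.exists_mem (hI : IsIndecomposable h) (hf : ∀ T ∈ h, ∃ v y, T = hMat 0 v 0 y) :
    ∃ y, hMat 0 1 0 y ∈ h := by
  by_contra! hc
  refine not_isIndecomposable_of_line (n := Pi.single 3 1) (fun T hT => ⟨0, ?_⟩)
    (by rw [ip_single_three]; norm_num) hI
  obtain ⟨v, y, rfl⟩ := hf T hT
  have hv : v = 0 := by
    by_contra hv
    apply hc (v⁻¹ • y)
    have := h.smul_mem v⁻¹ hT
    rwa [hMat_smul, inv_mul_cancel₀ hv] at this
  rw [hMat_mulVec, hv, zero_smul]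
  ext i; fin_cases i <;> simp

/-- Otherwise h is spanned by h(0, 1, 0, z), and the three-dimensional space W spanned by e₁, e₅ and
a modification of e₄ by z is invariant and nondegenerate. -/
theorem exists_mem_ne_zero (hI : IsIndecomposable h) (hf : ∀ T ∈ h, ∃ v y, T = hMat 0 v 0 y)
    {z : Fin 2 → ℝ} (hz : hMat 0 1 0 z ∈ h) : ∃ w, w ≠ 0 ∧ hMat 0 0 0 w ∈ h := by
  by_contra! hc
  have h1 : ∀ T ∈ h, ∃ v : ℝ, T = hMat 0 v 0 (v • z) := by
    intro T hT
    obtain ⟨v, y, rfl⟩ := hf T hT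
    refine ⟨v, ?_⟩
    have h2 := h.add_mem hT (h.smul_mem (-v) hz)
    rw [hMat_smul, hMat_add, mul_one, add_neg_cancel] at h2
    have h3 : y + -v • z = 0 := by
      by_contra hne
      exact hc _ hne h2
    rw [neg_smul, add_neg_eq_zero] at h3
    rw [h3]
  let W : Submodule ℝ V7 :=
    { carrier := {x | x 5 = 0 ∧ x 6 = 0 ∧ √2 * x 1 = z 0 * x 3 ∧ √2 * x 2 = z 1 * x 3}
      zero_mem' := by simp
      add_mem' := by
        rintro x y ⟨h1, h2, h3, h4⟩ ⟨k1, k2, k3, k4⟩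
        refine ⟨by simp [h1, k1], by simp [h2, k2], ?_, ?_⟩ <;>
          simp only [Pi.add_apply, mul_add, h3, h4, k3, k4]
      smul_mem' := by
        rintro c x ⟨h1, h2, h3, h4⟩
        refine ⟨by simp [h1], by simp [h2], ?_, ?_⟩ <;> simp only [Pi.smul_apply, smul_eq_mul]
        · linear_combination c * h3
        · linear_combination c * h4 }
  have h0 : √2 ≠ 0 := by positivity
  have hq : √2 * √2 = 2 := Real.mul_self_sqrt (by norm_num)
  have e0 : (Pi.single 0 1 : V7) ∈ W := ⟨by simp, by simp, by simp, by simp⟩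
  have e3 : (![0, z 0 / √2, z 1 / √2, 1, 0, 0, 0] : V7) ∈ W :=
    ⟨by simp, by simp, by simp; field_simp, by simp; field_simp⟩
  have e4 : (Pi.single 4 1 : V7) ∈ W := ⟨by simp, by simp, by simp, by simp⟩
  have hWi : IsInvariant h W := by
    rintro S hS x ⟨h1', h2, h3, h4⟩
    obtain ⟨v, rfl⟩ := h1 S hS
    rw [hMat_mulVec]
    refine ⟨by simp, by simp, ?_, ?_⟩ <;> simp [h1', h2] <;> ring
  have hWn : IsNondegenerate W := by
    rintro w ⟨h1, h2, h3, h4⟩ hw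
    have f0 := hw _ e0
    have f3 := hw _ e3
    have f4 := hw _ e4
    rw [ip_apply] at f0 f3 f4
    simp [h1, h2] at f0 f3 f4
    simp [f3, h0] at h3 h4
    ext i; fin_cases i <;> simp [h1, h2, h3, h4, f0, f3, f4]
  rcases hI W hWi hWn with h1 | h1
  · rw [h1, Submodule.mem_bot] at e0
    simpa using congrFun e0 0
  · have : (Pi.single 5 1 : V7) ∈ W := by rw [h1]; trivial
    simpa using this.1

/-- An indecomposable algebra of matrices `h(0, v, 0, y)` is conjugate to `𝔪(1,0,1)` or
`𝔪(1,0,2)`. -/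
theorem isConjugate_m101_or_m102 (hI : IsIndecomposable h)
    (hf : ∀ T ∈ h, ∃ v y, T = hMat 0 v 0 y) : IsConjugate h m101 ∨ IsConjugate h m102 := by
  obtain ⟨z, hz⟩ := Shape.exists_mem hI hf
  obtain ⟨w, hw0, hw⟩ := exists_mem_ne_zero hI hf hz
  have hadd : ∀ v c : ℝ, ∀ y, hMat 0 0 0 y ∈ h → hMat 0 v 0 (v • z + c • y) ∈ h := by
    intro v c y hy
    have := h.add_mem (h.smul_mem v hz) (h.smul_mem c hy)
    rwa [hMat_smul, hMat_smul, hMat_add, mul_one, mul_zero, add_zero] at this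
  by_cases hall : ∀ y, hMat 0 0 0 y ∈ h
  · right
    refine ⟨1, G2Star.one_mem, fun A => ?_⟩
    simp only [inv_one, Units.val_one, one_mul, mul_one]
    rw [mem_m102]
    refine ⟨hf A, ?_⟩
    rintro ⟨v, y, rfl⟩
    have := hadd v 1 _ (hall (y - v • z))
    rwa [one_smul, add_sub_cancel] at this
  · left
    push Not at hall
    obtain ⟨x, hx⟩ := hall
    -- The vectors y of elements with v = 0 form a proper subspace of ℝ², hence the line of w.
    have hwy : ∀ y, hMat 0 0 0 y ∈ h → w 0 * y 1 = w 1 * y 0 := by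
      intro y hy
      by_contra hne
      have hne : w 0 * y 1 - w 1 * y 0 ≠ 0 := sub_ne_zero.2 hne
      apply hx
      have := h.add_mem (h.smul_mem ((x 0 * y 1 - x 1 * y 0) / (w 0 * y 1 - w 1 * y 0)) hw)
        (h.smul_mem ((w 0 * x 1 - w 1 * x 0) / (w 0 * y 1 - w 1 * y 0)) hy)
      rw [hMat_smul, hMat_smul, hMat_add, mul_zero, mul_zero, add_zero] at this
      convert this using 2
      ext i; fin_cases i <;> simp <;>
        rw [div_mul_eq_mul_div, div_mul_eq_mul_div, ← add_div, eq_div_iff hne] <;> ring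
    obtain ⟨r, s, hrs⟩ : ∃ r s, w 0 * s - w 1 * r = 1 := by
      by_cases h0 : w 0 = 0
      · have h1 : w 1 ≠ 0 := by
          intro h1; apply hw0; ext i; fin_cases i <;> simp [h0, h1]
        exact ⟨-(w 1)⁻¹, 0, by field_simp; ring⟩
      · exact ⟨0, (w 0)⁻¹, by field_simp; ring⟩
    -- The change of basis of E sends w to (1, 0); t then cancels the second component of the image
    -- of z, which the unipotent element shifts by 3 t.
    obtain ⟨t, ht⟩ : ∃ t, t = -(-w 1 * z 0 + w 0 * z 1) / 3 := ⟨_, rfl⟩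
    obtain ⟨g, hg⟩ : ∃ g, g = unipotentGL t * (planeGL hrs)⁻¹ := ⟨_, rfl⟩
    have hgm : g ∈ G2Star := by
      rw [hg]
      exact G2Star.mul_mem (unipotentGL_mem t) (G2Star.inv_mem (planeGL_isAut hrs).mem)
    have hconj : ∀ v c : ℝ, g.val * hMat 0 v 0 (v • z + c • w) * (g⁻¹).val =
        hMat 0 v 0 ![v * (s * z 0 - r * z 1) + c, 0] := by
      intro v c
      have e1 := conj_hMat_plane' hrs 0 v (v • z + c • w)
      simp only [mul_zero, zero_mul] at e1
      have e2 : g.val * hMat 0 v 0 (v • z + c • w) * (g⁻¹).val = (unipotentGL t).val *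
          ((planeGL hrs)⁻¹.val * hMat 0 v 0 (v • z + c • w) * (planeGL hrs).val) *
            (unipotentGL t)⁻¹.val := by
        rw [hg, mul_inv_rev, inv_inv, Units.val_mul, Units.val_mul]
        simp only [mul_assoc]
      rw [e2, e1, unipotentGL_conj]
      congr 1
      ext i; fin_cases i <;> simp
      · linear_combination c * hrs
      · rw [ht]; ring
    refine ⟨g, hgm, fun A => ?_⟩
    rw [mem_m101]
    constructor
    · intro hA
      obtain ⟨v, y, rfl⟩ := hf A hA
      have h1 := h.add_mem hA (h.smul_mem (-v) hz)
      rw [hMat_smul, hMat_add, mul_one, add_neg_cancel] at h1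
      have h2 := hwy _ h1
      simp at h2
      have h4 := hconj v (s * (y 0 - v * z 0) - r * (y 1 - v * z 1))
      have h5 : y = v • z + (s * (y 0 - v * z 0) - r * (y 1 - v * z 1)) • w := by
        ext i; fin_cases i <;> simp
        · linear_combination (v * z 0 - y 0) * hrs + r * h2
        · linear_combination (v * z 1 - y 1) * hrs + s * h2
      rw [← h5] at h4
      exact ⟨v, _, h4⟩
    · rintro ⟨v, a, e⟩
      have h1 := hconj v (a - v * (s * z 0 - r * z 1))
      rw [add_sub_cancel, ← e] at h1
      rw [← conj_conj g A, ← h1, conj_conj]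
      exact hadd _ _ _ hw

theorem finrank_and_isConjugate (hg : h ≤ g2Star) (hI : IsIndecomposable h) (h3 : IsTypeIII h)
    (hab : ∀ S ∈ h, ∀ T ∈ h, ⁅S, T⁆ = 0) :
    (∃ g : GL (Fin 7) ℝ, IsAut g ∧ ∀ T ∈ conjSub g h, ∃ v y, T = hMat 0 v 0 y) ∧
    ((Module.finrank ℝ h = 2 ∧ IsConjugate h m101) ∨
      (Module.finrank ℝ h = 3 ∧ IsConjugate h m102)) := by
  obtain ⟨g, hga, hsh, -⟩ := exists_frame hg hI h3
  have hI' := hI.conjSub hga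
  have hf : ∀ T ∈ conjSub g h, ∃ v y, T = hMat 0 v 0 y := by
    intro T hT
    have h1 := hsh.partE_eq_zero_of_abelian hI' (fun S hS T hT => by
      have h2 := conj_lie g (g.val * S * (g⁻¹).val) (g.val * T * (g⁻¹).val)
      rw [hab _ hS _ hT, conj_conj, conj_conj] at h2
      simpa using h2) hT
    obtain ⟨A, v, y, rfl⟩ := hsh.shape T hT
    rw [partE_hMat] at h1
    exact ⟨v, y, by rw [h1]⟩
  refine ⟨⟨g, hga, hf⟩, ?_⟩
  rcases isConjugate_m101_or_m102 hI' hf with h1 | h1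
  · left
    have h2 := (isConjugate_conjSub hga.mem).trans h1
    exact ⟨h2.finrank_eq.trans finrank_m101, h2⟩
  · right
    have h2 := (isConjugate_conjSub hga.mem).trans h1
    exact ⟨h2.finrank_eq.trans finrank_m102, h2⟩

end G2StarHolonomy

/-! ### The two models are abelian, indecomposable and of type III -/

namespace G2StarHolonomy

variable {m : LieSubalgebra ℝ Mat7}

set_option maxHeartbeats 1000000 in
theorem hMat_mem_g2Star (A : Matrix (Fin 2) (Fin 2) ℝ) (v : ℝ) (y : Fin 2 → ℝ) :
    hMat A v 0 y ∈ g2Star := by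
  obtain ⟨s, hs, h2⟩ : ∃ s : ℝ, √2 = s ∧ s ^ 2 = 2 := ⟨√2, rfl, Real.sq_sqrt (by norm_num)⟩
  rw [omega0_mem_iff]
  intro a b c
  simp only [omega0_apply, hMat_mulVec, hs, Matrix.cons_val, Matrix.trace_fin_two]
  ring_nf
  simp only [h2]
  ring

theorem m102_le : m102 ≤ g2Star := by
  intro A hA
  obtain ⟨v, y, rfl⟩ := mem_m102.1 hA
  exact hMat_mem_g2Star 0 v y

theorem m101_le_m102 : m101 ≤ m102 := by
  intro A hA
  obtain ⟨v, c, rfl⟩ := mem_m101.1 hA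
  exact mem_m102.2 ⟨v, _, rfl⟩

theorem isLieAbelian_of_le_m102 (hm : m ≤ m102) : IsLieAbelian m := by
  refine ⟨fun S T => Subtype.ext ?_⟩
  obtain ⟨v, y, e⟩ := mem_m102.1 (hm S.2)
  obtain ⟨v', y', e'⟩ := mem_m102.1 (hm T.2)
  change ⁅S.val, T.val⁆ = 0
  rw [e, e', hMat_lie]

theorem hMat_v_mulVec (x : V7) : (hMat 0 1 0 0).mulVec x =
    ![√2 * x 3, x 6, -x 5, √2 * x 4, 0, 0, 0] := by
  rw [hMat_mulVec]; simp

theorem hMat_y_mulVec (x : V7) : (hMat 0 0 0 ![1, 0]).mulVec x =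
    ![-x 5, x 4, 0, 0, 0, 0, 0] := by
  rw [hMat_mulVec]; simp

theorem hMat_v_sq_mulVec (x : V7) : (hMat 0 1 0 0).mulVec ((hMat 0 1 0 0).mulVec x) =
    (2 * x 4) • Pi.single 0 1 := by
  rw [hMat_v_mulVec, hMat_v_mulVec]
  ext i; fin_cases i <;> simp
  rw [← mul_assoc, Real.mul_self_sqrt (by norm_num)]

/-- Where the coordinate 4 vanishes, the images of W under the two elements are orthogonal to W,
hence zero. This removes the coordinates 5, 3 and 6, and what is left of W is isotropic. -/
theorem eq_bot_of_invariant (hT : hMat 0 1 0 0 ∈ m) (hN : hMat 0 0 0 ![1, 0] ∈ m)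
    {W : Submodule ℝ V7} (hi : IsInvariant m W) (hn : IsNondegenerate W)
    (h4 : ∀ w ∈ W, w 4 = 0) : W = ⊥ := by
  have h5 : ∀ w ∈ W, w 5 = 0 := by
    intro w hw
    have := hn _ (hi _ hN w hw) fun w' hw' => by
      rw [hMat_y_mulVec, ip_apply]; simp [h4 w hw, h4 w' hw']
    rw [hMat_y_mulVec] at this
    simpa using congrFun this 0
  have h36 : ∀ w ∈ W, (hMat 0 1 0 0).mulVec w = 0 := by
    intro w hw
    refine hn _ (hi _ hT w hw) fun w' hw' => ?_
    rw [hMat_v_mulVec, ip_apply]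
    simp [h4 w hw, h4 w' hw', h5 w hw, h5 w' hw']
  have h3 : ∀ w ∈ W, w 3 = 0 := by
    intro w hw
    have := h36 w hw
    rw [hMat_v_mulVec] at this
    simpa using congrFun this 0
  have h6 : ∀ w ∈ W, w 6 = 0 := by
    intro w hw
    have := h36 w hw
    rw [hMat_v_mulVec] at this
    simpa using congrFun this 1
  rw [Submodule.eq_bot_iff]
  intro w hw
  refine hn w hw fun w' hw' => ?_
  rw [ip_apply, h3 w hw, h4 w hw, h5 w hw, h6 w hw, h4 w' hw', h5 w' hw', h6 w' hw']
  ring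

/-- A vector of W with nonzero coordinate 4 puts the first basis vector into W by applying h(0, 1,
0, 0) twice. Then `eq_bot_of_invariant` applies to the orthogonal complement of W. -/
theorem isIndecomposable_of_le_m102 (hm : m ≤ m102) (hT : hMat 0 1 0 0 ∈ m)
    (hN : hMat 0 0 0 ![1, 0] ∈ m) : IsIndecomposable m := by
  intro W hi hn
  by_cases h4 : ∀ w ∈ W, w 4 = 0
  · exact Or.inl (eq_bot_of_invariant hT hN hi hn h4)
  · right
    push Not at h4
    obtain ⟨w, hw, h4⟩ := h4
    have h0 : (Pi.single 0 1 : V7) ∈ W := by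
      have h1 := hi _ hT _ (hi _ hT w hw)
      rw [hMat_v_sq_mulVec] at h1
      have h2 := W.smul_mem (2 * w 4)⁻¹ h1
      have h3 : 2 * w 4 ≠ 0 := mul_ne_zero two_ne_zero h4
      rwa [smul_smul, inv_mul_cancel₀ h3, one_smul] at h2
    have hr : ip.IsRefl := fun x y hxy => by rw [ip_comm]; exact hxy
    have ho : ip.orthogonal W = orth W := by
      ext x
      exact forall₂_congr fun w _ => by change ip w x = 0 ↔ ip x w = 0; rw [ip_comm]
    have hc : IsCompl W (orth W) := by
      rw [← ho]
      refine (LinearMap.BilinForm.isCompl_orthogonal_iff_disjoint hr).2 ?_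
      rw [ho, disjoint_iff, Submodule.eq_bot_iff]
      rintro x ⟨h1, h2⟩
      exact hn x h1 h2
    have hb : orth W = ⊥ := by
      refine eq_bot_of_invariant hT hN (hi.orth (hm.trans m102_le)) ?_ fun x hx => ?_
      · intro x hx hx'
        refine ip_nondegenerate fun y => ?_
        have hy : y ∈ W ⊔ orth W := by rw [hc.sup_eq_top]; trivial
        obtain ⟨a, ha, b, hb, rfl⟩ := Submodule.mem_sup.1 hy
        rw [map_add, hx a ha, hx' b hb, add_zero]
      · have := hx _ h0
        rw [ip_apply] at this
        simpa using this
    have := hc.sup_eq_top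
    rwa [hb, sup_bot_eq] at this

theorem finrank_S0 : Module.finrank ℝ S0 = 3 := by
  let f : (Fin 3 → ℝ) →ₗ[ℝ] V7 :=
    { toFun := fun x => ![x 0, x 1, x 2, 0, 0, 0, 0]
      map_add' := fun x y => by ext i; fin_cases i <;> simp
      map_smul' := fun c x => by ext i; fin_cases i <;> simp }
  have h1 : S0 = LinearMap.range f := by
    ext x
    constructor
    · rintro ⟨h3, h4, h5, h6⟩
      refine ⟨![x 0, x 1, x 2], ?_⟩
      ext i; fin_cases i <;> simp [f, h3, h4, h5, h6]
    · rintro ⟨y, rfl⟩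
      exact ⟨rfl, rfl, rfl, rfl⟩
  have h2 : Function.Injective f := fun x y e => by
    ext i
    fin_cases i
    · exact congrFun e 0
    · exact congrFun e 1
    · exact congrFun e 2
  rw [h1, LinearMap.finrank_range_of_inj h2]
  simp

/-- h(0, 1, 0, 0) is nilpotent and commutes with m, so an irreducible subrepresentation lies in its
kernel, which is `S0`. Conversely m annihilates `S0`, so each of its lines is irreducible. -/
theorem socle_eq_S0 (hm : m ≤ m102) (hT : hMat 0 1 0 0 ∈ m) : socle m = S0 := by
  apply le_antisymm
  · refine sSup_le fun U hU => ?_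
    have hK : IsInvariant m (U ⊓ LinearMap.ker (hMat 0 1 0 0).mulVecLin) := by
      rintro S hS u ⟨hu, hk⟩
      refine ⟨hU.1 S hS u hu, ?_⟩
      obtain ⟨v, y, rfl⟩ := mem_m102.1 (hm hS)
      have hk : (hMat 0 1 0 0).mulVec u = 0 := hk
      have h1 := hMat_lie 1 v 0 y
      rw [Ring.lie_def, sub_eq_zero] at h1
      change (hMat 0 1 0 0).mulVec _ = 0
      rw [Matrix.mulVec_mulVec, h1, ← Matrix.mulVec_mulVec, hk, Matrix.mulVec_zero]
    have hne : U ⊓ LinearMap.ker (hMat 0 1 0 0).mulVecLin ≠ ⊥ := by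
      intro hb
      have h1 : ∀ u ∈ U, (hMat 0 1 0 0).mulVec u = 0 → u = 0 := by
        intro u hu hk
        have : u ∈ U ⊓ LinearMap.ker (hMat 0 1 0 0).mulVecLin := ⟨hu, hk⟩
        rwa [hb, Submodule.mem_bot] at this
      apply hU.2.1
      rw [Submodule.eq_bot_iff]
      intro u hu
      refine h1 u hu (h1 _ (hU.1 _ hT u hu) (h1 _ (hU.1 _ hT _ (hU.1 _ hT u hu)) ?_))
      rw [hMat_v_sq_mulVec, hMat_v_mulVec]
      ext i; fin_cases i <;> simp
    have h2 := (hU.2.2 _ inf_le_left hK).resolve_left hne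
    intro u hu
    rw [← h2] at hu
    have hk : (hMat 0 1 0 0).mulVec u = 0 := hu.2
    rw [hMat_v_mulVec] at hk
    have e0 := congrFun hk 0
    have e1 := congrFun hk 1
    have e2 := congrFun hk 2
    have e3 := congrFun hk 3
    simp at e0 e1 e2 e3
    exact ⟨e0, e3, e2, e1⟩
  · rintro x ⟨h3, h4, h5, h6⟩
    by_cases hx : x = 0
    · rw [hx]; exact Submodule.zero_mem _
    have hs : IsSimpleSubrep m (Submodule.span ℝ {x}) := by
      refine ⟨?_, ?_, ?_⟩
      · intro S hS w hw
        obtain ⟨c, rfl⟩ := Submodule.mem_span_singleton.1 hw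
        obtain ⟨v, y, rfl⟩ := mem_m102.1 (hm hS)
        have : (hMat 0 v 0 y).mulVec (c • x) = 0 := by
          rw [hMat_mulVec]
          ext i; fin_cases i <;> simp [h3, h4, h5, h6]
        rw [this]
        exact Submodule.zero_mem _
      · simpa using hx
      · intro W' hW' _
        rcases (nonzero_span_atom x hx).le_iff.1 hW' with h1 | h1
        · exact Or.inl h1
        · exact Or.inr h1
    exact Submodule.mem_sSup_of_mem hs (Submodule.mem_span_singleton_self x)

/-- The algebras `𝔪(1,0,1)` and `𝔪(1,0,2)` are abelian, indecomposable and of type III. -/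
theorem m101_m102_properties {m : LieSubalgebra ℝ Mat7}
    (hm : m ∈ ({m101, m102} : Set (LieSubalgebra ℝ Mat7))) :
    m ≤ g2Star ∧ IsIndecomposable m ∧ IsTypeIII m ∧ IsLieAbelian m := by
  have h1 : m101 ≤ m := by
    rcases hm with rfl | rfl
    · exact le_rfl
    · exact m101_le_m102
  have h2 : m ≤ m102 := by
    rcases hm with rfl | rfl
    · exact m101_le_m102
    · exact le_rfl
  have hT : hMat 0 1 0 0 ∈ m := h1 (mem_m101.2 ⟨1, 0, by
    congr 1; ext i; fin_cases i <;> rfl⟩)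
  have hN : hMat 0 0 0 ![1, 0] ∈ m := h1 (mem_m101.2 ⟨0, 1, rfl⟩)
  exact ⟨h2.trans m102_le, isIndecomposable_of_le_m102 h2 hT hN,
    by rw [IsTypeIII, socle_eq_S0 h2 hT, finrank_S0], isLieAbelian_of_le_m102 h2⟩

end G2StarHolonomy

/-! ### Connections with the two abelian holonomy algebras -/

namespace G2StarHolonomy

variable {h k : LieSubalgebra ℝ Mat7}

section Algebra

variable {𝔤 : Type*} [LieRing 𝔤] [LieAlgebra ℝ 𝔤]

theorem compLinearMap_omega0 (b : Module.Basis (Fin 7) ℝ 𝔤) (X Y Z : 𝔤) :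
    (omega0.compLinearMap b.equivFun.toLinearMap) ![X, Y, Z] =
      omega0 ![b.equivFun X, b.equivFun Y, b.equivFun Z] := by
  rw [AlternatingMap.compLinearMap_apply]
  congr 1
  ext i j; fin_cases i <;> rfl

theorem isLeviCivita_of_mem_g2Star {b : Module.Basis (Fin 7) ℝ 𝔤} {Λ : 𝔤 →ₗ[ℝ] Module.End ℝ 𝔤}
    (ht : ∀ X Y : 𝔤, Λ X Y - Λ Y X = ⁅X, Y⁆) (hg : ∀ X, LinearMap.toMatrix b b (Λ X) ∈ g2Star) :
    IsLeviCivita (frameMetric b) Λ := by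
  refine ⟨ht, fun X Y Z => ?_⟩
  have := ip_mulVec (hg X) (b.equivFun Y) (b.equivFun Z)
  rwa [toMatrix_mulVec_equivFun, toMatrix_mulVec_equivFun] at this

/-- A torsion-free connection with values in `𝔤₂*` defines a parallel structure. -/
theorem hasParallel_of_mem_g2Star {b : Module.Basis (Fin 7) ℝ 𝔤} {Λ : 𝔤 →ₗ[ℝ] Module.End ℝ 𝔤}
    (ht : ∀ X Y : 𝔤, Λ X Y - Λ Y X = ⁅X, Y⁆) (hg : ∀ X, LinearMap.toMatrix b b (Λ X) ∈ g2Star)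
    (hh : h.toSubmodule = (infinitesimalHolonomy Λ).map (LinearMap.toMatrix b b).toLinearMap) :
    HasParallelG2StarStructureWithHolonomy 𝔤 h := by
  refine ⟨_, b, Λ, rfl, isLeviCivita_of_mem_g2Star ht hg, fun W X Y Z => ?_, hh⟩
  have := hg W (b.equivFun X) (b.equivFun Y) (b.equivFun Z)
  simp only [toMatrix_mulVec_equivFun] at this
  simpa only [compLinearMap_omega0] using this

/-- The connection stays the same; only the frame is changed, by g⁻¹ on coordinates. -/
theorem HasParallelG2StarStructureWithHolonomy.of_isConjugate
    (H : HasParallelG2StarStructureWithHolonomy 𝔤 k) (hc : IsConjugate h k) :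
    HasParallelG2StarStructureWithHolonomy 𝔤 h := by
  obtain ⟨φ, b, Λ, hφ, hΛ, hp, hh⟩ := H
  obtain ⟨g, hg, e⟩ := hc
  let G : V7 ≃ₗ[ℝ] V7 := LinearEquiv.ofLinearMap (g⁻¹).val.mulVecLin g.val.mulVecLin
    (LinearMap.ext (GL_inv_mulVec g)) (LinearMap.ext (GL_mulVec_inv g))
  let b' : Module.Basis (Fin 7) ℝ 𝔤 := Module.Basis.ofEquivFun (b.equivFun.trans G)
  have hb' : ∀ X, b'.equivFun X = (g⁻¹).val.mulVec (b.equivFun X) := by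
    intro X
    simp only [b', Module.Basis.equivFun_ofEquivFun]
    rfl
  have hmat : ∀ f : Module.End ℝ 𝔤, LinearMap.toMatrix b' b' f =
      (g⁻¹).val * LinearMap.toMatrix b b f * g.val := by
    intro f
    apply Matrix.ext_of_mulVec_single
    intro i
    obtain ⟨X, hX⟩ := b'.equivFun.surjective (Pi.single i 1)
    rw [← hX, toMatrix_mulVec_equivFun, hb', hb', ← Matrix.mulVec_mulVec, ← Matrix.mulVec_mulVec,
      GL_mulVec_inv, toMatrix_mulVec_equivFun]
  refine hasParallel_of_mem_g2Star (b := b') (Λ := Λ) hΛ.torsion_free (fun X => ?_) ?_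
  · rw [hmat]
    refine conj_mem_g2Star hg ?_
    rw [omega0_mem_iff]
    intro x y z
    obtain ⟨Y, rfl⟩ := b.equivFun.surjective x
    obtain ⟨Z, rfl⟩ := b.equivFun.surjective y
    obtain ⟨W, rfl⟩ := b.equivFun.surjective z
    have := hp X Y Z W
    rw [hφ] at this
    simpa only [compLinearMap_omega0, toMatrix_mulVec_equivFun] using this
  · ext A
    rw [LieSubalgebra.mem_toSubmodule, e, ← LieSubalgebra.mem_toSubmodule, hh]
    constructor
    · rintro ⟨f, hf, hf'⟩
      refine ⟨f, hf, ?_⟩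
      change LinearMap.toMatrix b b f = _ at hf'
      change LinearMap.toMatrix b' b' f = _
      rw [hmat, hf', conj_conj]
    · rintro ⟨f, hf, rfl⟩
      refine ⟨f, hf, ?_⟩
      change LinearMap.toMatrix b b f = g.val * LinearMap.toMatrix b' b' f * (g⁻¹).val
      rw [hmat, conj_conj']

/-- The Levi-Civita connection of the example with abelian holonomy. -/
def exampleConn (ε : ℝ) : V7 →ₗ[ℝ] Mat7 where
  toFun x := hMat (x 4 • !![2, 0; 0, -3]) (x 5) 0 ![x 1 - √2 / 2 * x 3, ε * x 6]
  map_add' x y := by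
    rw [hMat_add']
    congr 1
    · simp only [Pi.add_apply, add_smul]
    · simp
    · ext i; fin_cases i <;> simp <;> ring
  map_smul' c x := by
    rw [RingHom.id_apply, hMat_smul']
    congr 1
    · simp only [Pi.smul_apply, smul_eq_mul, mul_smul]
    · simp
    · ext i; fin_cases i <;> simp <;> ring

theorem exampleConn_apply (ε : ℝ) (x : V7) : exampleConn ε x =
    hMat (x 4 • !![2, 0; 0, -3]) (x 5) 0 ![x 1 - √2 / 2 * x 3, ε * x 6] := rfl

theorem bra_exampleConn (ε : ℝ) (x y : V7) : bra (exampleConn ε) x y =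
    ![-(x 4 * y 0 - x 0 * y 4) + √2 * (x 5 * y 3 - x 3 * y 5)
        - ((x 1 - √2 / 2 * x 3) * y 5 - (y 1 - √2 / 2 * y 3) * x 5),
      2 * (x 4 * y 1 - y 4 * x 1) + (x 1 - √2 / 2 * x 3) * y 4 - (y 1 - √2 / 2 * y 3) * x 4
        + x 5 * y 6 - y 5 * x 6,
      -3 * (x 4 * y 2 - y 4 * x 2) + ε * (x 6 * y 4 - y 6 * x 4),
      √2 * (x 5 * y 4 - y 5 * x 4), 0, -2 * (x 4 * y 5 - y 4 * x 5), 3 * (x 4 * y 6 - y 4 * x 6)] := by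
  rw [bra, exampleConn_apply, exampleConn_apply, hMat_mulVec, hMat_mulVec]
  ext i; fin_cases i <;> simp [Matrix.trace_fin_two] <;> ring

theorem hMat_sub (A A' : Matrix (Fin 2) (Fin 2) ℝ) (v v' : ℝ) (u u' y y' : Fin 2 → ℝ) :
    hMat A v u y - hMat A' v' u' y' = hMat (A - A') (v - v') (u - u') (y - y') :=
  (map_sub hLin (A, v, u, y) (A', v', u', y')).symm

/-- The block A vanishes because the diagonal matrices commute and brackets have no coordinate 4. -/
theorem cur_exampleConn (ε : ℝ) (x y : V7) : cur (exampleConn ε) x y =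
    hMat 0 (x 4 * y 5 - y 4 * x 5) 0
      ![x 4 * (y 1 - √2 / 2 * y 3) - y 4 * (x 1 - √2 / 2 * x 3)
        - bra (exampleConn ε) x y 1 + √2 / 2 * bra (exampleConn ε) x y 3,
        ε * (-7 * (x 4 * y 6 - y 4 * x 6))] := by
  rw [cur, exampleConn_apply, exampleConn_apply, exampleConn_apply, hMat_bracket, hMat_sub]
  have h5 : bra (exampleConn ε) x y 5 = -2 * (x 4 * y 5 - y 4 * x 5) := by
    rw [bra_exampleConn]; rfl
  have h6 : bra (exampleConn ε) x y 6 = 3 * (x 4 * y 6 - y 4 * x 6) := by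
    rw [bra_exampleConn]; rfl
  have h4 : bra (exampleConn ε) x y 4 = 0 := by
    rw [bra_exampleConn]; rfl
  rw [h4, h5, h6]
  congr 1
  · rw [Ring.lie_def]
    ext i j; fin_cases i <;> fin_cases j <;> simp <;> ring
  · simp [Matrix.trace_fin_two]; ring
  · simp
  · ext i; fin_cases i <;> simp [Matrix.trace_fin_two, Matrix.vecHead, Matrix.vecTail] <;> ring

/-- The bracket of the Lie algebra of the example. -/
def exampleBra (x y : V7) : V7 :=
  ![x 0 * y 4 - x 4 * y 0 + x 5 * y 1 - x 1 * y 5, x 4 * y 1 - x 1 * y 4 + x 5 * y 6 - x 6 * y 5,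
    3 * (x 2 * y 4 - x 4 * y 2), 0, 0, 2 * (x 5 * y 4 - x 4 * y 5), 3 * (x 4 * y 6 - x 6 * y 4)]

/-- The components with respect to the adapted frame. -/
def exampleFrame (ε : ℝ) : V7 ≃ₗ[ℝ] V7 where
  toFun x := ![x 0, x 1 - √2 / 2 * x 3 - x 5 / 6, x 2 - ε / 6 * x 6, x 3 + √2 / 2 * x 5, x 4, x 5, x 6]
  invFun x := ![x 0, x 1 + √2 / 2 * x 3 - x 5 / 3, x 2 + ε / 6 * x 6, x 3 - √2 / 2 * x 5, x 4, x 5, x 6]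
  map_add' x y := by ext i; fin_cases i <;> simp <;> ring
  map_smul' c x := by ext i; fin_cases i <;> simp <;> ring
  left_inv x := by
    have h2 : √2 ^ 2 = 2 := Real.sq_sqrt (by norm_num)
    ext i; fin_cases i <;> simp
    linear_combination x 5 / 4 * h2
  right_inv x := by
    have h2 : √2 ^ 2 = 2 := Real.sq_sqrt (by norm_num)
    ext i; fin_cases i <;> simp
    linear_combination x 5 / 4 * h2

theorem exampleFrame_apply (ε : ℝ) (x : V7) : exampleFrame ε x =
    ![x 0, x 1 - √2 / 2 * x 3 - x 5 / 6, x 2 - ε / 6 * x 6, x 3 + √2 / 2 * x 5, x 4, x 5, x 6] := rfl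

/-- The parameter ε is absorbed by the linear change: both holonomy algebras occur on the same Lie
algebra. -/
theorem bra_exampleFrame (ε : ℝ) (x y : V7) :
    bra (exampleConn ε) (exampleFrame ε x) (exampleFrame ε y) =
      exampleFrame ε (exampleBra x y) := by
  have h2 : √2 ^ 2 = 2 := Real.sq_sqrt (by norm_num)
  rw [bra_exampleConn, exampleFrame_apply, exampleFrame_apply, exampleFrame_apply, exampleBra]
  ext i; fin_cases i <;> simp <;> ring_nf <;> simp only [h2] <;> ring

/-- The example has a parallel structure with abelian holonomy. -/
theorem hasParallel_of_exampleBra {ε : ℝ} (F : 𝔤 ≃ₗ[ℝ] V7)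
    (hF : ∀ X Y, F ⁅X, Y⁆ = exampleBra (F X) (F Y))
    (hk : ∀ T, T ∈ k ↔ ∃ v a c : ℝ, T = hMat 0 v 0 ![a, ε * c]) :
    HasParallelG2StarStructureWithHolonomy 𝔤 k := by
  let b : Module.Basis (Fin 7) ℝ 𝔤 := Module.Basis.ofEquivFun (F.trans (exampleFrame ε))
  have hb : ∀ X, b.equivFun X = exampleFrame ε (F X) := by
    intro X
    simp only [b, Module.Basis.equivFun_ofEquivFun]
    rfl
  let Λ : 𝔤 →ₗ[ℝ] Module.End ℝ 𝔤 :=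
    (LinearMap.toMatrix b b).symm.toLinearMap ∘ₗ exampleConn ε ∘ₗ b.equivFun.toLinearMap
  have hΛ : ∀ X, LinearMap.toMatrix b b (Λ X) = exampleConn ε (b.equivFun X) := fun X =>
    (LinearMap.toMatrix b b).apply_symm_apply _
  have ht : ∀ X Y : 𝔤, Λ X Y - Λ Y X = ⁅X, Y⁆ := by
    intro X Y
    apply b.equivFun.injective
    rw [map_sub, ← toMatrix_mulVec_equivFun, ← toMatrix_mulVec_equivFun, hΛ, hΛ, hb ⁅X, Y⁆, hF,
      ← bra_exampleFrame, bra, hb, hb]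
  have hg : ∀ X, LinearMap.toMatrix b b (Λ X) ∈ g2Star := fun X => by
    rw [hΛ, exampleConn_apply]; exact hMat_mem_g2Star _ _ _
  have hL : frameConn b Λ = exampleConn ε := by
    ext1 i
    refine LinearMap.ext_ring ?_
    obtain ⟨X, hX⟩ := b.equivFun.surjective (Pi.single i 1)
    change frameConn b Λ (Pi.single i 1) = exampleConn ε (Pi.single i 1)
    rw [← hX, frameConn_equivFun, hΛ]
  have hcur : ∀ x y, ∃ f ∈ infinitesimalHolonomy Λ,
      LinearMap.toMatrix b b f = cur (exampleConn ε) x y := by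
    intro x y
    obtain ⟨X, rfl⟩ := b.equivFun.surjective x
    obtain ⟨Y, rfl⟩ := b.equivFun.surjective y
    refine ⟨curvature Λ X Y, curvature_mem_infinitesimalHolonomy Λ X Y, ?_⟩
    rw [← cur_frameConn (isLeviCivita_of_mem_g2Star ht hg), hL]
  refine hasParallel_of_mem_g2Star ht hg (le_antisymm (fun T hT => ?_) ?_)
  · obtain ⟨v, a, c, rfl⟩ := (hk T).1 hT
    have h2 : √2 * √2 = 2 := Real.mul_self_sqrt (by norm_num)
    -- Three curvature values already span k, so no covariant derivatives are needed for this
    -- inclusion.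
    have e1 : cur (exampleConn ε) (Pi.single 4 1) (Pi.single 5 1) = hMat 0 1 0 ![-1, 0] := by
      rw [cur_exampleConn, bra_exampleConn]
      congr 1
      · simp
      · ext i; fin_cases i <;> simp
        linear_combination h2 / 2
    have e2 : cur (exampleConn ε) (Pi.single 3 1) (Pi.single 4 1) = hMat 0 0 0 ![√2, 0] := by
      rw [cur_exampleConn, bra_exampleConn]
      congr 1
      · simp
      · ext i; fin_cases i <;> simp
    have e3 : cur (exampleConn ε) (Pi.single 4 1) (Pi.single 6 1) = hMat 0 0 0 ![0, -7 * ε] := by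
      rw [cur_exampleConn, bra_exampleConn]
      congr 1
      · simp
      · ext i; fin_cases i <;> simp
        ring
    have h1 := fun x y => (show cur (exampleConn ε) x y ∈
      (infinitesimalHolonomy Λ).map (LinearMap.toMatrix b b).toLinearMap from hcur x y)
    have e4 : hMat 0 v 0 ![a, ε * c] = v • hMat 0 1 0 ![-1, 0] +
        ((a + v) / √2) • hMat 0 0 0 ![√2, 0] + (-c / 7) • hMat 0 0 0 ![0, -7 * ε] := by
      rw [hMat_smul, hMat_smul, hMat_smul, hMat_add, hMat_add]
      congr 1
      · simp
      · ext i; fin_cases i <;> simp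
        ring
    rw [e4, ← e1, ← e2, ← e3]
    exact add_mem (add_mem (Submodule.smul_mem _ _ (h1 _ _)) (Submodule.smul_mem _ _ (h1 _ _)))
      (Submodule.smul_mem _ _ (h1 _ _))
  · refine Submodule.map_le_iff_le_comap.2 (infinitesimalHolonomy_le (fun X Y => ?_) fun X f hf => ?_)
    · change LinearMap.toMatrix b b _ ∈ k
      rw [← cur_frameConn (isLeviCivita_of_mem_g2Star ht hg), hL, cur_exampleConn, hk]
      exact ⟨_, _, _, rfl⟩
    · change LinearMap.toMatrix b b f ∈ k at hf
      obtain ⟨v, a, c, e⟩ := (hk _).1 hf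
      change LinearMap.toMatrix b b _ ∈ k
      rw [toMatrix_lie, hΛ, e, exampleConn_apply, hMat_bracket, hk]
      obtain ⟨x, hx⟩ : ∃ x, b.equivFun X = x := ⟨_, rfl⟩
      rw [hx]
      -- The weights of diag(2, -3), of trace -1: -1 on v, and 2 - 1 and -3 - 1 on the two entries
      -- of y.
      refine ⟨-x 4 * v, x 4 * a, -4 * x 4 * c, ?_⟩
      congr 1
      · simp
      · simp [Matrix.trace_fin_two]; ring
      · simp
      · ext i; fin_cases i <;> simp [Matrix.trace_fin_two, Matrix.vecHead, Matrix.vecTail] <;> ring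

end Algebra

end G2StarHolonomy

/-! ### The Lie group of the example -/

namespace G2StarHolonomy

open scoped Manifold ContDiff
open Real

/-- The model space of the example. -/
abbrev E7 : Type := EuclideanSpace ℝ (Fin 7)

/-- The linear part of the left translation by `x`. -/
def transMat (x : E7) (y : E7) : E7 :=
  !₂[exp (-x 4) * y 0 + x 5 * exp (x 4) * y 1 + x 5 ^ 2 / 2 * exp (x 4) ^ 3 * y 6,
    exp (x 4) * y 1 + x 5 * exp (x 4) ^ 3 * y 6, exp (-x 4) ^ 3 * y 2, y 3, y 4,
    exp (-x 4) ^ 2 * y 5, exp (x 4) ^ 3 * y 6]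

/-- The group structure on `ℝ⁷`. -/
instance exampleGroup : Group E7 :=
  letI : Mul E7 := ⟨fun x y => x + transMat x y⟩
  letI : One E7 := ⟨0⟩
  -- The linear part depends only on the coordinates 4 and 5, so it suffices to insert those of the
  -- inverse.
  letI : Inv E7 := ⟨fun x => -transMat !₂[0, 0, 0, 0, -x 4, -exp (x 4) ^ 2 * x 5, 0] x⟩
  Group.ofLeftAxioms (by
    intro x y z
    change (x + transMat x y) + transMat (x + transMat x y) z = x + transMat x (y + transMat y z)
    ext i
    fin_cases i <;> simp [transMat, exp_add, exp_neg] <;> (try field_simp) <;> (try ring)) (by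
    intro x
    change 0 + transMat 0 x = x
    ext i
    fin_cases i <;> simp [transMat]) (by
    intro x
    change -transMat _ x + transMat (-transMat _ x) x = 0
    ext i
    fin_cases i <;> simp [transMat, exp_neg])

theorem contDiff_transMat : ContDiff ℝ ∞ fun p : E7 × E7 => transMat p.1 p.2 := by
  rw [contDiff_euclidean]
  intro i
  fin_cases i <;> simp [transMat] <;> fun_prop

instance : LieGroup 𝓘(ℝ, E7) ∞ E7 where
  contMDiff_mul := by
    rw [← modelWithCornersSelf_prod, chartedSpaceSelf_prod, contMDiff_iff_contDiff]
    exact contDiff_fst.add contDiff_transMat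
  contMDiff_inv := by
    rw [contMDiff_iff_contDiff]
    refine (contDiff_transMat.comp (ContDiff.prodMk ?_ contDiff_id)).neg
    rw [contDiff_euclidean]
    intro i
    fin_cases i <;> simp <;> fun_prop

/-- The left translations as affine maps. -/
def transLin (x : E7) : E7 →L[ℝ] E7 := LinearMap.toContinuousLinearMap
  { toFun := transMat x
    map_add' := fun y z => by ext i; fin_cases i <;> simp [transMat] <;> ring
    map_smul' := fun c y => by ext i; fin_cases i <;> simp [transMat] <;> ring }

/-- Left translations are affine, so their derivative is the linear part. -/
theorem mulInvariantVectorField_eq (v : GroupLieAlgebra 𝓘(ℝ, E7) E7) (x : E7) :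
    mulInvariantVectorField v x = transMat x v := by
  have h1 : HasFDerivAt (fun y : E7 => x * y) (transLin x) (1 : E7) :=
    (transLin x).hasFDerivAt.const_add x
  rw [mulInvariantVectorField, mfderiv_eq_fderiv, h1.fderiv]
  rfl

/-- The derivative of `transMat` at the identity. -/
def transDeriv (u v : E7) : E7 :=
  !₂[-u 4 * v 0 + u 5 * v 1, u 4 * v 1 + u 5 * v 6, -3 * u 4 * v 2, 0, 0, -2 * u 4 * v 5,
    3 * u 4 * v 6]

theorem fderiv_transMat (u v : E7) : fderiv ℝ (fun x => transMat x v) 0 u = transDeriv u v := by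
  have hd : DifferentiableAt ℝ (fun x => transMat x v) 0 :=
    ((contDiff_transMat.comp (ContDiff.prodMk contDiff_id contDiff_const)).differentiable
      (by simp)).differentiableAt
  -- The derivative is computed coordinatewise along the line t • u, where only one-variable
  -- exponentials occur.
  have hl : HasDerivAt (fun t : ℝ => t • u) u 0 := by
    simpa using (hasDerivAt_id (0 : ℝ)).smul_const u
  have h0 : HasFDerivAt (fun x => transMat x v) (fderiv ℝ (fun x => transMat x v) 0)
      ((0 : ℝ) • u) := by
    rw [zero_smul]; exact hd.hasFDerivAt
  have h1 := h0.comp_hasDerivAt (0 : ℝ) hl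
  have he : HasDerivAt (fun t : ℝ => exp (t * u 4)) (u 4) 0 := by
    simpa using ((hasDerivAt_id (0 : ℝ)).mul_const (u 4)).exp
  have he' : HasDerivAt (fun t : ℝ => exp (-(t * u 4))) (-u 4) 0 := by
    simpa using ((hasDerivAt_id (0 : ℝ)).mul_const (u 4)).neg.exp
  have hs : HasDerivAt (fun t : ℝ => t * u 5) (u 5) 0 := by
    simpa using (hasDerivAt_id (0 : ℝ)).mul_const (u 5)
  ext i
  refine ((EuclideanSpace.proj (𝕜 := ℝ) i).hasFDerivAt.comp_hasDerivAt (0 : ℝ) h1).unique ?_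
  change HasDerivAt (fun t : ℝ => transMat (t • u) v i) (transDeriv u v i) 0
  fin_cases i
  · refine ((((he'.mul_const (v 0)).add ((hs.mul he).mul_const (v 1))).add
      ((((hs.pow 2).div_const 2).mul (he.pow 3)).mul_const (v 6))).congr_deriv
        ?_).congr_of_eventuallyEq (.of_forall fun t => ?_)
    · simp [transDeriv]
    · simp [transMat]
  · refine (((he.mul_const (v 1)).add ((hs.mul (he.pow 3)).mul_const (v 6))).congr_deriv
      ?_).congr_of_eventuallyEq (.of_forall fun t => ?_)
    · simp [transDeriv]
    · simp [transMat]
  · refine (((he'.pow 3).mul_const (v 2)).congr_deriv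
      ?_).congr_of_eventuallyEq (.of_forall fun t => ?_)
    · simp [transDeriv]
    · simp [transMat]
  · exact hasDerivAt_const _ _
  · exact hasDerivAt_const _ _
  · refine (((he'.pow 2).mul_const (v 5)).congr_deriv
      ?_).congr_of_eventuallyEq (.of_forall fun t => ?_)
    · simp [transDeriv]
    · simp [transMat]
  · refine (((he.pow 3).mul_const (v 6)).congr_deriv
      ?_).congr_of_eventuallyEq (.of_forall fun t => ?_)
    · simp [transDeriv]
    · simp [transMat]

theorem lieBracket_transMat (v w : E7) :
    VectorField.lieBracket ℝ (fun x => transMat x v) (fun x => transMat x w) 0 =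
      transDeriv v w - transDeriv w v := by
  have h : ∀ v : E7, transMat 0 v = v := by
    intro v; ext i; fin_cases i <;> simp [transMat]
  rw [VectorField.lieBracket, h, h, fderiv_transMat, fderiv_transMat]

theorem bracket_eq (v w : GroupLieAlgebra 𝓘(ℝ, E7) E7) :
    ⁅v, w⁆ = transDeriv v w - transDeriv w v := by
  have h : ∀ v : GroupLieAlgebra 𝓘(ℝ, E7) E7,
      (mulInvariantVectorField v : E7 → E7) = fun x => transMat x v :=
    fun v => funext (mulInvariantVectorField_eq v)
  rw [GroupLieAlgebra.bracket_def, VectorField.mlieBracket,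
    VectorField.mlieBracketWithin_eq_lieBracketWithin]
  change VectorField.lieBracketWithin ℝ (mulInvariantVectorField v : E7 → E7)
    (mulInvariantVectorField w : E7 → E7) Set.univ (0 : E7) = _
  rw [h, h, VectorField.lieBracketWithin_univ]
  exact lieBracket_transMat v w

/-- The coordinates on the Lie algebra of the example. -/
def groupCoord : GroupLieAlgebra 𝓘(ℝ, E7) E7 ≃ₗ[ℝ] V7 := WithLp.linearEquiv 2 ℝ V7

theorem groupCoord_bracket (v w : GroupLieAlgebra 𝓘(ℝ, E7) E7) :
    groupCoord ⁅v, w⁆ = exampleBra (groupCoord v) (groupCoord w) := by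
  rw [bracket_eq]
  have key : ∀ v w : E7, WithLp.ofLp (transDeriv v w - transDeriv w v) =
      exampleBra (WithLp.ofLp v) (WithLp.ofLp w) := by
    intro v w
    ext i
    fin_cases i <;> simp [transDeriv, exampleBra] <;> ring
  exact key v w

theorem isHolonomy_of_isConjugate {h k : LieSubalgebra ℝ Mat7} {ε : ℝ} (hc : IsConjugate h k)
    (hk : ∀ T, T ∈ k ↔ ∃ v a c : ℝ, T = hMat 0 v 0 ![a, ε * c]) :
    IsHolonomyOfLeftInvariantG2StarStructure h :=
  ⟨E7, inferInstance, inferInstance, exampleGroup, inferInstance, inferInstance, inferInstance,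
    (hasParallel_of_exampleBra groupCoord groupCoord_bracket hk).of_isConjugate hc⟩

end G2StarHolonomy

end

/-! ### Assembly of the theorem -/

theorem theorem1p1 :
    (∀ h : LieSubalgebra ℝ G2StarHolonomy.Mat7,
      h ≤ G2StarHolonomy.g2Star →
      G2StarHolonomy.IsIndecomposable h →
      G2StarHolonomy.IsTypeIII h →
      (G2StarHolonomy.IsHolonomyOfLeftInvariantG2StarStructure h ↔ IsLieAbelian h) ∧
      (IsLieAbelian h →
        (Module.finrank ℝ h = 2 ∧ G2StarHolonomy.IsConjugate h G2StarHolonomy.m101) ∨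
        (Module.finrank ℝ h = 3 ∧ G2StarHolonomy.IsConjugate h G2StarHolonomy.m102))) ∧
    (∀ m ∈ ({G2StarHolonomy.m101, G2StarHolonomy.m102} : Set (LieSubalgebra ℝ G2StarHolonomy.Mat7)),
      m ≤ G2StarHolonomy.g2Star ∧
      G2StarHolonomy.IsIndecomposable m ∧
      G2StarHolonomy.IsTypeIII m ∧
      IsLieAbelian m) := by
  refine ⟨fun h hg hI h3 => ?_, fun m hm => G2StarHolonomy.m101_m102_properties hm⟩
  have hcl : IsLieAbelian h →
      (Module.finrank ℝ h = 2 ∧ G2StarHolonomy.IsConjugate h G2StarHolonomy.m101) ∨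
      (Module.finrank ℝ h = 3 ∧ G2StarHolonomy.IsConjugate h G2StarHolonomy.m102) := fun hab =>
    (G2StarHolonomy.finrank_and_isConjugate hg hI h3 fun S hS T hT =>
      congrArg Subtype.val (hab.trivial ⟨S, hS⟩ ⟨T, hT⟩)).2
  refine ⟨⟨?_, fun hab => ?_⟩, hcl⟩
  · rintro ⟨G, _, _, _, _, _, _, H⟩
    obtain ⟨L, hL⟩ := H.exists_holData hI
    exact ⟨fun S T => Subtype.ext (hL.lie_eq_zero hg h3 S.2 T.2)⟩
  · rcases hcl hab with ⟨-, hc⟩ | ⟨-, hc⟩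
    -- ε = 0 removes the second entry of y from the holonomy; ε = 1 keeps it.
    · refine G2StarHolonomy.isHolonomy_of_isConjugate (ε := 0) hc fun T => ?_
      rw [G2StarHolonomy.mem_m101]
      simp
    · refine G2StarHolonomy.isHolonomy_of_isConjugate (ε := 1) hc fun T => ?_
      rw [G2StarHolonomy.mem_m102]
      constructor
      · rintro ⟨v, y, rfl⟩
        refine ⟨v, y 0, y 1, ?_⟩
        congr 1
        ext i; fin_cases i <;> simp
      · rintro ⟨v, a, c, rfl⟩
        exact ⟨v, _, rfl⟩
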